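/- An $n\times n$ image is a matrix $M\in\{0,1\}^{n\times n}$ ($1$ is black, $0$ is white). It is connected if any two of its black pixels are joined by a path in the image graph, whose vertices are the black pixels $(i,j)$ and whose edges join $(i,j)$ and $(i',j')$ when $|i-i'|+|j-j'|=1$ (the all-white image is connected). It is $\epsilon$-far from connected if at least $\epsilon n^2$ of its pixels have to be changed to make it connected. A 1-sided error $\epsilon$-tester for connectedness of $n\times n$ images is a randomized algorithm with query access to the pixels of $M$ that always accepts if $M$ is connected, and rejects with probability at least $2/3$ if $M$ is $\epsilon$-far from connected. It is nonadaptive if it makes all its queries before receiving any answers. Algorithms are programs for a word RAM that is given $n$ and $\lceil 1/\epsilon\rceil$, has words of $O(\log n)$ bits, and in one step performs a basic arithmetic or memory operation, draws a uniformly random element of $\{0,\dots,k-1\}$ for a given $k$, submits a query, or receives the answer to a query. **Theorem.** (1) There are a program $P$ and a constant $C$ such that for every $\epsilon\in(0,1)$ and every integer $n\ge 8\epsilon^{-3/2}$, $P$ is a 1-sided error $\epsilon$-tester for connectedness of $n\times n$ images that, in the worst case over images and random choices, makes at most $C\,\epsilon^{-3/2}\sqrt{\log_2(1/\epsilon)}$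 queries and halts within $C\bigl(1+\epsilon^{-3/2}\sqrt{\log_2(1/\epsilon)}\bigr)$ steps. In particular, for $\epsilon\le 1/2$ both its query complexity and its running time are $O\bigl(\epsilon^{-3/2}\sqrt{\log(1/\epsilon)}\bigr)$. (2) There are a program $P'$ and a constant $C'$ such that for every $\epsilon\in(0,1)$ and every integer $n\ge 8\epsilon^{-3/2}$, $P'$ is a nonadaptive 1-sided error $\epsilon$-tester for connectedness of $n\times n$ images that, in the worst case, makes at most $C'/\epsilon^{2}$ queries and halts within $C'/\epsilon^{2}$ steps. -/

import Mathlib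

namespace ImageTesting

/-! ### Images, connectedness, distance -/

/-- An `n × n` black-and-white image; `true` is black and `false` is white. -/
abbrev Image (n : ℕ) : Type := Matrix (Fin n) (Fin n) Bool

/-- The image graph: the vertices are the black pixels, and two of them are adjacent when they are
at Manhattan distance one. -/
def imageGraph {n : ℕ} (M : Image n) : SimpleGraph {p : Fin n × Fin n // M p.1 p.2 = true} where
  Adj p q := |(p.1.1 : ℤ) - (q.1.1 : ℤ)| + |(p.1.2 : ℤ) - (q.1.2 : ℤ)| = 1
  symm := ⟨fun p q h => by
    rw [abs_sub_comm (q.1.1 : ℤ), abs_sub_comm (q.1.2 : ℤ)]; exact h⟩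
  loopless := ⟨fun p h => by simp at h⟩

/-- The property of being connected: any two black pixels are joined by a path in the image graph.
The image without black pixels is connected. -/
def connectedImages (n : ℕ) : Set (Image n) := {M | (imageGraph M).Preconnected}

/-- The number of pixels on which two images differ. -/
def hammingDistance {n : ℕ} (M M' : Image n) : ℕ :=
  (Finset.univ.filter fun p : Fin n × Fin n => M p.1 p.2 ≠ M' p.1 p.2).card

/-- The smallest number of pixels of `M` that have to be modified to get an image in `Q`
(for a nonempty property `Q`). -/
noncomputable def absoluteDistance {n : ℕ} (M : Image n) (Q : Set (Image n)) : ℕ :=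
  sInf (hammingDistance M '' Q)

/-- The relative distance from `M` to `Q`. -/
noncomputable def relativeDistance {n : ℕ} (M : Image n) (Q : Set (Image n)) : ℝ :=
  (absoluteDistance M Q : ℝ) / (n : ℝ) ^ 2

/-- `M` is `ε`-far from `Q`. -/
def IsFar {n : ℕ} (ε : ℝ) (M : Image n) (Q : Set (Image n)) : Prop :=
  ε ≤ relativeDistance M Q

/-- The colour of the pixel `(x, y)` as a number, `1` for black and `0` for white; positions outside
the image read as white. -/
def pixel {n : ℕ} (M : Image n) (p : ℕ × ℕ) : ℕ :=
  if h : p.1 < n ∧ p.2 < n then (M ⟨p.1, h.1⟩ ⟨p.2, h.2⟩).toNat else 0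

/-! ### A randomized word RAM with query access to an image

The machine has registers and a random access memory, all zero at the start except for the input.
Every cell holds a word of `w` bits. A program is a fixed structured program, so the evaluation of
one of its expressions takes constantly many basic operations. -/

/-- The basic operations on words. -/
inductive Op where
  | add | sub | mul | div | mod | lt | eq

/-- Their effect, with words read as natural numbers: `sub` is truncated at zero, a quotient by zero
is zero, and the comparisons return `1` or `0`. -/
def Op.apply : Op → ℕ → ℕ → ℕ
  | .add, a, b => a + b
  | .sub, a, b => a - b
  | .mul, a, b => a * b
  | .div, a, b => a / b
  | .mod, a, b => a % b
  | .lt, a, b => if a < b then 1 else 0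
  | .eq, a, b => if a = b then 1 else 0

/-- Expressions: literals, registers, memory cells at a computed address, basic operations. -/
inductive Term where
  | lit (k : ℕ)
  | reg (r : ℕ)
  | load (a : Term)
  | bin (o : Op) (a b : Term)

/-- The value of an expression on a machine with `w`-bit words; operations are modulo `2 ^ w`. -/
def Term.eval (w : ℕ) (reg mem : ℕ → ℕ) : Term → ℕ
  | .lit k => k % 2 ^ w
  | .reg r => reg r
  | .load a => mem (a.eval w reg mem)
  | .bin o a b => o.apply (a.eval w reg mem) (b.eval w reg mem) % 2 ^ w

/-- Programs. Submitting a query and receiving its answer are separate instructions. -/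
inductive Program where
  /-- assign the value of `e` to register `r` -/
  | set (r : ℕ) (e : Term)
  /-- write the value of `e` to the memory cell at address `a` -/
  | store (a e : Term)
  /-- assign to register `r` a fresh uniformly random element of `{0, …, e - 1}` (`0` if `e = 0`) -/
  | rand (r : ℕ) (e : Term)
  /-- submit a query to the pixel `(x, y)` -/
  | query (x y : Term)
  /-- assign to register `r` the answer to the query with number `e`, counting from `0` -/
  | receive (r : ℕ) (e : Term)
  | seq (p q : Program)
  /-- run `p` if `e` is nonzero and `q` otherwise -/
  | cond (e : Term) (p q : Program)
  /-- run `p` as long as `e` is nonzero -/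
  | loop (e : Term) (p : Program)
  /-- stop, and accept (`true`) or reject (`false`) -/
  | halt (b : Bool)

/-- A configuration of the machine. -/
structure Config where
  /-- what remains to be executed, in order -/
  stack : List Program
  reg : ℕ → ℕ
  mem : ℕ → ℕ
  /-- the queries submitted so far, in order -/
  queries : List (ℕ × ℕ)
  /-- whether the machine has already asked for the answer to a query -/
  received : Bool
  /-- whether some query was submitted after an answer had been received -/
  interleaved : Bool
  /-- `none` while running, then `some true` (accept) or `some false` (reject) -/
  verdict : Option Bool

/-- The uniform distribution on `{0, …, k - 1}`; for `k = 0`, the constant `0`. -/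
noncomputable def uniformBelow (k : ℕ) : PMF ℕ :=
  (PMF.uniformOfFintype (Fin (k - 1 + 1))).map Fin.val

/-- One step of the machine with `w`-bit words on the image `M`. A machine that has halted stays as
it is; so does a machine that ran out of instructions without a verdict, which thus never halts. -/
noncomputable def step {n : ℕ} (M : Image n) (w : ℕ) (z : Config) : PMF Config :=
  match z.verdict, z.stack with
  | some _, _ => PMF.pure z
  | none, [] => PMF.pure z
  | none, .set r e :: K =>
      PMF.pure { z with stack := K, reg := Function.update z.reg r (e.eval w z.reg z.mem) }
  | none, .store a e :: K =>
      PMF.pure { z with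
        stack := K
        mem := Function.update z.mem (a.eval w z.reg z.mem) (e.eval w z.reg z.mem) }
  | none, .rand r e :: K =>
      (uniformBelow (e.eval w z.reg z.mem)).map fun v =>
        { z with stack := K, reg := Function.update z.reg r v }
  | none, .query x y :: K =>
      PMF.pure { z with
        stack := K
        queries := z.queries ++ [(x.eval w z.reg z.mem, y.eval w z.reg z.mem)]
        interleaved := z.interleaved || z.received }
  | none, .receive r e :: K =>
      PMF.pure { z with
        stack := K
        reg := Function.update z.reg r
          (((z.queries[e.eval w z.reg z.mem]?).map (pixel M)).getD 0 % 2 ^ w)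
        received := true }
  | none, .seq p q :: K => PMF.pure { z with stack := p :: q :: K }
  | none, .cond e p q :: K =>
      PMF.pure { z with stack := (if e.eval w z.reg z.mem ≠ 0 then p else q) :: K }
  | none, .loop e p :: K =>
      PMF.pure { z with
        stack := if e.eval w z.reg z.mem ≠ 0 then p :: .loop e p :: K else K }
  | none, .halt b :: _ => PMF.pure { z with stack := [], verdict := some b }

/-- The distribution of the configuration after `t` steps. -/
noncomputable def run {n : ℕ} (M : Image n) (w : ℕ) : ℕ → Config → PMF Config
  | 0, z => PMF.pure z
  | t + 1, z => (step M w z).bind (run M w t)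

/-- The initial configuration: the side length of the image is in register `0`, the integer
`⌈1/ε⌉` that represents the proximity parameter is in register `1`, all else is zero. -/
noncomputable def initial (P : Program) (n : ℕ) (ε : ℝ) : Config where
  stack := [P]
  reg := fun r => if r = 0 then n else if r = 1 then ⌈1 / ε⌉₊ else 0
  mem := fun _ => 0
  queries := []
  received := false
  interleaved := false
  verdict := none

/-- The distribution of the configuration after `t` steps, from the initial configuration and with
words of `c` times as many bits as the binary expansion of `n` has. -/
noncomputable def outcome (P : Program) (c : ℕ) (ε : ℝ) {n : ℕ} (M : Image n) (t : ℕ) :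
    PMF Config :=
  run M (c * Nat.size n) t (initial P n ε)

/-- `P` is a 1-sided error `ε`-tester for connectedness of `n × n` images that always halts within
`t` steps and never makes more than `q` queries: it always accepts connected images, and it rejects
images that are `ε`-far from connected with probability at least `2/3`. -/
structure IsTester (P : Program) (c n : ℕ) (ε q t : ℝ) : Prop where
  halts : ∀ M : Image n, ∀ z ∈ (outcome P c ε M ⌊t⌋₊).support, z.verdict ≠ none
  queries_le : ∀ M : Image n, ∀ z ∈ (outcome P c ε M ⌊t⌋₊).support, (z.queries.length : ℝ) ≤ q
  accepts : ∀ M : Image n, M ∈ connectedImages n →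
    ∀ z ∈ (outcome P c ε M ⌊t⌋₊).support, z.verdict = some true
  rejects : ∀ M : Image n, IsFar ε M (connectedImages n) →
    2 / 3 ≤ ((outcome P c ε M ⌊t⌋₊).map Config.verdict) (some false)

/-- `P` makes all its queries before it receives any answers. -/
def IsNonadaptive (P : Program) (c n : ℕ) (ε : ℝ) : Prop :=
  ∀ (M : Image n) (t : ℕ), ∀ z ∈ (outcome P c ε M t).support, z.interleaved = false

end ImageTesting

open ImageTesting

namespace ImageTesting

/-! ### Expressions without overflow -/

/-! Put `k = ⌈1/ε⌉` and `R = l * 2 ^ J`, with `R` between `4k` and `9k/2`. A certificate of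
disconnectedness is a component of black pixels that avoids the grid lines of side `R`, hence stays
in one square of that grid, together with a black pixel in another square
(`not_mem_connectedImages`). Both testers reject only on such a certificate, which makes the error
one-sided. What remains is that random samples find one in every far image.

The second half is easy. A square has at most `R * R` pixels, a fixed fraction below one of the `ε
n²` black pixels of a far image, so the squares split into two groups with at least `ε n² / 8` black
pixels each (`exists_groups`). The first `128 k` samples are likely to meet both groups, and
whichever square holds the component, one of two black samples in different squares lies outside of
it.

For the component, connect the image by hand and count the cost. Painting the grid of side `R` costs
at most `3/4 ε n²`. A square of side `l * 2 ^ e` is bad if some black pixel in it lies on the grid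
of side `l` but is linked to nothing on the grid of side `l * 2 ^ e`. In every bad square of side `l
* 2 ^ (e + 1)` paint the lines that divide it into four. The painted backbone is connected
(`joined_of_backbone`), every black pixel not isolated at scale `l` is linked to it
(`exists_backbone_linked`), and the isolated ones are erased. So the sides of all bad squares and
the number of isolated pixels add up to a constant times `ε n²`, unless the extra term of the
adaptive case takes over. Level `i` spends `256 * 2 ^ i` samples on squares of side `r = R / 2 ^ i`.
A bad one is hit by `r²` pixels, and `256 * 2 ^ i * r² = 256 * R * r`, so the expected number of
hits is a constant (`sum_card_levelSet_ge`) and missing all of them is unlikely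
(`drawList_avoiding_le`).

The nonadaptive tester links adjacent pixels, takes `l` between `8` and `17` and reads whole
squares. The costs `2 ^ i * r²` form a geometric series with sum `O(R²)`.

The adaptive tester links pixels of a common closed cell of side `l`, so that a square is explored
from the pixels on the grid of side `l` alone, in total time `O(l * 4 ^ J) = O(R * 2 ^ J)`. Cells
link pixels that are not adjacent, but a component that avoids the coarse grid can be tied by at
most `2 l + 2` pixels to something closer to the backbone (`exists_link`,
`absoluteDistance_le_of_cellRel`). If this extra cost is large, there are many components, and few
of them exceed `K = 256 * l * R` pixels. Sample `t` explores its own component within a budget of `K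
/ t`. A component `C` is then found from every `t ≤ K / |C|`, so each contributes at least `K / 2`
whatever its size (`card_smallComponents_le`). The cost is `O(K log K)`, and `4 ^ J` of order `k log
k` balances it with `R * 2 ^ J` (`adaptiveTime_le`, `mul_pow_le`).

On the machine side, `Runs` is a timed program logic for deterministic code. All randomness sits in
the samples, which are drawn before anything else depends on chance (`run_draw`), so a run is a
function of the list of samples (`exists_run_tester`). Every test uses a fresh block of zero memory,
so that no time is spent on clearing. -/

instance : Add Term := ⟨.bin .add⟩
instance : Sub Term := ⟨.bin .sub⟩
instance : Mul Term := ⟨.bin .mul⟩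
instance : Div Term := ⟨.bin .div⟩
instance : Mod Term := ⟨.bin .mod⟩
instance (k : ℕ) : OfNat Term k := ⟨.lit k⟩

/-- The comparison `a < b` as an expression. -/
def Term.lt (a b : Term) : Term := .bin .lt a b

/-- The test `a = b` as an expression. -/
def Term.eq (a b : Term) : Term := .bin .eq a b

/-- The value of an expression on a machine with unbounded words. -/
def Term.ideal (reg mem : ℕ → ℕ) : Term → ℕ
  | .lit k => k
  | .reg r => reg r
  | .load a => mem (a.ideal reg mem)
  | .bin o a b => o.apply (a.ideal reg mem) (b.ideal reg mem)

section ideal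
variable (reg mem : ℕ → ℕ) (a b : Term)
@[simp] theorem Term.ideal_lit (k : ℕ) : (Term.lit k).ideal reg mem = k := rfl
@[simp] theorem Term.ideal_ofNat (k : ℕ) :
    (no_index (OfNat.ofNat k) : Term).ideal reg mem = OfNat.ofNat k := rfl
@[simp] theorem Term.ideal_reg (r : ℕ) : (Term.reg r).ideal reg mem = reg r := rfl
@[simp] theorem Term.ideal_load : (Term.load a).ideal reg mem = mem (a.ideal reg mem) := rfl
@[simp] theorem Term.ideal_add :
    (a + b).ideal reg mem = a.ideal reg mem + b.ideal reg mem := rfl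
@[simp] theorem Term.ideal_sub :
    (a - b).ideal reg mem = a.ideal reg mem - b.ideal reg mem := rfl
@[simp] theorem Term.ideal_mul :
    (a * b).ideal reg mem = a.ideal reg mem * b.ideal reg mem := rfl
@[simp] theorem Term.ideal_div :
    (a / b).ideal reg mem = a.ideal reg mem / b.ideal reg mem := rfl
@[simp] theorem Term.ideal_mod :
    (a % b).ideal reg mem = a.ideal reg mem % b.ideal reg mem := rfl
@[simp] theorem Term.ideal_lt_eq_zero :
    (a.lt b).ideal reg mem = 0 ↔ ¬ a.ideal reg mem < b.ideal reg mem := by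
  show (if _ then 1 else 0) = 0 ↔ _
  split_ifs with h <;> simpa using h
@[simp] theorem Term.ideal_eq_eq_zero :
    (a.eq b).ideal reg mem = 0 ↔ ¬ a.ideal reg mem = b.ideal reg mem := by
  show (if _ then 1 else 0) = 0 ↔ _
  split_ifs with h <;> simpa using h
end ideal

/-- The number of leaves of an expression, counting each memory access as a leaf. -/
def Term.size : Term → ℕ
  | .lit _ => 1
  | .reg _ => 1
  | .load a => a.size + 1
  | .bin _ a b => a.size + b.size

/-- All literals of the expression are at most `1000`. -/
def Term.litSmall : Term → Bool
  | .lit k => decide (k ≤ 1000)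
  | .reg _ => true
  | .load a => a.litSmall
  | .bin _ a b => a.litSmall && b.litSmall

/-- Expressions with at most `60` leaves and literals at most `1000`. -/
def Term.Small (e : Term) : Prop := e.litSmall = true ∧ e.size ≤ 60

instance (e : Term) : Decidable e.Small := inferInstanceAs (Decidable (_ ∧ _))

theorem Term.one_le_size (e : Term) : 1 ≤ e.size := by
  induction e with
  | lit k => simp [Term.size]
  | reg r => simp [Term.size]
  | load a ih => simp [Term.size]
  | bin o a b iha ihb => simp only [Term.size]; omega

theorem Op.apply_le (o : Op) {x y : ℕ} : o.apply x y ≤ max 1 (max (x + y) (x * y)) := by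
  cases o <;> simp only [Op.apply]
  · omega
  · omega
  · exact le_max_of_le_right (le_max_right _ _)
  · exact (Nat.div_le_self x y).trans (by omega)
  · exact (Nat.mod_le x y).trans (by omega)
  · split_ifs <;> omega
  · split_ifs <;> omega

/-- Every leaf is worth one factor `B`. Both powers of `B` are at least `2`, so their product
dominates their sum, and no operation exceeds the larger of sum, product and `1`. -/
theorem Term.ideal_le {B : ℕ} (hB : 1000 ≤ B) {reg mem : ℕ → ℕ} (hr : ∀ r, reg r ≤ B)
    (hm : ∀ a, mem a ≤ B) (e : Term) (he : e.litSmall = true) : e.ideal reg mem ≤ B ^ e.size := by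
  induction e with
  | lit k => simp [Term.litSmall] at he; simp [Term.size, Term.ideal]; omega
  | reg r => simpa [Term.size, Term.ideal] using hr r
  | load a ih =>
    simp only [Term.size, Term.ideal]
    exact (hm _).trans (Nat.le_self_pow (by omega) B)
  | bin o a b iha ihb =>
    simp only [Term.litSmall, Bool.and_eq_true] at he
    have ha := iha he.1
    have hb := ihb he.2
    simp only [Term.size, Term.ideal]
    have h1 : 2 ≤ B ^ a.size := (by omega : 2 ≤ B).trans
      (Nat.le_self_pow (by have := a.one_le_size; omega) B)
    have h2 : 2 ≤ B ^ b.size := (by omega : 2 ≤ B).trans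
      (Nat.le_self_pow (by have := b.one_le_size; omega) B)
    rw [pow_add]
    refine (o.apply_le).trans (max_le (by nlinarith) (max_le ?_ (Nat.mul_le_mul ha hb)))
    nlinarith

/-- No intermediate value reaches `2 ^ w`, so every reduction modulo `2 ^ w` is the identity. From
here on, programs are analysed with exact arithmetic; the only obligations left are that
`Term.Small` holds, which is decidable, and that stored words are at most `B`. -/
theorem Term.eval_eq_ideal {B w : ℕ} (hB : 1000 ≤ B) (hw : B ^ 60 < 2 ^ w) {reg mem : ℕ → ℕ}
    (hr : ∀ r, reg r ≤ B) (hm : ∀ a, mem a ≤ B) (e : Term) (he : e.Small) :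
    e.eval w reg mem = e.ideal reg mem := by
  have key : ∀ e : Term, e.Small → e.ideal reg mem < 2 ^ w := fun e he =>
    (e.ideal_le hB hr hm he.1).trans_lt ((Nat.pow_le_pow_right (by omega) he.2).trans_lt hw)
  induction e with
  | lit k => exact Nat.mod_eq_of_lt (key _ he)
  | reg r => rfl
  | load a ih =>
    have ha : a.Small := ⟨he.1, by have := he.2; simp only [Term.size] at this; omega⟩
    simp only [Term.eval, Term.ideal, ih ha]
  | bin o a b iha ihb =>
    have h1 := he.1
    have h2 := he.2
    simp only [Term.litSmall, Bool.and_eq_true] at h1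
    simp only [Term.size] at h2
    have ha : a.Small := ⟨h1.1, by omega⟩
    have hb : b.Small := ⟨h1.2, by omega⟩
    have := key _ he
    simp only [Term.ideal] at this
    simp only [Term.eval, Term.ideal, iha ha, ihb hb]
    exact Nat.mod_eq_of_lt this

/-! ### Timed correctness of deterministic programs -/

/-- The data of a running machine without its stack. -/
structure St where
  reg : ℕ → ℕ
  mem : ℕ → ℕ
  qs : List (ℕ × ℕ)
  rcv : Bool
  itl : Bool

/-- The configuration with stack `K` and data `s`. -/
def St.cfg (s : St) (K : List Program) : Config := ⟨K, s.reg, s.mem, s.qs, s.rcv, s.itl, none⟩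

def St.set (s : St) (r v : ℕ) : St := { s with reg := Function.update s.reg r v }
def St.put (s : St) (a v : ℕ) : St := { s with mem := Function.update s.mem a v }
def St.ask (s : St) (p : ℕ × ℕ) : St := { s with qs := s.qs ++ [p], itl := s.itl || s.rcv }
def St.recv (s : St) : St := { s with rcv := true }

section St
variable (s : St) (r v r' a : ℕ) (p : ℕ × ℕ)
@[simp] theorem St.set_reg : (s.set r v).reg r' = if r' = r then v else s.reg r' := by
  simp [St.set, Function.update_apply]
@[simp] theorem St.set_mem : (s.set r v).mem = s.mem := rfl
@[simp] theorem St.set_qs : (s.set r v).qs = s.qs := rfl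
@[simp] theorem St.set_rcv : (s.set r v).rcv = s.rcv := rfl
@[simp] theorem St.set_itl : (s.set r v).itl = s.itl := rfl
@[simp] theorem St.put_reg : (s.put r v).reg = s.reg := rfl
@[simp] theorem St.put_mem : (s.put r v).mem a = if a = r then v else s.mem a := by
  simp [St.put, Function.update_apply]
@[simp] theorem St.put_qs : (s.put r v).qs = s.qs := rfl
@[simp] theorem St.put_rcv : (s.put r v).rcv = s.rcv := rfl
@[simp] theorem St.put_itl : (s.put r v).itl = s.itl := rfl
@[simp] theorem St.ask_reg : (s.ask p).reg = s.reg := rfl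
@[simp] theorem St.ask_mem : (s.ask p).mem = s.mem := rfl
@[simp] theorem St.ask_qs : (s.ask p).qs = s.qs ++ [p] := rfl
@[simp] theorem St.ask_rcv : (s.ask p).rcv = s.rcv := rfl
@[simp] theorem St.ask_itl : (s.ask p).itl = (s.itl || s.rcv) := rfl
@[simp] theorem St.recv_reg : s.recv.reg = s.reg := rfl
@[simp] theorem St.recv_mem : s.recv.mem = s.mem := rfl
@[simp] theorem St.recv_qs : s.recv.qs = s.qs := rfl
@[simp] theorem St.recv_itl : s.recv.itl = s.itl := rfl
@[simp] theorem St.recv_rcv : s.recv.rcv = true := rfl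
end St

/-- The value of an expression in a state. -/
abbrev Term.val (e : Term) (s : St) : ℕ := e.ideal s.reg s.mem

theorem run_add {n : ℕ} (M : Image n) (w a b : ℕ) (z : Config) :
    run M w (a + b) z = (run M w a z).bind (run M w b) := by
  induction a generalizing z with
  | zero => simp [run]
  | succ a ih =>
    rw [Nat.succ_add]
    simp only [run, PMF.bind_bind]
    congr 1
    funext z'
    exact ih z'

theorem run_succ_of_step {n : ℕ} {M : Image n} {w t : ℕ} {z z' : Config}
    (h : step M w z = PMF.pure z') : run M w (t + 1) z = run M w t z' := by
  simp [run, h]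

/-- `p` takes the data `s` to `s'` in exactly `t` steps, all deterministic. -/
def Exec {n : ℕ} (M : Image n) (w : ℕ) (p : Program) (s : St) (t : ℕ) (s' : St) : Prop :=
  ∀ K, run M w t (s.cfg (p :: K)) = PMF.pure (s'.cfg K)

/-- An image together with a word length and a bound on the words that occur. -/
structure Ctx (n : ℕ) where
  M : Image n
  w : ℕ
  B : ℕ
  hB : 1000 ≤ B
  hw : B ^ 60 < 2 ^ w

variable {n : ℕ} {X : Ctx n}

/-- All words are at most `B`. -/
def Ctx.Good (X : Ctx n) (s : St) : Prop := (∀ r, s.reg r ≤ X.B) ∧ ∀ a, s.mem a ≤ X.B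

theorem Ctx.Good.eval {s : St} (h : X.Good s) {e : Term} (he : e.Small) :
    e.eval X.w s.reg s.mem = e.val s := Term.eval_eq_ideal X.hB X.hw h.1 h.2 e he

theorem Ctx.Good.set {s : St} (h : X.Good s) {r v : ℕ} (hv : v ≤ X.B) : X.Good (s.set r v) :=
  ⟨fun r' => by rw [St.set_reg]; split_ifs <;> [exact hv; exact h.1 r'], h.2⟩

theorem Ctx.Good.put {s : St} (h : X.Good s) {r v : ℕ} (hv : v ≤ X.B) : X.Good (s.put r v) :=
  ⟨h.1, fun b => by rw [St.put_mem]; split_ifs <;> [exact hv; exact h.2 b]⟩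

/-- Started on `s`, the program `p` terminates deterministically within `T` steps, in a state with
property `Q`, provided that words and the number of queries stay bounded. -/
def Runs (X : Ctx n) (s : St) (p : Program) (T : ℕ) (Q : St → Prop) : Prop :=
  X.Good s → s.qs.length + T ≤ X.B → ∃ t ≤ T, ∃ s', Exec X.M X.w p s t s' ∧ X.Good s' ∧
    s'.qs.length ≤ s.qs.length + t ∧ Q s'

namespace Runs
variable {s : St} {p q : Program} {T T' : ℕ} {Q Q' : St → Prop} {e e' : Term} {r : ℕ}

theorem intro_good (h : X.Good s → s.qs.length + T ≤ X.B → Runs X s p T Q) : Runs X s p T Q :=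
  fun hg hq => h hg hq hg hq

theorem mono (h : Runs X s p T Q) (hT : T ≤ T') (hQ : ∀ s', X.Good s' → Q s' → Q' s') :
    Runs X s p T' Q' := fun hg hq => by
  obtain ⟨t, ht, s', h1, h2, h3, h4⟩ := h hg (by omega)
  exact ⟨t, ht.trans hT, s', h1, h2, h3, hQ s' h2 h4⟩

theorem time (h : Runs X s p T Q) (hT : T ≤ T') : Runs X s p T' Q := h.mono hT fun _ _ h => h

theorem set (he : e.Small) (hv : e.val s ≤ X.B) (hQ : Q (s.set r (e.val s))) :
    Runs X s (.set r e) 1 Q := fun hg _ =>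
  ⟨1, le_rfl, s.set r (e.val s), fun K => by
    rw [run_succ_of_step (z' := (s.set r (e.val s)).cfg K)]
    · rfl
    · rw [← hg.eval he]; rfl, hg.set hv, by simp, hQ⟩

theorem store (ha : e'.Small) (he : e.Small) (hv : e.val s ≤ X.B)
    (hQ : Q (s.put (e'.val s) (e.val s))) : Runs X s (.store e' e) 1 Q := fun hg _ =>
  ⟨1, le_rfl, s.put (e'.val s) (e.val s), fun K => by
    rw [run_succ_of_step (z' := (s.put (e'.val s) (e.val s)).cfg K)]
    · rfl
    · rw [← hg.eval he, ← hg.eval ha]; rfl, hg.put hv, by simp, hQ⟩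

theorem query (ha : e'.Small) (he : e.Small)
    (hQ : Q (s.ask (e'.val s, e.val s))) : Runs X s (.query e' e) 1 Q := fun hg _ =>
  ⟨1, le_rfl, s.ask (e'.val s, e.val s), fun K => by
    rw [run_succ_of_step (z' := (s.ask (e'.val s, e.val s)).cfg K)]
    · rfl
    · rw [← hg.eval he, ← hg.eval ha]; rfl, ⟨hg.1, hg.2⟩, by simp, hQ⟩

theorem receive {x : ℕ × ℕ} (he : e.Small) (hx : s.qs[e.val s]? = some x)
    (hQ : Q (s.recv.set r (pixel X.M x))) : Runs X s (.receive r e) 1 Q := fun hg _ => by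
  have hp : pixel X.M x ≤ 1 := by
    unfold pixel
    split_ifs
    · exact Bool.toNat_le _
    · omega
  have hpB : pixel X.M x ≤ X.B := hp.trans (by have := X.hB; omega)
  have hw : pixel X.M x % 2 ^ X.w = pixel X.M x :=
    Nat.mod_eq_of_lt (hpB.trans_lt ((Nat.le_self_pow (by norm_num) _).trans_lt X.hw))
  refine ⟨1, le_rfl, s.recv.set r (pixel X.M x), fun K => ?_, ?_, by simp, hQ⟩
  · rw [run_succ_of_step (z' := (s.recv.set r (pixel X.M x)).cfg K)]
    · rfl
    · show PMF.pure _ = _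
      simp only [St.cfg, hg.eval he, hx, Option.map_some, Option.getD_some, hw]
      rfl
  · exact Ctx.Good.set (s := s.recv) ⟨hg.1, hg.2⟩ hpB

theorem seq (h : Runs X s p T fun s' => Runs X s' q T' Q) :
    Runs X s (.seq p q) (T + T' + 1) Q := fun hg hq => by
  obtain ⟨t, ht, s', h1, h2, h3, h4⟩ := h hg (by omega)
  -- The first part makes at most one query per step, so its time pays for its queries and the bound
  -- on their number carries over to the second part.
  obtain ⟨t', ht', s'', h1', h2', h3', h4'⟩ := h4 h2 (by omega)
  refine ⟨t + t' + 1, by omega, s'', fun K => ?_, h2', by omega, h4'⟩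
  rw [run_succ_of_step (z' := s.cfg (p :: q :: K)) rfl, run_add, h1, PMF.pure_bind, h1']

theorem cond (he : e.Small) (h1 : e.val s ≠ 0 → Runs X s p T Q)
    (h2 : e.val s = 0 → Runs X s q T Q) : Runs X s (.cond e p q) (T + 1) Q := fun hg hq => by
  by_cases h : e.val s = 0
  · obtain ⟨t, ht, s', h1, h2, h3, h4⟩ := h2 h hg (by omega)
    refine ⟨t + 1, by omega, s', fun K => ?_, h2, by omega, h4⟩
    rw [run_succ_of_step (z' := s.cfg (q :: K)), h1]
    show PMF.pure _ = _
    simp only [St.cfg, hg.eval he, h]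
    rfl
  · obtain ⟨t, ht, s', h1, h2, h3, h4⟩ := h1 h hg (by omega)
    refine ⟨t + 1, by omega, s', fun K => ?_, h2, by omega, h4⟩
    rw [run_succ_of_step (z' := s.cfg (p :: K)), h1]
    show PMF.pure _ = _
    simp only [St.cfg, hg.eval he]
    rw [if_pos h]

theorem loop_zero (he : e.Small) (h : e.val s = 0) (hQ : Q s) : Runs X s (.loop e p) 1 Q :=
  fun hg _ => ⟨1, le_rfl, s, fun K => by
    rw [run_succ_of_step (z' := s.cfg K)]
    · rfl
    · show PMF.pure _ = _
      simp only [St.cfg, hg.eval he, h]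
      rfl, hg, by simp, hQ⟩

theorem loop_succ (he : e.Small) (h : e.val s ≠ 0)
    (hp : Runs X s p T fun s' => Runs X s' (.loop e p) T' Q) :
    Runs X s (.loop e p) (T + 1 + T') Q := fun hg hq => by
  obtain ⟨t, ht, s', h1, h2, h3, h4⟩ := hp hg (by omega)
  obtain ⟨t', ht', s'', h1', h2', h3', h4'⟩ := h4 h2 (by omega)
  refine ⟨t + t' + 1, by omega, s'', fun K => ?_, h2', by omega, h4'⟩
  rw [run_succ_of_step (z' := s.cfg (p :: .loop e p :: K)), run_add, h1, PMF.pure_bind, h1']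
  show PMF.pure _ = _
  simp only [St.cfg, hg.eval he]
  rw [if_pos h]

/-- A loop with a known number of iterations. -/
theorem loop_for (I : ℕ → St → Prop) (m : ℕ) (c : ℕ → ℕ) (he : e.Small) (h0 : I 0 s)
    (hpos : ∀ i < m, ∀ s, I i s → e.val s ≠ 0)
    (hbody : ∀ i < m, ∀ s, I i s → Runs X s p (c i) (I (i + 1)))
    (hend : ∀ s, I m s → e.val s = 0) :
    Runs X s (.loop e p) (∑ i ∈ Finset.range m, (c i + 1) + 1) (I m) := by
  -- Induction on the number `j` of iterations still to come, because `loop_succ` peels off the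
  -- first iteration.
  have key : ∀ j ≤ m, ∀ s, I (m - j) s →
      Runs X s (.loop e p) (∑ i ∈ Finset.Ico (m - j) m, (c i + 1) + 1) (I m) := by
    intro j
    induction j with
    | zero => intro _ s hs; simpa using loop_zero he (hend s hs) hs
    | succ j ih =>
      intro hj s hs
      have hlt : m - (j + 1) < m := by omega
      have e1 : m - (j + 1) + 1 = m - j := by omega
      rw [Finset.sum_eq_sum_Ico_succ_bot hlt, add_assoc, e1]
      refine loop_succ he (hpos _ hlt s hs) ((hbody _ hlt s hs).mono le_rfl fun s' _ h => ?_)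
      rw [e1] at h
      exact ih (by omega) s' h
  have := key m le_rfl s (by simpa using h0)
  rw [Nat.sub_self] at this
  rw [Finset.range_eq_Ico]
  exact this

/-- A loop with a decreasing measure. -/
theorem loop_while (I : St → Prop) (μ : St → ℕ) (c : ℕ) (he : e.Small) (h0 : I s)
    (hpos : ∀ s, I s → e.val s ≠ 0 → 0 < μ s)
    (hbody : ∀ s, X.Good s → I s → e.val s ≠ 0 → Runs X s p c fun s' => I s' ∧ μ s' < μ s) :
    Runs X s (.loop e p) ((c + 1) * μ s + 1) fun s' => I s' ∧ e.val s' = 0 := by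
  have key : ∀ m, ∀ s, I s → μ s ≤ m →
      Runs X s (.loop e p) ((c + 1) * m + 1) fun s' => I s' ∧ e.val s' = 0 := by
    intro m
    induction m with
    | zero =>
      intro s hs hm
      refine intro_good fun hg _ => ?_
      by_cases h : e.val s = 0
      · simpa using loop_zero he h ⟨hs, h⟩
      · exact absurd (hpos s hs h) (by omega)
    | succ m ih =>
      intro s hs hm
      refine intro_good fun hg _ => ?_
      by_cases h : e.val s = 0
      · exact (loop_zero he h ⟨hs, h⟩).time (by omega)
      · have e1 : (c + 1) * (m + 1) + 1 = c + 1 + ((c + 1) * m + 1) := by ring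
        rw [e1]
        exact loop_succ he h ((hbody s hg hs h).mono le_rfl fun s' _ h =>
          ih s' h.1 (by omega))
  exact key _ s h0 le_rfl

end Runs
end ImageTesting

namespace ImageTesting

notation:50 p:51 "⨟" q:50 => Program.seq p q

/-- A program without effect. -/
def skip : Program := .loop 0 (.halt true)

theorem Runs.skip {n : ℕ} {X : Ctx n} {s : St} {Q : St → Prop} (hQ : Q s) :
    Runs X s skip 1 Q := Runs.loop_zero (by decide) rfl hQ

/-! ### Exploring a grid graph

Vertices are numbers `a * S + b` below `S * S`. The marks are stored from address `b` on, and the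
queue of all vertices seen so far from address `b + H` on, where `S`, `b` and `H` are in the
registers `15`, `16` and `7`. Registers `22` and `23` hold the head and the tail of the queue. -/

/-- Mark the vertex in register `21` and append it to the queue. -/
def pushVertex : Program :=
  .store (.reg 16 + .reg 21) 1 ⨟ .store (.reg 16 + .reg 7 + .reg 23) (.reg 21) ⨟
    .set 23 (.reg 23 + 1)

/-- Push the vertex in register `21` if it is new and the program `E` finds it adjacent to the
vertex in register `20`. -/
def visit (E : Program) : Program :=
  .cond ((Term.reg 21).lt (.reg 15 * .reg 15))
    (.cond (.load (.reg 16 + .reg 21)) skip (E ⨟ .cond (.reg 30) pushVertex skip)) skip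

/-- Visit the four neighbours of the next vertex in the queue. -/
def expand (E : Program) : Program :=
  .set 20 (.load (.reg 16 + .reg 7 + .reg 22)) ⨟ .set 22 (.reg 22 + 1) ⨟
  .set 21 (.reg 20 + 1) ⨟ visit E ⨟ .set 21 (.reg 20 - 1) ⨟ visit E ⨟
  .set 21 (.reg 20 + .reg 15) ⨟ visit E ⨟ .set 21 (.reg 20 - .reg 15) ⨟ visit E

/-- The four neighbours of a vertex. -/
def nbrs (S v : ℕ) : List ℕ := [v + 1, v - 1, v + S, v - S]

/-- The vertices reachable from a list of vertices. -/
inductive Reach (S : ℕ) (op : ℕ → ℕ → Prop) (q₀ : List ℕ) : ℕ → Prop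
  | base {x : ℕ} (h : x ∈ q₀) : Reach S op q₀ x
  | step {y u : ℕ} (hy : Reach S op q₀ y) (hu : u ∈ nbrs S y) (hS : u < S * S) (ho : op y u) :
      Reach S op q₀ u

/-- The state holds the queue `q`, and differs from `s₀` only in the working registers and in the
working memory. -/
structure QInv (Env : St → Prop) (s₀ : St) (q : List ℕ) (s : St) : Prop where
  env : Env s
  frame : ∀ r, r < 20 ∨ 40 < r → s.reg r = s₀.reg r
  tail : s.reg 23 = q.length
  nodup : q.Nodup
  lt : ∀ x ∈ q, x < s₀.reg 15 * s₀.reg 15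
  mark : ∀ x < s₀.reg 15 * s₀.reg 15, s.mem (s₀.reg 16 + x) ≠ 0 ↔ x ∈ q
  queue : ∀ (i : ℕ) (h : i < q.length), s.mem (s₀.reg 16 + s₀.reg 7 + i) = q[i]
  mem : ∀ a, a < s₀.reg 16 ∨ s₀.reg 16 + 2 * s₀.reg 7 ≤ a → s.mem a = s₀.mem a

/-- `Env` only depends on registers outside of the working registers, and on the queries. -/
def Stable (Env : St → Prop) : Prop :=
  ∀ s u : St, Env s → (∀ r, r < 20 ∨ 40 ≤ r → u.reg r = s.reg r) → u.qs = s.qs →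
    u.rcv = s.rcv → u.itl = s.itl → Env u

/-- The program `E` computes in register `30` whether the vertices in the registers `20` and `21`
are adjacent. -/
def EdgeSpec {n : ℕ} (X : Ctx n) (Env : St → Prop) (E : Program) (S : ℕ) (op : ℕ → ℕ → Prop)
    (τ : ℕ) : Prop :=
  ∀ s, Env s → s.reg 20 < S * S → s.reg 21 < S * S → Runs X s E τ fun s' => Env s' ∧
    (∀ r, r < 30 ∨ 40 < r → s'.reg r = s.reg r) ∧ s'.mem = s.mem ∧
    (s'.reg 30 ≠ 0 ↔ op (s.reg 20) (s.reg 21))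

theorem length_le_of_nodup_lt {q : List ℕ} {m : ℕ} (h : q.Nodup) (hq : ∀ x ∈ q, x < m) :
    q.length ≤ m := by
  rw [← List.toFinset_card_of_nodup h, ← Finset.card_range m]
  exact Finset.card_le_card fun x hx => Finset.mem_range.2 (hq x (List.mem_toFinset.1 hx))

/-! ### Correctness of the breadth-first exploration of a grid graph. -/

section flood
variable {n : ℕ} {X : Ctx n} {Env : St → Prop} {s₀ : St} {E : Program} {op : ℕ → ℕ → Prop}
  {τ : ℕ} {s : St} {q : List ℕ}

theorem QInv.set (hst : Stable Env) (h : QInv Env s₀ q s) {r v : ℕ}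
    (hr : 20 ≤ r ∧ r < 40 ∧ r ≠ 23) : QInv Env s₀ q (s.set r v) where
  env := hst s _ h.env (fun r' hr' => by rw [St.set_reg, if_neg (by omega)]) rfl rfl rfl
  frame r' hr' := by rw [St.set_reg, if_neg (by omega), h.frame r' hr']
  tail := by rw [St.set_reg, if_neg (by omega), h.tail]
  nodup := h.nodup
  lt := h.lt
  mark := h.mark
  queue := h.queue
  mem := h.mem

/-- Marks occupy the first `S * S` cells of the block and the queue starts `H` cells later, so `S *
S ≤ H` keeps them apart. The queue has distinct entries below `S * S` and cannot run out of its half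
of the block either. -/
theorem runs_pushVertex (hst : Stable Env) (hS : s₀.reg 15 * s₀.reg 15 ≤ s₀.reg 7)
    (h : QInv Env s₀ q s) (hu : s.reg 21 < s₀.reg 15 * s₀.reg 15) (hq : s.reg 21 ∉ q) :
    Runs X s pushVertex 5 fun s' => QInv Env s₀ (q ++ [s.reg 21]) s' ∧
      ∀ r, r ≠ 23 → s'.reg r = s.reg r := by
  refine Runs.intro_good fun hg _ => ?_
  have h16 := h.frame 16 (by omega)
  have h7 := h.frame 7 (by omega)
  have hlt' : ∀ x ∈ q ++ [s.reg 21], x < s₀.reg 15 * s₀.reg 15 := by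
    intro x hx
    rcases List.mem_append.1 hx with hx | hx
    · exact h.lt x hx
    · rw [List.mem_singleton] at hx; omega
  have hnd : (q ++ [s.reg 21]).Nodup := by
    rw [List.nodup_append]
    exact ⟨h.nodup, List.nodup_singleton _, by
      intro a ha b hb e
      rw [List.mem_singleton] at hb
      exact hq (by rw [← hb, ← e]; exact ha)⟩
  have hlen : q.length + 1 ≤ s₀.reg 15 * s₀.reg 15 := by
    simpa using length_le_of_nodup_lt hnd hlt'
  have hB := X.hB
  refine Runs.time (Runs.seq (Runs.store (by decide) (by decide) ?_ (Runs.seq (Runs.store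
    (by decide) (by decide) ?_ (Runs.set (by decide) ?_ ⟨?_, ?_⟩))))) le_rfl
  · simpa using (by omega : 1 ≤ X.B)
  · simpa using hg.1 21
  · have h1 := hg.1 7
    simp [h.tail]
    omega
  · refine ⟨?_, ?_, ?_, hnd, hlt', ?_, ?_, ?_⟩
    · refine hst s _ h.env (fun r' hr' => ?_) rfl rfl rfl
      simp only [St.set_reg, St.put_reg]
      rw [if_neg (by omega)]
    · intro r' hr'
      simp only [St.set_reg, St.put_reg]
      rw [if_neg (by omega), h.frame r' hr']
    · simp [h.tail]
    · intro x hx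
      simp [h16, h7, h.tail]
      rw [if_neg (by omega)]
      by_cases hxu : x = s.reg 21
      · simp [hxu]
      · simp [hxu, h.mark x hx]
    · intro i hi
      simp [h16, h7, h.tail] at hi ⊢
      by_cases hiq : i = q.length
      · simp [hiq]
      · have : i < q.length := by omega
        rw [if_neg hiq, if_neg (by omega), h.queue i this, List.getElem_append_left this]
    · intro a ha
      simp [h16, h7, h.tail]
      rw [if_neg (by omega), if_neg (by omega), h.mem a ha]
  · intro r hr
    simp [hr]

/-- What a visit does to the queue. -/
def Visited (S : ℕ) (op : ℕ → ℕ → Prop) (v u : ℕ) (q q' : List ℕ) : Prop :=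
  (q' = q ∨ q' = q ++ [u] ∧ u < S * S ∧ op v u) ∧ (u < S * S → op v u → u ∈ q')

theorem runs_visit (hst : Stable Env) (hS : s₀.reg 15 * s₀.reg 15 ≤ s₀.reg 7)
    (hE : EdgeSpec X Env E (s₀.reg 15) op τ) (h : QInv Env s₀ q s)
    (hv : s.reg 20 < s₀.reg 15 * s₀.reg 15) :
    Runs X s (visit E) (τ + 9) fun s' => ∃ q', QInv Env s₀ q' s' ∧
      Visited (s₀.reg 15) op (s.reg 20) (s.reg 21) q q' ∧ ∀ r, r < 23 → s'.reg r = s.reg r := by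
  have h16 := h.frame 16 (by omega)
  have h15 := h.frame 15 (by omega)
  refine Runs.time (Runs.cond (T := τ + 8) (by decide) (fun hu => ?_) fun hu => ?_) le_rfl
  · simp [h15] at hu
    refine Runs.cond (T := τ + 7) (by decide) (fun hm => ?_) fun hm => ?_
    · refine (Runs.skip ?_).time (by omega)
      simp only [Term.ideal_load, Term.ideal_add, Term.ideal_reg, h16] at hm
      exact ⟨q, h, ⟨Or.inl rfl, fun _ _ => (h.mark _ hu).1 hm⟩, fun _ _ => rfl⟩
    · simp only [Term.ideal_load, Term.ideal_add, Term.ideal_reg, h16] at hm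
      have hq : s.reg 21 ∉ q := fun hc => (h.mark _ hu).2 hc hm
      refine Runs.seq (T := τ) (T' := 6) ((hE s h.env hv hu).mono le_rfl ?_)
      rintro s' - ⟨e1, e2, e3, e4⟩
      have hs' : QInv Env s₀ q s' := by
        refine ⟨e1, fun r hr => ?_, ?_, h.nodup, h.lt, ?_, ?_, ?_⟩
        · rw [e2 r (by omega), h.frame r hr]
        · rw [e2 23 (by omega), h.tail]
        · rw [e3]; exact h.mark
        · rw [e3]; exact h.queue
        · rw [e3]; exact h.mem
      have e21 := e2 21 (by omega)
      refine Runs.cond (by decide) (fun ho => ?_) fun ho => ?_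
      · simp only [Term.ideal_reg] at ho
        refine (runs_pushVertex hst hS hs' (by rw [e21]; exact hu) (by rw [e21]; exact hq)).mono
          le_rfl ?_
        rintro s'' - ⟨f1, f2⟩
        rw [e21] at f1
        refine ⟨_, f1, ⟨Or.inr ⟨rfl, hu, e4.1 ho⟩, fun _ _ => by simp⟩, fun r hr => ?_⟩
        rw [f2 r (by omega), e2 r (by omega)]
      · simp only [Term.ideal_reg] at ho
        refine (Runs.skip ?_).time (by omega)
        exact ⟨q, hs', ⟨Or.inl rfl, fun _ hop => absurd ho (e4.2 hop)⟩,
          fun r hr => e2 r (by omega)⟩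
  · simp [h15] at hu
    refine (Runs.skip ?_).time (by omega)
    exact ⟨q, h, ⟨Or.inl rfl, fun hc => by omega⟩, fun _ _ => rfl⟩

theorem Visited.prefix {S v u : ℕ} {q q' : List ℕ} (h : Visited S op v u q q') : q <+: q' := by
  rcases h.1 with h | h
  · rw [h]
  · rw [h.1]; exact List.prefix_append _ _

theorem Visited.mem {S v u x : ℕ} {q q' : List ℕ} (h : Visited S op v u q q') (hx : x ∈ q') :
    x ∈ q ∨ (x = u ∧ u < S * S ∧ op v u) := by
  rcases h.1 with h | h
  · rw [h] at hx; exact Or.inl hx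
  · rw [h.1] at hx
    rcases List.mem_append.1 hx with hx | hx
    · exact Or.inl hx
    · exact Or.inr ⟨List.mem_singleton.1 hx, h.2⟩

/-- A visit preserves all registers below `23`, so the current vertex and the head survive the four
visits, and the queue only grows at its end. Thus neighbours found early stay in the final queue. -/
theorem runs_expand (hst : Stable Env) (hS : s₀.reg 15 * s₀.reg 15 ≤ s₀.reg 7)
    (hSB : 2 * s₀.reg 7 ≤ X.B) (hE : EdgeSpec X Env E (s₀.reg 15) op τ) (h : QInv Env s₀ q s)
    (hh : s.reg 22 < q.length) :
    Runs X s (expand E) (4 * τ + 51) fun s' => ∃ q', QInv Env s₀ q' s' ∧ q <+: q' ∧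
      s'.reg 22 = s.reg 22 + 1 ∧
      (∀ u ∈ nbrs (s₀.reg 15) q[s.reg 22], u < s₀.reg 15 * s₀.reg 15 → op q[s.reg 22] u → u ∈ q') ∧
      ∀ x ∈ q', x ∈ q ∨ (x ∈ nbrs (s₀.reg 15) q[s.reg 22] ∧ x < s₀.reg 15 * s₀.reg 15 ∧
        op q[s.reg 22] x) := by
  refine Runs.intro_good fun hg _ => ?_
  have h16 := h.frame 16 (by omega)
  have h15 := h.frame 15 (by omega)
  have h7 := h.frame 7 (by omega)
  have hB := X.hB
  have hlen := length_le_of_nodup_lt h.nodup h.lt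
  have hv : q[s.reg 22] < s₀.reg 15 * s₀.reg 15 := h.lt _ (List.getElem_mem hh)
  have hval : s.mem (s.reg 16 + s.reg 7 + s.reg 22) = q[s.reg 22] := by
    rw [h16, h7]; exact h.queue _ hh
  set v := q[s.reg 22] with hvdef
  have hSS : s₀.reg 15 ≤ s₀.reg 15 * s₀.reg 15 := Nat.le_mul_self _
  refine Runs.time (Runs.seq (Runs.set (by decide) ?_ (Runs.seq (Runs.set (by decide) ?_
    (Runs.seq (Runs.set (by decide) ?_ (Runs.seq (T := τ + 9) (T' := 3 * τ + 35)
      ((runs_visit hst hS hE (((h.set hst (by omega)).set hst (by omega)).set hst (by omega))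
        ?_).mono le_rfl ?_)))))))) (by omega)
  · simp [hval]; omega
  · simp; omega
  · simp [hval]; omega
  · simp [hval]; omega
  rintro s1 - ⟨q1, g1, v1, f1⟩
  have k1 : s1.reg 20 = v := by rw [f1 20 (by omega)]; simp [hval]
  have k1' : s1.reg 22 = s.reg 22 + 1 := by rw [f1 22 (by omega)]; simp
  refine Runs.time (Runs.seq (Runs.set (by decide) ?_ (Runs.seq (T := τ + 9) (T' := 2 * τ + 23)
      ((runs_visit hst hS hE (g1.set hst (by omega)) ?_).mono le_rfl ?_)))) (by omega)
  · simp [k1]; omega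
  · simp [k1]; omega
  rintro s2 - ⟨q2, g2, v2, f2⟩
  have k2 : s2.reg 20 = v := by rw [f2 20 (by omega)]; simp [k1]
  have k2' : s2.reg 22 = s.reg 22 + 1 := by rw [f2 22 (by omega)]; simp [k1']
  refine Runs.time (Runs.seq (Runs.set (by decide) ?_ (Runs.seq (T := τ + 9) (T' := τ + 11)
      ((runs_visit hst hS hE (g2.set hst (by omega)) ?_).mono le_rfl ?_)))) (by omega)
  · simp [k2, g2.frame 15]; omega
  · simp [k2]; omega
  rintro s3 - ⟨q3, g3, v3, f3⟩
  have k3 : s3.reg 20 = v := by rw [f3 20 (by omega)]; simp [k2]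
  have k3' : s3.reg 22 = s.reg 22 + 1 := by rw [f3 22 (by omega)]; simp [k2']
  refine Runs.time (Runs.seq (T' := τ + 9) (Runs.set (by decide) ?_
      ((runs_visit hst hS hE (g3.set hst (by omega)) ?_).mono le_rfl ?_))) (by omega)
  · simp [k3, g3.frame 15]; omega
  · simp [k3]; omega
  rintro s4 - ⟨q4, g4, v4, f4⟩
  have k4' : s4.reg 22 = s.reg 22 + 1 := by rw [f4 22 (by omega)]; simp [k3']
  simp [hval] at v1
  simp [k1] at v2
  simp [k2, g2.frame 15] at v3
  simp [k3, g3.frame 15] at v4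
  refine ⟨q4, g4, (v1.prefix.trans v2.prefix).trans (v3.prefix.trans v4.prefix), k4', ?_, ?_⟩
  · intro u hu hlt ho
    simp only [nbrs, List.mem_cons, List.not_mem_nil, or_false] at hu
    rcases hu with rfl | rfl | rfl | rfl
    · exact v4.prefix.subset (v3.prefix.subset (v2.prefix.subset (v1.2 hlt ho)))
    · exact v4.prefix.subset (v3.prefix.subset (v2.2 hlt ho))
    · exact v4.prefix.subset (v3.2 hlt ho)
    · exact v4.2 hlt ho
  · intro x hx
    simp only [nbrs, List.mem_cons, List.not_mem_nil, or_false]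
    rcases v4.mem hx with hx | ⟨rfl, a, b⟩
    · rcases v3.mem hx with hx | ⟨rfl, a, b⟩
      · rcases v2.mem hx with hx | ⟨rfl, a, b⟩
        · rcases v1.mem hx with hx | ⟨rfl, a, b⟩
          · exact Or.inl hx
          · exact Or.inr ⟨by simp, a, b⟩
        · exact Or.inr ⟨by simp, a, b⟩
      · exact Or.inr ⟨by simp, a, b⟩
    · exact Or.inr ⟨by simp, a, b⟩

/-- The queue `q` extends `q₀` by reachable vertices, and its first `m` vertices are processed. -/
structure Explored (S : ℕ) (op : ℕ → ℕ → Prop) (q₀ q : List ℕ) (m : ℕ) : Prop where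
  pre : q₀ <+: q
  reach : ∀ x ∈ q, Reach S op q₀ x
  closed : ∀ (i : ℕ) (h : i < q.length), i < m → ∀ u ∈ nbrs S q[i], u < S * S → op q[i] u → u ∈ q

/-- The loop condition `e` is left abstract to serve both the complete exploration of a square and
the exploration within a budget. It must bound the head by `m`, which makes `m` minus the head a
decreasing measure; `P` remembers what the condition guaranteed about each expanded vertex. -/
theorem runs_flood (hst : Stable Env) (hS : s₀.reg 15 * s₀.reg 15 ≤ s₀.reg 7)
    (hSB : 2 * s₀.reg 7 ≤ X.B) (hE : EdgeSpec X Env E (s₀.reg 15) op τ) {e : Term} (he : e.Small)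
    {m : ℕ} {P : ℕ → Prop} (hcond : ∀ s q, QInv Env s₀ q s → e.val s ≠ 0 →
      ∃ h : s.reg 22 < q.length, s.reg 22 < m ∧ P q[s.reg 22])
    (h : QInv Env s₀ q s) (hh : s.reg 22 = 0) :
    Runs X s (.loop e (expand E)) ((4 * τ + 52) * m + 1) fun s' => ∃ q', QInv Env s₀ q' s' ∧
      Explored (s₀.reg 15) op q q' (s'.reg 22) ∧ s'.reg 22 ≤ q'.length ∧
      (∀ (i : ℕ) (h : i < q'.length), i < s'.reg 22 → P q'[i]) ∧ e.val s' = 0 := by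
  refine (Runs.loop_while (fun s' => ∃ q', QInv Env s₀ q' s' ∧
      Explored (s₀.reg 15) op q q' (s'.reg 22) ∧ s'.reg 22 ≤ q'.length ∧
      ∀ (i : ℕ) (h : i < q'.length), i < s'.reg 22 → P q'[i]) (fun s => m - s.reg 22)
      (4 * τ + 51) he ?_ ?_ ?_).mono (by simp [hh]) ?_
  · refine ⟨q, h, ⟨List.prefix_refl q, fun x hx => .base hx, fun i hi hlt => ?_⟩, by omega,
      fun i _ hlt => ?_⟩
    all_goals omega
  · rintro s ⟨q', h1, -⟩ hne
    obtain ⟨-, h2, -⟩ := hcond s q' h1 hne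
    omega
  · rintro s hg ⟨q', h1, h2, h2', h2''⟩ hne
    obtain ⟨c1, c2, c3⟩ := hcond s q' h1 hne
    refine (runs_expand hst hS hSB hE h1 c1).mono le_rfl ?_
    rintro s' - ⟨q'', g1, g2, g3, g4, g5⟩
    refine ⟨⟨q'', g1, ⟨h2.pre.trans g2, fun x hx => ?_, fun i hi hlt u hu hus hop => ?_⟩, ?_, fun i hi hlt => ?_⟩, ?_⟩
    · rcases g5 x hx with hx | ⟨a, b, c⟩
      · exact h2.reach x hx
      · exact .step (h2.reach _ (List.getElem_mem c1)) a b c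
    · rw [g3] at hlt
      have hiq : i < q'.length := by omega
      have e1 : q''[i] = q'[i] := (g2.getElem hiq).symm
      rw [e1] at hu hop
      rcases Nat.lt_succ_iff_lt_or_eq.1 hlt with hlt | rfl
      · exact g2.subset (h2.closed i hiq hlt u hu hus hop)
      · exact g4 u hu hus hop
    · have := g2.length_le
      omega
    · have hiq : i < q'.length := by omega
      rw [← g2.getElem hiq]
      rcases Nat.lt_succ_iff_lt_or_eq.1 (g3 ▸ hlt) with hlt | rfl
      · exact h2'' i hiq hlt
      · exact c3
    · omega
  · rintro s' - ⟨⟨q', h1, h2, h3, h3'⟩, h4⟩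
    exact ⟨q', h1, h2, h3, h3', h4⟩

end flood
end ImageTesting

namespace ImageTesting

/-! ### Exploring a square from its border -/

/-- The vertex `x` is not on the outer ring of the grid. -/
def inside (S x : ℕ) : Prop := (0 < x / S ∧ x / S + 1 < S) ∧ 0 < x % S ∧ x % S + 1 < S

instance (S x : ℕ) : Decidable (inside S x) := inferInstanceAs (Decidable (_ ∧ _))

/-- The test whether the vertex given by `e` is inside. -/
def insideTerm (e : Term) : Term :=
  Term.lt 0 (e / .reg 15) * (e / .reg 15 + 1).lt (.reg 15) *
    (Term.lt 0 (e % .reg 15) * (e % .reg 15 + 1).lt (.reg 15))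

theorem insideTerm_val (e : Term) (s : St) :
    (insideTerm e).val s ≠ 0 ↔ inside (s.reg 15) (e.val s) := by
  have key : ∀ p q r t : Prop, ∀ [Decidable p] [Decidable q] [Decidable r] [Decidable t],
      (if p then 1 else 0) * (if q then 1 else 0) * ((if r then 1 else 0) * (if t then 1 else 0))
        ≠ 0 ↔ (p ∧ q) ∧ r ∧ t := by
    intro p q r t _ _ _ _
    split_ifs <;> simp_all
  exact key _ _ _ _

/-- The vertices on the outer ring. -/
def ringList (S : ℕ) : List ℕ := (List.range (S * S)).filter fun x => ¬ inside S x

theorem mem_ringList {S x : ℕ} : x ∈ ringList S ↔ x < S * S ∧ ¬ inside S x := by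
  simp [ringList]

/-- Put the outer ring into the queue. -/
def initRing : Program :=
  .set 23 0 ⨟ .set 22 0 ⨟ .set 21 0 ⨟
  .loop ((Term.reg 21).lt (.reg 15 * .reg 15))
    (.cond (insideTerm (.reg 21)) skip pushVertex ⨟ .set 21 (.reg 21 + 1))

/-- Set register `24` to `1` if the program `I` finds some unmarked vertex interesting. -/
def checkUnmarked (I : Program) : Program :=
  .set 24 0 ⨟ .set 20 0 ⨟
  .loop ((Term.reg 20).lt (.reg 15 * .reg 15))
    (.cond (.load (.reg 16 + .reg 20)) skip (I ⨟ .cond (.reg 30) (.set 24 1) skip) ⨟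
      .set 20 (.reg 20 + 1))

/-- Explore the grid from its outer ring along the edges given by `E`, and look for unmarked
vertices that `I` finds interesting. -/
def tileTest (E I : Program) : Program :=
  initRing ⨟ .loop ((Term.reg 22).lt (.reg 23)) (expand E) ⨟ checkUnmarked I

/-- The program `I` computes in register `30` whether the vertex in register `20` is interesting. -/
def VertexSpec {n : ℕ} (X : Ctx n) (Env : St → Prop) (I : Program) (S : ℕ) (int : ℕ → Prop)
    (τ : ℕ) : Prop :=
  ∀ s, Env s → s.reg 20 < S * S → Runs X s I τ fun s' => Env s' ∧
    (∀ r, r < 30 ∧ r ≠ 21 ∧ r ≠ 25 ∨ 40 < r → s'.reg r = s.reg r) ∧ s'.mem = s.mem ∧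
    (s'.reg 30 ≠ 0 ↔ int (s.reg 20))

/-! ### Correctness of the exploration of a square from its outer ring. -/

section tile
variable {n : ℕ} {X : Ctx n} {Env : St → Prop} {s₀ : St} {E I : Program} {op : ℕ → ℕ → Prop}
  {int : ℕ → Prop} {τ τ' : ℕ} {s : St} {q : List ℕ}

/-- The block starts at zero, so the empty queue agrees with the marks before the loop. After `i`
rounds the queue is the ring part of `range i`, in increasing order, so the next vertex is never in
it yet. -/
theorem runs_initRing (hst : Stable Env) (hS : s₀.reg 15 * s₀.reg 15 ≤ s₀.reg 7)
    (hSB : 2 * s₀.reg 7 ≤ X.B) (h : Env s)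
    (hfr : ∀ r, r < 20 ∨ 40 < r → s.reg r = s₀.reg r) (hmem : s.mem = s₀.mem)
    (hz : ∀ a, s₀.reg 16 ≤ a → a < s₀.reg 16 + s₀.reg 7 → s₀.mem a = 0) :
    Runs X s initRing (10 * (s₀.reg 15 * s₀.reg 15) + 8) fun s' =>
      QInv Env s₀ (ringList (s₀.reg 15)) s' ∧ s'.reg 22 = 0 := by
  have hB := X.hB
  refine Runs.time (Runs.seq (Runs.set (by decide) (by simp) (Runs.seq (Runs.set (by decide)
    (by simp) (Runs.seq (Runs.set (by decide) (by simp) (Runs.mono (Runs.loop_for (fun i s' =>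
      QInv Env s₀ ((List.range i).filter fun x => ¬ inside (s₀.reg 15) x) s' ∧ s'.reg 22 = 0 ∧
        s'.reg 21 = i ∧ i ≤ s₀.reg 15 * s₀.reg 15)
      (s₀.reg 15 * s₀.reg 15) (fun _ => 9)
      (by decide) ?_ ?_ ?_ ?_) le_rfl ?_))))))) ?_
  · refine ⟨⟨?_, ?_, ?_, ?_, ?_, ?_, ?_, ?_⟩, ?_, ?_, ?_⟩
    · refine hst s _ h (fun r hr => ?_) rfl rfl rfl
      simp only [St.set_reg]
      rw [if_neg (by omega), if_neg (by omega), if_neg (by omega)]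
    · intro r hr
      simp only [St.set_reg]
      rw [if_neg (by omega), if_neg (by omega), if_neg (by omega), hfr r hr]
    · simp
    · simp
    · simp
    · intro x hx
      simp [hmem, hz (s₀.reg 16 + x) (by omega) (by omega)]
    · simp
    · simp [hmem]
    · simp
    · simp
    · simp
  · rintro i hi s' ⟨h1, -, h2, -⟩
    simp [h2, h1.frame 15, hi]
  · rintro i hi s' ⟨h1, h2, h4, -⟩
    have h15 := h1.frame 15 (by omega)
    have hin := insideTerm_val (.reg 21) s'
    simp only [Term.ideal_reg, h15, h4] at hin
    refine Runs.time (Runs.seq (T := 6) (T' := 1) (Q := fun s' =>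
      QInv Env s₀ ((List.range (i + 1)).filter fun x => ¬ inside (s₀.reg 15) x) s' ∧
        s'.reg 22 = 0 ∧ s'.reg 21 = i + 1 ∧
        i + 1 ≤ s₀.reg 15 * s₀.reg 15)
      (Runs.mono (Q := fun s' =>
        QInv Env s₀ ((List.range (i + 1)).filter fun x => ¬ inside (s₀.reg 15) x) s' ∧
        s'.reg 22 = 0 ∧ s'.reg 21 = i)
        (Runs.cond (T := 5) (by decide) (fun hc => ?_) fun hc => ?_) le_rfl ?_)) (by omega)
    · have hc := hin.1 hc
      refine (Runs.skip ?_).time (by omega)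
      rw [List.range_succ, List.filter_append]
      simpa [hc] using And.intro h1 ⟨h2, h4⟩
    · have hc : ¬ inside (s₀.reg 15) i := fun h => hin.2 h hc
      refine (runs_pushVertex hst hS h1 (by omega) (by simp [h4])).mono le_rfl ?_
      rintro s'' - ⟨g1, g2⟩
      rw [List.range_succ, List.filter_append]
      rw [h4] at g1
      simp only [g2 22 (by omega), g2 21 (by omega)]
      simpa [hc] using And.intro g1 ⟨h2, h4⟩
    · rintro s'' - ⟨g1, g2, g4⟩
      refine Runs.set (by decide) (by simp [g4]; omega) ⟨g1.set hst (by omega), ?_⟩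
      simp [g2, g4]; omega
  · rintro s' ⟨h1, -, h2, -⟩
    simp [h2, h1.frame 15]
  · rintro s' - ⟨h1, h2, -⟩
    exact ⟨h1, h2⟩
  · simp; omega

theorem runs_checkUnmarked (hst : Stable Env) (hS : s₀.reg 15 * s₀.reg 15 ≤ s₀.reg 7)
    (hSB : 2 * s₀.reg 7 ≤ X.B) (hI : VertexSpec X Env I (s₀.reg 15) int τ)
    (h : QInv Env s₀ q s) :
    Runs X s (checkUnmarked I) ((τ + 8) * (s₀.reg 15 * s₀.reg 15) + 5) fun s' =>
      QInv Env s₀ q s' ∧ (s'.reg 24 ≠ 0 ↔ ∃ v < s₀.reg 15 * s₀.reg 15, v ∉ q ∧ int v) := by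
  have hB := X.hB
  refine Runs.time (Runs.seq (Runs.set (by decide) (by simp) (Runs.seq (Runs.set (by decide)
    (by simp) (Runs.mono (Runs.loop_for (fun i s' =>
      QInv Env s₀ q s' ∧ s'.reg 20 = i ∧ (s'.reg 24 ≠ 0 ↔ ∃ v < i, v ∉ q ∧ int v))
      (s₀.reg 15 * s₀.reg 15) (fun _ => τ + 7)
      (by decide) ?_ ?_ ?_ ?_) le_rfl ?_))))) ?_
  · exact ⟨(h.set hst (by omega)).set hst (by omega), by simp, by simp⟩
  · rintro i hi s' ⟨h1, h2, -⟩
    simp [h2, h1.frame 15, hi]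
  · rintro i hi s' ⟨h1, h2, h3⟩
    have h16 := h1.frame 16 (by omega)
    refine Runs.time (Runs.seq (T := τ + 5) (T' := 1) (Runs.mono (Q := fun s' =>
        QInv Env s₀ q s' ∧ s'.reg 20 = i ∧ (s'.reg 24 ≠ 0 ↔ ∃ v < i + 1, v ∉ q ∧ int v))
        (Runs.cond (T := τ + 4) (by decide) (fun hc => ?_) fun hc => ?_) le_rfl ?_)) (by omega)
    · simp only [Term.ideal_load, Term.ideal_add, Term.ideal_reg, h16, h2] at hc
      have hiq := (h1.mark i hi).1 hc
      refine (Runs.skip ⟨h1, h2, h3.trans ?_⟩).time (by omega)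
      constructor
      · rintro ⟨v, hv, hv'⟩
        exact ⟨v, by omega, hv'⟩
      · rintro ⟨v, hv, hv'⟩
        refine ⟨v, ?_, hv'⟩
        rcases Nat.lt_succ_iff_lt_or_eq.1 hv with hv | rfl
        · exact hv
        · exact absurd hiq hv'.1
    · simp only [Term.ideal_load, Term.ideal_add, Term.ideal_reg, h16, h2] at hc
      have hiq : i ∉ q := fun h => (h1.mark i hi).2 h hc
      refine Runs.time (Runs.seq (T := τ) (T' := 2) ((hI s' h1.env (by omega)).mono le_rfl ?_))
        (by omega)
      rintro s'' - ⟨e1, e2, e3, e4⟩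
      rw [h2] at e4
      have hs'' : QInv Env s₀ q s'' := by
        refine ⟨e1, fun r hr => ?_, ?_, h.nodup, h.lt, ?_, ?_, ?_⟩
        · rw [e2 r (by omega), h1.frame r hr]
        · rw [e2 23 (by omega), h1.tail]
        · rw [e3]; exact h1.mark
        · rw [e3]; exact h1.queue
        · rw [e3]; exact h1.mem
      refine Runs.cond (by decide) (fun ho => ?_) fun ho => ?_
      · simp only [Term.ideal_reg] at ho
        refine Runs.set (by decide) (by simp; omega) ⟨hs''.set hst (by omega), ?_, ?_⟩
        · simp [e2 20, h2]
        · simpa using ⟨i, by omega, hiq, e4.1 ho⟩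
      · simp only [Term.ideal_reg] at ho
        refine Runs.skip ⟨hs'', by rw [e2 20 (by omega), h2], ?_⟩
        rw [e2 24 (by omega), h3]
        constructor
        · rintro ⟨v, hv, hv'⟩
          exact ⟨v, by omega, hv'⟩
        · rintro ⟨v, hv, hv'⟩
          refine ⟨v, ?_, hv'⟩
          rcases Nat.lt_succ_iff_lt_or_eq.1 hv with hv | rfl
          · exact hv
          · exact absurd ho (e4.2 hv'.2)
    · rintro s'' - ⟨g1, g2, g3⟩
      refine Runs.set (by decide) (by simp [g2]; omega) ⟨g1.set hst (by omega), ?_⟩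
      simpa [g2] using g3
  · rintro s' ⟨h1, h2, -⟩
    simp [h2, h1.frame 15]
  · rintro s' - ⟨h1, -, h3⟩
    exact ⟨h1, h3⟩
  · simp; nlinarith

/-- The queue `q` lists the vertices reachable from the outer ring. -/
structure RingClosure (S : ℕ) (op : ℕ → ℕ → Prop) (q : List ℕ) : Prop where
  ring : ∀ x < S * S, ¬ inside S x → x ∈ q
  reach : ∀ x ∈ q, Reach S op (ringList S) x
  closed : ∀ x ∈ q, ∀ u ∈ nbrs S x, u < S * S → op x u → u ∈ q

/-- The flood stops only when the head has caught up with the tail, so every vertex in the queue has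
been expanded and the marked set is closed under edges. At most `S * S` expansions are possible,
which bounds the time. -/
theorem runs_tileTest (hst : Stable Env) (hS : s.reg 15 * s.reg 15 ≤ s.reg 7)
    (hSB : 2 * s.reg 7 ≤ X.B) (hE : EdgeSpec X Env E (s.reg 15) op τ)
    (hI : VertexSpec X Env I (s.reg 15) int τ') (h : Env s)
    (hz : ∀ a, s.reg 16 ≤ a → a < s.reg 16 + s.reg 7 → s.mem a = 0) :
    Runs X s (tileTest E I) ((4 * τ + τ' + 70) * (s.reg 15 * s.reg 15) + 20) fun s' =>
      ∃ q, QInv Env s q s' ∧ RingClosure (s.reg 15) op q ∧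
        (s'.reg 24 ≠ 0 ↔ ∃ v < s.reg 15 * s.reg 15, v ∉ q ∧ int v) := by
  refine Runs.time (Runs.seq (T' := (4 * τ + 52) * (s.reg 15 * s.reg 15) + 1 +
      ((τ' + 8) * (s.reg 15 * s.reg 15) + 5) + 1)
    ((runs_initRing hst hS hSB h (fun _ _ => rfl) rfl hz).mono le_rfl ?_)) ?_
  · rintro s1 - ⟨g1, g2⟩
    refine Runs.seq ((runs_flood hst hS hSB hE (e := (Term.reg 22).lt (.reg 23)) (by decide)
      (m := s.reg 15 * s.reg 15) (P := fun _ => True) ?_ g1 g2).mono le_rfl ?_)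
    · intro s2 q2 k1 k2
      have hl := length_le_of_nodup_lt k1.nodup k1.lt
      simp [k1.tail] at k2
      exact ⟨k2, by omega, trivial⟩
    · rintro s2 - ⟨q2, k1, k2, k3, -, k4⟩
      refine (runs_checkUnmarked hst hS hSB hI k1).mono le_rfl ?_
      rintro s3 - ⟨l1, l2⟩
      refine ⟨q2, l1, ⟨fun x hx hin => k2.pre.subset (mem_ringList.2 ⟨hx, hin⟩), k2.reach, ?_⟩, l2⟩
      intro x hx u hu huS ho
      obtain ⟨i, hi, rfl⟩ := List.mem_iff_getElem.1 hx
      simp [k1.tail] at k4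
      exact k2.closed i hi (by omega) u hu huS ho
  · nlinarith

end tile
end ImageTesting

namespace ImageTesting

/-! ### Adjacency tests -/

/-- The pixel `p` is black. -/
def Black {n : ℕ} (M : Image n) (p : ℕ × ℕ) : Prop := pixel M p ≠ 0

theorem pixel_le_one {n : ℕ} (M : Image n) (p : ℕ × ℕ) : pixel M p ≤ 1 := by
  unfold pixel
  split_ifs
  · exact Bool.toNat_le _
  · omega

/-- The pixel that belongs to the vertex `v` of the grid with corner `(x, y)`. -/
def vertexPixel (x y S v : ℕ) : ℕ × ℕ := (x + v / S, y + v % S)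

/-- Query the pixel `(x, y)` and put its colour into register `r`. -/
def askPixel (x y : Term) (r : ℕ) : Program :=
  .query x y ⨟ .receive r (.reg 40) ⨟ .set 40 (.reg 40 + 1)

section edges
variable {n : ℕ} {X : Ctx n}

/-- Queries are numbered from `0`, so the number of earlier queries in register `40` is the index of
the new one. -/
theorem runs_askPixel {s : St} {x y : Term} {r : ℕ} {Q : St → Prop} (hx : x.Small) (hy : y.Small)
    (hr : r ≠ 40) (h40 : s.reg 40 = s.qs.length)
    (hQ : ∀ s', s'.reg 40 = s'.qs.length → (∀ r', r' ≠ r → r' ≠ 40 → s'.reg r' = s.reg r') →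
      s'.mem = s.mem → s'.reg r = pixel X.M (x.val s, y.val s) → Q s') :
    Runs X s (askPixel x y r) 5 Q := by
  refine Runs.intro_good fun hg hq => ?_
  refine Runs.seq (Runs.query hx hy (Runs.seq (Runs.receive (x := (x.val s, y.val s)) (by decide)
    ?_ (Runs.set (by decide) ?_ ?_))))
  · simp [h40]
  · simp [hr.symm, h40]
    omega
  · refine hQ _ ?_ ?_ ?_ ?_
    · simp [hr.symm, h40]
    · intro r' h1 h2
      simp [h1, h2]
    · simp
    · simp [hr]

/-! #### Pixels that were queried before -/

/-- The pixels of the grid are the queries from number `qb` on. -/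
structure Prequeried (S qb : ℕ) (qs : List (ℕ × ℕ)) (s : St) : Prop where
  h15 : s.reg 15 = S
  h18 : s.reg 18 = qb
  qs_eq : s.qs = qs
  itl : s.itl = false

theorem stable_prequeried (S qb : ℕ) (qs : List (ℕ × ℕ)) : Stable (Prequeried S qb qs) :=
  fun s s' h hr hq _ hi => ⟨by rw [hr 15 (by omega), h.h15], by rw [hr 18 (by omega), h.h18],
    by rw [hq, h.qs_eq], by rw [hi, h.itl]⟩

/-- Whether the pixels `v` and `u` of the grid are both black, from earlier queries. -/
def bothBlack : Program :=
  .receive 31 (.reg 18 + .reg 20) ⨟ .receive 32 (.reg 18 + .reg 21) ⨟ .set 30 (.reg 31 * .reg 32)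

/-- Whether the pixel `v` of the grid is black, from earlier queries. -/
def isBlack : Program := .receive 30 (.reg 18 + .reg 20)

theorem edgeSpec_bothBlack {S qb x y : ℕ} {qs : List (ℕ × ℕ)}
    (hqs : ∀ v < S * S, qs[qb + v]? = some (vertexPixel x y S v)) :
    EdgeSpec X (Prequeried S qb qs) bothBlack S
      (fun v u => Black X.M (vertexPixel x y S v) ∧ Black X.M (vertexPixel x y S u)) 5 := by
  intro s h h20 h21
  have hB := X.hB
  refine Runs.seq (Runs.receive (x := vertexPixel x y S (s.reg 20)) (by decide) ?_ (Runs.seq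
    (Runs.receive (x := vertexPixel x y S (s.reg 21)) (by decide) ?_ (Runs.set (by decide) ?_
    ⟨⟨?_, ?_, ?_, ?_⟩, ?_, ?_, ?_⟩))))
  · simp [h.h18, h.qs_eq, hqs _ h20]
  · simp [h.h18, h.qs_eq, hqs _ h21]
  · have h1 := pixel_le_one X.M (vertexPixel x y S (s.reg 20))
    have h2 := pixel_le_one X.M (vertexPixel x y S (s.reg 21))
    simp
    nlinarith
  · simp [h.h15]
  · simp [h.h18]
  · simp [h.qs_eq]
  · simp [h.itl]
  · intro r hr
    simp only [St.set_reg, St.recv_reg]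
    rw [if_neg (by omega), if_neg (by omega), if_neg (by omega)]
  · simp
  · simp [Black]

theorem vertexSpec_isBlack {S qb x y : ℕ} {qs : List (ℕ × ℕ)}
    (hqs : ∀ v < S * S, qs[qb + v]? = some (vertexPixel x y S v)) :
    VertexSpec X (Prequeried S qb qs) isBlack S (fun v => Black X.M (vertexPixel x y S v)) 1 := by
  intro s h h20
  refine Runs.receive (x := vertexPixel x y S (s.reg 20)) (by decide) ?_
    ⟨⟨?_, ?_, ?_, ?_⟩, ?_, ?_, ?_⟩
  · simp [h.h18, h.qs_eq, hqs _ h20]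
  · simp [h.h15]
  · simp [h.h18]
  · simp [h.qs_eq]
  · simp [h.itl]
  · intro r hr
    simp only [St.set_reg, St.recv_reg]
    rw [if_neg (by omega)]
  · simp
  · simp [Black]

/-! #### Pixels that are queried on demand -/

/-- The grid has corner `(x, y)`, width `S` and cells of side `l`; register `40` holds the number of
queries made so far. -/
structure OnDemand (l x y S : ℕ) (s : St) : Prop where
  h3 : s.reg 3 = l
  h13 : s.reg 13 = x
  h14 : s.reg 14 = y
  h15 : s.reg 15 = S
  h40 : s.reg 40 = s.qs.length

theorem stable_onDemand (l x y S : ℕ) : Stable (OnDemand l x y S) :=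
  fun s s' h hr hq _ _ => ⟨by rw [hr 3 (by omega), h.h3], by rw [hr 13 (by omega), h.h13],
    by rw [hr 14 (by omega), h.h14], by rw [hr 15 (by omega), h.h15],
    by rw [hr 40 (by omega), h.h40, hq]⟩

theorem OnDemand.of_eq {l x y S : ℕ} {s s' : St} (h : OnDemand l x y S s)
    (hr : ∀ r, r < 30 → s'.reg r = s.reg r) (h40 : s'.reg 40 = s'.qs.length) :
    OnDemand l x y S s' :=
  ⟨by rw [hr 3 (by omega), h.h3], by rw [hr 13 (by omega), h.h13],
    by rw [hr 14 (by omega), h.h14], by rw [hr 15 (by omega), h.h15], h40⟩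

/-- Whether the pixel `u` of the grid is black. -/
def askBlack : Program :=
  askPixel (.reg 13 + .reg 21 / .reg 15) (.reg 14 + .reg 21 % .reg 15) 30

theorem edgeSpec_askBlack {l x y S : ℕ} :
    EdgeSpec X (OnDemand l x y S) askBlack S (fun _ u => Black X.M (vertexPixel x y S u)) 5 := by
  intro s h h20 h21
  refine runs_askPixel (by decide) (by decide) (by omega) h.h40 fun s' h1 h2 h3 h4 => ?_
  refine ⟨h.of_eq (fun r hr => h2 r (by omega) (by omega)) h1,
    fun r hr => h2 r (by omega) (by omega), h3, ?_⟩
  rw [h4]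
  simp [h.h13, h.h14, h.h15, Black, vertexPixel]

/-- The `j`-th pixel of the segment between the adjacent cells `v` and `u` of the grid. -/
def segPixel (l x y S v u j : ℕ) : ℕ × ℕ :=
  if max v u - min v u = 1 then (x + min v u / S * l - l + j, y + min v u % S * l)
  else (x + min v u / S * l, y + min v u % S * l - l + j)

/-- Whether the segment between the cells `v` and `u` contains a black pixel. -/
def askSegment : Program :=
  .cond ((Term.reg 21).lt (.reg 20))
    (.set 37 (.reg 21) ⨟ .set 38 (.reg 20 - .reg 21))
    (.set 37 (.reg 20) ⨟ .set 38 (.reg 21 - .reg 20)) ⨟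
  .cond ((Term.reg 38).eq 1)
    (.set 33 (.reg 13 + .reg 37 / .reg 15 * .reg 3 - .reg 3) ⨟
      .set 34 (.reg 14 + .reg 37 % .reg 15 * .reg 3) ⨟ .set 35 1 ⨟ .set 36 0)
    (.set 33 (.reg 13 + .reg 37 / .reg 15 * .reg 3) ⨟
      .set 34 (.reg 14 + .reg 37 % .reg 15 * .reg 3 - .reg 3) ⨟ .set 35 0 ⨟ .set 36 1) ⨟
  .set 30 0 ⨟ .set 32 0 ⨟
  .loop ((Term.reg 32).lt (.reg 3 + 1))
    (askPixel (.reg 33 + .reg 32 * .reg 35) (.reg 34 + .reg 32 * .reg 36) 31 ⨟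
      .set 30 (.reg 30 + .reg 31) ⨟ .set 32 (.reg 32 + 1))

/-- No adjacency of the two cells is assumed: the program evaluates the formula of `segPixel`,
whatever pixels it names. Its geometric meaning enters only with `exists_segPixel_iff`. -/
theorem edgeSpec_askSegment {l x y S : ℕ} (hx : x + S * l ≤ X.B) (hy : y + S * l ≤ X.B)
    (hl : l + 1 ≤ X.B) :
    EdgeSpec X (OnDemand l x y S) askSegment S
      (fun v u => ∃ j ≤ l, Black X.M (segPixel l x y S v u j)) (11 * l + 40) := by
  intro s h h20 h21
  have hB := X.hB
  have hg20 : ∀ {a}, a < S * S → x + a / S * l ≤ X.B ∧ y + a % S * l ≤ X.B := by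
    intro a ha
    have hS : 0 < S := Nat.pos_of_ne_zero fun h0 => by simp [h0] at ha
    have h1 : a / S ≤ S := (Nat.div_lt_of_lt_mul ha).le
    have h2 : a % S ≤ S := (Nat.mod_lt _ hS).le
    have := Nat.mul_le_mul_right l h1
    have := Nat.mul_le_mul_right l h2
    omega
  refine Runs.intro_good fun hg _ => ?_
  -- the smaller of the two vertices and their difference
  refine Runs.time (Runs.seq (T := 4) (T' := 11 * l + 24) (Runs.mono (T := 4) (Q := fun s' =>
      (∀ r, r ≠ 37 → r ≠ 38 → s'.reg r = s.reg r) ∧ s'.mem = s.mem ∧ s'.qs = s.qs ∧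
      s'.reg 37 = min (s.reg 20) (s.reg 21) ∧
      s'.reg 38 = max (s.reg 20) (s.reg 21) - min (s.reg 20) (s.reg 21))
    (Runs.cond (T := 3) (by decide) (fun hc => ?_) fun hc => ?_) le_rfl ?_)) (by omega)
  · simp at hc
    refine Runs.seq (Runs.set (by decide) (by simpa using hg.1 21) (Runs.set (by decide) ?_ ?_))
    · simpa using (Nat.sub_le _ _).trans (hg.1 20)
    · refine ⟨fun r h1 h2 => by simp [h1, h2], rfl, rfl, ?_, ?_⟩
      · simp; omega
      · simp; omega
  · simp at hc
    refine Runs.seq (Runs.set (by decide) (by simpa using hg.1 20) (Runs.set (by decide) ?_ ?_))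
    · simpa using (Nat.sub_le _ _).trans (hg.1 21)
    · refine ⟨fun r h1 h2 => by simp [h1, h2], rfl, rfl, ?_, ?_⟩
      · simp; omega
      · simp; omega
  rintro s1 - ⟨a1, a2, a3, a4, a5⟩
  set v := s.reg 20 with hv
  set u := s.reg 21 with hu
  have hmin : min v u < S * S := lt_of_le_of_lt (min_le_left _ _) h20
  obtain ⟨b1, b2⟩ := hg20 hmin
  have c3 : s1.reg 3 = l := by rw [a1 3 (by omega) (by omega), h.h3]
  have c13 : s1.reg 13 = x := by rw [a1 13 (by omega) (by omega), h.h13]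
  have c14 : s1.reg 14 = y := by rw [a1 14 (by omega) (by omega), h.h14]
  have c15 : s1.reg 15 = S := by rw [a1 15 (by omega) (by omega), h.h15]
  -- the first pixel and the direction of the segment
  refine Runs.time (Runs.seq (T := 8) (T' := 11 * l + 15) (Runs.mono (T := 8) (Q := fun s' =>
      (∀ r, r < 30 ∨ 40 ≤ r → s'.reg r = s.reg r) ∧ s'.mem = s.mem ∧ s'.qs = s.qs ∧
      ∀ j, (s'.reg 33 + j * s'.reg 35, s'.reg 34 + j * s'.reg 36) = segPixel l x y S v u j)
    (Runs.cond (T := 7) (by decide) (fun hc => ?_) fun hc => ?_) le_rfl ?_)) (by omega)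
  · simp [a5] at hc
    refine Runs.seq (Runs.set (by decide) ?_ (Runs.seq (Runs.set (by decide) ?_ (Runs.seq
      (Runs.set (by decide) ?_ (Runs.set (by decide) ?_ ?_))))))
    · simp [c3, c13, c15, a4]; omega
    · simp [c3, c14, c15, a4]; omega
    · simp; omega
    · simp
    · refine ⟨fun r hr => ?_, a2, a3, fun j => ?_⟩
      · simp only [St.set_reg]
        rw [if_neg (by omega), if_neg (by omega), if_neg (by omega), if_neg (by omega),
          a1 r (by omega) (by omega)]
      · simp [c3, c13, c14, c15, a4, segPixel, hc]
  · simp [a5] at hc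
    refine Runs.seq (Runs.set (by decide) ?_ (Runs.seq (Runs.set (by decide) ?_ (Runs.seq
      (Runs.set (by decide) ?_ (Runs.set (by decide) ?_ ?_))))))
    · simp [c3, c13, c15, a4]; omega
    · simp [c3, c14, c15, a4]; omega
    · simp
    · simp; omega
    · refine ⟨fun r hr => ?_, a2, a3, fun j => ?_⟩
      · simp only [St.set_reg]
        rw [if_neg (by omega), if_neg (by omega), if_neg (by omega), if_neg (by omega),
          a1 r (by omega) (by omega)]
      · simp [c3, c13, c14, c15, a4, segPixel, hc]
  rintro s2 - ⟨d1, d2, d3, d4⟩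
  have e3 : s2.reg 3 = l := by rw [d1 3 (by omega), h.h3]
  -- the loop over the segment
  refine Runs.time (Runs.seq (Runs.set (by decide) (by simp) (Runs.seq (Runs.set (by decide)
    (by simp) (Runs.mono (Runs.loop_for (fun i s' =>
      (∀ r, r < 30 ∨ 40 < r → s'.reg r = s.reg r) ∧ s'.mem = s.mem ∧ s'.reg 40 = s'.qs.length ∧
      (∀ r, 33 ≤ r → r < 37 → s'.reg r = s2.reg r) ∧ s'.reg 32 = i ∧ s'.reg 30 ≤ i ∧
      (s'.reg 30 ≠ 0 ↔ ∃ j < i, Black X.M (segPixel l x y S v u j)))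
      (l + 1) (fun _ => 9) (by decide) ?_ ?_ ?_ ?_) le_rfl ?_))))) ?_
  · refine ⟨fun r hr => ?_, d2, ?_, fun r h1 h2 => ?_, ?_, ?_, ?_⟩
    · simp only [St.set_reg]
      rw [if_neg (by omega), if_neg (by omega), d1 r (by omega)]
    · simp [d1 40, d3, h.h40]
    · simp only [St.set_reg]
      rw [if_neg (by omega), if_neg (by omega)]
    · simp
    · simp
    · simp
  · rintro i hi s' ⟨f1, -, -, -, f5, -⟩
    have : s'.reg 3 = l := by rw [f1 3 (by omega), h.h3]
    simp [f5, this]; omega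
  · rintro i hi s' ⟨f1, f2, f3, f4, f5, f6, f7⟩
    refine Runs.time (Runs.seq (T' := 3) (runs_askPixel (by decide) (by decide) (by omega) f3
      fun s'' g1 g2 g3 g4 => ?_)) (by omega)
    have g4' : s''.reg 31 = pixel X.M (segPixel l x y S v u i) := by
      rw [g4, ← d4 i]
      simp [f5, f4 33, f4 34, f4 35, f4 36]
    have hp := pixel_le_one X.M (segPixel l x y S v u i)
    have k30 := g2 30 (by omega) (by omega)
    have k32 := g2 32 (by omega) (by omega)
    refine Runs.seq (Runs.set (by decide) ?_ (Runs.set (by decide) ?_ ⟨?_, ?_, ?_, ?_, ?_, ?_, ?_⟩))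
    · simp [k30, g4']; omega
    · simp [k32, f5]; omega
    · intro r hr
      simp only [St.set_reg]
      rw [if_neg (by omega), if_neg (by omega), g2 r (by omega) (by omega), f1 r hr]
    · simp [g3, f2]
    · simp [g1]
    · intro r h1 h2
      simp only [St.set_reg]
      rw [if_neg (by omega), if_neg (by omega), g2 r (by omega) (by omega), f4 r h1 h2]
    · simp [k32, f5]
    · simp [k30, g4']; omega
    · simp only [St.set_reg, Term.ideal_add, Term.ideal_reg, k30, g4']
      norm_num
      constructor
      · intro hne
        by_cases h0 : s'.reg 30 = 0
        · exact ⟨i, by omega, hne h0⟩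
        · obtain ⟨j, hj, hb⟩ := f7.1 h0
          exact ⟨j, by omega, hb⟩
      · rintro ⟨j, hj, hb⟩ h0
        rcases Nat.lt_or_eq_of_le hj with hj | rfl
        · exact absurd h0 (f7.2 ⟨j, hj, hb⟩)
        · exact hb
  · rintro s' ⟨f1, -, -, -, f5, -⟩
    have : s'.reg 3 = l := by rw [f1 3 (by omega), h.h3]
    simp [f5, this]
  · rintro s' - ⟨f1, f2, f3, -, -, -, f7⟩
    refine ⟨h.of_eq (fun r hr => f1 r (by omega)) f3, f1, f2, f7.trans ?_⟩
    simp
  · simp; omega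

/-- Whether one of the two lower segments of the cell `v` contains a black pixel. -/
def askLowerSegments : Program :=
  .set 21 (.reg 20 - 1) ⨟ askSegment ⨟ .set 25 (.reg 30) ⨟ .set 21 (.reg 20 - .reg 15) ⨟
    askSegment ⨟ .cond (.reg 25) (.set 30 1) skip

theorem vertexSpec_askLowerSegments {l x y S : ℕ} (hx : x + S * l ≤ X.B) (hy : y + S * l ≤ X.B)
    (hl : l + 1 ≤ X.B) :
    VertexSpec X (OnDemand l x y S) askLowerSegments S
      (fun v => (∃ j ≤ l, Black X.M (segPixel l x y S v (v - 1) j)) ∨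
        ∃ j ≤ l, Black X.M (segPixel l x y S v (v - S) j)) (22 * l + 90) := by
  intro s h h20
  have hB := X.hB
  have hst := stable_onDemand l x y S
  have hE := edgeSpec_askSegment hx hy hl
  refine Runs.intro_good fun hg _ => ?_
  refine Runs.time (Runs.seq (Runs.set (by decide) ?_ (Runs.seq (T' := 11 * l + 47) ((hE _ ?_ ?_
    ?_).mono le_rfl ?_)))) (T' := 22 * l + 90) (by omega)
  · simpa using (Nat.sub_le _ _).trans (hg.1 20)
  · exact hst s _ h (fun r hr => by rw [St.set_reg, if_neg (by omega)]) rfl rfl rfl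
  · simpa using h20
  · simp; omega
  rintro s1 hg1 ⟨a1, a2, a3, a4⟩
  have k20 : s1.reg 20 = s.reg 20 := by rw [a2 20 (by omega)]; simp
  have k15 : s1.reg 15 = S := a1.h15
  refine Runs.time (Runs.seq (Runs.set (by decide) (hg1.1 30) (Runs.seq (Runs.set (by decide) ?_
    (Runs.seq (T' := 2) ((hE _ ?_ ?_ ?_).mono le_rfl ?_)))))) (by omega)
  · simpa using (Nat.sub_le _ _).trans (hg1.1 20)
  · refine hst s1 _ a1 (fun r hr => ?_) rfl rfl rfl
    simp only [St.set_reg]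
    rw [if_neg (by omega), if_neg (by omega)]
  · simpa [k20] using h20
  · simp [k20]; omega
  rintro s2 hg2 ⟨b1, b2, b3, b4⟩
  have k25 : s2.reg 25 = s1.reg 30 := by rw [b2 25 (by omega)]; simp
  simp [k20, k15] at a4 b4
  have hfr : ∀ r, r < 30 ∧ r ≠ 21 ∧ r ≠ 25 ∨ 40 < r → s2.reg r = s.reg r := by
    intro r hr
    rw [b2 r (by omega)]
    simp only [St.set_reg]
    rw [if_neg (by omega), if_neg (by omega), a2 r (by omega), St.set_reg, if_neg (by omega)]
  refine Runs.cond (by decide) (fun hc => ?_) fun hc => ?_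
  · refine Runs.set (by decide) (by simp; omega) ⟨?_, fun r hr => ?_, ?_, ?_⟩
    · exact b1.of_eq (fun r hr => by rw [St.set_reg, if_neg (by omega)]) (by simp [b1.h40])
    · rw [St.set_reg, if_neg (by omega), hfr r hr]
    · simp [b3, a3]
    · simp [k25] at hc
      simpa using Or.inl (a4.1 hc)
  · refine Runs.skip ⟨b1, hfr, by simp [b3, a3], ?_⟩
    simp [k25] at hc
    constructor
    · exact fun h0 => Or.inr (b4.1 h0)
    · rintro (h0 | h0)
      · exact absurd hc (a4.2 h0)
      · exact b4.2 h0

end edges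
end ImageTesting

namespace ImageTesting

/-! ### Geometry of grids of pixels and of cells -/

/-- Manhattan distance one. -/
def Adj (p q : ℕ × ℕ) : Prop :=
  (p.1 = q.1 ∧ (p.2 + 1 = q.2 ∨ q.2 + 1 = p.2)) ∨ (p.2 = q.2 ∧ (p.1 + 1 = q.1 ∨ q.1 + 1 = p.1))

/-- The closed square cell of side `l` with index `c` contains `p`. -/
def InCell (l : ℕ) (c p : ℕ × ℕ) : Prop :=
  (c.1 * l ≤ p.1 ∧ p.1 ≤ c.1 * l + l) ∧ c.2 * l ≤ p.2 ∧ p.2 ≤ c.2 * l + l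

/-- Some closed cell of side `l` contains `p` and `q`. -/
def CellRel (l : ℕ) (p q : ℕ × ℕ) : Prop := ∃ c, InCell l c p ∧ InCell l c q

/-- `p` lies on a grid line of the grid of side `r`. -/
def OnGrid (r : ℕ) (p : ℕ × ℕ) : Prop := r ∣ p.1 ∨ r ∣ p.2

/-- The half-open square of side `r` that contains `p`. -/
def tile (r : ℕ) (p : ℕ × ℕ) : ℕ × ℕ := (p.1 / r, p.2 / r)

/-- The equivalence closure of a symmetric relation on black pixels. -/
def Linked {n : ℕ} (M : Image n) (rel : ℕ × ℕ → ℕ × ℕ → Prop) : ℕ × ℕ → ℕ × ℕ → Prop :=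
  Relation.ReflTransGen fun p q => rel p q ∧ Black M p ∧ Black M q

/-- The black pixel `p` is not linked to the grid of side `r`. -/
def Isolated {n : ℕ} (M : Image n) (rel : ℕ × ℕ → ℕ × ℕ → Prop) (r : ℕ) (p : ℕ × ℕ) : Prop :=
  Black M p ∧ ∀ q, Linked M rel p q → ¬ OnGrid r q

theorem Adj.symm {p q : ℕ × ℕ} (h : Adj p q) : Adj q p := by
  unfold Adj at *; omega

theorem CellRel.symm {l : ℕ} {p q : ℕ × ℕ} (h : CellRel l p q) : CellRel l q p :=
  h.imp fun _ h => h.symm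

theorem Linked.symm {n : ℕ} {M : Image n} {rel : ℕ × ℕ → ℕ × ℕ → Prop}
    (hrel : ∀ p q, rel p q → rel q p) {p q : ℕ × ℕ} (h : Linked M rel p q) : Linked M rel q p := by
  induction h with
  | refl => exact .refl
  | tail _ h ih => exact .head ⟨hrel _ _ h.1, h.2.2, h.2.1⟩ ih

/-- The row of a vertex. -/
def row (S v : ℕ) : ℕ := v / S

/-- The column of a vertex. -/
def col (S v : ℕ) : ℕ := v % S

theorem inside.coords {S v : ℕ} (h : inside S v) :
    (0 < row S v ∧ row S v + 1 < S) ∧ 0 < col S v ∧ col S v + 1 < S := h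

theorem vertexPixel_eq (x y S v : ℕ) : vertexPixel x y S v = (x + row S v, y + col S v) := rfl

section grid
variable {S v u : ℕ}

theorem div_mod_of_eq {S a b v : ℕ} (h : v = a * S + b) (hb : b < S) :
    row S v = a ∧ col S v = b := by
  subst h
  unfold row col
  have hS : 0 < S := by omega
  rw [Nat.mul_comm]
  exact ⟨by rw [Nat.mul_add_div hS, Nat.div_eq_of_lt hb, add_zero],
    by rw [Nat.mul_add_mod, Nat.mod_eq_of_lt hb]⟩

theorem lt_of_coords {S a b v : ℕ} (h : v = a * S + b) (ha : a < S) (hb : b < S) : v < S * S := by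
  have := Nat.mul_le_mul_right S (Nat.succ_le_of_lt ha)
  rw [Nat.succ_mul] at this
  omega

/-- The neighbours of an inner vertex in coordinates. -/
theorem nbrs_of_inside (hv : inside S v) (hu : u ∈ nbrs S v) :
    (u < S * S ∧ v ∈ nbrs S u) ∧
    ((row S u = row S v ∧ col S u = col S v + 1 ∧ u = v + 1) ∨
      (row S u = row S v ∧ col S u + 1 = col S v ∧ u + 1 = v) ∨
      (row S u = row S v + 1 ∧ col S u = col S v ∧ u = v + S) ∨
      (row S u + 1 = row S v ∧ col S u = col S v ∧ u + S = v)) := by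
  obtain ⟨⟨h1, h2⟩, h3, h4⟩ := hv.coords
  have hdm : v = row S v * S + col S v := (Nat.div_add_mod' v S).symm
  generalize row S v = a at *
  generalize col S v = b at *
  obtain ⟨a', rfl⟩ : ∃ a', a = a' + 1 := ⟨a - 1, by omega⟩
  have hmul : (a' + 1) * S = a' * S + S := by ring
  simp only [nbrs, List.mem_cons, List.not_mem_nil, or_false] at hu ⊢
  rcases hu with rfl | rfl | rfl | rfl
  · have e : v + 1 = (a' + 1) * S + (b + 1) := by omega
    have := div_mod_of_eq e (by omega)
    have := lt_of_coords e (by omega) (by omega)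
    omega
  · have e : v - 1 = (a' + 1) * S + (b - 1) := by omega
    have := div_mod_of_eq e (by omega)
    have := lt_of_coords e (by omega) (by omega)
    omega
  · have e : v + S = (a' + 1 + 1) * S + b := by
      have : (a' + 1 + 1) * S = (a' + 1) * S + S := by ring
      omega
    have := div_mod_of_eq e (by omega)
    have := lt_of_coords e (by omega) (by omega)
    omega
  · have e : v - S = a' * S + b := by omega
    have := div_mod_of_eq e (by omega)
    have := lt_of_coords e (by omega) (by omega)
    omega

theorem inside.lt (h : inside S v) : S < v := by
  obtain ⟨⟨h1, h2⟩, h3, h4⟩ := h.coords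
  have hdm : v = row S v * S + col S v := (Nat.div_add_mod' v S).symm
  have := Nat.mul_le_mul_right S (Nat.succ_le_of_lt h1)
  omega

/-- Symmetry of `nbrs` can fail only where a subtraction is cut off at zero, and an inner vertex is
positive. -/
theorem mem_nbrs_symm (hu : inside S u) (h : u ∈ nbrs S v) : v ∈ nbrs S u := by
  obtain ⟨⟨h1, h2⟩, h3, h4⟩ := hu.coords
  have : 0 < u := Nat.pos_of_ne_zero fun h0 => by simp [h0, col] at h3
  simp only [nbrs, List.mem_cons, List.not_mem_nil, or_false] at h ⊢
  omega

theorem inside_of_lt (hv : v < S * S) (h1 : 0 < row S v) (h2 : row S v + 1 ≠ S) (h3 : 0 < col S v)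
    (h4 : col S v + 1 ≠ S) : inside S v := by
  have hS : 0 < S := Nat.pos_of_ne_zero fun h0 => by simp [h0] at hv
  have h5 : row S v < S := Nat.div_lt_of_lt_mul hv
  have h6 : col S v < S := Nat.mod_lt v hS
  exact ⟨⟨h1, show row S v + 1 < S by omega⟩, h3, show col S v + 1 < S by omega⟩

theorem coords_lt (hv : v < S * S) : row S v < S ∧ col S v < S := by
  have hS : 0 < S := Nat.pos_of_ne_zero fun h0 => by simp [h0] at hv
  exact ⟨Nat.div_lt_of_lt_mul hv, Nat.mod_lt v hS⟩

end grid

theorem dvd_add_lt {r x a : ℕ} (hx : r ∣ x) (ha : 0 < a) (har : a < r) : ¬ r ∣ x + a := by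
  intro h
  have := Nat.le_of_dvd ha ((Nat.dvd_add_right hx).1 h)
  omega

/-- A half-open block of length `r` that starts at a multiple of `r` does not cross a multiple of
`R`. This carries a component found in a small square over to the large square that is recorded. -/
theorem add_div_of_lt {r R x a : ℕ} (hx : r ∣ x) (hrR : r ∣ R) (ha : a < r) :
    (x + a) / R = x / R := by
  obtain ⟨c, rfl⟩ := hx
  obtain ⟨d, rfl⟩ := hrR
  have hr : 0 < r := by omega
  rw [← Nat.div_div_eq_div_mul, ← Nat.div_div_eq_div_mul, Nat.mul_add_div hr,
    Nat.div_eq_of_lt ha, Nat.mul_div_cancel_left _ hr, add_zero]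

/-! #### Grids of pixels -/

section pixelGrid
variable {r x y v u : ℕ}

/-- The closed square of side `r` has `r + 1` pixels per row, and since its corner lies on the grid,
its offsets divisible by `r` are exactly the first and the last one. -/
theorem onGrid_vertexPixel (hr : 0 < r) (hx : r ∣ x) (hy : r ∣ y)
    (hv : v < (r + 1) * (r + 1)) :
    OnGrid r (vertexPixel x y (r + 1) v) ↔ ¬ inside (r + 1) v := by
  have hc := coords_lt hv
  have key : ∀ {x a}, r ∣ x → a < r + 1 → (r ∣ x + a ↔ ¬ (0 < a ∧ a + 1 < r + 1)) := by
    intro x a hx ha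
    constructor
    · rintro h ⟨h1, h2⟩
      exact dvd_add_lt hx h1 (by omega) h
    · intro h
      rcases Nat.eq_zero_or_pos a with rfl | h0
      · exact hx
      · have : a = r := by omega
        subst this
        exact Dvd.dvd.add hx dvd_rfl
  rw [vertexPixel_eq]
  show _ ∨ _ ↔ ¬ ((_ ∧ _) ∧ _ ∧ _)
  rw [key hx hc.1, key hy hc.2]
  unfold row col
  tauto

theorem adj_vertexPixel {S : ℕ} (hv : inside S v) (hu : u ∈ nbrs S v) :
    Adj (vertexPixel x y S v) (vertexPixel x y S u) := by
  have := (nbrs_of_inside hv hu).2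
  simp only [vertexPixel_eq, Adj]
  omega

theorem exists_nbr_of_adj {S : ℕ} {z : ℕ × ℕ} (hv : inside S v)
    (h : Adj (vertexPixel x y S v) z) : ∃ u ∈ nbrs S v, vertexPixel x y S u = z := by
  obtain ⟨z1, z2⟩ := z
  have k1 := (nbrs_of_inside hv (u := v + 1) (by simp [nbrs])).2
  have k2 := (nbrs_of_inside hv (u := v - 1) (by simp [nbrs])).2
  have k3 := (nbrs_of_inside hv (u := v + S) (by simp [nbrs])).2
  have k4 := (nbrs_of_inside hv (u := v - S) (by simp [nbrs])).2
  obtain ⟨⟨h1, h2⟩, h3, h4⟩ := hv.coords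
  have hlt := hv.lt
  simp only [vertexPixel_eq, Adj] at h
  rcases h with ⟨e, e' | e'⟩ | ⟨e, e' | e'⟩
  · exact ⟨v + 1, by simp [nbrs], by rw [vertexPixel_eq]; ext <;> simp only <;> omega⟩
  · exact ⟨v - 1, by simp [nbrs], by rw [vertexPixel_eq]; ext <;> simp only <;> omega⟩
  · exact ⟨v + S, by simp [nbrs], by rw [vertexPixel_eq]; ext <;> simp only <;> omega⟩
  · exact ⟨v - S, by simp [nbrs], by rw [vertexPixel_eq]; ext <;> simp only <;> omega⟩

end pixelGrid

/-- Some component of black pixels lies inside the square `c` of side `R`. -/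
def IsoTile {n : ℕ} (M : Image n) (R : ℕ) (c : ℕ × ℕ) : Prop :=
  ∃ p, Isolated M Adj R p ∧ tile R p = c

theorem OnGrid.of_dvd {r R : ℕ} (h : r ∣ R) {p : ℕ × ℕ} (hp : OnGrid R p) : OnGrid r p :=
  hp.imp (dvd_trans h) (dvd_trans h)

theorem Isolated.of_dvd {n : ℕ} {M : Image n} {rel : ℕ × ℕ → ℕ × ℕ → Prop} {r R : ℕ} (h : r ∣ R)
    {p : ℕ × ℕ} (hp : Isolated M rel r p) : Isolated M rel R p :=
  ⟨hp.1, fun q hq hR => hp.2 q hq (hR.of_dvd h)⟩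

/-! ### Unmarked pixels of a square and isolated components. -/

section pixelTest
variable {n : ℕ} {M : Image n} {r R x y : ℕ} {q : List ℕ}

theorem isoTile_of_vertex {v : ℕ} (hrR : r ∣ R) (hx : r ∣ x) (hy : r ∣ y)
    (hin : inside (r + 1) v) (hiso : Isolated M Adj r (vertexPixel x y (r + 1) v)) :
    IsoTile M R (x / R, y / R) := by
  refine ⟨_, hiso.of_dvd hrR, ?_⟩
  obtain ⟨⟨h1, h2⟩, h3, h4⟩ := hin.coords
  rw [vertexPixel_eq]
  unfold tile
  simp only
  rw [add_div_of_lt hx hrR (by omega), add_div_of_lt hy hrR (by omega)]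

/-- Exploring all pixels of a square finds an isolated component, if there is an unmarked black
pixel. -/
theorem isoTile_of_unmarked (hr : 0 < r) (hrR : r ∣ R) (hx : r ∣ x) (hy : r ∣ y)
    (hq : RingClosure (r + 1) (fun v u => Black M (vertexPixel x y (r + 1) v) ∧
      Black M (vertexPixel x y (r + 1) u)) q) {v : ℕ} (hv : v < (r + 1) * (r + 1)) (hvq : v ∉ q)
    (hb : Black M (vertexPixel x y (r + 1) v)) : IsoTile M R (x / R, y / R) := by
  have hin : ∀ {v}, v < (r + 1) * (r + 1) → v ∉ q → inside (r + 1) v := fun {v} hv hvq => by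
    by_contra hc
    exact hvq (hq.ring v hv hc)
  refine isoTile_of_vertex hrR hx hy (hin hv hvq) ⟨hb, fun z hz => ?_⟩
  -- A chain of black pixels that starts at an unmarked vertex never meets a marked one. Unmarked
  -- vertices are inner, so the next pixel is again a vertex of the grid, and if it were marked,
  -- closure would have marked its predecessor.
  have key : ∃ u < (r + 1) * (r + 1), u ∉ q ∧ vertexPixel x y (r + 1) u = z := by
    induction hz with
    | refl => exact ⟨v, hv, hvq, rfl⟩
    | tail _ h ih =>
      obtain ⟨w, hw, hwq, rfl⟩ := ih
      obtain ⟨u, hu, rfl⟩ := exists_nbr_of_adj (hin hw hwq) h.1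
      have hu' := (nbrs_of_inside (hin hw hwq) hu).1
      exact ⟨u, hu'.1, fun huq => hwq (hq.closed u huq w hu'.2 hw ⟨h.2.2, h.2.1⟩), rfl⟩
  obtain ⟨u, hu, huq, rfl⟩ := key
  rw [onGrid_vertexPixel hr hx hy hu]
  exact not_not.2 (hin hu huq)

/-- If the vertex of `p` were marked, a path of black pixels would lead from it to the outer ring,
which lies on the grid, and `p` would not be isolated. The colour of a ring vertex does not matter
here, since it is itself the required grid pixel. -/
theorem exists_unmarked_of_isolated (hr : 0 < r)
    (hq : RingClosure (r + 1) (fun v u =>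
      Black M (vertexPixel (x * r) (y * r) (r + 1) v) ∧
      Black M (vertexPixel (x * r) (y * r) (r + 1) u)) q) {p : ℕ × ℕ} (hp : tile r p = (x, y))
    (hiso : Isolated M Adj r p) :
    ∃ v < (r + 1) * (r + 1), v ∉ q ∧ Black M (vertexPixel (x * r) (y * r) (r + 1) v) := by
  have hx : r ∣ x * r := dvd_mul_left _ _
  have hy : r ∣ y * r := dvd_mul_left _ _
  obtain ⟨p1, p2⟩ := p
  simp only [tile, Prod.mk.injEq] at hp
  have d1 := Nat.div_add_mod' p1 r
  have d2 := Nat.div_add_mod' p2 r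
  rw [hp.1] at d1
  rw [hp.2] at d2
  have m1 := Nat.mod_lt p1 hr
  have m2 := Nat.mod_lt p2 hr
  have hvS := lt_of_coords (S := r + 1) (a := p1 % r) (b := p2 % r) rfl (by omega) (by omega)
  have hco := div_mod_of_eq (S := r + 1) (a := p1 % r) (b := p2 % r) rfl (by omega)
  set v := p1 % r * (r + 1) + p2 % r
  have hpv : vertexPixel (x * r) (y * r) (r + 1) v = (p1, p2) := by
    rw [vertexPixel_eq, hco.1, hco.2, d1, d2]
  refine ⟨v, hvS, fun hvq => ?_, by rw [hpv]; exact hiso.1⟩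
  have key : ∀ u, Reach (r + 1) (fun v u => Black M (vertexPixel (x * r) (y * r) (r + 1) v) ∧
      Black M (vertexPixel (x * r) (y * r) (r + 1) u)) (ringList (r + 1)) u →
      ∃ g, OnGrid r g ∧ Linked M Adj (vertexPixel (x * r) (y * r) (r + 1) u) g := by
    intro u hu
    induction hu with
    | base h =>
      rw [mem_ringList] at h
      exact ⟨_, (onGrid_vertexPixel hr hx hy h.1).2 h.2, .refl⟩
    | @step w u hw hu huS ho ih =>
      by_cases hin : inside (r + 1) u
      · obtain ⟨g, hg, hl⟩ := ih
        exact ⟨g, hg, .head ⟨adj_vertexPixel hin (mem_nbrs_symm hin hu), ho.2, ho.1⟩ hl⟩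
      · exact ⟨_, (onGrid_vertexPixel hr hx hy huS).2 hin, .refl⟩
  obtain ⟨g, hg, hl⟩ := key v (hq.reach v hvq)
  rw [hpv] at hl
  exact hiso.2 g hl hg

/-! #### Exploring a component -/

/-- The hypothesis `q.length ≤ m` says that every vertex of the queue was expanded. All of them
being inner, their black neighbours are in the queue again, so the queue contains the whole
component and misses the ring. -/
theorem isoTile_of_explored (hr : 0 < r) (hx : r ∣ x) (hy : r ∣ y) {v m : ℕ}
    (hb : Black M (vertexPixel x y (r + 1) v))
    (hq : Explored (r + 1) (fun _ u => Black M (vertexPixel x y (r + 1) u)) [v] q m)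
    (hm : q.length ≤ m) (hlt : ∀ u ∈ q, u < (r + 1) * (r + 1))
    (hin : ∀ u ∈ q, inside (r + 1) u) : IsoTile M r (x / r, y / r) := by
  have hvq : v ∈ q := hq.pre.subset (by simp)
  refine isoTile_of_vertex dvd_rfl hx hy (hin v hvq) ⟨hb, fun z hz => ?_⟩
  have key : ∃ u ∈ q, vertexPixel x y (r + 1) u = z := by
    induction hz with
    | refl => exact ⟨v, hvq, rfl⟩
    | tail _ h ih =>
      obtain ⟨w, hw, rfl⟩ := ih
      obtain ⟨u, hu, rfl⟩ := exists_nbr_of_adj (hin w hw) h.1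
      have hu' := (nbrs_of_inside (hin w hw) hu).1
      obtain ⟨i, hi, rfl⟩ := List.mem_iff_getElem.1 hw
      exact ⟨u, hq.closed i hi (by omega) u hu hu'.1 h.2.2, rfl⟩
  obtain ⟨u, hu, rfl⟩ := key
  rw [onGrid_vertexPixel hr hx hy (hlt u hu)]
  exact not_not.2 (hin u hu)

/-- From an isolated start the exploration cannot leave the component, and hence meets no ring
vertex. This holds at any stage of the exploration, whether or not it is complete. -/
theorem linked_of_explored (hr : 0 < r) (hx : r ∣ x) (hy : r ∣ y) {v m : ℕ}
    (hvS : v < (r + 1) * (r + 1))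
    (hiso : Isolated M Adj r (vertexPixel x y (r + 1) v))
    (hq : Explored (r + 1) (fun _ u => Black M (vertexPixel x y (r + 1) u)) [v] q m) :
    ∀ u ∈ q, inside (r + 1) u ∧
      Linked M Adj (vertexPixel x y (r + 1) v) (vertexPixel x y (r + 1) u) := by
  intro u hu
  have key := hq.reach u hu
  have hins : ∀ u, u < (r + 1) * (r + 1) →
      Linked M Adj (vertexPixel x y (r + 1) v) (vertexPixel x y (r + 1) u) →
      inside (r + 1) u := fun u hu hl => by
    by_contra hc
    exact hiso.2 _ hl ((onGrid_vertexPixel hr hx hy hu).2 hc)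
  clear hu
  suffices h : Black M (vertexPixel x y (r + 1) u) ∧ inside (r + 1) u ∧
      Linked M Adj (vertexPixel x y (r + 1) v) (vertexPixel x y (r + 1) u) from h.2
  induction key with
  | base h =>
    rw [List.mem_singleton] at h
    subst h
    exact ⟨hiso.1, hins _ hvS .refl, .refl⟩
  | step hy hu huS ho ih =>
    have hl := ih.2.2.tail ⟨adj_vertexPixel (x := x) (y := y) ih.2.1 hu, ih.1, ho⟩
    exact ⟨ho, hins _ huS hl, hl⟩

end pixelTest

/-! #### Grids of cells -/

section cells
variable {n : ℕ} {M : Image n} {l W x y : ℕ} {q : List ℕ}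

/-- The pixel `z` belongs to the closed cell `v` of the grid of cells with corner `(x, y)`. -/
def InVertex (l x y S v : ℕ) (z : ℕ × ℕ) : Prop :=
  (x + row S v * l ≤ z.1 + l ∧ z.1 ≤ x + row S v * l) ∧ y + col S v * l ≤ z.2 + l ∧ z.2 ≤ y + col S v * l

theorem segPixel_comm (l x y S v u j : ℕ) : segPixel l x y S v u j = segPixel l x y S u v j := by
  unfold segPixel
  rw [max_comm, min_comm]

/-- Row and column of an inner cell are positive, so the truncated `- l` in `segPixel` is exact. The
numbers of two neighbours differ by `1` or by `S`, and `S > 1` tells the two directions apart. -/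
theorem exists_segPixel_iff {S v u : ℕ} (hv : inside S v) (hu : u ∈ nbrs S v) {z : ℕ × ℕ} :
    (∃ j ≤ l, segPixel l x y S v u j = z) ↔ InVertex l x y S v z ∧ InVertex l x y S u z := by
  have hn := (nbrs_of_inside hv hu).2
  obtain ⟨⟨h1, h2⟩, h3, h4⟩ := hv.coords
  have hS : 1 < S := by omega
  obtain ⟨z1, z2⟩ := z
  have hm1 : ∀ a : ℕ, (a + 1) * l = a * l + l := fun a => by ring
  unfold InVertex segPixel
  rcases hn with ⟨e1, e2, e3⟩ | ⟨e1, e2, e3⟩ | ⟨e1, e2, e3⟩ | ⟨e1, e2, e3⟩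
  · have hmin : min v u = v := by omega
    have hmax : max v u = u := by omega
    obtain ⟨a, ha⟩ : ∃ a, row S v = a + 1 := ⟨row S v - 1, by omega⟩
    simp only [hmin, hmax, if_pos (show u - v = 1 by omega)]
    simp only [← row.eq_1, ← col.eq_1]
    rw [e1, e2, hm1, ha, hm1]
    constructor
    · rintro ⟨j, hj, h⟩
      rw [Prod.mk.injEq] at h
      refine ⟨⟨⟨?_, ?_⟩, ?_, ?_⟩, ⟨?_, ?_⟩, ?_, ?_⟩ <;> omega
    · rintro ⟨⟨⟨c1, c2⟩, c3, c4⟩, ⟨c5, c6⟩, c7, c8⟩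
      exact ⟨z1 - (x + a * l), by omega, by rw [Prod.mk.injEq]; omega⟩
  · have hmin : min v u = u := by omega
    have hmax : max v u = v := by omega
    obtain ⟨a, ha⟩ : ∃ a, row S v = a + 1 := ⟨row S v - 1, by omega⟩
    simp only [hmin, hmax, if_pos (show v - u = 1 by omega)]
    simp only [← row.eq_1, ← col.eq_1]
    rw [e1, ← e2, hm1, ha, hm1]
    constructor
    · rintro ⟨j, hj, h⟩
      rw [Prod.mk.injEq] at h
      refine ⟨⟨⟨?_, ?_⟩, ?_, ?_⟩, ⟨?_, ?_⟩, ?_, ?_⟩ <;> omega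
    · rintro ⟨⟨⟨c1, c2⟩, c3, c4⟩, ⟨c5, c6⟩, c7, c8⟩
      exact ⟨z1 - (x + a * l), by omega, by rw [Prod.mk.injEq]; omega⟩
  · have hmin : min v u = v := by omega
    have hmax : max v u = u := by omega
    obtain ⟨a, ha⟩ : ∃ a, col S v = a + 1 := ⟨col S v - 1, by omega⟩
    simp only [hmin, hmax, if_neg (show ¬ u - v = 1 by omega)]
    simp only [← row.eq_1, ← col.eq_1]
    rw [e1, e2, hm1, ha, hm1]
    constructor
    · rintro ⟨j, hj, h⟩
      rw [Prod.mk.injEq] at h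
      refine ⟨⟨⟨?_, ?_⟩, ?_, ?_⟩, ⟨?_, ?_⟩, ?_, ?_⟩ <;> omega
    · rintro ⟨⟨⟨c1, c2⟩, c3, c4⟩, ⟨c5, c6⟩, c7, c8⟩
      exact ⟨z2 - (y + a * l), by omega, by rw [Prod.mk.injEq]; omega⟩
  · have hmin : min v u = u := by omega
    have hmax : max v u = v := by omega
    obtain ⟨a, ha⟩ : ∃ a, col S v = a + 1 := ⟨col S v - 1, by omega⟩
    simp only [hmin, hmax, if_neg (show ¬ v - u = 1 by omega)]
    simp only [← row.eq_1, ← col.eq_1]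
    rw [e2, ← e1, hm1, ha, hm1]
    constructor
    · rintro ⟨j, hj, h⟩
      rw [Prod.mk.injEq] at h
      refine ⟨⟨⟨?_, ?_⟩, ?_, ?_⟩, ⟨?_, ?_⟩, ?_, ?_⟩ <;> omega
    · rintro ⟨⟨⟨c1, c2⟩, c3, c4⟩, ⟨c5, c6⟩, c7, c8⟩
      exact ⟨z2 - (y + a * l), by omega, by rw [Prod.mk.injEq]; omega⟩

/-- Two adjacent cells are linked if their common segment contains a black pixel. -/
def SegBlack {n : ℕ} (M : Image n) (l x y S v u : ℕ) : Prop :=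
  ∃ j ≤ l, Black M (segPixel l x y S v u j)

theorem SegBlack.symm {S v u : ℕ} (h : SegBlack M l x y S v u) : SegBlack M l x y S u v := by
  unfold SegBlack at *
  simpa only [segPixel_comm l x y S u v] using h

theorem segBlack_iff {S v u : ℕ} (hv : inside S v) (hu : u ∈ nbrs S v) :
    SegBlack M l x y S v u ↔ ∃ z, Black M z ∧ InVertex l x y S v z ∧ InVertex l x y S u z := by
  constructor
  · rintro ⟨j, hj, hb⟩
    exact ⟨_, hb, (exists_segPixel_iff hv hu).1 ⟨j, hj, rfl⟩⟩
  · rintro ⟨z, hb, hz⟩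
    obtain ⟨j, hj, rfl⟩ := (exists_segPixel_iff hv hu).2 hz
    exact ⟨j, hj, hb⟩

/-- A black pixel in an unmarked cell is isolated. -/
theorem isoTile_of_unmarked_cell {R : ℕ} (hl : 0 < l) (hW : 0 < W) (hrR : l * W ∣ R)
    (hx : l * W ∣ x) (hy : l * W ∣ y)
    (hq : RingClosure (W + 2) (SegBlack M l x y (W + 2)) q) {v : ℕ}
    (hv : v < (W + 2) * (W + 2)) (hvq : v ∉ q) {z₀ : ℕ × ℕ} (hb : Black M z₀)
    (hz₀ : InVertex l x y (W + 2) v z₀) : IsoTile M R (x / R, y / R) := by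
  have hin : ∀ {v}, v < (W + 2) * (W + 2) → v ∉ q → inside (W + 2) v := fun {v} hv hvq => by
    by_contra hc
    exact hvq (hq.ring v hv hc)
  have hnb : ∀ {v u z}, v < (W + 2) * (W + 2) → v ∉ q → u ∈ nbrs (W + 2) v → Black M z →
      InVertex l x y (W + 2) v z → InVertex l x y (W + 2) u z →
      u < (W + 2) * (W + 2) ∧ u ∉ q := fun {v u z} hv hvq hu hb h1 h2 => by
    have hn := (nbrs_of_inside (hin hv hvq) hu).1
    refine ⟨hn.1, fun huq => hvq (hq.closed u huq v hn.2 hv ?_)⟩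
    exact ((segBlack_iff (hin hv hvq) hu).2 ⟨z, hb, h1, h2⟩).symm
  have hm1 : ∀ a : ℕ, (a + 1) * l = a * l + l := fun a => by ring
  -- a black pixel in an unmarked cell is in the interior of the square
  have hstrict : ∀ {v z}, v < (W + 2) * (W + 2) → v ∉ q → Black M z →
      InVertex l x y (W + 2) v z → (x < z.1 ∧ z.1 < x + l * W) ∧ y < z.2 ∧ z.2 < y + l * W := by
    intro v z hv hvq hb hz
    have hiv := hin hv hvq
    have n1 := nbrs_of_inside hiv (u := v + 1) (by simp [nbrs])
    have n2 := nbrs_of_inside hiv (u := v - 1) (by simp [nbrs])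
    have n3 := nbrs_of_inside hiv (u := v + (W + 2)) (by simp [nbrs])
    have n4 := nbrs_of_inside hiv (u := v - (W + 2)) (by simp [nbrs])
    obtain ⟨⟨h1, h2⟩, h3, h4⟩ := hiv.coords
    have hlt := hiv.lt
    obtain ⟨⟨z1, z2⟩, z3, z4⟩ := id hz
    -- Sharing a black pixel with an unmarked cell makes a neighbour unmarked, hence inner. A black
    -- pixel on the boundary of the square would also lie in a cell of the outer ring, which is
    -- excluded in each of the four directions below.
    have no : ∀ u ∈ nbrs (W + 2) v, InVertex l x y (W + 2) u z → inside (W + 2) u :=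
      fun u hu h => (fun k => hin k.1 k.2) (hnb hv hvq hu hb hz h)
    have b1 : row (W + 2) v * l ≤ W * l := Nat.mul_le_mul_right l (by omega)
    have b2 : col (W + 2) v * l ≤ W * l := Nat.mul_le_mul_right l (by omega)
    have b3 : 1 * l ≤ row (W + 2) v * l := Nat.mul_le_mul_right l (by omega)
    have b4 : 1 * l ≤ col (W + 2) v * l := Nat.mul_le_mul_right l (by omega)
    rw [Nat.mul_comm l W]
    have eqOf : ∀ {a b : ℕ}, a * l = b * l → a = b := fun h => Nat.eq_of_mul_eq_mul_right hl h
    refine ⟨⟨?_, ?_⟩, ?_, ?_⟩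
    · by_contra hc
      have e : row (W + 2) v = 1 := eqOf (by omega)
      have e5 : row (W + 2) (v - (W + 2)) = 0 := by omega
      have e6 : col (W + 2) (v - (W + 2)) = col (W + 2) v := by omega
      have := no (v - (W + 2)) (by simp [nbrs]) ⟨by rw [e5]; omega, by rw [e6]; exact ⟨z3, z4⟩⟩
      have := this.coords.1.1
      omega
    · by_contra hc
      have e : row (W + 2) v = W := eqOf (by omega)
      have e5 : row (W + 2) (v + (W + 2)) = W + 1 := by omega
      have e6 : col (W + 2) (v + (W + 2)) = col (W + 2) v := by omega
      have := no (v + (W + 2)) (by simp [nbrs]) ⟨by rw [e5, hm1]; omega, by rw [e6]; exact ⟨z3, z4⟩⟩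
      have := this.coords.1.2
      omega
    · by_contra hc
      have e : col (W + 2) v = 1 := eqOf (by omega)
      have e5 : col (W + 2) (v - 1) = 0 := by omega
      have e6 : row (W + 2) (v - 1) = row (W + 2) v := by omega
      have := no (v - 1) (by simp [nbrs]) ⟨by rw [e6]; exact ⟨z1, z2⟩, by rw [e5]; omega⟩
      have := this.coords.2.1
      omega
    · by_contra hc
      have e : col (W + 2) v = W := eqOf (by omega)
      have e5 : col (W + 2) (v + 1) = W + 1 := by omega
      have e6 : row (W + 2) (v + 1) = row (W + 2) v := by omega
      have := no (v + 1) (by simp [nbrs]) ⟨by rw [e6]; exact ⟨z1, z2⟩, by rw [e5, hm1]; omega⟩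
      have := this.coords.2.2
      omega
  have hiso : Isolated M Adj (l * W) z₀ := by
    refine ⟨hb, fun z hz => ?_⟩
    have key : Black M z ∧ ∃ u < (W + 2) * (W + 2), u ∉ q ∧ InVertex l x y (W + 2) u z := by
      induction hz with
      | refl => exact ⟨hb, v, hv, hvq, hz₀⟩
      | @tail z z' _ h ih =>
        refine ⟨h.2.2, ?_⟩
        obtain ⟨-, w, hw, hwq, hwz⟩ := ih
        have hiw := hin hw hwq
        have n1 := (nbrs_of_inside hiw (u := w + 1) (by simp [nbrs])).2
        have n2 := (nbrs_of_inside hiw (u := w - 1) (by simp [nbrs])).2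
        have n3 := (nbrs_of_inside hiw (u := w + (W + 2)) (by simp [nbrs])).2
        have n4 := (nbrs_of_inside hiw (u := w - (W + 2)) (by simp [nbrs])).2
        obtain ⟨⟨h1, h2⟩, h3, h4⟩ := hiw.coords
        have hlt := hiw.lt
        by_cases hwz' : InVertex l x y (W + 2) w z'
        · exact ⟨w, hw, hwq, hwz'⟩
        -- If the step from `z` leaves the closed cell `w`, then `z` lies on the side that is
        -- crossed, and the neighbour cell in that direction contains both pixels.
        suffices hs : ∃ u ∈ nbrs (W + 2) w, InVertex l x y (W + 2) u z ∧
            InVertex l x y (W + 2) u z' by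
          obtain ⟨u, hu, hz1, hz2⟩ := hs
          obtain ⟨g1, g2⟩ := hnb hw hwq hu h.2.1 hwz hz1
          exact ⟨u, g1, g2, hz2⟩
        obtain ⟨⟨z1, z2⟩, z3, z4⟩ := id hwz
        have hadj := h.1
        unfold Adj at hadj
        unfold InVertex at hwz'
        rcases hadj with ⟨a1, a2 | a2⟩ | ⟨a1, a2 | a2⟩
        · refine ⟨w + 1, by simp [nbrs], ?_, ?_⟩
          all_goals
            unfold InVertex
            rw [(by omega : row (W + 2) (w + 1) = row (W + 2) w),
              (by omega : col (W + 2) (w + 1) = col (W + 2) w + 1), hm1]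
            omega
        · refine ⟨w - 1, by simp [nbrs], ?_, ?_⟩
          all_goals
            obtain ⟨c, hc⟩ : ∃ c, col (W + 2) w = c + 1 := ⟨col (W + 2) w - 1, by omega⟩
            have hc' := hm1 c
            rw [← hc] at hc'
            unfold InVertex
            rw [(by omega : row (W + 2) (w - 1) = row (W + 2) w),
              (by omega : col (W + 2) (w - 1) = c)]
            omega
        · refine ⟨w + (W + 2), by simp [nbrs], ?_, ?_⟩
          all_goals
            unfold InVertex
            rw [(by omega : row (W + 2) (w + (W + 2)) = row (W + 2) w + 1),
              (by omega : col (W + 2) (w + (W + 2)) = col (W + 2) w), hm1]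
            omega
        · refine ⟨w - (W + 2), by simp [nbrs], ?_, ?_⟩
          all_goals
            obtain ⟨c, hc⟩ : ∃ c, row (W + 2) w = c + 1 := ⟨row (W + 2) w - 1, by omega⟩
            have hc' := hm1 c
            rw [← hc] at hc'
            unfold InVertex
            rw [(by omega : row (W + 2) (w - (W + 2)) = c),
              (by omega : col (W + 2) (w - (W + 2)) = col (W + 2) w)]
            omega
    obtain ⟨hbz, u, hu, huq, huz⟩ := key
    have hs := hstrict hu huq hbz huz
    rintro (hd | hd)
    · obtain ⟨a, ha⟩ : ∃ a, z.1 = x + a := ⟨z.1 - x, by omega⟩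
      rw [ha] at hd
      exact dvd_add_lt hx (by omega) (by omega) hd
    · obtain ⟨a, ha⟩ : ∃ a, z.2 = y + a := ⟨z.2 - y, by omega⟩
      rw [ha] at hd
      exact dvd_add_lt hy (by omega) (by omega) hd
  refine ⟨z₀, hiso.of_dvd hrR, ?_⟩
  have hs := hstrict hv hvq hb hz₀
  obtain ⟨a, ha⟩ : ∃ a, z₀.1 = x + a := ⟨z₀.1 - x, by omega⟩
  obtain ⟨b, hb⟩ : ∃ b, z₀.2 = y + b := ⟨z₀.2 - y, by omega⟩
  unfold tile
  rw [ha, hb, add_div_of_lt hx hrR (by omega), add_div_of_lt hy hrR (by omega)]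

/-- The cell of the grid that contains a given pixel. -/
def cellOf (l x y S : ℕ) (p : ℕ × ℕ) : ℕ := ((p.1 - x) / l + 1) * S + ((p.2 - y) / l + 1)

/-- The `+ 1` in both coordinates skips the ring of cells around the square. The pixel is placed in
the half-open cell that contains it, so if an offset is divisible by `l`, the pixel lies on the
lower side, which is shared with the lower neighbour. -/
theorem cellOf_spec (hl : 0 < l) {p : ℕ × ℕ} (h1 : x ≤ p.1) (h2 : p.1 < x + l * W) (h3 : y ≤ p.2)
    (h4 : p.2 < y + l * W) :
    (cellOf l x y (W + 2) p < (W + 2) * (W + 2) ∧ inside (W + 2) (cellOf l x y (W + 2) p)) ∧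
      InVertex l x y (W + 2) (cellOf l x y (W + 2) p) p ∧
      (l ∣ p.1 - x → InVertex l x y (W + 2) (cellOf l x y (W + 2) p - (W + 2)) p) ∧
      (l ∣ p.2 - y → InVertex l x y (W + 2) (cellOf l x y (W + 2) p - 1) p) := by
  have a1 : (p.1 - x) / l < W := Nat.div_lt_of_lt_mul (by omega)
  have a2 : (p.2 - y) / l < W := Nat.div_lt_of_lt_mul (by omega)
  have hc := div_mod_of_eq (S := W + 2) (v := cellOf l x y (W + 2) p) rfl (by omega)
  have hlt := lt_of_coords (S := W + 2) (v := cellOf l x y (W + 2) p) rfl (by omega) (by omega)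
  set v := cellOf l x y (W + 2) p with hv
  have hin : inside (W + 2) v :=
    show (0 < row (W + 2) v ∧ row (W + 2) v + 1 < W + 2) ∧ 0 < col (W + 2) v ∧
      col (W + 2) v + 1 < W + 2 by
    rw [hc.1, hc.2]
    exact ⟨⟨Nat.succ_pos _, by omega⟩, Nat.succ_pos _, by omega⟩
  have n2 := (nbrs_of_inside hin (u := v - 1) (by simp [nbrs])).2
  have n4 := (nbrs_of_inside hin (u := v - (W + 2)) (by simp [nbrs])).2
  have hvlt := hin.lt
  have d1 := Nat.div_add_mod' (p.1 - x) l
  have d2 := Nat.div_add_mod' (p.2 - y) l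
  have m1 := Nat.mod_lt (p.1 - x) hl
  have m2 := Nat.mod_lt (p.2 - y) hl
  have hm1 : ∀ a : ℕ, (a + 1) * l = a * l + l := fun a => by ring
  refine ⟨⟨hlt, hin⟩, ?_, ?_, ?_⟩
  · unfold InVertex
    rw [hc.1, hc.2, hm1, hm1]
    omega
  · intro hd
    have := Nat.mod_eq_zero_of_dvd hd
    unfold InVertex
    rw [(by omega : row (W + 2) (v - (W + 2)) = (p.1 - x) / l),
      (by omega : col (W + 2) (v - (W + 2)) = col (W + 2) v), hc.2, hm1]
    omega
  · intro hd
    have := Nat.mod_eq_zero_of_dvd hd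
    unfold InVertex
    rw [(by omega : col (W + 2) (v - 1) = (p.2 - y) / l),
      (by omega : row (W + 2) (v - 1) = row (W + 2) v), hc.1, hm1]
    omega

/-- Go back along the path from the ring: the black pixel on the common segment is in the same
closed cell as `z`, so it is one `CellRel` step away. Where the path comes from a ring cell, that
segment lies on the boundary of the square, which is part of the grid of side `l * W`. -/
theorem linked_onGrid_of_reach (hx : l * W ∣ x) (hy : l * W ∣ y) {v : ℕ}
    (h : Reach (W + 2) (SegBlack M l x y (W + 2)) (ringList (W + 2)) v) (hv : inside (W + 2) v) :
    ∀ z, Black M z → InVertex l x y (W + 2) v z →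
      ∃ g, OnGrid (l * W) g ∧ Linked M (CellRel l) z g := by
  have hm1 : ∀ a : ℕ, (a + 1) * l = a * l + l := fun a => by ring
  have hrel : ∀ {v z z'}, inside (W + 2) v → InVertex l x y (W + 2) v z →
      InVertex l x y (W + 2) v z' → CellRel l z z' := by
    intro v z z' hv h1 h2
    obtain ⟨c, hc⟩ := (dvd_mul_right l W).trans hx
    obtain ⟨d, hd⟩ := (dvd_mul_right l W).trans hy
    obtain ⟨a, ha⟩ : ∃ a, row (W + 2) v = a + 1 := ⟨row (W + 2) v - 1, by have := hv.coords.1.1; omega⟩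
    obtain ⟨b, hb⟩ : ∃ b, col (W + 2) v = b + 1 := ⟨col (W + 2) v - 1, by have := hv.coords.2.1; omega⟩
    have e1 : (c + a) * l = x + a * l := by rw [hc]; ring
    have e2 : (d + b) * l = y + b * l := by rw [hd]; ring
    refine ⟨(c + a, d + b), ?_, ?_⟩
    · unfold InVertex at h1
      rw [ha, hb, hm1, hm1] at h1
      unfold InCell
      simp only
      rw [e1, e2]
      omega
    · unfold InVertex at h2
      rw [ha, hb, hm1, hm1] at h2
      unfold InCell
      simp only
      rw [e1, e2]
      omega
  induction h with
  | base h => exact absurd hv (mem_ringList.1 h).2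
  | @step w u hw hu huS ho ih =>
    intro z hb hz
    have hwu := mem_nbrs_symm hv hu
    obtain ⟨z', hb', hz1, hz2⟩ := (segBlack_iff hv hwu).1 ho.symm
    by_cases hin : inside (W + 2) w
    · obtain ⟨g, hg, hl⟩ := ih hin z' hb' hz2
      exact ⟨g, hg, .head ⟨hrel hv hz hz1, hb, hb'⟩ hl⟩
    · refine ⟨z', ?_, .single ⟨hrel hv hz hz1, hb, hb'⟩⟩
      have hn := nbrs_of_inside hv hwu
      have hc := coords_lt hn.1.1
      have hbd : row (W + 2) w = 0 ∨ row (W + 2) w = W + 1 ∨ col (W + 2) w = 0 ∨ col (W + 2) w = W + 1 := by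
        by_contra hcon
        exact hin (inside_of_lt hn.1.1 (by omega) (by omega) (by omega) (by omega))
      obtain ⟨⟨i1, i2⟩, i3, i4⟩ := hv.coords
      have hn2 := hn.2
      obtain ⟨⟨c1, c2⟩, c3, c4⟩ := hz1
      obtain ⟨⟨d1, d2⟩, d3, d4⟩ := hz2
      have hWl : W * l = l * W := Nat.mul_comm _ _
      rcases hbd with e | e | e | e
      · left
        have e' : row (W + 2) u = 1 := by omega
        rw [e] at d1 d2
        rw [e'] at c1 c2
        rw [(by omega : z'.1 = x)]
        exact hx
      · left
        have e' : row (W + 2) u = W := by omega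
        rw [e, hm1] at d1 d2
        rw [e'] at c1 c2
        rw [(by omega : z'.1 = x + l * W)]
        exact Dvd.dvd.add hx dvd_rfl
      · right
        have e' : col (W + 2) u = 1 := by omega
        rw [e] at d3 d4
        rw [e'] at c3 c4
        rw [(by omega : z'.2 = y)]
        exact hy
      · right
        have e' : col (W + 2) u = W := by omega
        rw [e, hm1] at d3 d4
        rw [e'] at c3 c4
        rw [(by omega : z'.2 = y + l * W)]
        exact Dvd.dvd.add hy dvd_rfl

theorem tile_bounds {r : ℕ} (hr : 0 < r) {p : ℕ × ℕ} {x y : ℕ} (hp : tile r p = (x, y)) :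
    x * r ≤ p.1 ∧ p.1 < x * r + r ∧ y * r ≤ p.2 ∧ p.2 < y * r + r := by
  simp only [tile, Prod.mk.injEq] at hp
  have d1 := Nat.div_add_mod' p.1 r
  have d2 := Nat.div_add_mod' p.2 r
  rw [hp.1] at d1
  rw [hp.2] at d2
  have m1 := Nat.mod_lt p.1 hr
  have m2 := Nat.mod_lt p.2 hr
  omega

theorem cellOf_not_mem_of_isolated (hl : 0 < l) (hW : 0 < W) {x y : ℕ}
    (hq : RingClosure (W + 2)
      (SegBlack M l (x * (l * W)) (y * (l * W)) (W + 2)) q) {p : ℕ × ℕ}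
    (hp : tile (l * W) p = (x, y)) (hiso : Isolated M (CellRel l) (l * W) p) :
    cellOf l (x * (l * W)) (y * (l * W)) (W + 2) p ∉ q := by
  obtain ⟨h1, h2, h3, h4⟩ := tile_bounds (Nat.mul_pos hl hW) hp
  obtain ⟨⟨g1, g2⟩, g3, -⟩ := cellOf_spec (W := W) hl h1 h2 h3 h4
  intro hmem
  obtain ⟨g, hg, hlk⟩ := linked_onGrid_of_reach (dvd_mul_left _ _) (dvd_mul_left _ _)
    (hq.reach _ hmem) g2 p hiso.1 g3
  exact hiso.2 g hlk hg

/-- A pixel on the grid of side `l` lies on one of the two lower sides of its half-open cell. That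
is why looking at two segments of each unmarked cell is enough. -/
theorem exists_unmarked_cell_of_isolated (hl : 0 < l) (hW : 0 < W) {x y : ℕ}
    (hq : RingClosure (W + 2)
      (SegBlack M l (x * (l * W)) (y * (l * W)) (W + 2)) q) {p : ℕ × ℕ}
    (hp : tile (l * W) p = (x, y)) (hiso : Isolated M (CellRel l) (l * W) p)
    (hgrid : OnGrid l p) :
    ∃ v < (W + 2) * (W + 2), v ∉ q ∧
      (SegBlack M l (x * (l * W)) (y * (l * W)) (W + 2) v (v - 1) ∨
        SegBlack M l (x * (l * W)) (y * (l * W)) (W + 2) v (v - (W + 2))) := by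
  obtain ⟨h1, h2, h3, h4⟩ := tile_bounds (Nat.mul_pos hl hW) hp
  obtain ⟨⟨g1, g2⟩, g3, g4, g5⟩ := cellOf_spec (W := W) hl h1 h2 h3 h4
  refine ⟨_, g1, cellOf_not_mem_of_isolated hl hW hq hp hiso, ?_⟩
  have hd : ∀ c : ℕ, l ∣ c * (l * W) := fun c => (dvd_mul_right l W).mul_left c
  rcases hgrid with hg | hg
  · right
    exact (segBlack_iff g2 (by simp [nbrs])).2 ⟨p, hiso.1, g3, g4 (Nat.dvd_sub hg (hd x))⟩
  · left
    exact (segBlack_iff g2 (by simp [nbrs])).2 ⟨p, hiso.1, g3, g5 (Nat.dvd_sub hg (hd y))⟩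

end cells
end ImageTesting

namespace ImageTesting

/-! ### What an execution never undoes -/

/-- The queries made between `z` and `z'`. -/
structure Extends (t : ℕ) (z z' : Config) : Prop where
  pre : z.queries <+: z'.queries
  length_le : z'.queries.length ≤ z.queries.length + t
  interleaved : z.interleaved = true → z'.interleaved = true

theorem extends_of_mem_support_step {n : ℕ} {M : Image n} {w : ℕ} {z z' : Config}
    (h : z' ∈ (step M w z).support) : Extends 1 z z' := by
  have key : ∀ y : Config, y.queries = z.queries → y.interleaved = z.interleaved →
      Extends 1 z y := fun y h1 h2 => ⟨by rw [h1], by rw [h1]; omega, by rw [h2]; exact id⟩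
  unfold step at h
  split at h
  case h_5 =>
    rw [PMF.support_map] at h
    obtain ⟨v, -, rfl⟩ := h
    exact key _ rfl rfl
  case h_6 =>
    rw [PMF.support_pure, Set.mem_singleton_iff] at h
    subst h
    exact ⟨List.prefix_append _ _, by simp, fun h => by simp [h]⟩
  all_goals
    rw [PMF.support_pure, Set.mem_singleton_iff] at h
    subst h
    exact key _ rfl rfl

theorem extends_of_mem_support_run {n : ℕ} {M : Image n} {w t : ℕ} {z z' : Config}
    (h : z' ∈ (run M w t z).support) : Extends t z z' := by
  induction t generalizing z with
  | zero =>
    rw [run, PMF.support_pure, Set.mem_singleton_iff] at h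
    subst h
    exact ⟨List.prefix_refl _, by simp, id⟩
  | succ t ih =>
    rw [run, PMF.mem_support_bind_iff] at h
    obtain ⟨y, hy, hz⟩ := h
    have h1 := extends_of_mem_support_step hy
    have h2 := ih hz
    exact ⟨h1.pre.trans h2.pre, by have := h1.length_le; have := h2.length_le; omega,
      fun h => h2.interleaved (h1.interleaved h)⟩

variable {n : ℕ} {X : Ctx n}

/-- Earlier queries keep their numbers. The answers for the first samples can therefore still be
read after all tests are done. -/
theorem Runs.prefix {s : St} {p : Program} {T : ℕ} {Q : St → Prop} (h : Runs X s p T Q) :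
    Runs X s p T fun s' => Q s' ∧ s.qs <+: s'.qs := fun hg hq => by
  obtain ⟨t, ht, s', h1, h2, h3, h4⟩ := h hg hq
  refine ⟨t, ht, s', h1, h2, h3, h4, ?_⟩
  have : s'.cfg [] ∈ (run X.M X.w t (s.cfg [p])).support := by rw [h1 []]; simp
  exact (extends_of_mem_support_run this).pre

/-! ### Testing the square around a sample -/

/-- The state while the samples `L` are processed: the parameters `l`, `R`, `K`, `H` are in
registers, the samples are at the bottom of the memory, `i` blocks of working memory have been used
so far, and the recorded square contains a component. -/
structure Sampled (M : Image n) (l R K H : ℕ) (L : List (ℕ × ℕ)) (i : ℕ) (s : St) : Prop where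
  h3 : s.reg 3 = l
  h4 : s.reg 4 = R
  h6 : s.reg 6 = K
  h7 : s.reg 7 = H
  samples : ∀ (t : ℕ) (h : t < L.length), s.mem (2 * t) = L[t].1 ∧ s.mem (2 * t + 1) = L[t].2
  h16 : s.reg 16 = 2 * L.length + i * (2 * H)
  zero : ∀ a, s.reg 16 ≤ a → s.mem a = 0
  sound : s.reg 41 ≠ 0 → IsoTile M R (s.reg 42, s.reg 43)

/-- A subprogram that looks for an isolated component in the square with corner in the registers
`13` and `14`, for the sample with number `t`. -/
def CoreSpec (X : Ctx n) (R : ℕ) (s : St) (core : Program) (T : ℕ) (Φ : St → Prop) (Det : Prop) :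
    Prop :=
  Runs X s core T fun s' => (∀ r, r < 20 ∨ 40 < r → s'.reg r = s.reg r) ∧
    (∀ a, a < s.reg 16 ∨ s.reg 16 + 2 * s.reg 7 ≤ a → s'.mem a = s.mem a) ∧ Φ s' ∧
    (s'.reg 24 ≠ 0 → IsoTile X.M R (s.reg 13 / R, s.reg 14 / R)) ∧ (Det → s'.reg 24 ≠ 0)

/-- `Φ` depends only on the queries. -/
def QueryOnly (Φ : St → Prop) : Prop :=
  ∀ s u : St, Φ s → u.reg 40 = s.reg 40 → u.qs = s.qs → u.itl = s.itl → Φ u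

/-- Run `core` on the square of side `reg 12` that contains the sample `reg 10`, with a grid of
width `e`, and record the square if `core` finds a component. -/
def sampleTest (e : Term) (core : Program) : Program :=
  .set 13 (.load (2 * .reg 10) / .reg 12 * .reg 12) ⨟
  .set 14 (.load (2 * .reg 10 + 1) / .reg 12 * .reg 12) ⨟ .set 15 e ⨟ core ⨟
  .cond (.reg 24) (.set 41 1 ⨟ .set 42 (.reg 13 / .reg 4) ⨟ .set 43 (.reg 14 / .reg 4)) skip ⨟
  .set 16 (.reg 16 + 2 * .reg 7)

/-- The three kinds of test share this frame. Moving register `16` up by `2 * H` leaves the used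
block behind; everything above it is still zero, so the next test starts on clean memory and the
time does not depend on `H`. The registers `41` to `43` change only upon a detection, hence the
recorded square is always sound. -/
theorem runs_sampleTest {l R K H : ℕ} {L : List (ℕ × ℕ)} {i S T t : ℕ} {s : St} {e : Term}
    {core : Program} {Φ : St → Prop} {Det : Prop} (he : e.Small)
    (hs : Sampled X.M l R K H L i s) (ht : t < L.length) (h10 : s.reg 10 = t)
    (hB : 2 * L.length + (i + 1) * (2 * H) ≤ X.B)
    (hΦ : QueryOnly Φ) (hs0 : Φ s) (hSB : S ≤ X.B)
    (heval : ∀ s', (∀ r, r < 13 → s'.reg r = s.reg r) → e.val s' = S)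
    (hcore : ∀ s1, Sampled X.M l R K H L i s1 → Φ s1 →
      (∀ r, r ≠ 13 → r ≠ 14 → r ≠ 15 → s1.reg r = s.reg r) →
      s1.reg 13 = L[t].1 / s.reg 12 * s.reg 12 → s1.reg 14 = L[t].2 / s.reg 12 * s.reg 12 →
      s1.reg 15 = S → s1.qs = s.qs → CoreSpec X R s1 core T Φ Det) :
    Runs X s (sampleTest e core) (T + 20) fun s' => Sampled X.M l R K H L (i + 1) s' ∧ Φ s' ∧
      (∀ r, r < 13 ∨ 16 < r ∧ r < 20 ∨ 43 < r → s'.reg r = s.reg r) ∧ s'.reg 15 = S ∧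
      (s.reg 41 ≠ 0 → s'.reg 41 ≠ 0) ∧ (Det → s'.reg 41 ≠ 0) := by
  refine Runs.intro_good fun hg _ => ?_
  have hXB := X.hB
  obtain ⟨m1, m2⟩ : s.mem (2 * s.reg 10) = L[t].1 ∧ s.mem (2 * s.reg 10 + 1) = L[t].2 := by
    rw [h10]
    exact hs.samples t ht
  have b1 := hg.2 (2 * s.reg 10)
  have b2 := hg.2 (2 * s.reg 10 + 1)
  refine Runs.time (Runs.seq (Runs.set (by decide) ?_ (Runs.seq (Runs.set (by decide) ?_
    (Runs.seq (Runs.set he ?_ (Runs.seq (T := T) (T' := 9) ((hcore _ ?_ ?_ ?_ ?_ ?_ ?_ ?_).mono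
      le_rfl ?_)))))))) (by omega)
  · simpa using (Nat.div_mul_le_self _ _).trans b1
  · simpa using (Nat.div_mul_le_self _ _).trans b2
  · rw [heval _ fun r hr => by simp only [St.set_reg]; rw [if_neg (by omega), if_neg (by omega)]]
    exact hSB
  · exact ⟨by simp [hs.h3], by simp [hs.h4], by simp [hs.h6], by simp [hs.h7],
      by simpa using hs.samples, by simp [hs.h16], by simpa using hs.zero, by simpa using hs.sound⟩
  · exact hΦ s _ hs0 (by simp) rfl rfl
  · intro r h1 h2 h3
    simp [h1, h2, h3]
  · simp [m1]
  · simp [m2]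
  · simp only [St.set_reg, if_true]
    exact heval _ fun r hr => by simp only [St.set_reg]; rw [if_neg (by omega), if_neg (by omega)]
  · simp
  set s1 := ((s.set 13 _).set 14 _).set 15 _ with hs1
  have f1 : ∀ r, r ≠ 13 → r ≠ 14 → r ≠ 15 → s1.reg r = s.reg r := fun r h1 h2 h3 => by
    simp [hs1, h1, h2, h3]
  have f15 : s1.reg 15 = S := by
    simp only [hs1, St.set_reg, if_true]
    exact heval _ fun r hr => by simp only [St.set_reg]; rw [if_neg (by omega), if_neg (by omega)]
  have fm : s1.mem = s.mem := rfl
  clear_value s1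
  rintro s2 hg2 ⟨g1, g2, g3, g4, g5⟩
  have k4 : s2.reg 4 = R := by rw [g1 4 (by omega), f1 4 (by omega) (by omega) (by omega), hs.h4]
  have k7 : s2.reg 7 = H := by rw [g1 7 (by omega), f1 7 (by omega) (by omega) (by omega), hs.h7]
  have e16 : s1.reg 16 = s.reg 16 := f1 16 (by omega) (by omega) (by omega)
  have e7 : s1.reg 7 = H := by rw [f1 7 (by omega) (by omega) (by omega), hs.h7]
  have k16 : s2.reg 16 = s.reg 16 := by rw [g1 16 (by omega), e16]
  have hsum : s.reg 16 + 2 * H = 2 * L.length + (i + 1) * (2 * H) := by rw [hs.h16]; ring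
  refine Runs.time (Runs.seq (T := 6) (T' := 1) (Runs.mono (T := 6) (Q := fun s3 =>
      (∀ r, r ≠ 41 → r ≠ 42 → r ≠ 43 → s3.reg r = s2.reg r) ∧ s3.mem = s2.mem ∧
      s3.qs = s2.qs ∧ s3.itl = s2.itl ∧ (s3.reg 41 ≠ 0 → IsoTile X.M R (s3.reg 42, s3.reg 43)) ∧
      (s.reg 41 ≠ 0 → s3.reg 41 ≠ 0) ∧ (Det → s3.reg 41 ≠ 0))
      (Runs.cond (T := 5) (by decide) (fun hc => ?_) fun hc => ?_) le_rfl ?_)) (by omega)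
  · simp only [Term.ideal_reg] at hc
    refine Runs.seq (Runs.set (by decide) (by simp; omega) (Runs.seq (Runs.set (by decide) ?_
      (Runs.set (by decide) ?_ ⟨?_, rfl, rfl, rfl, ?_, ?_, ?_⟩))))
    · simpa using (Nat.div_le_self _ _).trans (hg2.1 13)
    · simpa using (Nat.div_le_self _ _).trans (hg2.1 14)
    · intro r h1 h2 h3
      simp [h1, h2, h3]
    · intro _
      simpa [k4, g1 13, g1 14] using g4 hc
    · simp
    · simp
  · simp only [Term.ideal_reg] at hc
    have h41 : ∀ r, 40 < r → s2.reg r = s.reg r := fun r hr => by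
      rw [g1 r (by omega), f1 r (by omega) (by omega) (by omega)]
    refine (Runs.skip ⟨fun _ _ _ _ => rfl, rfl, rfl, rfl, ?_, ?_, fun h => absurd hc (g5 h)⟩).time
      (by omega)
    · rw [h41 41 (by omega), h41 42 (by omega), h41 43 (by omega)]
      exact hs.sound
    · rw [h41 41 (by omega)]
      exact id
  rintro s3 - ⟨c1, c2, c3, c4, c5, c6, c7⟩
  have d7 : s3.reg 7 = H := by rw [c1 7 (by omega) (by omega) (by omega), k7]
  have d16 : s3.reg 16 = s.reg 16 := by rw [c1 16 (by omega) (by omega) (by omega), k16]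
  have hr : ∀ r, r < 13 ∨ 16 < r ∧ r < 20 ∨ 43 < r → s3.reg r = s.reg r := fun r h => by
    rw [c1 r (by omega) (by omega) (by omega), g1 r (by omega), f1 r (by omega) (by omega)
      (by omega)]
  refine Runs.set (by decide) ?_ ⟨⟨?_, ?_, ?_, ?_, ?_, ?_, ?_, ?_⟩, ?_, ?_, ?_, ?_, ?_⟩
  · simp [d16, d7]; omega
  · simp [hr, hs.h3]
  · simp [hr, hs.h4]
  · simp [hr, hs.h6]
  · simp [hr, hs.h7]
  · intro t' ht'
    rw [St.set_mem, c2, g2 _ (by rw [e16, hs.h16]; omega), g2 _ (by rw [e16, hs.h16]; omega), fm]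
    exact hs.samples t' ht'
  · simp [d16, d7]; omega
  · intro a ha
    simp [d16, d7] at ha
    rw [St.set_mem, c2, g2 _ (by rw [e16, e7]; omega), fm]
    exact hs.zero a (by omega)
  · simpa using c5
  · exact hΦ s2 _ g3 (by simp [c1]) (by simp [c3]) (by simp [c4])
  · intro r h
    rw [St.set_reg, if_neg (by omega), hr r h]
  · simp [c1, g1 15, f15]
  · simpa using c6
  · simpa using c7

end ImageTesting

namespace ImageTesting

/-! ### Correctness of the three tests of a single sample. -/

variable {n : ℕ} {X : Ctx n}

/-- All queries are known, and no query was made after an answer had been received. -/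
def Settled (qs : List (ℕ × ℕ)) (s : St) : Prop := s.qs = qs ∧ s.itl = false

theorem queryOnly_settled (qs : List (ℕ × ℕ)) : QueryOnly (Settled qs) :=
  fun _ _ h _ h2 h3 => ⟨h2.trans h.1, h3.trans h.2⟩

/-- Register `40` counts the queries. -/
def Counted (s : St) : Prop := s.reg 40 = s.qs.length

theorem queryOnly_counted : QueryOnly Counted := fun s s' h h1 h2 _ => by
  unfold Counted at *
  rw [h1, h2, h]

section
variable {l R K H : ℕ} {L : List (ℕ × ℕ)} {i t : ℕ} {s : St}

theorem Sampled.zero_block {M : Image n} (h : Sampled M l R K H L i s) :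
    ∀ a, s.reg 16 ≤ a → a < s.reg 16 + s.reg 7 → s.mem a = 0 := fun a h1 _ => h.zero a h1

/-! #### Pixels that were queried before -/

/-- Explore the square of a sample pixel by pixel, using earlier queries. -/
def pixelSample : Program := sampleTest (.reg 12 + 1) (tileTest bothBlack isBlack)

theorem runs_pixelSample {qs : List (ℕ × ℕ)} {qb : ℕ} (hs : Sampled X.M l R K H L i s)
    (ht : t < L.length) (h10 : s.reg 10 = t) (hB : 2 * L.length + (i + 1) * (2 * H) ≤ X.B)
    (hset : Settled qs s) (h18 : s.reg 18 = qb) (hr : 0 < s.reg 12) (hrR : s.reg 12 ∣ R)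
    (hH : (s.reg 12 + 1) * (s.reg 12 + 1) ≤ H)
    (hqs : ∀ v < (s.reg 12 + 1) * (s.reg 12 + 1), qs[qb + v]? = some (vertexPixel
      (L[t].1 / s.reg 12 * s.reg 12) (L[t].2 / s.reg 12 * s.reg 12) (s.reg 12 + 1) v)) :
    Runs X s pixelSample (91 * ((s.reg 12 + 1) * (s.reg 12 + 1)) + 40) fun s' =>
      Sampled X.M l R K H L (i + 1) s' ∧ Settled qs s' ∧
      (∀ r, r < 13 ∨ 16 < r ∧ r < 20 ∨ 43 < r → s'.reg r = s.reg r) ∧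
      s'.reg 15 = s.reg 12 + 1 ∧ (s.reg 41 ≠ 0 → s'.reg 41 ≠ 0) ∧
      ((∃ p, Isolated X.M Adj (s.reg 12) p ∧ tile (s.reg 12) p = tile (s.reg 12) L[t]) →
        s'.reg 41 ≠ 0) := by
  have h2H : 2 * H ≤ X.B := by nlinarith
  refine Runs.time (runs_sampleTest (S := s.reg 12 + 1) (by decide) hs ht h10 hB
    (queryOnly_settled qs) hset ?_ (fun s' h => by simp [h]) ?_
    (T := 91 * ((s.reg 12 + 1) * (s.reg 12 + 1)) + 20)) (by omega)
  · nlinarith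
  intro s1 hs1 hΦ f1 f13 f14 f15 _
  set r := s.reg 12
  set x := L[t].1 / r
  set y := L[t].2 / r
  have k7 := hs1.h7
  have k18 : s1.reg 18 = qb := by rw [f1 18 (by omega) (by omega) (by omega), h18]
  refine Runs.mono (runs_tileTest (Env := Prequeried (r + 1) qb qs)
    (stable_prequeried _ _ _) ?_ ?_ (τ := 5) (τ' := 1) ?_ ?_ ?_ hs1.zero_block
    (op := fun v u => Black X.M (vertexPixel (x * r) (y * r) (r + 1) v) ∧
      Black X.M (vertexPixel (x * r) (y * r) (r + 1) u))
    (int := fun v => Black X.M (vertexPixel (x * r) (y * r) (r + 1) v))) ?_ ?_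
  · rw [f15, k7]; exact hH
  · rw [k7]; exact h2H
  · rw [f15]; exact edgeSpec_bothBlack hqs
  · rw [f15]; exact vertexSpec_isBlack hqs
  · exact ⟨f15, k18, hΦ.1, hΦ.2⟩
  · rw [f15]
  · rintro s' - ⟨q, g1, g2, g3⟩
    rw [f15] at g2 g3
    refine ⟨g1.frame, g1.mem, ⟨g1.env.qs_eq, g1.env.itl⟩, fun h => ?_, ?_⟩
    · obtain ⟨v, hv, hvq, hb⟩ := g3.1 h
      rw [f13, f14]
      exact isoTile_of_unmarked hr hrR (dvd_mul_left _ _) (dvd_mul_left _ _) g2 hv hvq hb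
    · rintro ⟨p, hp, hpt⟩
      exact g3.2 (exists_unmarked_of_isolated hr g2 hpt hp)

/-! #### Cells -/

/-- The cell of the sample. -/
def cellTerm : Term :=
  ((.load (2 * .reg 10) - .reg 13) / .reg 3 + 1) * .reg 15 +
    ((.load (2 * .reg 10 + 1) - .reg 14) / .reg 3 + 1)

/-- Whether the sample is black and its cell is not marked. -/
def checkSample : Program :=
  askPixel (.load (2 * .reg 10)) (.load (2 * .reg 10 + 1)) 30 ⨟
  .cond (.reg 30) (.cond (.load (.reg 16 + cellTerm)) skip (.set 24 1)) skip

/-- Explore the square of a sample cell by cell. -/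
def cellSample : Program :=
  sampleTest (.reg 12 / .reg 3 + 2) (tileTest askSegment askLowerSegments ⨟ checkSample)

/-- Two detections are needed. An isolated pixel on the grid of side `l` shows up in a segment of an
unmarked cell, for every sample in the same square. A component in the interior of one cell meets no
segment, so it is found only if the sample itself is black and its cell unmarked. The time is `O(l)`
for each of the `(W + 2) * (W + 2)` cells. -/
theorem runs_cellSample {W : ℕ} (hs : Sampled X.M l R K H L i s)
    (ht : t < L.length) (h10 : s.reg 10 = t) (hB : 2 * L.length + (i + 1) * (2 * H) ≤ X.B)
    (hset : Counted s) (hl : 0 < l) (hW : 0 < W) (h12 : s.reg 12 = l * W) (hrR : l * W ∣ R)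
    (hH : (W + 2) * (W + 2) ≤ H) (h1 : L[t].1 + (W + 2) * l ≤ X.B)
    (h2 : L[t].2 + (W + 2) * l ≤ X.B) :
    Runs X s cellSample ((66 * l + 320) * ((W + 2) * (W + 2)) + 50) fun s' =>
      Sampled X.M l R K H L (i + 1) s' ∧ Counted s' ∧
      (∀ r, r < 13 ∨ 16 < r ∧ r < 20 ∨ 43 < r → s'.reg r = s.reg r) ∧
      (s.reg 41 ≠ 0 → s'.reg 41 ≠ 0) ∧
      (((∃ p, Isolated X.M (CellRel l) (l * W) p ∧ OnGrid l p ∧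
          tile (l * W) p = tile (l * W) L[t]) ∨ Isolated X.M (CellRel l) (l * W) L[t]) →
        s'.reg 41 ≠ 0) := by
  have h2H : 2 * H ≤ X.B := by nlinarith
  have hXB := X.hB
  refine Runs.mono (runs_sampleTest (S := W + 2) (by decide) hs ht h10 hB
    queryOnly_counted hset ?_ (fun s' h => ?_) ?_
    (T := (66 * l + 320) * ((W + 2) * (W + 2)) + 30)) le_rfl
    (fun s' _ h => ⟨h.1, h.2.1, h.2.2.1, h.2.2.2.2⟩)
  · nlinarith
  · simp [h, h12, hs.h3, Nat.mul_div_cancel_left _ hl]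
  intro s1 hs1 hΦ f1 f13 f14 f15 _
  rw [h12] at f13 f14
  set x := L[t].1 / (l * W) with hx
  set y := L[t].2 / (l * W) with hy
  have k7 := hs1.h7
  have hxl : x * (l * W) + (W + 2) * l ≤ X.B := by
    have : x * (l * W) ≤ L[t].1 := Nat.div_mul_le_self L[t].1 (l * W)
    omega
  have hyl : y * (l * W) + (W + 2) * l ≤ X.B := by
    have : y * (l * W) ≤ L[t].2 := Nat.div_mul_le_self L[t].2 (l * W)
    omega
  have hl1 : l + 1 ≤ X.B := by nlinarith
  refine Runs.time (Runs.seq (T' := 9) (Runs.mono (runs_tileTest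
    (Env := OnDemand l (x * (l * W)) (y * (l * W)) (W + 2))
    (stable_onDemand _ _ _ _) ?_ ?_ (τ := 11 * l + 40) (τ' := 22 * l + 90) ?_ ?_ ?_
      hs1.zero_block
    (op := SegBlack X.M l (x * (l * W)) (y * (l * W)) (W + 2))
    (int := fun v => SegBlack X.M l (x * (l * W)) (y * (l * W)) (W + 2) v (v - 1) ∨
      SegBlack X.M l (x * (l * W)) (y * (l * W)) (W + 2) v (v - (W + 2)))) le_rfl ?_)) ?_
  · rw [f15, k7]; exact hH
  · rw [k7]; exact h2H
  · rw [f15]; exact edgeSpec_askSegment hxl hyl hl1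
  · rw [f15]; exact vertexSpec_askLowerSegments hxl hyl hl1
  · exact ⟨hs1.h3, f13, f14, f15, hΦ⟩
  swap
  · rw [f15]; nlinarith
  rintro s2 - ⟨q, g1, g2, g3⟩
  rw [f15] at g2 g3
  have hp : tile (l * W) L[t] = (x, y) := rfl
  obtain ⟨c1, c2, c3, c4⟩ := tile_bounds (Nat.mul_pos hl hW) hp
  obtain ⟨⟨d1, d2⟩, d3, -⟩ := cellOf_spec (W := W) hl c1 c2 c3 c4
  have k10 : s2.reg 10 = t := by
    rw [g1.frame 10 (by omega), f1 10 (by omega) (by omega) (by omega), h10]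
  have hmem : ∀ a < 2 * L.length, s2.mem a = s1.mem a := fun a ha =>
    g1.mem a (by rw [hs1.h16]; omega)
  have km1 : s2.mem (2 * t) = L[t].1 := by rw [hmem _ (by omega), (hs1.samples t ht).1]
  have km2 : s2.mem (2 * t + 1) = L[t].2 := by rw [hmem _ (by omega), (hs1.samples t ht).2]
  have hsound : s2.reg 24 ≠ 0 → IsoTile X.M R (s1.reg 13 / R, s1.reg 14 / R) := fun h => by
    obtain ⟨v, hv, hvq, hb⟩ := g3.1 h
    have hiv : inside (W + 2) v := by
      by_contra hc
      exact hvq (g2.ring v hv hc)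
    rw [f13, f14]
    obtain ⟨z, hz, hzv⟩ : ∃ z, Black X.M z ∧ InVertex l (x * (l * W)) (y * (l * W)) (W + 2) v z := by
      rcases hb with hb | hb
      · obtain ⟨z, hz, hzv, -⟩ := (segBlack_iff hiv (by simp [nbrs])).1 hb
        exact ⟨z, hz, hzv⟩
      · obtain ⟨z, hz, hzv, -⟩ := (segBlack_iff hiv (by simp [nbrs])).1 hb
        exact ⟨z, hz, hzv⟩
    exact isoTile_of_unmarked_cell hl hW hrR (dvd_mul_left _ _) (dvd_mul_left _ _) g2 hv hvq hz hzv
  have hdet : (∃ p, Isolated X.M (CellRel l) (l * W) p ∧ OnGrid l p ∧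
      tile (l * W) p = tile (l * W) L[t]) → s2.reg 24 ≠ 0 := by
    rintro ⟨p, hp1, hp2, hp3⟩
    exact g3.2 (exists_unmarked_cell_of_isolated hl hW g2 hp3 hp1 hp2)
  refine Runs.time (Runs.seq (T' := 3) (runs_askPixel (by decide) (by decide) (by omega) g1.env.h40
    fun s3 e1 e2 e3 e4 => ?_)) le_rfl
  simp only [Term.ideal_load, Term.ideal_mul, Term.ideal_add, Term.ideal_ofNat, Term.ideal_reg,
    k10, km1, km2] at e4
  have k24 := e2 24 (by omega) (by omega)
  have kcell : (Term.load (.reg 16 + cellTerm)).val s3 =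
      s2.mem (s1.reg 16 + cellOf l (x * (l * W)) (y * (l * W)) (W + 2) L[t]) := by
    simp [cellTerm, e3, e2, k10, km1, km2, cellOf, g1.env.h13, g1.env.h14, g1.env.h15, g1.env.h3,
      g1.frame 16]
  have hmark := g1.mark (cellOf l (x * (l * W)) (y * (l * W)) (W + 2) L[t]) (by rw [f15]; exact d1)
  have hfr : ∀ r, r < 20 ∨ 40 < r → s3.reg r = s1.reg r := fun r hr => by
    rw [e2 r (by omega) (by omega), g1.frame r hr]
  have hmem3 : ∀ a, a < s1.reg 16 ∨ s1.reg 16 + 2 * s1.reg 7 ≤ a → s3.mem a = s1.mem a :=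
    fun a ha => by rw [e3, g1.mem a ha]
  refine Runs.cond (by decide) (fun hc => Runs.cond (by decide) (fun hc' => Runs.skip ?_)
    fun hc' => Runs.set (by decide) (by simp; omega) ?_) fun hc => (Runs.skip ?_).time (by omega)
  · rw [kcell, hmark] at hc'
    refine ⟨hfr, hmem3, e1, fun h => hsound (by rwa [← k24]), ?_⟩
    rw [k24]
    rintro (h | h)
    · exact hdet h
    · exact absurd hc' (cellOf_not_mem_of_isolated hl hW g2 hp h)
  · simp only [Term.ideal_reg, e4] at hc
    have hc'' := fun h => hmark.2 h (by rw [← kcell]; exact hc')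
    refine ⟨fun r hr => ?_, ?_, ?_, fun _ => ?_, fun _ => by simp⟩
    · rw [St.set_reg, if_neg (by omega), hfr r hr]
    · simpa using hmem3
    · exact queryOnly_counted s3 _ e1 (by simp) rfl rfl
    · rw [f13, f14]
      exact isoTile_of_unmarked_cell hl hW hrR (dvd_mul_left _ _) (dvd_mul_left _ _) g2 d1 hc''
        hc d3
  · simp only [Term.ideal_reg, e4] at hc
    refine ⟨hfr, hmem3, e1, fun h => hsound (by rwa [← k24]), ?_⟩
    rw [k24]
    rintro (h | h)
    · exact hdet h
    · exact absurd hc h.1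

/-! #### Exploring the component of a sample -/

/-- Explore as long as the queue has unprocessed vertices, the next one is inside the grid, and the
budget in register `17` is not exceeded. -/
def exploreTerm : Term :=
  (Term.reg 22).lt (.reg 23) * insideTerm (.load (.reg 16 + .reg 7 + .reg 22)) *
    (Term.reg 23).lt (.reg 17 + 1)

/-- Explore the component of the sample, within the budget. -/
def explore : Program :=
  askPixel (.load (2 * .reg 10)) (.load (2 * .reg 10 + 1)) 30 ⨟
  .cond (.reg 30)
    (.set 23 0 ⨟ .set 22 0 ⨟
      .set 21 ((.load (2 * .reg 10) - .reg 13) * .reg 15 + (.load (2 * .reg 10 + 1) - .reg 14)) ⨟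
      pushVertex ⨟ .loop exploreTerm (expand askBlack) ⨟ .set 24 ((Term.reg 22).eq (.reg 23)))
    (.set 24 0)

/-- Explore the component of a sample in its square. -/
def componentSample : Program := sampleTest (.reg 12 + 1) explore

theorem exploreTerm_val (s : St) : exploreTerm.val s ≠ 0 ↔ s.reg 22 < s.reg 23 ∧
    inside (s.reg 15) (s.mem (s.reg 16 + s.reg 7 + s.reg 22)) ∧ s.reg 23 < s.reg 17 + 1 := by
  have h := insideTerm_val (.load (.reg 16 + .reg 7 + .reg 22)) s
  simp only [exploreTerm, Term.ideal_mul, ne_eq, mul_eq_zero, Term.ideal_lt_eq_zero,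
    Term.ideal_reg, Term.ideal_add, Term.ideal_ofNat, not_or, not_not] at h ⊢
  rw [h]
  simp only [Term.ideal_load, Term.ideal_reg, Term.ideal_add]
  tauto

/-- The time depends on the budget in register `17` only, not on the size of the square: while the
loop runs, the head is below the tail and the tail is within the budget. Soundness needs the loop to
stop with an exhausted queue, in which case the component is complete. -/
theorem runs_componentSample (hs : Sampled X.M l R K H L i s)
    (ht : t < L.length) (h10 : s.reg 10 = t) (hB : 2 * L.length + (i + 1) * (2 * H) ≤ X.B)
    (hset : Counted s) (h12 : s.reg 12 = R) (hR : 0 < R) (hH : (R + 1) * (R + 1) ≤ H) :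
    Runs X s componentSample (72 * s.reg 17 + 60) fun s' =>
      Sampled X.M l R K H L (i + 1) s' ∧ Counted s' ∧
      (∀ r, r < 13 ∨ 16 < r ∧ r < 20 ∨ 43 < r → s'.reg r = s.reg r) ∧
      (s.reg 41 ≠ 0 → s'.reg 41 ≠ 0) ∧
      ((Isolated X.M Adj R L[t] ∧ ∀ A : Finset (ℕ × ℕ), (∀ p ∈ A, Linked X.M Adj L[t] p) →
          A.card ≤ s.reg 17) → s'.reg 41 ≠ 0) := by
  have h2H : 2 * H ≤ X.B := by nlinarith
  have hXB := X.hB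
  refine Runs.mono (runs_sampleTest (S := R + 1) (by decide) hs ht h10 hB
    queryOnly_counted hset ?_ (fun s' h => ?_) ?_ (T := 72 * s.reg 17 + 40)) (by omega)
    (fun s' _ h => ⟨h.1, h.2.1, h.2.2.1, h.2.2.2.2⟩)
  · nlinarith
  · simp [h, h12]
  intro s1 hs1 hΦ f1 f13 f14 f15 _
  rw [h12] at f13 f14
  set x := L[t].1 / R with hx
  set y := L[t].2 / R with hy
  have k7 := hs1.h7
  have k10 : s1.reg 10 = t := by rw [f1 10 (by omega) (by omega) (by omega), h10]
  have k17 : s1.reg 17 = s.reg 17 := f1 17 (by omega) (by omega) (by omega)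
  obtain ⟨km1, km2⟩ := hs1.samples t ht
  have hp : tile R L[t] = (x, y) := rfl
  obtain ⟨c1, c2, c3, c4⟩ := tile_bounds hR hp
  set v := (L[t].1 - x * R) * (R + 1) + (L[t].2 - y * R) with hv
  have hvS : v < (R + 1) * (R + 1) := lt_of_coords hv (by omega) (by omega)
  have hvp : vertexPixel (x * R) (y * R) (R + 1) v = L[t] := by
    obtain ⟨h1, h2⟩ := div_mod_of_eq hv (by omega)
    rw [vertexPixel_eq, h1, h2]
    ext <;> simp only <;> omega
  refine Runs.time (Runs.seq (T' := 72 * s.reg 17 + 20) (runs_askPixel (by decide) (by decide)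
    (by omega) hΦ fun s2 e1 e2 e3 e4 => ?_)) (by omega)
  simp only [Term.ideal_load, Term.ideal_mul, Term.ideal_add, Term.ideal_ofNat, Term.ideal_reg,
    k10, km1, km2] at e4
  have hfr : ∀ r, r < 20 ∨ 40 < r → s2.reg r = s1.reg r := fun r hr => e2 r (by omega) (by omega)
  refine Runs.cond (T := 72 * s.reg 17 + 19) (by decide) (fun hc => ?_) fun hc => ?_
  swap
  · simp only [Term.ideal_reg, e4] at hc
    refine (Runs.set (by decide) (by simp) ⟨fun r hr => ?_, ?_, ?_, ?_, ?_⟩).time (by omega)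
    · rw [St.set_reg, if_neg (by omega), hfr r hr]
    · simp [e3]
    · exact queryOnly_counted s2 _ e1 (by simp) rfl rfl
    · simp
    · exact fun h => absurd hc h.1.1
  simp only [Term.ideal_reg, e4] at hc
  have hstab := stable_onDemand l (x * R) (y * R) (R + 1)
  have hb : Black X.M (vertexPixel (x * R) (y * R) (R + 1) v) := by rw [hvp]; exact hc
  have henv2 : OnDemand l (x * R) (y * R) (R + 1) s2 :=
    ⟨by rw [hfr 3 (by omega), hs1.h3], by rw [hfr 13 (by omega), f13],
      by rw [hfr 14 (by omega), f14], by rw [hfr 15 (by omega), f15], e1⟩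
  have hv' : s2.mem (2 * s2.reg 10) - s2.reg 13 = L[t].1 - x * R ∧
      s2.mem (2 * s2.reg 10 + 1) - s2.reg 14 = L[t].2 - y * R := by
    rw [hfr 10 (by omega), k10, e3, km1, km2, hfr 13 (by omega), hfr 14 (by omega), f13, f14]
    exact ⟨rfl, rfl⟩
  have hv2 : (s2.mem (2 * s2.reg 10) - s2.reg 13) * s2.reg 15 +
      (s2.mem (2 * s2.reg 10 + 1) - s2.reg 14) = v := by rw [hv'.1, hv'.2, henv2.h15]
  refine Runs.time (Runs.seq (Runs.set (by decide) (by simp) (Runs.seq (Runs.set (by decide)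
    (by simp) (Runs.seq (Runs.set (by decide) ?_ (Runs.seq (T := 5) (T' := 72 * s.reg 17 + 3)
    ((runs_pushVertex (Env := OnDemand l (x * R) (y * R) (R + 1)) (s₀ := s1) (q := []) hstab ?_ ?_
    ?_ ?_).mono le_rfl ?_)))))))) (by omega)
  · simp [hv2]; omega
  · rw [f15, k7]; exact hH
  · refine ⟨?_, fun r hr => ?_, ?_, ?_, ?_, ?_, ?_, ?_⟩
    · refine hstab s2 _ henv2 (fun r hr => ?_) rfl rfl rfl
      simp only [St.set_reg]
      rw [if_neg (by omega), if_neg (by omega), if_neg (by omega)]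
    · simp only [St.set_reg]
      rw [if_neg (by omega), if_neg (by omega), if_neg (by omega), hfr r hr]
    · simp
    · simp
    · simp
    · intro a ha
      simp [e3, hs1.zero (s1.reg 16 + a) (by omega)]
    · simp
    · intro a ha
      simp [e3]
  · simp [hv2, f15, hvS]
  · simp
  rintro s3 - ⟨g1, g2⟩
  have e21 : (List.nil ++ [(((s2.set 23 (Term.val 0 s2)).set 22 (Term.val 0 (s2.set 23 (Term.val 0 s2)))).set 21
      (((Term.load (2 * .reg 10) - .reg 13) * .reg 15 + (Term.load (2 * .reg 10 + 1) - .reg 14)).val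
        ((s2.set 23 (Term.val 0 s2)).set 22 (Term.val 0 (s2.set 23 (Term.val 0 s2)))))).reg 21]) = [v] := by
    simp [hv2]
  rw [e21] at g1
  refine Runs.time (Runs.seq (T := 72 * s.reg 17 + 1) (T' := 1) (Runs.mono (runs_flood hstab ?_ ?_
    (τ := 5) ?_ (e := exploreTerm) (by decide)
    (m := s.reg 17) (P := inside (R + 1)) ?_ g1 ?_
    (op := fun _ u => Black X.M (vertexPixel (x * R) (y * R) (R + 1) u))) (by omega) ?_)) (by omega)
  · rw [f15, k7]; exact hH
  · rw [k7]; exact h2H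
  · rw [f15]; exact edgeSpec_askBlack
  · intro s4 q4 h4 hne
    rw [exploreTerm_val] at hne
    obtain ⟨a1, a2, a3⟩ := hne
    rw [h4.tail] at a1 a3
    refine ⟨a1, ?_, ?_⟩
    · rw [h4.frame 17 (by omega), k17] at a3
      omega
    · rw [h4.frame 15 (by omega), h4.frame 16 (by omega), h4.frame 7 (by omega), f15,
        h4.queue _ a1] at a2
      exact a2
  · rw [g2 22 (by omega)]; simp
  rintro s4 - ⟨q, d1, d2, d3, d4, d5⟩
  rw [f15] at d2
  have hlt : ∀ u ∈ q, u < (R + 1) * (R + 1) := fun u hu => by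
    have := d1.lt u hu
    rwa [f15] at this
  refine Runs.set (by decide) ?_ ⟨fun r hr => ?_, ?_, ?_, fun h => ?_, ?_⟩
  · show (if _ then 1 else 0) ≤ _
    split_ifs <;> omega
  · rw [St.set_reg, if_neg (by omega), d1.frame r hr]
  · simpa using d1.mem
  · exact queryOnly_counted s4 _ d1.env.h40 (by simp) rfl rfl
  · simp [d1.tail] at h
    rw [f13, f14]
    refine isoTile_of_explored hR (dvd_mul_left _ _) (dvd_mul_left _ _) hb d2 h.ge hlt ?_
    intro u hu
    obtain ⟨j, hj, rfl⟩ := List.mem_iff_getElem.1 hu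
    exact d4 j hj (by omega)
  · rintro ⟨hiso, hcard⟩
    rw [← hvp] at hiso
    have hall := linked_of_explored hR (dvd_mul_left _ _) (dvd_mul_left _ _) hvS hiso d2
    have hlen : q.length ≤ s.reg 17 := by
      rw [← List.toFinset_card_of_nodup d1.nodup,
        ← Finset.card_image_of_injOn (f := vertexPixel (x * R) (y * R) (R + 1))]
      · refine hcard _ fun p hp => ?_
        obtain ⟨u, hu, rfl⟩ := Finset.mem_image.1 hp
        rw [← hvp]
        exact (hall u (List.mem_toFinset.1 hu)).2
      · intro a _ b _ hab
        simp only [vertexPixel_eq, Prod.mk.injEq, Nat.add_left_cancel_iff] at hab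
        have h1 := Nat.div_add_mod' a (R + 1)
        have h2 := Nat.div_add_mod' b (R + 1)
        unfold row col at hab
        rw [hab.1, hab.2] at h1
        exact h1.symm.trans h2
    simp [d1.tail]
    -- The queue injects into the component, so it fits the budget, and all its vertices are inner.
    -- With the head below the tail, every condition of the loop would still hold, so the loop would
    -- not have stopped.
    by_contra hne
    have hlt22 : s4.reg 22 < q.length := by omega
    refine absurd d5 ((exploreTerm_val s4).2 ⟨by rw [d1.tail]; exact hlt22, ?_, ?_⟩)
    · rw [d1.frame 15 (by omega), d1.frame 16 (by omega), d1.frame 7 (by omega), f15,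
        d1.queue _ hlt22]
      exact (hall _ (List.getElem_mem hlt22)).1
    · rw [d1.tail, d1.frame 17 (by omega), k17]
      omega

end
end ImageTesting

namespace ImageTesting

variable {n : ℕ} {X : Ctx n}

/-! ### Processing all samples -/

/-- Only the registers `10`, `11` and `12` differ. -/
structure SameBut (s s' : St) : Prop where
  reg : ∀ r, r < 10 ∨ 12 < r → s'.reg r = s.reg r
  mem : s'.mem = s.mem
  qs : s'.qs = s.qs
  rcv : s'.rcv = s.rcv
  itl : s'.itl = s.itl

/-- The side of the square that is tested for the sample with number `t`. -/
def side (l J t : ℕ) : ℕ := l * 2 ^ (J + 8 - Nat.log 2 t)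

/-- The registers `10`, `11` and `12` hold the number of the next sample, the number at which the
side will change next, and the side. -/
structure Scheduled (l J t : ℕ) (s : St) : Prop where
  h10 : s.reg 10 = t
  h11 : s.reg 11 = 2 ^ (Nat.log 2 t + 1)
  h12 : s.reg 12 = side l J t

/-- Go to the next sample. -/
def advance : Program :=
  .set 10 (.reg 10 + 1) ⨟
  .cond ((Term.reg 10).eq (.reg 11))
    (.set 11 (2 * .reg 11) ⨟ .cond ((Term.reg 3).lt (.reg 12)) (.set 12 (.reg 12 / 2)) skip) skip

/-- The logarithm of the sample number grows exactly when the number reaches the power of two in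
register `11`. Halving the side stops at `l`, which is where the truncated exponent in `side`
becomes zero. -/
theorem runs_advance {l J t : ℕ} {s : St} (hs : Scheduled l J t s) (h3 : s.reg 3 = l) (hl : 0 < l)
    (ht : 0 < t) (htB : 4 * t ≤ X.B) :
    Runs X s advance 7 fun s' => Scheduled l J (t + 1) s' ∧ SameBut s s' := by
  refine Runs.intro_good fun hg _ => ?_
  have hlt : t < 2 ^ (Nat.log 2 t + 1) := Nat.lt_pow_succ_log_self (by norm_num) t
  have hle : 2 ^ Nat.log 2 t ≤ t := Nat.pow_log_le_self 2 (by omega)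
  have hpow : 2 ^ (Nat.log 2 t + 1) = 2 * 2 ^ Nat.log 2 t := by rw [pow_succ, mul_comm]
  refine Runs.time (Runs.seq (T' := 5) (Runs.set (by decide) ?_ ?_)) le_rfl
  · simp [hs.h10]; omega
  refine Runs.cond (T := 4) (by decide) (fun hc => ?_) fun hc => ?_
  · simp [hs.h10, hs.h11] at hc
    have hlog : Nat.log 2 (t + 1) = Nat.log 2 t + 1 := by
      rw [hc]; exact Nat.log_pow (by norm_num) _
    refine Runs.time (Runs.seq (T' := 2) (Runs.set (by decide) ?_ ?_)) le_rfl
    · simp [hs.h11]; omega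
    refine Runs.cond (by decide) (fun hc' => ?_) fun hc' => ?_
    · simp [hs.h12, h3] at hc'
      obtain ⟨f, hf⟩ : ∃ f, J + 8 - Nat.log 2 t = f + 1 := by
        refine ⟨J + 8 - Nat.log 2 t - 1, ?_⟩
        have : J + 8 - Nat.log 2 t ≠ 0 := fun h0 => by simp [side, h0] at hc'
        omega
      refine Runs.set (by decide) ?_ ⟨⟨?_, ?_, ?_⟩, ⟨?_, rfl, rfl, rfl, rfl⟩⟩
      · simpa using (Nat.div_le_self _ _).trans (hg.1 12)
      · simp [hs.h10]
      · simp [hs.h11, hlog, pow_succ]; ring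
      · simp [hs.h12, side, hlog, hf, (by omega : J + 8 - (Nat.log 2 t + 1) = f), pow_succ]
        rw [← mul_assoc, Nat.mul_div_cancel _ (by norm_num)]
      · intro r hr
        simp only [St.set_reg]
        rw [if_neg (by omega), if_neg (by omega), if_neg (by omega)]
    · simp [hs.h12, h3] at hc'
      have hf : J + 8 - Nat.log 2 t = 0 := by
        by_contra h0
        have : 2 ≤ 2 ^ (J + 8 - Nat.log 2 t) := Nat.le_self_pow h0 2
        unfold side at hc'
        nlinarith
      refine Runs.skip ⟨⟨?_, ?_, ?_⟩, ⟨?_, rfl, rfl, rfl, rfl⟩⟩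
      · simp [hs.h10]
      · simp [hs.h11, hlog, pow_succ]; ring
      · simp [hs.h12, side, hlog, hf, (by omega : J + 8 - (Nat.log 2 t + 1) = 0)]
      · intro r hr
        simp only [St.set_reg]
        rw [if_neg (by omega), if_neg (by omega)]
  · simp [hs.h10, hs.h11] at hc
    have hlog : Nat.log 2 (t + 1) = Nat.log 2 t := by
      refine (Nat.log_eq_iff (Or.inr ⟨by norm_num, by omega⟩)).2 ⟨by omega, by omega⟩
    refine (Runs.skip ⟨⟨?_, ?_, ?_⟩, ⟨?_, rfl, rfl, rfl, rfl⟩⟩).time (by omega)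
    · simp [hs.h10]
    · simp [hs.h11, hlog]
    · simp [hs.h12, side, hlog]
    · intro r hr
      simp only [St.set_reg]
      rw [if_neg (by omega)]

/-- Run `body` for all samples from number `256` on. -/
def levelLoop (body : Program) : Program :=
  .set 10 256 ⨟ .set 11 512 ⨟ .set 12 (.reg 4) ⨟
    .loop ((Term.reg 10).lt (512 * .reg 4)) (body ⨟ advance)

/-- The samples run from `256 = 2 ^ 8` to `512 * R - 1`. At `256` the side is `l * 2 ^ J = R`; this
explains the `8` in `side`. The invariant `I` has to ignore the registers `10` to `12`, which
`advance` changes. -/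
theorem runs_levelLoop {l J R : ℕ} {s : St} {body : Program} (I : ℕ → St → Prop) (c : ℕ → ℕ)
    (hR : R = l * 2 ^ J) (hl : 0 < l) (hRB : 4 * (512 * R) ≤ X.B)
    (h34 : ∀ i s, I i s → s.reg 3 = l ∧ s.reg 4 = R) (h0 : I 0 s)
    (hI : ∀ i s s', I i s → SameBut s s' → I i s')
    (hbody : ∀ i < 512 * R - 256, ∀ s, I i s → Scheduled l J (256 + i) s →
      Runs X s body (c i) fun s' => I (i + 1) s' ∧ ∀ r, 10 ≤ r → r ≤ 12 → s'.reg r = s.reg r) :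
    Runs X s (levelLoop body) (∑ i ∈ Finset.range (512 * R - 256), (c i + 9) + 7)
      (I (512 * R - 256)) := by
  have hRpos : 0 < R := hR ▸ Nat.mul_pos hl (by positivity)
  have hXB := X.hB
  obtain ⟨h3, h4⟩ := h34 0 s h0
  refine Runs.time (Runs.seq (Runs.set (by decide) (by simp; omega) (Runs.seq (Runs.set (by decide)
    (by simp; omega) (Runs.seq (Runs.set (by decide) (by simp [h4]; omega) (Runs.mono
    (Runs.loop_for (fun i s => I i s ∧ Scheduled l J (256 + i) s) (512 * R - 256) (fun i => c i + 8)
      (by decide) ?_ ?_ ?_ ?_) le_rfl fun s _ h => h.1))))))) (by simp only [add_assoc, Nat.reduceAdd]; omega)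
  · refine ⟨hI 0 s _ h0 ⟨fun r hr => ?_, rfl, rfl, rfl, rfl⟩, ⟨?_, ?_, ?_⟩⟩
    · simp only [St.set_reg]
      rw [if_neg (by omega), if_neg (by omega), if_neg (by omega)]
    · simp
    · have : Nat.log 2 256 = 8 := Nat.log_pow (b := 2) (by norm_num) 8
      simp [this]
    · have : Nat.log 2 256 = 8 := Nat.log_pow (b := 2) (by norm_num) 8
      simp [this, h4, hR, side]
  · rintro i hi s ⟨h1, h2⟩
    simp [h2.h10, (h34 i s h1).2]
    omega
  · rintro i hi s ⟨h1, h2⟩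
    refine Runs.seq (T := c i) (T' := 7) ((hbody i hi s h1 h2).mono le_rfl ?_)
    rintro s' - ⟨g1, g2⟩
    refine (runs_advance (J := J) (t := 256 + i) ⟨?_, ?_, ?_⟩ (h34 _ _ g1).1 hl (by omega) (by omega)).mono
      le_rfl ?_
    · rw [g2 10 (by omega) (by omega), h2.h10]
    · rw [g2 11 (by omega) (by omega), h2.h11]
    · rw [g2 12 (by omega) (by omega), h2.h12]
    · rintro s'' - ⟨k1, k2⟩
      exact ⟨hI _ _ _ g1 k2, k1⟩
  · rintro s ⟨h1, h2⟩
    simp [h2.h10, (h34 _ s h1).2]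
    omega

theorem side_pos {l J t : ℕ} (hl : 0 < l) : 0 < side l J t := Nat.mul_pos hl (by positivity)

theorem side_dvd {l J t : ℕ} (ht : 256 ≤ t) : side l J t ∣ l * 2 ^ J := by
  have : 8 ≤ Nat.log 2 t := Nat.le_log_of_pow_le (by norm_num) (by simpa using ht)
  exact Nat.mul_dvd_mul_left l (pow_dvd_pow 2 (by omega))

theorem side_le {l J t : ℕ} (hl : 0 < l) (ht : 256 ≤ t) : side l J t ≤ l * 2 ^ J :=
  Nat.le_of_dvd (Nat.mul_pos hl (by positivity)) (side_dvd ht)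

theorem Sampled.of_sameBut {M : Image n} {l R K H i : ℕ} {L : List (ℕ × ℕ)} {s s' : St}
    (h : Sampled M l R K H L i s) (hs : SameBut s s') : Sampled M l R K H L i s' := by
  refine ⟨?_, ?_, ?_, ?_, ?_, ?_, ?_, ?_⟩
  · rw [hs.reg 3 (by omega), h.h3]
  · rw [hs.reg 4 (by omega), h.h4]
  · rw [hs.reg 6 (by omega), h.h6]
  · rw [hs.reg 7 (by omega), h.h7]
  · rw [hs.mem]; exact h.samples
  · rw [hs.reg 16 (by omega), h.h16]
  · rw [hs.reg 16 (by omega), hs.mem]; exact h.zero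
  · rw [hs.reg 41 (by omega), hs.reg 42 (by omega), hs.reg 43 (by omega)]; exact h.sound

/-- Registers below `20` and above `40`, with exceptions, determine `Sampled`. -/
theorem Sampled.congr {M : Image n} {l R K H i : ℕ} {L : List (ℕ × ℕ)} {s s' : St}
    (h : Sampled M l R K H L i s)
    (hr : ∀ r, r = 3 ∨ r = 4 ∨ r = 6 ∨ r = 7 ∨ r = 16 ∨ r = 41 ∨ r = 42 ∨ r = 43 →
      s'.reg r = s.reg r) (hm : s'.mem = s.mem) : Sampled M l R K H L i s' := by
  refine ⟨?_, ?_, ?_, ?_, ?_, ?_, ?_, ?_⟩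
  · rw [hr 3 (by omega), h.h3]
  · rw [hr 4 (by omega), h.h4]
  · rw [hr 6 (by omega), h.h6]
  · rw [hr 7 (by omega), h.h7]
  · rw [hm]; exact h.samples
  · rw [hr 16 (by omega), h.h16]
  · rw [hr 16 (by omega), hm]; exact h.zero
  · rw [hr 41 (by omega), hr 42 (by omega), hr 43 (by omega)]; exact h.sound

/-! #### The samples that are compared with the recorded square -/

/-- Query the first `128 * reg 1` samples. -/
def queryPrefix : Program :=
  .set 10 0 ⨟ .loop ((Term.reg 10).lt (128 * .reg 1))
    (.query (.load (2 * .reg 10)) (.load (2 * .reg 10 + 1)) ⨟ .set 10 (.reg 10 + 1))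

/-- Set register `44` to `1` if one of the first `128 * reg 1` samples is black and not in the
recorded square. -/
def compare : Program :=
  .set 44 0 ⨟ .set 10 0 ⨟ .loop ((Term.reg 10).lt (128 * .reg 1))
    (.receive 31 (.reg 10) ⨟
      .cond (.reg 31 * (1 - (Term.load (2 * .reg 10) / .reg 4).eq (.reg 42) *
        (Term.load (2 * .reg 10 + 1) / .reg 4).eq (.reg 43))) (.set 44 1) skip ⨟
      .set 10 (.reg 10 + 1))

variable {l R K H k : ℕ} {L : List (ℕ × ℕ)} {i : ℕ} {s : St}

theorem runs_queryPrefix (hs : Sampled X.M l R K H L i s) (h1 : s.reg 1 = k)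
    (hk : 128 * k ≤ L.length) (hB : L.length ≤ X.B) (hq : s.qs = []) (hrcv : s.rcv = false)
    (hitl : s.itl = false) :
    Runs X s queryPrefix (512 * k + 3) fun s' => (∀ r, r ≠ 10 → s'.reg r = s.reg r) ∧
      s'.mem = s.mem ∧ s'.qs = L.take (128 * k) ∧ s'.rcv = false ∧ s'.itl = false := by
  refine Runs.time (Runs.seq (Runs.set (by decide) (by simp) (Runs.mono (Runs.loop_for (fun j s' =>
      s'.reg 10 = j ∧ (∀ r, r ≠ 10 → s'.reg r = s.reg r) ∧ s'.mem = s.mem ∧ s'.qs = L.take j ∧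
      s'.rcv = false ∧ s'.itl = false) (128 * k) (fun _ => 3) (by decide) ?_ ?_ ?_ ?_) le_rfl
      fun s' _ h => h.2))) (by simp; omega)
  · exact ⟨by simp, fun r hr => by simp [hr], rfl, by simp [hq], hrcv, hitl⟩
  · rintro j hj s' ⟨g1, g2, -⟩
    simp [g1, g2, h1]; omega
  · rintro j hj s' ⟨g1, g2, g3, g4, g5, g6⟩
    refine Runs.seq (Runs.query (by decide) (by decide) (Runs.set (by decide) ?_
      ⟨?_, fun r hr => ?_, ?_, ?_, ?_, ?_⟩))
    · simp [g1]; omega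
    · simp [g1]
    · simp [hr, g2]
    · simp [g3]
    · obtain ⟨m1, m2⟩ := hs.samples j (by omega)
      simp only [St.set_qs, St.ask_qs, g4, Term.ideal_load, Term.ideal_mul, Term.ideal_add,
        Term.ideal_ofNat, Term.ideal_reg, g1, g3, m1, m2]
      rw [List.take_add_one, List.getElem?_eq_getElem (by omega)]
      rfl
    · simp [g5]
    · simp [g5, g6]
  · rintro s' ⟨g1, g2, -⟩
    simp [g1, g2, h1]

theorem runs_compare (hs : Sampled X.M l R K H L i s) (h1 : s.reg 1 = k)
    (hk : 128 * k ≤ L.length) (hB : L.length ≤ X.B) (hq : L.take (128 * k) <+: s.qs) :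
    Runs X s compare (1024 * k + 5) fun s' => (∀ r, 41 ≤ r → r < 44 → s'.reg r = s.reg r) ∧
      s'.qs = s.qs ∧ s'.itl = s.itl ∧
      (s'.reg 44 ≠ 0 ↔ ∃ j < 128 * k, Black X.M (L.getD j 0) ∧
        tile R (L.getD j 0) ≠ (s.reg 42, s.reg 43)) := by
  have hXB := X.hB
  refine Runs.time (Runs.seq (Runs.set (by decide) (by simp) (Runs.seq (Runs.set (by decide)
    (by simp) (Runs.mono (Runs.loop_for (fun j s' =>
      s'.reg 10 = j ∧ (∀ r, r ≠ 10 → r ≠ 31 → r ≠ 44 → s'.reg r = s.reg r) ∧ s'.mem = s.mem ∧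
      s'.qs = s.qs ∧ s'.itl = s.itl ∧ (s'.reg 44 ≠ 0 ↔ ∃ j' < j, Black X.M (L.getD j' 0) ∧
        tile R (L.getD j' 0) ≠ (s.reg 42, s.reg 43)))
      (128 * k) (fun _ => 7) (by decide) ?_ ?_ ?_ ?_) le_rfl
      fun s' _ h => ⟨fun r h1 h2 => h.2.1 r (by omega) (by omega) (by omega), h.2.2.2.1,
        h.2.2.2.2.1, h.2.2.2.2.2⟩))))) (by simp; omega)
  · exact ⟨by simp, fun r h1 h2 h3 => by simp [h1, h3], rfl, rfl, rfl, by simp⟩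
  · rintro j hj s' ⟨g1, g2, -⟩
    simp [g1, g2, h1]; omega
  · rintro j hj s' ⟨g1, g2, g3, g4, g5, g6⟩
    have hjL : j < L.length := by omega
    have hget : L.getD j 0 = L[j] := List.getD_eq_getElem _ _ hjL
    obtain ⟨m1, m2⟩ := hs.samples j hjL
    refine Runs.time (Runs.seq (T := 1) (T' := 5) (Runs.receive (x := L[j]) (by decide) ?_ (Runs.seq
      (T := 3) (T' := 1) (Runs.mono (T := 2) (Q := fun s' =>
      s'.reg 10 = j ∧ (∀ r, r ≠ 10 → r ≠ 31 → r ≠ 44 → s'.reg r = s.reg r) ∧ s'.mem = s.mem ∧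
      s'.qs = s.qs ∧ s'.itl = s.itl ∧ (s'.reg 44 ≠ 0 ↔ ∃ j' < j + 1, Black X.M (L.getD j' 0) ∧
        tile R (L.getD j' 0) ≠ (s.reg 42, s.reg 43))) ?_ (by omega) ?_)))) (by omega)
    · simp only [Term.ideal_reg, g1, g4]
      have : (L.take (128 * k))[j]? = some L[j] := by
        rw [List.getElem?_take, if_pos hj, List.getElem?_eq_getElem hjL]
      obtain ⟨suf, hsuf⟩ := hq
      rw [← hsuf, List.getElem?_append_left (by rw [List.length_take]; omega)]
      exact this
    · have hval : (Term.reg 31 * (1 - (Term.load (2 * .reg 10) / .reg 4).eq (.reg 42) *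
          (Term.load (2 * .reg 10 + 1) / .reg 4).eq (.reg 43))).val
            (s'.recv.set 31 (pixel X.M L[j])) ≠ 0 ↔
          Black X.M L[j] ∧ tile R L[j] ≠ (s.reg 42, s.reg 43) := by
        have key : ∀ (a : ℕ) (p q : Prop) [Decidable p] [Decidable q],
            a * (1 - (if p then 1 else 0) * (if q then 1 else 0)) ≠ 0 ↔ a ≠ 0 ∧ ¬ (p ∧ q) := by
          intro a p q _ _
          split_ifs <;> simp_all
        have := key (pixel X.M L[j]) (L[j].1 / R = s.reg 42) (L[j].2 / R = s.reg 43)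
        rw [show Black X.M L[j] ∧ tile R L[j] ≠ (s.reg 42, s.reg 43) ↔ pixel X.M L[j] ≠ 0 ∧
          ¬ (L[j].1 / R = s.reg 42 ∧ L[j].2 / R = s.reg 43) by
            simp only [Black, tile, ne_eq, Prod.mk.injEq]]
        rw [← this]
        simp only [Term.ideal_mul, Term.ideal_sub, Term.ideal_reg, Term.ideal_ofNat, St.set_reg,
          if_true]
        simp [Term.eq, Term.ideal, Op.apply, g1, g2, g3, m1, m2, hs.h4]
      refine Runs.cond (T := 1) (by decide) (fun hc => ?_) fun hc => ?_
      · rw [hval] at hc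
        refine Runs.set (by decide) (by simp; omega) ⟨?_, fun r h1 h2 h3 => ?_, ?_, ?_, ?_, ?_⟩
        · simp [g1]
        · simp [h2, h3, g2 r h1 h2 h3]
        · simp [g3]
        · simp [g4]
        · simp [g5]
        · simp only [St.set_reg, if_true]
          exact iff_of_true (by simp) ⟨j, by omega, by rw [hget]; exact hc⟩
      · rw [← not_not (a := _ = 0)] at hc
        rw [← ne_eq, hval] at hc
        refine Runs.skip ⟨?_, fun r h1 h2 h3 => ?_, ?_, ?_, ?_, ?_⟩
        · simp [g1]
        · simp [h2, g2 r h1 h2 h3]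
        · simp [g3]
        · simp [g4]
        · simp [g5]
        · simp only [St.set_reg, St.recv_reg]
          rw [if_neg (by omega), g6]
          constructor
          · rintro ⟨j', hj', h⟩
            exact ⟨j', by omega, h⟩
          · rintro ⟨j', hj', h⟩
            refine ⟨j', ?_, h⟩
            rcases Nat.lt_succ_iff_lt_or_eq.1 hj' with hj' | rfl
            · exact hj'
            · rw [hget] at h
              exact absurd h hc
    · rintro s'' - ⟨k1, k2, k3, k4, k5, k6⟩
      refine Runs.set (by decide) (by simp [k1]; omega) ⟨?_, fun r h1 h2 h3 => ?_, ?_, ?_, ?_, ?_⟩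
      · simp [k1]
      · simp [h1, k2 r h1 h2 h3]
      · simp [k3]
      · simp [k4]
      · simp [k5]
      · simpa using k6
  · rintro s' ⟨g1, g2, -⟩
    simp [g1, g2, h1]

end ImageTesting

namespace ImageTesting

/-! ### What a rejection certifies and what forces it. -/

variable {n : ℕ} {X : Ctx n} {l R K H k J : ℕ} {L : List (ℕ × ℕ)} {s : St}

/-- The outcome of the main part: registers `41` and `44` are nonzero only if there is a component
inside of a square and a black sample outside of it; they are nonzero if something was detected and
two of the first samples are black and in different squares. -/
structure Outcome (M : Image n) (R k : ℕ) (L : List (ℕ × ℕ)) (Det : Prop) (s : St) : Prop where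
  sound : s.reg 41 * s.reg 44 ≠ 0 → ∃ c, IsoTile M R c ∧ ∃ j < 128 * k, Black M (L.getD j 0) ∧
    tile R (L.getD j 0) ≠ c
  complete : Det → (∃ j < 128 * k, ∃ j' < 128 * k, Black M (L.getD j 0) ∧ Black M (L.getD j' 0) ∧
    tile R (L.getD j 0) ≠ tile R (L.getD j' 0)) → s.reg 41 * s.reg 44 ≠ 0

/-- Of two black samples in different squares, at least one is not in the recorded square, whichever
square that is. So the detection and the two black samples can be treated as separate events. -/
theorem runs_compare_outcome {i : ℕ} {Det : Prop} (hs : Sampled X.M l R K H L i s)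
    (h1 : s.reg 1 = k) (hk : 128 * k ≤ L.length) (hB : L.length ≤ X.B)
    (hq : L.take (128 * k) <+: s.qs) (hdet : Det → s.reg 41 ≠ 0) :
    Runs X s compare (1024 * k + 5) fun s' => Outcome X.M R k L Det s' ∧ s'.qs = s.qs ∧
      s'.itl = s.itl := by
  refine (runs_compare hs h1 hk hB hq).mono le_rfl ?_
  rintro s' - ⟨g1, g2, g3, g4⟩
  refine ⟨⟨fun h => ?_, ?_⟩, g2, g3⟩
  · rw [mul_ne_zero_iff, g1 41 (by omega) (by omega), g4] at h
    exact ⟨_, hs.sound h.1, h.2⟩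
  · rintro hd ⟨j, hj, j', hj', b1, b2, b3⟩
    rw [mul_ne_zero_iff, g1 41 (by omega) (by omega), g4]
    refine ⟨hdet hd, ?_⟩
    by_cases hc : tile R (L.getD j 0) = (s.reg 42, s.reg 43)
    · exact ⟨j', hj', b2, fun h => b3 (hc.trans h.symm)⟩
    · exact ⟨j, hj, b1, hc⟩

/-! ### The adaptive tester -/

/-- What the test of the square of the sample `t` by cells detects. -/
def CellDet (M : Image n) (l J : ℕ) (L : List (ℕ × ℕ)) (t : ℕ) : Prop :=
  (∃ p, Isolated M (CellRel l) (side l J t) p ∧ OnGrid l p ∧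
    tile (side l J t) p = tile (side l J t) (L.getD t 0)) ∨
  Isolated M (CellRel l) (side l J t) (L.getD t 0)

/-- What the exploration of the component of the sample `t` detects. -/
def ComponentDet (M : Image n) (R K : ℕ) (L : List (ℕ × ℕ)) (t : ℕ) : Prop :=
  Isolated M Adj R (L.getD t 0) ∧
    ∀ A : Finset (ℕ × ℕ), (∀ p ∈ A, Linked M Adj (L.getD t 0) p) → A.card ≤ K / t

/-- Explore the components of the samples `1`, …, `K`. -/
def componentLoop : Program :=
  .set 12 (.reg 4) ⨟ .set 10 1 ⨟ .loop ((Term.reg 10).lt (.reg 6 + 1))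
    (.set 17 (.reg 6 / .reg 10) ⨟ componentSample ⨟ .set 10 (.reg 10 + 1))

/-- The part of the adaptive tester after its samples are drawn. -/
def adaptiveMain : Program :=
  queryPrefix ⨟ .set 40 (128 * .reg 1) ⨟ levelLoop cellSample ⨟ componentLoop ⨟ compare

/-- The running time of the adaptive tester. -/
def adaptiveTime (l J R K k : ℕ) : ℕ :=
  ∑ i ∈ Finset.range (512 * R - 256),
    ((66 * l + 320) * ((2 ^ (J + 8 - Nat.log 2 (256 + i)) + 2) *
      (2 ^ (J + 8 - Nat.log 2 (256 + i)) + 2)) + 59) +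
  ∑ i ∈ Finset.range K, (72 * (K / (1 + i)) + 66) + (1536 * k + 40)

theorem runs_levelLoop_cellSample (hs : Sampled X.M l R K H L 0 s) (hc : Counted s)
    (h1 : s.reg 1 = k) (hl : 0 < l) (hR : R = l * 2 ^ J) (hRL : 512 * R ≤ L.length)
    (hLB : ∀ p ∈ L, p.1 + 3 * R ≤ X.B ∧ p.2 + 3 * R ≤ X.B) (hH : (R + 2) * (R + 2) ≤ H)
    (hB : 2 * L.length + (512 * R - 256) * (2 * H) ≤ X.B) :
    Runs X s (levelLoop cellSample) (∑ i ∈ Finset.range (512 * R - 256),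
      ((66 * l + 320) * ((2 ^ (J + 8 - Nat.log 2 (256 + i)) + 2) *
        (2 ^ (J + 8 - Nat.log 2 (256 + i)) + 2)) + 59) + 7) fun s' =>
      Sampled X.M l R K H L (512 * R - 256) s' ∧ Counted s' ∧ s'.reg 1 = k ∧
      ∀ j < 512 * R - 256, CellDet X.M l J L (256 + j) → s'.reg 41 ≠ 0 := by
  have hRl : l ≤ R := hR ▸ Nat.le_mul_of_pos_right l (by positivity)
  refine Runs.mono (runs_levelLoop (J := J) (fun i s => Sampled X.M l R K H L i s ∧ Counted s ∧
    s.reg 1 = k ∧ ∀ j < i, CellDet X.M l J L (256 + j) → s.reg 41 ≠ 0)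
    (fun i => (66 * l + 320) * ((2 ^ (J + 8 - Nat.log 2 (256 + i)) + 2) *
        (2 ^ (J + 8 - Nat.log 2 (256 + i)) + 2)) + 50) hR hl ?_ ?_ ?_ ?_ ?_) le_rfl
    fun _ _ h => h
  · have h1 : 256 * R ≤ 512 * R - 256 := by omega
    have h2 : 4 ≤ H := by nlinarith
    have := Nat.mul_le_mul h1 (Nat.mul_le_mul_left 2 h2)
    omega
  · rintro i s ⟨h, -⟩
    exact ⟨h.h3, h.h4⟩
  · exact ⟨hs, hc, h1, by omega⟩
  · rintro i s s' ⟨g1, g2, g3, g4⟩ h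
    refine ⟨g1.of_sameBut h, queryOnly_counted s s' g2 (h.reg 40 (by omega)) h.qs h.itl,
      by rw [h.reg 1 (by omega), g3], by rw [h.reg 41 (by omega)]; exact g4⟩
  · rintro i hi s ⟨g1, g2, g3, g4⟩ hsch
    have hside := side_le (J := J) hl (show 256 ≤ 256 + i by omega)
    have hW : side l J (256 + i) = l * 2 ^ (J + 8 - Nat.log 2 (256 + i)) := rfl
    have hWpos : 0 < 2 ^ (J + 8 - Nat.log 2 (256 + i)) := by positivity
    have hdvd := side_dvd (l := l) (J := J) (show 256 ≤ 256 + i by omega)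
    have h12 := hsch.h12
    have htL : 256 + i < L.length := by omega
    have hget : L.getD (256 + i) 0 = L[256 + i] := List.getD_eq_getElem _ _ htL
    rw [hW] at hside h12 hdvd
    rw [← hR] at hside hdvd
    set W := 2 ^ (J + 8 - Nat.log 2 (256 + i))
    have hWR : W ≤ R := (Nat.le_mul_of_pos_left W hl).trans hside
    have hb := hLB L[256 + i] (List.getElem_mem htL)
    have hWl : (W + 2) * l ≤ 3 * R := by nlinarith
    have hB' : 2 * L.length + (i + 1) * (2 * H) ≤ X.B :=
      (Nat.add_le_add_left (Nat.mul_le_mul_right _ hi) _).trans hB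
    have hWH : (W + 2) * (W + 2) ≤ H := (Nat.mul_le_mul (by omega) (by omega)).trans hH
    refine (runs_cellSample (W := W) g1 htL hsch.h10 hB' g2 hl hWpos h12 hdvd hWH (by omega)
      (by omega)).mono le_rfl ?_
    rintro s' - ⟨k1, k2, k3, k4, k5⟩
    refine ⟨⟨k1, k2, by rw [k3 1 (by omega), g3], fun j hj hd => ?_⟩, fun r _ _ => k3 r (by omega)⟩
    rcases Nat.lt_succ_iff_lt_or_eq.1 hj with hj | rfl
    · exact k4 (g4 j hj hd)
    · unfold CellDet at hd
      rw [hget] at hd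
      exact k5 hd

theorem runs_componentLoop {i₀ : ℕ} (hs : Sampled X.M l R K H L i₀ s) (hc : Counted s)
    (h1 : s.reg 1 = k) (hR : 0 < R) (hK : K < L.length) (hH : (R + 2) * (R + 2) ≤ H)
    (hB : 2 * L.length + (i₀ + K) * (2 * H) ≤ X.B) :
    Runs X s componentLoop (∑ i ∈ Finset.range K, (72 * (K / (1 + i)) + 66) + 5) fun s' =>
      Sampled X.M l R K H L (i₀ + K) s' ∧ s'.reg 1 = k ∧ (s.reg 41 ≠ 0 → s'.reg 41 ≠ 0) ∧
      ∀ j < K, ComponentDet X.M R K L (1 + j) → s'.reg 41 ≠ 0 := by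
  have hXB := X.hB
  refine Runs.intro_good fun hg _ => ?_
  have hRB := hg.1 4
  have hKB := hg.1 6
  refine Runs.time (Runs.seq (Runs.set (by decide) (by simpa using hRB) (Runs.seq
    (Runs.set (by decide) (by simp; omega) (Runs.mono (Runs.loop_for (fun i s' =>
      (Sampled X.M l R K H L (i₀ + i) s' ∧ Counted s' ∧ s'.reg 10 = 1 + i ∧ s'.reg 12 = R) ∧
      s'.reg 1 = k ∧ (s.reg 41 ≠ 0 → s'.reg 41 ≠ 0) ∧
      ∀ j < i, ComponentDet X.M R K L (1 + j) → s'.reg 41 ≠ 0) K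
      (fun i => 72 * (K / (1 + i)) + 65) (by decide) ?_ ?_ ?_ ?_) le_rfl
      fun s' _ h => ⟨h.1.1, h.2⟩))))) (by simp only [add_assoc, Nat.reduceAdd]; omega)
  · refine ⟨⟨hs.congr (fun r hr => ?_) rfl, ?_, ?_, ?_⟩, ?_, ?_, ?_⟩
    · simp only [St.set_reg]
      rw [if_neg (by omega), if_neg (by omega)]
    · exact queryOnly_counted s _ hc (by simp) rfl rfl
    · simp
    · simp [hs.h4]
    · simp [h1]
    · simp
    · omega
  · rintro i hi s' ⟨⟨g1, g2, g3, g4⟩, -⟩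
    simp [g3, g1.h6]; omega
  · rintro i hi s' ⟨⟨g1, g2, g3, g4⟩, g5, g6, g7⟩
    have htL : 1 + i < L.length := by omega
    have hget : L.getD (1 + i) 0 = L[1 + i] := List.getD_eq_getElem _ _ htL
    have hB' : 2 * L.length + (i₀ + i + 1) * (2 * H) ≤ X.B :=
      (Nat.add_le_add_left (Nat.mul_le_mul_right _ (by omega)) _).trans hB
    have hKt : K / (1 + i) ≤ K := Nat.div_le_self _ _
    rw [hs.h6] at hKB
    refine Runs.time (Runs.seq (T := 1) (T' := 72 * (K / (1 + i)) + 62) (Runs.set (by decide) ?_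
      (Runs.seq (T := 72 * (K / (1 + i)) + 60) (T' := 1) (Runs.mono (runs_componentSample
      (t := 1 + i) (i := i₀ + i)
      (g1.congr (s' := s'.set 17 _) (fun r hr => ?_) rfl) htL ?_ hB' ?_ ?_ hR ?_) ?_ ?_)))) (by omega)
    · simp [g3, g1.h6]; omega
    · simp only [St.set_reg]
      rw [if_neg (by omega)]
    · simp [g3]
    · exact queryOnly_counted s' _ g2 (by simp) rfl rfl
    · simp [g4]
    · nlinarith
    · simp [g3, g1.h6]
    · rintro s'' - ⟨k1, k2, k3, k4, k5⟩
      have k10 : s''.reg 10 = 1 + i := by rw [k3 10 (by omega)]; simp [g3]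
      refine Runs.set (by decide) (by simp [k10]; omega) ⟨⟨k1.congr (fun r hr => ?_) rfl, ?_, ?_, ?_⟩,
        ?_, fun h => ?_, fun j hj hd => ?_⟩
      · simp only [St.set_reg]
        rw [if_neg (by omega)]
      · exact queryOnly_counted s'' _ k2 (by simp) rfl rfl
      · simp [k10]; omega
      · simp [k3, g4]
      · simp [k3, g5]
      · simpa using k4 (by simpa using g6 h)
      · rw [St.set_reg, if_neg (by omega)]
        rcases Nat.lt_succ_iff_lt_or_eq.1 hj with hj | rfl
        · exact k4 (by simpa using g7 j hj hd)
        · refine k5 ?_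
          unfold ComponentDet at hd
          rw [hget] at hd
          simpa [g3, g1.h6] using hd
  · rintro s' ⟨⟨g1, g2, g3, g4⟩, -⟩
    simp [g3, g1.h6]

/-- The first `128 * k` samples are queried before anything else, so that `compare` finds their
answers at the indices `0` to `128 * k - 1`. Setting register `40` to `128 * k` lets the later tests
number their queries from there. -/
theorem runs_adaptiveMain (hs : Sampled X.M l R K H L 0 s) (h1 : s.reg 1 = k) (hl : 0 < l)
    (hR : R = l * 2 ^ J) (hq : s.qs = []) (hrcv : s.rcv = false) (hitl : s.itl = false)
    (hk : 128 * k ≤ L.length) (hRL : 512 * R ≤ L.length) (hK : K < L.length)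
    (hLB : ∀ p ∈ L, p.1 + 3 * R ≤ X.B ∧ p.2 + 3 * R ≤ X.B) (hH : (R + 2) * (R + 2) ≤ H)
    (hB : 2 * L.length + (512 * R - 256 + K) * (2 * H) ≤ X.B) :
    Runs X s adaptiveMain (adaptiveTime l J R K k) (Outcome X.M R k L
      ((∃ j < 512 * R - 256, CellDet X.M l J L (256 + j)) ∨
        ∃ j < K, ComponentDet X.M R K L (1 + j))) := by
  have hRpos : 0 < R := hR ▸ Nat.mul_pos hl (by positivity)
  have hXB := X.hB
  have hLB' : L.length ≤ X.B := by omega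
  refine Runs.time (Runs.seq (T' := _ + _ + 1) ((runs_queryPrefix hs h1 hk hLB' hq hrcv hitl).mono
    le_rfl ?_)) (T' := adaptiveTime l J R K k) (?_ : 512 * k + 3 + (1 +
      (∑ i ∈ Finset.range (512 * R - 256),
        ((66 * l + 320) * ((2 ^ (J + 8 - Nat.log 2 (256 + i)) + 2) *
          (2 ^ (J + 8 - Nat.log 2 (256 + i)) + 2)) + 59) + 7 +
      (∑ i ∈ Finset.range K, (72 * (K / (1 + i)) + 66) + 5 + (1024 * k + 5) + 1) + 1) + 1) + 1 ≤ _)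
  swap
  · unfold adaptiveTime; omega
  rintro s1 - ⟨g1, g2, g3, -, -⟩
  have hlen : s1.qs.length = 128 * k := by rw [g3, List.length_take]; omega
  refine Runs.seq (Runs.set (by decide) ?_ (Runs.seq ((Runs.prefix (runs_levelLoop_cellSample
    (J := J) (k := k) (hs.congr (s' := s1.set 40 _) (fun r hr => ?_) g2) ?_ ?_ hl hR hRL hLB hH
      ?_)).mono le_rfl ?_)))
  · simp [g1, h1]; omega
  · rw [St.set_reg, if_neg (by omega), g1 r (by omega)]
  · simp [Counted, g1, h1, hlen]
  · simp [g1, h1]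
  · refine le_trans (Nat.add_le_add_left (Nat.mul_le_mul_right _ ?_) _) hB
    omega
  rintro s2 - ⟨⟨k1, k2, k3, k4⟩, k5⟩
  refine Runs.seq ((Runs.prefix (runs_componentLoop k1 k2 k3 hRpos hK hH hB)).mono le_rfl ?_)
  rintro s3 - ⟨⟨c1, c2, c3, c4⟩, c5⟩
  refine (runs_compare_outcome c1 c2 hk hLB' ?_ ?_).mono le_rfl fun s' _ h => h.1
  · rw [← g3]; exact List.IsPrefix.trans k5 c5
  · rintro (⟨j, hj, hd⟩ | ⟨j, hj, hd⟩)
    · exact c3 (k4 j hj hd)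
    · exact c4 j hj hd

end ImageTesting

namespace ImageTesting

variable {n : ℕ} {X : Ctx n} {l R K H k J : ℕ} {L : List (ℕ × ℕ)} {s : St}

/-! ### The nonadaptive tester -/

/-- The pixels of the closed square of side `r` around `p`. -/
def tileQueries (r : ℕ) (p : ℕ × ℕ) : List (ℕ × ℕ) :=
  (List.range ((r + 1) * (r + 1))).map (vertexPixel (p.1 / r * r) (p.2 / r * r) (r + 1))

/-- The queries made for the first `m` tests. -/
def levelQueries (l J : ℕ) (L : List (ℕ × ℕ)) (m : ℕ) : List (ℕ × ℕ) :=
  (List.range m).flatMap fun j => tileQueries (side l J (256 + j)) (L.getD (256 + j) 0)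

theorem levelQueries_succ (l J : ℕ) (L : List (ℕ × ℕ)) (m : ℕ) :
    levelQueries l J L (m + 1) =
      levelQueries l J L m ++ tileQueries (side l J (256 + m)) (L.getD (256 + m) 0) := by
  simp [levelQueries, List.range_succ, List.flatMap_append]

theorem levelQueries_prefix {l J : ℕ} {L : List (ℕ × ℕ)} {m m' : ℕ} (h : m ≤ m') :
    levelQueries l J L m <+: levelQueries l J L m' := by
  induction m', h using Nat.le_induction with
  | base => exact List.prefix_refl _
  | succ m' _ ih => exact ih.trans (by rw [levelQueries_succ]; exact List.prefix_append _ _)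

theorem length_tileQueries (r : ℕ) (p : ℕ × ℕ) :
    (tileQueries r p).length = (r + 1) * (r + 1) := by simp [tileQueries]

/-- The answer for vertex `v` of test `j` is found by an index computation alone: skip the prefix
and the queries of all earlier tests. The second pass of the nonadaptive tester maintains this
offset in register `18`. -/
theorem getElem?_levelQueries {pre : List (ℕ × ℕ)} {m j v : ℕ} (hj : j < m)
    (hv : v < (side l J (256 + j) + 1) * (side l J (256 + j) + 1)) :
    (pre ++ levelQueries l J L m)[pre.length + (levelQueries l J L j).length + v]? =
      some (vertexPixel ((L.getD (256 + j) 0).1 / side l J (256 + j) * side l J (256 + j))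
        ((L.getD (256 + j) 0).2 / side l J (256 + j) * side l J (256 + j))
        (side l J (256 + j) + 1) v) := by
  obtain ⟨suf, hsuf⟩ := levelQueries_prefix (l := l) (J := J) (L := L) hj
  rw [levelQueries_succ] at hsuf
  rw [← hsuf, List.getElem?_append_right (by omega), List.append_assoc,
    List.getElem?_append_right (by omega), List.getElem?_append_left
      (by rw [length_tileQueries]; omega)]
  rw [show pre.length + (levelQueries l J L j).length + v - pre.length -
    (levelQueries l J L j).length = v by omega]
  simp [tileQueries, hv]

/-- Query the whole square around the sample `reg 10`. -/
def queryTile : Program :=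
  .set 13 (.load (2 * .reg 10) / .reg 12 * .reg 12) ⨟
  .set 14 (.load (2 * .reg 10 + 1) / .reg 12 * .reg 12) ⨟ .set 15 (.reg 12 + 1) ⨟ .set 20 0 ⨟
  .loop ((Term.reg 20).lt (.reg 15 * .reg 15))
    (.query (.reg 13 + .reg 20 / .reg 15) (.reg 14 + .reg 20 % .reg 15) ⨟ .set 20 (.reg 20 + 1))

theorem runs_queryTile {i t r : ℕ} (hs : Sampled X.M l R K H L i s) (ht : t < L.length)
    (h10 : s.reg 10 = t) (h12 : s.reg 12 = r) (hrB : (r + 1) * (r + 1) ≤ X.B)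
    (hrcv : s.rcv = false) (hitl : s.itl = false) :
    Runs X s queryTile (4 * ((r + 1) * (r + 1)) + 9) fun s' =>
      (∀ r, r < 13 ∨ 15 < r ∧ r < 20 ∨ 40 < r → s'.reg r = s.reg r) ∧ s'.mem = s.mem ∧
      s'.qs = s.qs ++ tileQueries r L[t] ∧ s'.rcv = false ∧ s'.itl = false := by
  refine Runs.intro_good fun hg _ => ?_
  obtain ⟨m1, m2⟩ : s.mem (2 * s.reg 10) = L[t].1 ∧ s.mem (2 * s.reg 10 + 1) = L[t].2 := by
    rw [h10]
    exact hs.samples t ht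
  have b1 := hg.2 (2 * s.reg 10)
  have b2 := hg.2 (2 * s.reg 10 + 1)
  refine Runs.time (Runs.seq (Runs.set (by decide) ?_ (Runs.seq (Runs.set (by decide) ?_
    (Runs.seq (Runs.set (by decide) ?_ (Runs.seq (Runs.set (by decide) (by simp) (Runs.mono
    (Runs.loop_for (fun j s' => s'.reg 20 = j ∧ (∀ r, r < 13 ∨ 15 < r ∧ r < 20 ∨ 40 < r →
      s'.reg r = s.reg r) ∧ s'.reg 13 = L[t].1 / r * r ∧ s'.reg 14 = L[t].2 / r * r ∧
      s'.reg 15 = r + 1 ∧ s'.mem = s.mem ∧ s'.qs = s.qs ++ (List.range j).map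
        (vertexPixel (L[t].1 / r * r) (L[t].2 / r * r) (r + 1)) ∧ s'.rcv = false ∧ s'.itl = false)
      ((r + 1) * (r + 1)) (fun _ => 3) (by decide) ?_ ?_ ?_ ?_) le_rfl
      fun s' _ h => ⟨h.2.1, h.2.2.2.2.2⟩))))))))) (by simp; omega)
  · simpa using (Nat.div_mul_le_self _ _).trans b1
  · simpa using (Nat.div_mul_le_self _ _).trans b2
  · simp [h12]; nlinarith
  · refine ⟨by simp, fun r hr => ?_, ?_, ?_, ?_, rfl, by simp, hrcv, hitl⟩
    · simp only [St.set_reg]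
      rw [if_neg (by omega), if_neg (by omega), if_neg (by omega), if_neg (by omega)]
    · simp [m1, h12]
    · simp [m2, h12]
    · simp [h12]
  · rintro j hj s' ⟨g1, -, -, -, g5, -⟩
    simp [g1, g5]; omega
  · rintro j hj s' ⟨g1, g2, g3, g4, g5, g6, g7, g8, g9⟩
    refine Runs.seq (Runs.query (by decide) (by decide) (Runs.set (by decide) ?_
      ⟨?_, fun r hr => ?_, ?_, ?_, ?_, ?_, ?_, ?_, ?_⟩))
    · simp [g1]; omega
    · simp [g1]
    · rw [St.set_reg, if_neg (by omega), St.ask_reg, g2 r hr]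
    · simp [g3]
    · simp [g4]
    · simp [g5]
    · simp [g6]
    · simp [g7, List.range_succ, vertexPixel, g1, g3, g4, g5]
    · simp [g8]
    · simp [g8, g9]
  · rintro s' ⟨g1, -, -, -, g5, -⟩
    simp [g1, g5]

/-- The part of the nonadaptive tester after its samples are drawn. -/
def nonadaptiveMain : Program :=
  queryPrefix ⨟ levelLoop queryTile ⨟ .set 18 (128 * .reg 1) ⨟
  levelLoop (pixelSample ⨟ .set 18 (.reg 18 + .reg 15 * .reg 15)) ⨟ compare

/-- The running time of the nonadaptive tester. -/
def nonadaptiveTime (l J R k : ℕ) : ℕ :=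
  ∑ i ∈ Finset.range (512 * R - 256),
    (4 * ((side l J (256 + i) + 1) * (side l J (256 + i) + 1)) + 18) +
  ∑ i ∈ Finset.range (512 * R - 256),
    (91 * ((side l J (256 + i) + 1) * (side l J (256 + i) + 1)) + 51) + (1536 * k + 40)

/-- What the test of the square of the sample `t` by pixels detects. -/
def PixelDet (M : Image n) (l J : ℕ) (L : List (ℕ × ℕ)) (t : ℕ) : Prop :=
  ∃ p, Isolated M Adj (side l J t) p ∧ tile (side l J t) p = tile (side l J t) (L.getD t 0)

theorem runs_levelLoop_queryTile {pre : List (ℕ × ℕ)} (hs : Sampled X.M l R K H L 0 s)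
    (h1 : s.reg 1 = k) (hl : 0 < l) (hR : R = l * 2 ^ J) (hRL : 512 * R ≤ L.length)
    (hH : (R + 2) * (R + 2) ≤ H) (hB : 2 * L.length + (512 * R - 256) * (2 * H) ≤ X.B)
    (hqs : s.qs = pre) (hrcv : s.rcv = false) (hitl : s.itl = false) :
    Runs X s (levelLoop queryTile) (∑ i ∈ Finset.range (512 * R - 256),
      (4 * ((side l J (256 + i) + 1) * (side l J (256 + i) + 1)) + 18) + 7) fun s' =>
      Sampled X.M l R K H L 0 s' ∧ s'.reg 1 = k ∧
      s'.qs = pre ++ levelQueries l J L (512 * R - 256) ∧ s'.rcv = false ∧ s'.itl = false := by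
  have hRl : l ≤ R := hR ▸ Nat.le_mul_of_pos_right l (by positivity)
  have h1' : 256 * R ≤ 512 * R - 256 := by omega
  refine Runs.mono (runs_levelLoop (J := J) (fun i s => Sampled X.M l R K H L 0 s ∧
    s.reg 1 = k ∧ s.qs = pre ++ levelQueries l J L i ∧ s.rcv = false ∧
      s.itl = false)
    (fun i => 4 * ((side l J (256 + i) + 1) * (side l J (256 + i) + 1)) + 9) hR hl ?_ ?_ ?_ ?_ ?_)
    le_rfl fun _ _ h => h
  · have h2 : 4 ≤ H := (Nat.mul_le_mul (Nat.le_add_left 2 R) (Nat.le_add_left 2 R)).trans hH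
    have := Nat.mul_le_mul h1' (Nat.mul_le_mul_left 2 h2)
    omega
  · rintro i s ⟨h, -⟩
    exact ⟨h.h3, h.h4⟩
  · exact ⟨hs, h1, by simp [levelQueries, hqs], hrcv, hitl⟩
  · rintro i s s' ⟨g1, g2, g4, g5, g6⟩ h
    refine ⟨g1.of_sameBut h, by rw [h.reg 1 (by omega), g2],
      by rw [h.qs, g4], by rw [h.rcv, g5], by rw [h.itl, g6]⟩
  · rintro i hi s ⟨g1, g2, g4, g5, g6⟩ hsch
    have hside := side_le (J := J) hl (show 256 ≤ 256 + i by omega)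
    rw [← hR] at hside
    have htL : 256 + i < L.length := by omega
    have hget : L.getD (256 + i) 0 = L[256 + i] := List.getD_eq_getElem _ _ htL
    have hsH : (side l J (256 + i) + 1) * (side l J (256 + i) + 1) ≤ H :=
      (Nat.mul_le_mul (by omega) (by omega)).trans hH
    have hHB : H ≤ X.B := by
      have := Nat.le_mul_of_pos_left (2 * H) (show 0 < 512 * R - 256 by omega)
      omega
    refine (runs_queryTile g1 htL hsch.h10 hsch.h12 (hsH.trans hHB) g5 g6).mono le_rfl ?_
    rintro s' - ⟨k1, k2, k3, k4, k5⟩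
    refine ⟨⟨g1.congr (fun r hr => k1 r (by omega)) k2, by rw [k1 1 (by omega), g2],
      ?_, k4, k5⟩, fun r _ _ => k1 r (by omega)⟩
    rw [k3, g4, levelQueries_succ, hget, List.append_assoc]

theorem runs_levelLoop_pixelSample {pre : List (ℕ × ℕ)} (hs : Sampled X.M l R K H L 0 s)
    (h1 : s.reg 1 = k) (hl : 0 < l) (hR : R = l * 2 ^ J) (hRL : 512 * R ≤ L.length)
    (hH : (R + 2) * (R + 2) ≤ H) (hB : 2 * L.length + (512 * R - 256) * (2 * H) ≤ X.B)
    (h18 : s.reg 18 = pre.length)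
    (hset : Settled (pre ++ levelQueries l J L (512 * R - 256)) s) :
    Runs X s (levelLoop (pixelSample ⨟ .set 18 (.reg 18 + .reg 15 * .reg 15)))
      (∑ i ∈ Finset.range (512 * R - 256),
      (91 * ((side l J (256 + i) + 1) * (side l J (256 + i) + 1)) + 51) + 7) fun s' =>
      Sampled X.M l R K H L (512 * R - 256) s' ∧ s'.reg 1 = k ∧
      Settled (pre ++ levelQueries l J L (512 * R - 256)) s' ∧
      ∀ j < 512 * R - 256, PixelDet X.M l J L (256 + j) → s'.reg 41 ≠ 0 := by
  have hRl : l ≤ R := hR ▸ Nat.le_mul_of_pos_right l (by positivity)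
  have h1' : 256 * R ≤ 512 * R - 256 := by omega
  refine Runs.intro_good fun _ hqB => ?_
  rw [hset.1] at hqB
  have hlen : ∀ i ≤ 512 * R - 256, pre.length + (levelQueries l J L i).length ≤ X.B := by
    intro i hi
    have := (levelQueries_prefix (l := l) (J := J) (L := L) hi).length_le
    rw [List.length_append] at hqB
    omega
  refine Runs.mono (runs_levelLoop (J := J) (fun i s => Sampled X.M l R K H L i s ∧
    s.reg 1 = k ∧ s.reg 18 = pre.length + (levelQueries l J L i).length ∧
    Settled (pre ++ levelQueries l J L (512 * R - 256)) s ∧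
      ∀ j < i, PixelDet X.M l J L (256 + j) → s.reg 41 ≠ 0)
    (fun i => 91 * ((side l J (256 + i) + 1) * (side l J (256 + i) + 1)) + 42) hR hl ?_ ?_ ?_ ?_ ?_)
    le_rfl fun _ _ h => ⟨h.1, h.2.1, h.2.2.2⟩
  · have h2 : 4 ≤ H := (Nat.mul_le_mul (Nat.le_add_left 2 R) (Nat.le_add_left 2 R)).trans hH
    have := Nat.mul_le_mul h1' (Nat.mul_le_mul_left 2 h2)
    omega
  · rintro i s ⟨h, -⟩
    exact ⟨h.h3, h.h4⟩
  · exact ⟨hs, h1, by simp [levelQueries, h18], hset, by omega⟩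
  · rintro i s s' ⟨g1, g2, g3, g4, g5⟩ h
    refine ⟨g1.of_sameBut h, by rw [h.reg 1 (by omega), g2], by rw [h.reg 18 (by omega), g3],
      ⟨by rw [h.qs, g4.1], by rw [h.itl, g4.2]⟩, by rw [h.reg 41 (by omega)]; exact g5⟩
  · rintro i hi s ⟨g1, g2, g3, g4, g5⟩ hsch
    have hside := side_le (J := J) hl (show 256 ≤ 256 + i by omega)
    have hpos := side_pos (J := J) (t := 256 + i) hl
    have hdvd := side_dvd (l := l) (J := J) (show 256 ≤ 256 + i by omega)
    rw [← hR] at hside hdvd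
    have htL : 256 + i < L.length := by omega
    have hget : L.getD (256 + i) 0 = L[256 + i] := List.getD_eq_getElem _ _ htL
    have hsH : (side l J (256 + i) + 1) * (side l J (256 + i) + 1) ≤ H :=
      (Nat.mul_le_mul (by omega) (by omega)).trans hH
    have hB' : 2 * L.length + (i + 1) * (2 * H) ≤ X.B :=
      (Nat.add_le_add_left (Nat.mul_le_mul_right _ hi) _).trans hB
    have hnext : (levelQueries l J L (i + 1)).length = (levelQueries l J L i).length +
        (side l J (256 + i) + 1) * (side l J (256 + i) + 1) := by
      rw [levelQueries_succ, List.length_append, length_tileQueries]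
    have h12 := hsch.h12
    have hlen' := hlen (i + 1) hi
    refine Runs.time (Runs.seq (T' := 1) (Runs.mono (runs_pixelSample (t := 256 + i) g1 htL hsch.h10 hB'
      g4 g3 (by rw [h12]; exact hpos) (by rw [h12]; exact hdvd) (by rw [h12]; exact hsH) ?_)
      le_rfl ?_)) (by rw [h12])
    · rw [h12, ← hget]
      intro v hv
      exact getElem?_levelQueries hi hv
    · rintro s' - ⟨k1, k2, k3, k4, k5, k6⟩
      rw [h12] at k4 k6
      have k18 : s'.reg 18 = pre.length + (levelQueries l J L i).length := by
        rw [k3 18 (by omega), g3]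
      refine Runs.set (by decide) ?_ ⟨⟨k1.congr (fun r hr => ?_) rfl, ?_, ?_, k2,
        fun j hj hd => ?_⟩, fun r _ _ => ?_⟩
      · simp only [Term.ideal_add, Term.ideal_mul, Term.ideal_reg, k18, k4]
        omega
      · rw [St.set_reg, if_neg (by omega)]
      · simp [k3, g2]
      · simp only [St.set_reg, Term.ideal_add, Term.ideal_mul, Term.ideal_reg, k18, k4, if_true]
        omega
      · rw [St.set_reg, if_neg (by omega)]
        rcases Nat.lt_succ_iff_lt_or_eq.1 hj with hj | rfl
        · exact k5 (g5 j hj hd)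
        · unfold PixelDet at hd
          rw [hget] at hd
          exact k6 hd
      · rw [St.set_reg, if_neg (by omega), k3 r (by omega)]

/-- The same schedule of squares is passed twice, the first time to submit all queries and the
second time to read the answers. The squares depend on the samples only, which is what makes
nonadaptivity possible. -/
theorem runs_nonadaptiveMain (hs : Sampled X.M l R K H L 0 s) (h1 : s.reg 1 = k) (hl : 0 < l)
    (hR : R = l * 2 ^ J) (hq : s.qs = []) (hrcv : s.rcv = false) (hitl : s.itl = false)
    (hk : 128 * k ≤ L.length) (hRL : 512 * R ≤ L.length) (hH : (R + 2) * (R + 2) ≤ H)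
    (hB : 2 * L.length + (512 * R - 256) * (2 * H) ≤ X.B) :
    Runs X s nonadaptiveMain (nonadaptiveTime l J R k) fun s' => Outcome X.M R k L
      (∃ j < 512 * R - 256, PixelDet X.M l J L (256 + j)) s' ∧ s'.itl = false := by
  have hXB := X.hB
  have hLB' : L.length ≤ X.B := by omega
  refine Runs.time (Runs.seq (T' := _ + _ + 1) ((runs_queryPrefix hs h1 hk hLB' hq hrcv hitl).mono
    le_rfl ?_)) (T' := nonadaptiveTime l J R k) (?_ : 512 * k + 3 + (
      (∑ i ∈ Finset.range (512 * R - 256),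
        (4 * ((side l J (256 + i) + 1) * (side l J (256 + i) + 1)) + 18) + 7) +
      (1 + (∑ i ∈ Finset.range (512 * R - 256),
        (91 * ((side l J (256 + i) + 1) * (side l J (256 + i) + 1)) + 51) + 7 + (1024 * k + 5) + 1)
        + 1) + 1) + 1 ≤ _)
  swap
  · unfold nonadaptiveTime; omega
  rintro s1 - ⟨g1, g2, g3, g4, g5⟩
  have hlen : (L.take (128 * k)).length = 128 * k := by rw [List.length_take]; omega
  refine Runs.seq ((runs_levelLoop_queryTile (J := J) (k := k) (hs.congr (s' := s1)
    (fun r hr => g1 r (by omega)) g2) (by rw [g1 1 (by omega), h1]) hl hR hRL hH hB g3 g4 g5).mono le_rfl ?_)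
  rintro s2 - ⟨k1, k2, k4, -, k6⟩
  refine Runs.seq (Runs.set (by decide) (by simp [k2]; omega) (Runs.seq ((runs_levelLoop_pixelSample
    (J := J) (k := k) (pre := L.take (128 * k)) (k1.congr (s' := s2.set 18 _) (fun r hr => ?_) rfl)
    ?_ hl hR hRL hH hB ?_ ⟨k4, k6⟩).mono le_rfl ?_)))
  · rw [St.set_reg, if_neg (by omega)]
  · simp [k2]
  · simp [k2]; omega
  rintro s3 - ⟨c1, c2, c3, c4⟩
  refine (runs_compare_outcome c1 c2 hk hLB' ?_ ?_).mono le_rfl fun s' _ h =>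
    ⟨h.1, by rw [h.2.2, c3.2]⟩
  · rw [c3.1]; exact List.prefix_append _ _
  · rintro ⟨j, hj, hd⟩
    exact c4 j hj hd

end ImageTesting

namespace ImageTesting

/-! ### Drawing the samples -/

theorem bind_congr_support {α β : Type*} {p : PMF α} {f g : α → PMF β}
    (h : ∀ a ∈ p.support, f a = g a) : p.bind f = p.bind g := by
  ext b
  rw [PMF.bind_apply, PMF.bind_apply]
  refine tsum_congr fun a => ?_
  by_cases ha : a ∈ p.support
  · rw [h a ha]
  · rw [(PMF.apply_eq_zero_iff p a).2 ha, zero_mul, zero_mul]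

/-- A uniformly random pixel of the square of side `N`. -/
noncomputable def drawPixel (N : ℕ) : PMF (ℕ × ℕ) :=
  (uniformBelow N).bind fun x => (uniformBelow N).map fun y => (x, y)

/-- A list of `m` independent uniformly random pixels of the square of side `N`. -/
noncomputable def drawList (N : ℕ) : ℕ → PMF (List (ℕ × ℕ))
  | 0 => PMF.pure []
  | m + 1 => (drawPixel N).bind fun p => (drawList N m).map (List.cons p)

theorem lt_of_mem_support_uniformBelow {N x : ℕ} (hN : 0 < N) (h : x ∈ (uniformBelow N).support) :
    x < N := by
  unfold uniformBelow at h
  rw [PMF.support_map] at h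
  obtain ⟨y, -, rfl⟩ := h
  have := y.2
  omega

theorem lt_of_mem_support_drawPixel {N : ℕ} {p : ℕ × ℕ} (hN : 0 < N)
    (h : p ∈ (drawPixel N).support) : p.1 < N ∧ p.2 < N := by
  unfold drawPixel at h
  rw [PMF.mem_support_bind_iff] at h
  obtain ⟨x, hx, h⟩ := h
  rw [PMF.support_map] at h
  obtain ⟨y, hy, rfl⟩ := h
  exact ⟨lt_of_mem_support_uniformBelow hN hx, lt_of_mem_support_uniformBelow hN hy⟩

theorem mem_support_drawList {N m : ℕ} {L : List (ℕ × ℕ)} (hN : 0 < N)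
    (h : L ∈ (drawList N m).support) : L.length = m ∧ ∀ p ∈ L, p.1 < N ∧ p.2 < N := by
  induction m generalizing L with
  | zero =>
    rw [drawList, PMF.support_pure, Set.mem_singleton_iff] at h
    subst h
    simp
  | succ m ih =>
    rw [drawList, PMF.mem_support_bind_iff] at h
    obtain ⟨p, hp, h⟩ := h
    rw [PMF.support_map] at h
    obtain ⟨L, hL, rfl⟩ := h
    obtain ⟨h1, h2⟩ := ih hL
    refine ⟨by simp [h1], fun q hq => ?_⟩
    rcases List.mem_cons.1 hq with rfl | hq
    · exact lt_of_mem_support_drawPixel hN hp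
    · exact h2 q hq

/-- Draw one sample and store it. -/
def drawBody : Program :=
  .rand 20 (.reg 5) ⨟ .rand 21 (.reg 5) ⨟ .store (2 * .reg 10) (.reg 20) ⨟
    .store (2 * .reg 10 + 1) (.reg 21) ⨟ .set 10 (.reg 10 + 1)

/-- Draw `reg 6 + 1` samples. -/
def draw : Program := .set 10 0 ⨟ .loop ((Term.reg 10).lt (.reg 6 + 1)) drawBody

/-- The state after a sample was stored. -/
def St.drawn (s : St) (p : ℕ × ℕ) : St :=
  ((((s.set 20 p.1).set 21 p.2).put (2 * s.reg 10) p.1).put (2 * s.reg 10 + 1) p.2).set 10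
    (s.reg 10 + 1)

variable {n : ℕ} {X : Ctx n}

theorem run_rand {s : St} (hg : X.Good s) {e : Term} (he : e.Small) {r t : ℕ} {K : List Program} :
    run X.M X.w (t + 1) (s.cfg (.rand r e :: K)) =
      (uniformBelow (e.val s)).bind fun v => run X.M X.w t ((s.set r v).cfg K) := by
  show ((uniformBelow (e.eval X.w s.reg s.mem)).map fun v => (s.set r v).cfg K).bind _ = _
  rw [hg.eval he, PMF.bind_map]
  rfl

theorem run_set {s : St} (hg : X.Good s) {e : Term} (he : e.Small) {r t : ℕ} {K : List Program} :
    run X.M X.w (t + 1) (s.cfg (.set r e :: K)) = run X.M X.w t ((s.set r (e.val s)).cfg K) := by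
  refine run_succ_of_step ?_
  rw [← hg.eval he]
  rfl

theorem run_store {s : St} (hg : X.Good s) {a e : Term} (ha : a.Small) (he : e.Small) {t : ℕ}
    {K : List Program} : run X.M X.w (t + 1) (s.cfg (.store a e :: K)) =
      run X.M X.w t ((s.put (a.val s) (e.val s)).cfg K) := by
  refine run_succ_of_step ?_
  rw [← hg.eval he, ← hg.eval ha]
  rfl

theorem run_seq {s : St} {p q : Program} {t : ℕ} {K : List Program} :
    run X.M X.w (t + 1) (s.cfg ((p ⨟ q) :: K)) = run X.M X.w t (s.cfg (p :: q :: K)) :=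
  run_succ_of_step rfl

theorem run_loop {s : St} (hg : X.Good s) {e : Term} (he : e.Small) {p : Program} {t : ℕ}
    {K : List Program} : run X.M X.w (t + 1) (s.cfg (.loop e p :: K)) =
      run X.M X.w t (s.cfg (if e.val s ≠ 0 then p :: .loop e p :: K else K)) := by
  refine run_succ_of_step ?_
  rw [← hg.eval he]
  rfl

theorem run_cond {s : St} (hg : X.Good s) {e : Term} (he : e.Small) {p q : Program} {t : ℕ}
    {K : List Program} : run X.M X.w (t + 1) (s.cfg (.cond e p q :: K)) =
      run X.M X.w t (s.cfg ((if e.val s ≠ 0 then p else q) :: K)) := by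
  refine run_succ_of_step ?_
  rw [← hg.eval he]
  rfl

theorem run_of_verdict {M : Image n} {w t : ℕ} {z : Config} (h : z.verdict ≠ none) :
    run M w t z = PMF.pure z := by
  induction t with
  | zero => rfl
  | succ t ih =>
    rw [run_succ_of_step (z' := z), ih]
    unfold step
    split
    · rfl
    all_goals simp_all

theorem run_halt {s : St} {b : Bool} {t : ℕ} {K : List Program} :
    run X.M X.w (t + 1) (s.cfg (.halt b :: K)) =
      PMF.pure { s.cfg [] with verdict := some b } := by
  rw [run_succ_of_step (z' := { s.cfg [] with verdict := some b }) rfl]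
  exact run_of_verdict (by simp)

theorem good_drawn {s : St} (hg : X.Good s) {p : ℕ × ℕ} (h1 : p.1 ≤ X.B) (h2 : p.2 ≤ X.B)
    (h10 : s.reg 10 + 1 ≤ X.B) : X.Good (s.drawn p) :=
  ((((hg.set h1).set h2).put h1).put h2).set h10

theorem run_drawBody {s : St} (hg : X.Good s) (h5 : 0 < s.reg 5)
    {t : ℕ} {K : List Program} : run X.M X.w (9 + t) (s.cfg (drawBody :: K)) =
      (drawPixel (s.reg 5)).bind fun p => run X.M X.w t ((s.drawn p).cfg K) := by
  rw [Nat.add_comm 9 t]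
  unfold drawBody drawPixel
  have hB := hg.1 5
  rw [run_seq, run_rand hg (by decide), PMF.bind_bind]
  refine bind_congr_support fun x hx => ?_
  have hx' := lt_of_mem_support_uniformBelow h5 hx
  have hg1 : X.Good (s.set 20 x) := hg.set (by omega)
  rw [run_seq, run_rand hg1 (by decide), PMF.bind_map]
  refine bind_congr_support fun y hy => ?_
  have hy' := lt_of_mem_support_uniformBelow h5 hy
  have hg2 : X.Good ((s.set 20 x).set 21 y) := hg1.set (by omega)
  rw [run_seq, run_store hg2 (by decide) (by decide), run_seq, run_store _ (by decide) (by decide),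
    run_set _ (by decide)]
  · simp [St.drawn]
  · exact (hg2.put (hg2.1 20)).put (by simpa using by omega)
  · exact hg2.put (hg2.1 20)

/-- Each round takes exactly ten steps whatever is drawn. Randomness therefore moves to the front:
draw the whole list, then continue from a state that is a fold over it. -/
theorem run_drawLoop {s : St} (hg : X.Good s) {N m : ℕ} (hN : 0 < N) (h5 : s.reg 5 = N)
    (h10 : s.reg 10 + m = s.reg 6 + 1) (hB : s.reg 6 + 1 ≤ X.B) {t : ℕ} {K : List Program} :
    run X.M X.w (10 * m + 1 + t) (s.cfg (.loop ((Term.reg 10).lt (.reg 6 + 1)) drawBody :: K)) =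
      (drawList N m).bind fun L => run X.M X.w t ((L.foldl St.drawn s).cfg K) := by
  induction m generalizing s with
  | zero =>
    rw [show 10 * 0 + 1 + t = t + 1 by ring, run_loop hg (by decide), if_neg, drawList,
      PMF.pure_bind]
    · rfl
    · simp; omega
  | succ m ih =>
    rw [show 10 * (m + 1) + 1 + t = 9 + (10 * m + 1 + t) + 1 by ring, run_loop hg (by decide),
      if_pos (by simp; omega), run_drawBody hg (by omega), drawList, PMF.bind_bind, h5]
    refine bind_congr_support fun p hp => ?_
    have hp' := lt_of_mem_support_drawPixel hN hp
    have := hg.1 5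
    rw [ih (good_drawn hg (by omega) (by omega) (by omega)), PMF.bind_map]
    · rfl
    · simp [St.drawn, h5]
    · simp [St.drawn]; omega
    · simpa [St.drawn] using hB

theorem run_draw {s : St} (hg : X.Good s) {N : ℕ} (hN : 0 < N) (h5 : s.reg 5 = N)
    (hB : s.reg 6 + 1 ≤ X.B) {t : ℕ} {K : List Program} :
    run X.M X.w (10 * (s.reg 6 + 1) + 3 + t) (s.cfg (draw :: K)) =
      (drawList N (s.reg 6 + 1)).bind fun L =>
        run X.M X.w t ((L.foldl St.drawn (s.set 10 0)).cfg K) := by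
  rw [show 10 * (s.reg 6 + 1) + 3 + t = 10 * (s.reg 6 + 1) + 1 + t + 1 + 1 by ring, draw, run_seq,
    run_set hg (by decide)]
  have hg' : X.Good (s.set 10 0) := hg.set (by omega)
  exact run_drawLoop (m := s.reg 6 + 1) hg' hN (by simp [h5]) (by simp) (by simpa using hB)

/-- What drawing samples does to the state. -/
theorem foldl_drawn {s : St} (hg : X.Good s) (L : List (ℕ × ℕ))
    (hL : ∀ p ∈ L, p.1 ≤ X.B ∧ p.2 ≤ X.B) (hB : s.reg 10 + L.length ≤ X.B) :
    X.Good (L.foldl St.drawn s) ∧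
    (∀ r, r ≠ 10 → r ≠ 20 → r ≠ 21 → (L.foldl St.drawn s).reg r = s.reg r) ∧
    (∀ (t : ℕ) (h : t < L.length), (L.foldl St.drawn s).mem (2 * (s.reg 10 + t)) = L[t].1 ∧
      (L.foldl St.drawn s).mem (2 * (s.reg 10 + t) + 1) = L[t].2) ∧
    (∀ a, a < 2 * s.reg 10 ∨ 2 * (s.reg 10 + L.length) ≤ a →
      (L.foldl St.drawn s).mem a = s.mem a) ∧
    (L.foldl St.drawn s).qs = s.qs ∧ (L.foldl St.drawn s).rcv = s.rcv ∧
    (L.foldl St.drawn s).itl = s.itl := by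
  induction L generalizing s with
  | nil => exact ⟨hg, by simp, by simp, by simp, rfl, rfl, rfl⟩
  | cons p L ih =>
    obtain ⟨hp1, hp2⟩ := hL p (by simp)
    simp only [List.length_cons] at hB
    have h10 : (s.drawn p).reg 10 = s.reg 10 + 1 := by simp [St.drawn]
    obtain ⟨g1, g2, g3, g4, g5, g6, g7⟩ := ih (s := s.drawn p)
      (good_drawn hg hp1 hp2 (by omega)) (fun q hq => hL q (by simp [hq])) (by rw [h10]; omega)
    rw [h10] at g3 g4
    simp only [List.foldl_cons]
    refine ⟨g1, fun r h1 h2 h3 => ?_, fun t ht => ?_, fun a ha => ?_, by rw [g5]; rfl,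
      by rw [g6]; rfl, by rw [g7]; rfl⟩
    · rw [g2 r h1 h2 h3]
      simp [St.drawn, h1, h2, h3]
    · cases t with
      | zero =>
        rw [g4 _ (by omega), g4 _ (by omega)]
        simp [St.drawn]
      | succ t =>
        simp only [List.length_cons, Nat.add_lt_add_iff_right] at ht
        rw [show s.reg 10 + (t + 1) = s.reg 10 + 1 + t by ring]
        exact g3 t ht
    · simp only [List.length_cons] at ha
      rw [g4 a (by omega)]
      simp only [St.drawn, St.set_mem, St.put_mem]
      rw [if_neg (by omega), if_neg (by omega)]

/-! ### Whole programs -/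

/-- Accept at once if `reg 1 ≤ 2`. Otherwise compute parameters, draw samples, run the main part and
reject if the registers `41` and `44` are nonzero. -/
def tester (params main : Program) : Program :=
  .cond ((Term.reg 1).lt 3) (.halt true)
    (params ⨟ draw ⨟ main ⨟ .cond (.reg 41 * .reg 44) (.halt false) (.halt true))

/-- The run of a tester, as a function of its samples. -/
theorem exists_run_tester {s : St} (hg : X.Good s) {params main : Program} {N K T₁ T₂ : ℕ}
    {Q : St → Prop} {Q' : List (ℕ × ℕ) → St → Prop} (h1 : 3 ≤ s.reg 1) (hN : 0 < N)
    (hqs : s.qs = []) (hB : T₁ + 10 * (K + 1) + T₂ + 10 ≤ X.B)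
    (hparams : Runs X s params T₁ fun s' => Q s' ∧ s'.qs = [] ∧ s'.reg 5 = N ∧ s'.reg 6 = K)
    (hmain : ∀ s', X.Good s' → Q s' → s'.qs = [] → s'.reg 5 = N → s'.reg 6 = K →
      ∀ L : List (ℕ × ℕ), L.length = K + 1 → (∀ p ∈ L, p.1 < N ∧ p.2 < N) →
      Runs X (L.foldl St.drawn (s'.set 10 0)) main T₂ (Q' L))
    {T : ℕ} (hT : T₁ + 10 * (K + 1) + T₂ + 10 ≤ T) :
    ∃ f : List (ℕ × ℕ) → Config, run X.M X.w T (s.cfg [tester params main]) =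
        (drawList N (K + 1)).map f ∧
      ∀ L ∈ (drawList N (K + 1)).support, ∃ s', Q' L s' ∧ (f L).interleaved = s'.itl ∧
        (f L).verdict = some (decide (s'.reg 41 * s'.reg 44 = 0)) := by
  obtain ⟨t₁, ht₁, s₁, hex, hg₁, hl₁, hQ, hq₁, h5, h6⟩ := hparams hg (by rw [hqs]; simp; omega)
  -- Once the samples are fixed, the rest is deterministic and ends in a single configuration. The
  -- subtracted number of steps is what the initial test, the parameters and the drawing have
  -- consumed.
  have key : ∀ L ∈ (drawList N (K + 1)).support, ∃ z : Config, ∃ s', Q' L s' ∧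
      z.interleaved = s'.itl ∧ z.verdict = some (decide (s'.reg 41 * s'.reg 44 = 0)) ∧
      run X.M X.w (T - (2 + t₁ + 1 + (10 * (K + 1) + 3)))
        ((L.foldl St.drawn (s₁.set 10 0)).cfg
          [main ⨟ .cond (.reg 41 * .reg 44) (.halt false) (.halt true)]) = PMF.pure z := by
    intro L hL
    obtain ⟨hlen, hlt⟩ := mem_support_drawList hN hL
    have hNB : N ≤ X.B := h5 ▸ hg₁.1 5
    obtain ⟨f1, -, -, -, f5, -, -⟩ := foldl_drawn (s := s₁.set 10 0) (hg₁.set (by omega)) L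
      (fun p hp => by have := hlt p hp; omega) (by simp [hlen]; omega)
    obtain ⟨t₂, ht₂, s₂, hex₂, hg₂, -, hQ₂⟩ := hmain s₁ hg₁ hQ hq₁ h5 h6 L hlen hlt f1
      (by rw [f5, St.set_qs, hq₁]; simp; omega)
    obtain ⟨u, hu⟩ : ∃ u, T - (2 + t₁ + 1 + (10 * (K + 1) + 3)) = t₂ + (u + 1 + 1) + 1 :=
      ⟨T - (2 + t₁ + 1 + (10 * (K + 1) + 3)) - t₂ - 3, by omega⟩
    rw [hu, run_seq, run_add, hex₂, PMF.pure_bind, run_cond hg₂ (by decide)]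
    by_cases h0 : s₂.reg 41 * s₂.reg 44 = 0
    · refine ⟨{ s₂.cfg [] with verdict := some true }, s₂, hQ₂, rfl, by simp only [h0]; rfl, ?_⟩
      rw [if_neg (fun h => h h0), run_halt]
    · refine ⟨{ s₂.cfg [] with verdict := some false }, s₂, hQ₂, rfl, by simp only [h0]; rfl, ?_⟩
      rw [if_pos (show (Term.reg 41 * .reg 44).val s₂ ≠ 0 from h0), run_halt]
  have : Nonempty Config := ⟨s.cfg []⟩
  choose! f hf using key
  refine ⟨f, ?_, fun L hL => ?_⟩
  · obtain ⟨u, hu⟩ : ∃ u, T = (t₁ + ((10 * (K + 1) + 3 + u) + 1)) + 1 + 1 :=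
      ⟨T - (2 + t₁ + 1 + (10 * (K + 1) + 3)), by omega⟩
    have hu' : T - (2 + t₁ + 1 + (10 * (K + 1) + 3)) = u := by omega
    rw [hu'] at hf
    rw [hu, tester, run_cond hg (by decide), if_neg (by simp; omega), run_seq, run_add, hex,
      PMF.pure_bind, run_seq, ← h6, run_draw hg₁ hN h5 (by omega), h6]
    refine (bind_congr_support fun L hL => ?_).trans (PMF.bind_pure_comp f _)
    obtain ⟨s', -, -, -, h⟩ := hf L hL
    exact h
  · obtain ⟨s', a, b, c, -⟩ := hf L hL
    exact ⟨s', a, b, c⟩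

theorem run_tester_of_lt {s : St} (hg : X.Good s) {params main : Program} (h1 : s.reg 1 < 3)
    {T : ℕ} (hT : 2 ≤ T) : run X.M X.w T (s.cfg [tester params main]) =
      PMF.pure { s.cfg [] with verdict := some true } := by
  obtain ⟨u, rfl⟩ : ∃ u, T = u + 1 + 1 := ⟨T - 2, by omega⟩
  rw [tester, run_cond hg (by decide), if_pos (by simpa using h1), run_halt]

end ImageTesting

namespace ImageTesting

/-! ### Parameters -/

/-- The smallest `l` with `4 * k ≤ l * 2 ^ J`. -/
def cellSide (k J : ℕ) : ℕ := (4 * k + 2 ^ J - 1) / 2 ^ J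

/-- Rounding up adds less than `2 ^ J ≤ k / 2` to `4 * k`, so `R` stays below `9 k / 2`. And `4 * k
≥ 8 * 2 ^ J` gives the lower bound `8`, which the analysis of the adaptive tester needs. -/
theorem cellSide_bounds {k J : ℕ} (hk : 3 ≤ k) (hJ : 2 * 2 ^ J ≤ k) :
    4 * k ≤ cellSide k J * 2 ^ J ∧ cellSide k J * 2 ^ J < 4 * k + 2 ^ J ∧ 8 ≤ cellSide k J ∧
      cellSide k J ≤ 4 * k := by
  have hp : 0 < 2 ^ J := by positivity
  have h1 := Nat.div_add_mod' (4 * k + 2 ^ J - 1) (2 ^ J)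
  have h2 := Nat.mod_lt (4 * k + 2 ^ J - 1) hp
  unfold cellSide
  refine ⟨by omega, by omega, (Nat.le_div_iff_mul_le hp).2 (by omega), ?_⟩
  refine Nat.div_le_of_le_mul ?_
  obtain ⟨q, hq⟩ : ∃ q, 2 ^ J = q + 1 := ⟨2 ^ J - 1, by omega⟩
  have : q ≤ q * (4 * k) := Nat.le_mul_of_pos_right q (by omega)
  rw [hq, add_mul]
  omega

/-- The side of the square from which pixels are sampled. -/
def padded (n R : ℕ) : ℕ := R * (n / R + 1)

theorem padded_bounds {n R : ℕ} (hR : 0 < R) : n < padded n R ∧ padded n R ≤ n + R := by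
  have h1 := Nat.div_add_mod n R
  have h2 := Nat.mod_lt n hR
  unfold padded
  rw [Nat.mul_add, Nat.mul_one]
  omega

/-- Compute the parameters from `reg 2`, a power of two. -/
def deriveParams : Program :=
  .set 3 ((4 * .reg 1 + .reg 2 - 1) / .reg 2) ⨟ .set 4 (.reg 3 * .reg 2) ⨟
  .set 5 (.reg 4 * (.reg 0 / .reg 4 + 1)) ⨟ .set 6 (256 * .reg 3 * .reg 4) ⨟
  .set 7 ((.reg 4 + 2) * (.reg 4 + 2)) ⨟ .set 16 (2 * (.reg 6 + 1))

/-- Double `reg 2` as long as `e` holds. -/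
def powerLoop (e : Term) : Program := .set 2 1 ⨟ .loop e (.set 2 (2 * .reg 2))

/-- Compute the binary logarithm of `reg 1`. -/
def logLoop : Program :=
  .set 8 1 ⨟ .set 9 0 ⨟
    .loop ((2 * Term.reg 8).lt (.reg 1 + 1)) (.set 8 (2 * .reg 8) ⨟ .set 9 (.reg 9 + 1))

/-- The parameters of the adaptive tester. -/
def adaptiveParams : Program :=
  logLoop ⨟ powerLoop ((16 * Term.reg 2 * .reg 2).lt (.reg 1 * .reg 9 + 1)) ⨟ deriveParams

/-- The parameters of the nonadaptive tester. -/
def nonadaptiveParams : Program := powerLoop ((4 * Term.reg 2).lt (.reg 1 + 1)) ⨟ deriveParams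

/-- The machine at the start. -/
def St.start (n k : ℕ) : St :=
  ⟨fun r => if r = 0 then n else if r = 1 then k else 0, fun _ => 0, [], false, false⟩

/-- The parameters were computed. -/
structure Ready (n k J l : ℕ) (s : St) : Prop where
  h1 : s.reg 1 = k
  h3 : s.reg 3 = l
  h4 : s.reg 4 = l * 2 ^ J
  h7 : s.reg 7 = (l * 2 ^ J + 2) * (l * 2 ^ J + 2)
  h16 : s.reg 16 = 2 * (256 * l * (l * 2 ^ J) + 1)
  h41 : s.reg 41 = 0
  mem : s.mem = fun _ => 0
  rcv : s.rcv = false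
  itl : s.itl = false

variable {n : ℕ} {X : Ctx n} {k : ℕ}

/-- Only registers from `2` to `19` differ from the start. -/
def Initial (n k : ℕ) (s : St) : Prop :=
  (∀ r, r < 2 ∨ 20 ≤ r → s.reg r = (St.start n k).reg r) ∧ s.mem = (fun _ => 0) ∧ s.qs = [] ∧
    s.rcv = false ∧ s.itl = false

theorem Initial.set {s : St} (h : Initial n k s) {r v : ℕ} (hr : 2 ≤ r ∧ r < 20) :
    Initial n k (s.set r v) :=
  ⟨fun r' hr' => by rw [St.set_reg, if_neg (by omega), h.1 r' hr'], h.2⟩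

theorem runs_deriveParams {s : St} (h : Initial n k s) {J : ℕ} (h2 : s.reg 2 = 2 ^ J) (hk : 3 ≤ k)
    (hJ : 2 * 2 ^ J ≤ k) (hkn : k ≤ n) (hB : 20000 * n ^ 2 ≤ X.B) :
    Runs X s deriveParams 11 fun s' => Ready n k J (cellSide k J) s' ∧ s'.qs = [] ∧
      s'.reg 5 = padded n (cellSide k J * 2 ^ J) ∧
      s'.reg 6 = 256 * cellSide k J * (cellSide k J * 2 ^ J) := by
  obtain ⟨b1, b2, b3, b4⟩ := cellSide_bounds hk hJ
  have h0 : s.reg 0 = n := by rw [h.1 0 (by omega)]; rfl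
  have h1 : s.reg 1 = k := by rw [h.1 1 (by omega)]; rfl
  have h41 : s.reg 41 = 0 := by rw [h.1 41 (by omega)]; rfl
  obtain ⟨p1, p2⟩ := padded_bounds (n := n) (R := cellSide k J * 2 ^ J) (by omega)
  have hl : (4 * k + 2 ^ J - 1) / 2 ^ J = cellSide k J := rfl
  have hp : cellSide k J * 2 ^ J * (n / (cellSide k J * 2 ^ J) + 1) =
    padded n (cellSide k J * 2 ^ J) := rfl
  generalize hRdef : cellSide k J * 2 ^ J = R at *
  generalize cellSide k J = l at *
  have hR : R ≤ 5 * n := by omega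
  have hll : l ≤ 4 * n := by omega
  have hK : 256 * l * R ≤ 5120 * n ^ 2 := by nlinarith
  refine Runs.seq (Runs.set (by decide) ?_ (Runs.seq (Runs.set (by decide) ?_ (Runs.seq
    (Runs.set (by decide) ?_ (Runs.seq (Runs.set (by decide) ?_ (Runs.seq (Runs.set (by decide) ?_
    (Runs.set (by decide) ?_ ⟨⟨?_, ?_, ?_, ?_, ?_, ?_, ?_, ?_, ?_⟩, ?_, ?_, ?_⟩))))))))))
  · simp [h1, h2, hl]; nlinarith
  · simp [h1, h2, hl, hRdef]; nlinarith
  · simp [h1, h2, h0, hl, hRdef, hp]; nlinarith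
  · simp [h1, h2, hl, hRdef]; nlinarith
  · simp [h1, h2, hl, hRdef]; nlinarith
  · simp [h1, h2, hl, hRdef]; nlinarith
  · simp [h1]
  · simp [h1, h2, hl]
  · simp [h1, h2, hl]
  · simp [h1, h2, hl]
  · simp [h1, h2, hl]
  · simp [h41]
  · simp [h.2.1]
  · simp [h.2.2.2.1]
  · simp [h.2.2.2.2]
  · simp [h.2.2.1]
  · simp [h1, h2, h0, hl, hRdef, hp]
  · simp [h1, h2, hl, hRdef]

/-- The hypothesis `4 * m ≤ k` is what preserves `2 * 2 ^ J ≤ k` through one more doubling. On exit,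
`c` fails at `2 ^ J` and, unless `J = 0`, holds one step before, so `2 ^ J` is the threshold up to a
factor two. -/
theorem runs_powerLoop {s : St} (h : Initial n k s) {e : Term} (he : e.Small) {c : ℕ → Prop}
    (hc : ∀ s', (∀ r, r ≠ 2 → s'.reg r = s.reg r) → (e.val s' ≠ 0 ↔ c (s'.reg 2)))
    (hck : ∀ m, c m → 4 * m ≤ k) (hk : 3 ≤ k) (hkB : k ≤ X.B) :
    Runs X s (powerLoop e) (2 * k + 3) fun s' => Initial n k s' ∧ ∃ J, s'.reg 2 = 2 ^ J ∧
      2 * 2 ^ J ≤ k ∧ ¬ c (2 ^ J) ∧ (J ≠ 0 → c (2 ^ (J - 1))) := by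
  refine Runs.time (Runs.seq (Runs.set (by decide) (by simp; have := X.hB; omega) (Runs.mono
    (Runs.loop_while (fun s' => Initial n k s' ∧ (∀ r, r ≠ 2 → s'.reg r = s.reg r) ∧
      ∃ J, s'.reg 2 = 2 ^ J ∧ 2 * 2 ^ J ≤ k ∧ (J ≠ 0 → c (2 ^ (J - 1))))
      (fun s' => k - s'.reg 2) 1 he ?_ ?_ ?_) le_rfl ?_))) (by simp; omega)
  · exact ⟨h.set (by omega), fun r hr => by simp [hr], 0, by simp, by simpa using by omega,
      by simp⟩
  · rintro s' ⟨-, g2, J, g3, g4, -⟩ hne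
    have := hck _ ((hc s' g2).1 hne)
    have : 0 < 2 ^ J := by positivity
    omega
  · rintro s' - ⟨g1, g2, J, g3, g4, g5⟩ hne
    have hcm := (hc s' g2).1 hne
    have hle := hck _ hcm
    have hpos : 0 < 2 ^ J := by positivity
    refine Runs.set (by decide) (by simp; omega) ⟨⟨g1.set (by omega), fun r hr => by
      simp [hr, g2 r hr], J + 1, ?_, ?_, ?_⟩, ?_⟩
    · simp [g3, pow_succ, mul_comm]
    · rw [g3] at hle
      rw [pow_succ]
      omega
    · rw [g3] at hcm
      simpa using hcm
    · simp
      omega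
  · rintro s' - ⟨⟨g1, g2, J, g3, g4, g5⟩, g6⟩
    refine ⟨g1, J, g3, g4, fun hcm => ?_, g5⟩
    rw [← g3] at hcm
    exact (hc s' g2).2 hcm g6

theorem runs_logLoop (hk : 3 ≤ k) (hkB : 2 * k ≤ X.B) :
    Runs X (St.start n k) logLoop (4 * k + 5) fun s' => Initial n k s' ∧
      s'.reg 9 = Nat.log 2 k := by
  have hXB := X.hB
  refine Runs.time (Runs.seq (Runs.set (by decide) (by simp; omega) (Runs.seq (Runs.set (by decide)
    (by simp) (Runs.mono (Runs.loop_while (fun s' => Initial n k s' ∧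
      s'.reg 8 = 2 ^ s'.reg 9 ∧ 2 ^ s'.reg 9 ≤ k)
      (fun s' => k - s'.reg 8) 3 (by decide) ?_ ?_ ?_) le_rfl ?_))))) (by simp; omega)
  · refine ⟨Initial.set (Initial.set ⟨fun _ _ => rfl, rfl, rfl, rfl, rfl⟩ (by omega)) (by omega),
      by simp, by simpa using by omega⟩
  · rintro s' ⟨g1, g2, g3⟩ hne
    have h1 : s'.reg 1 = k := by rw [g1.1 1 (by omega)]; rfl
    have : 0 < 2 ^ s'.reg 9 := by positivity
    simp [h1] at hne
    omega
  · rintro s' - ⟨g1, g2, g3⟩ hne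
    have h1 : s'.reg 1 = k := by rw [g1.1 1 (by omega)]; rfl
    have hpos : 0 < 2 ^ s'.reg 9 := by positivity
    simp [h1] at hne
    have hlt : s'.reg 9 < 2 ^ s'.reg 9 := Nat.lt_two_pow_self
    refine Runs.seq (Runs.set (by decide) (by simp; omega) (Runs.set (by decide) (by simp; omega)
      ⟨⟨(g1.set (by omega)).set (by omega), ?_, ?_⟩, ?_⟩))
    · simp [g2, pow_succ, mul_comm]
    · simp [pow_succ]; omega
    · simp; omega
  · rintro s' - ⟨⟨g1, g2, g3⟩, g4⟩
    have h1 : s'.reg 1 = k := by rw [g1.1 1 (by omega)]; rfl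
    simp [h1] at g4
    refine ⟨g1, ((Nat.log_eq_iff (Or.inr ⟨by norm_num, by omega⟩)).2 ⟨g3, ?_⟩).symm⟩
    rw [pow_succ]
    omega

/-- Here `2 ^ J` is as large as `k` permits, up to constants, so that `l` is bounded and the
smallest squares have constant size. -/
theorem runs_nonadaptiveParams (hk : 3 ≤ k) (hkn : k ≤ n) (hB : 20000 * n ^ 2 ≤ X.B) :
    Runs X (St.start n k) nonadaptiveParams (2 * k + 15) fun s' => ∃ J, (2 * 2 ^ J ≤ k ∧
      k < 4 * 2 ^ J) ∧ Ready n k J (cellSide k J) s' ∧ s'.qs = [] ∧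
      s'.reg 5 = padded n (cellSide k J * 2 ^ J) ∧
      s'.reg 6 = 256 * cellSide k J * (cellSide k J * 2 ^ J) := by
  refine Runs.time (Runs.seq (T' := 11) ((runs_powerLoop (c := fun m => 4 * m ≤ k)
    (e := (4 * Term.reg 2).lt (.reg 1 + 1)) (s := St.start n k) (n := n) (k := k)
    ⟨fun _ _ => rfl, rfl, rfl, rfl, rfl⟩ (by decide) ?_ (fun m h => h) hk ?_).mono le_rfl ?_))
    (by omega)
  · intro s' hs'
    have h1 : s'.reg 1 = k := by rw [hs' 1 (by omega)]; rfl
    simp [h1]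
  · nlinarith
  · rintro s' - ⟨g1, J, g2, g3, g4, g5⟩
    exact (runs_deriveParams g1 g2 hk g3 hkn hB).mono le_rfl fun s'' _ h =>
      ⟨J, ⟨g3, by omega⟩, h⟩

/-- Choosing `4 ^ J` of order `k * log k` balances the exploration of squares, of cost `R * 2 ^ J`,
with that of components, of cost `l * R * log k`. -/
theorem runs_adaptiveParams (hk : 3 ≤ k) (hkn : k ≤ n) (hB : 20000 * n ^ 2 ≤ X.B) :
    Runs X (St.start n k) adaptiveParams (6 * k + 21) fun s' => ∃ J, (2 * 2 ^ J ≤ k ∧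
      k * Nat.log 2 k < 16 * (2 ^ J * 2 ^ J) ∧
      (J ≠ 0 → 4 * (2 ^ J * 2 ^ J) ≤ k * Nat.log 2 k)) ∧ Ready n k J (cellSide k J) s' ∧
      s'.qs = [] ∧
      s'.reg 5 = padded n (cellSide k J * 2 ^ J) ∧
      s'.reg 6 = 256 * cellSide k J * (cellSide k J * 2 ^ J) := by
  have hkB : 2 * k ≤ X.B := by nlinarith
  have hlog : Nat.log 2 k ≤ k := Nat.log_le_self 2 k
  refine Runs.time (Runs.seq (T' := 2 * k + 15) ((runs_logLoop hk hkB).mono le_rfl ?_)) (by omega)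
  rintro s1 - ⟨f1, f2⟩
  refine Runs.time (Runs.seq (T' := 11) ((runs_powerLoop
    (c := fun m => 16 * m * m ≤ k * Nat.log 2 k)
    (e := (16 * Term.reg 2 * .reg 2).lt (.reg 1 * .reg 9 + 1)) f1 (by decide) ?_ (fun m h => ?_) hk
    (by omega)).mono le_rfl ?_)) (by omega)
  · intro s' hs'
    have h1 : s'.reg 1 = k := by rw [hs' 1 (by omega), f1.1 1 (by omega)]; rfl
    have h9 : s'.reg 9 = Nat.log 2 k := by rw [hs' 9 (by omega), f2]
    simp [h1, h9]
  -- Since `log k ≤ k`, the condition gives `16 m² ≤ k²`, that is `4 m ≤ k`.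
  · by_contra hlt
    nlinarith
  · rintro s' - ⟨g1, J, g2, g3, g4, g5⟩
    refine (runs_deriveParams g1 g2 hk g3 hkn hB).mono le_rfl fun s'' _ h =>
      ⟨J, ⟨g3, by rw [← mul_assoc]; omega, fun h0 => ?_⟩, h⟩
    obtain ⟨J, rfl⟩ : ∃ J', J = J' + 1 := ⟨J - 1, by omega⟩
    have := g5 h0
    simp only [Nat.add_sub_cancel] at this
    rw [pow_succ]
    nlinarith

end ImageTesting

namespace ImageTesting
open scoped ENNReal

/-! ### Probabilities -/

theorem uniformBelow_apply {N x : ℕ} (hx : x < N) : uniformBelow N x = (N : ℝ≥0∞)⁻¹ := by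
  have h : N - 1 + 1 = N := by omega
  unfold uniformBelow
  rw [PMF.map_apply, tsum_eq_single (⟨x, by omega⟩ : Fin (N - 1 + 1))]
  · simp only [if_true, PMF.uniformOfFintype_apply, Fintype.card_fin]
    rw [h]
  · intro b hb
    rw [if_neg]
    intro h
    exact hb (Fin.ext h.symm)

theorem drawPixel_apply {N : ℕ} {p : ℕ × ℕ} (h1 : p.1 < N) (h2 : p.2 < N) :
    drawPixel N p = ((N : ℝ≥0∞) ^ 2)⁻¹ := by
  unfold drawPixel
  rw [PMF.bind_apply, tsum_eq_single p.1]
  · rw [PMF.map_apply, tsum_eq_single p.2, if_pos rfl, uniformBelow_apply h1,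
      uniformBelow_apply h2, sq, ENNReal.mul_inv (by simp) (by simp)]
    intro y hy
    rw [if_neg]
    intro h
    exact hy (congrArg Prod.snd h).symm
  · intro x hx
    rw [PMF.map_apply, ENNReal.tsum_eq_zero.2, mul_zero]
    intro y
    rw [if_neg]
    rintro rfl
    exact hx rfl

/-- The probability of avoiding a set of pixels. -/
theorem drawPixel_compl_le {N : ℕ} (B : Finset (ℕ × ℕ)) (hB : ∀ p ∈ B, p.1 < N ∧ p.2 < N) :
    (drawPixel N).toOuterMeasure (B : Set (ℕ × ℕ))ᶜ ≤
      ENNReal.ofReal (Real.exp (-((B.card : ℝ) / (N : ℝ) ^ 2))) := by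
  rw [← PMF.toMeasure_apply_eq_toOuterMeasure, MeasureTheory.prob_compl_eq_one_sub
    B.measurableSet, PMF.toMeasure_apply_eq_toOuterMeasure, PMF.toOuterMeasure_apply_finset,
    Finset.sum_congr rfl fun p hp => drawPixel_apply (hB p hp).1 (hB p hp).2, Finset.sum_const,
    nsmul_eq_mul]
  rcases B.eq_empty_or_nonempty with rfl | ⟨p, hp⟩
  · simp
  have hN : 0 < N := by have := hB p hp; omega
  have e : (B.card : ℝ≥0∞) * ((N : ℝ≥0∞) ^ 2)⁻¹ = ENNReal.ofReal ((B.card : ℝ) / (N : ℝ) ^ 2) := by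
    rw [ENNReal.ofReal_div_of_pos (by positivity), ENNReal.ofReal_natCast,
      ENNReal.ofReal_pow (by positivity), ENNReal.ofReal_natCast, div_eq_mul_inv]
  rw [e, ← ENNReal.ofReal_one, ← ENNReal.ofReal_sub _ (by positivity)]
  refine ENNReal.ofReal_le_ofReal ?_
  have := Real.add_one_le_exp (-((B.card : ℝ) / (N : ℝ) ^ 2))
  linarith

/-- The lists of samples that avoid given sets. -/
def avoiding (m : ℕ) (B : ℕ → Finset (ℕ × ℕ)) : Set (List (ℕ × ℕ)) :=
  {L | ∀ i < m, L.getD i 0 ∉ B i}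

/-- The samples are independent, so the probabilities of missing multiply, and each is at most the
exponential of minus the density of its target. Only the sum of the sizes of the targets matters,
which pools samples of all levels. -/
theorem drawList_avoiding_le {N : ℕ} (m : ℕ) (B : ℕ → Finset (ℕ × ℕ))
    (hB : ∀ i < m, ∀ p ∈ B i, p.1 < N ∧ p.2 < N) :
    (drawList N m).toOuterMeasure (avoiding m B) ≤
      ENNReal.ofReal (Real.exp (-((∑ i ∈ Finset.range m, (B i).card : ℕ) / (N : ℝ) ^ 2))) := by
  induction m generalizing B with
  | zero =>
    simp only [Finset.range_zero, Finset.sum_empty, Nat.cast_zero, zero_div, neg_zero,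
      Real.exp_zero, ENNReal.ofReal_one]
    rw [drawList, PMF.toOuterMeasure_pure_apply]
    split_ifs <;> simp
  | succ m ih =>
    have key : ∀ p, ((drawList N m).map (List.cons p)).toOuterMeasure (avoiding (m + 1) B) =
        Set.indicator ((B 0 : Set (ℕ × ℕ))ᶜ)
          (fun _ => (drawList N m).toOuterMeasure (avoiding m fun i => B (i + 1))) p := by
      intro p
      rw [PMF.toOuterMeasure_map_apply]
      by_cases hp : p ∈ B 0
      · rw [Set.indicator_of_notMem (by simpa using hp)]
        have : List.cons p ⁻¹' avoiding (m + 1) B = ∅ :=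
          Set.eq_empty_of_forall_notMem fun L hL => hL 0 (by omega) (by simpa using hp)
        rw [this, MeasureTheory.measure_empty]
      · rw [Set.indicator_of_mem (by simpa using hp)]
        congr 1
        ext L
        constructor
        · intro h i hi
          simpa using h (i + 1) (by omega)
        · intro h i hi
          cases i with
          | zero => simpa using hp
          | succ i => simpa using h i (by omega)
    rw [drawList, PMF.toOuterMeasure_bind_apply]
    simp only [key]
    have e : ∀ p, drawPixel N p * Set.indicator ((B 0 : Set (ℕ × ℕ))ᶜ)
          (fun _ => (drawList N m).toOuterMeasure (avoiding m fun i => B (i + 1))) p =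
        Set.indicator ((B 0 : Set (ℕ × ℕ))ᶜ) (drawPixel N) p *
          (drawList N m).toOuterMeasure (avoiding m fun i => B (i + 1)) := by
      intro p
      by_cases hp : p ∈ (B 0 : Set (ℕ × ℕ))ᶜ
      · rw [Set.indicator_of_mem hp, Set.indicator_of_mem hp]
      · rw [Set.indicator_of_notMem hp, Set.indicator_of_notMem hp, mul_zero, zero_mul]
    simp only [e]
    rw [ENNReal.tsum_mul_right, ← PMF.toOuterMeasure_apply]
    refine (mul_le_mul' (drawPixel_compl_le (B 0) (hB 0 (by omega)))
      (ih (fun i => B (i + 1)) fun i hi => hB (i + 1) (by omega))).trans ?_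
    rw [← ENNReal.ofReal_mul (Real.exp_nonneg _), ← Real.exp_add, Finset.sum_range_succ']
    refine ENNReal.ofReal_le_ofReal (Real.exp_le_exp.2 (le_of_eq ?_))
    push_cast
    ring

/-- Equivalent to `9 ^ 4 ≤ e ^ 9`. The value `1/9` leaves room for three bad events with total
probability `1/3`. -/
theorem exp_neg_le : Real.exp (-(9 / 4)) ≤ 1 / 9 := by
  have h1 : (9 : ℝ) ^ 4 ≤ Real.exp (9 / 4) ^ 4 := by
    rw [← Real.exp_nat_mul, show ((4 : ℕ) : ℝ) * (9 / 4) = (9 : ℕ) * 1 by norm_num,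
      Real.exp_nat_mul]
    have := Real.exp_one_gt_d9
    refine le_trans ?_ (pow_le_pow_left₀ (by norm_num) this.le 9)
    norm_num
  have h2 : (9 : ℝ) ≤ Real.exp (9 / 4) :=
    le_of_pow_le_pow_left₀ (by norm_num) (Real.exp_nonneg _) h1
  rw [Real.exp_neg, one_div]
  exact inv_anti₀ (by norm_num) h2

/-- The union bound for three events. -/
theorem two_thirds_le_map_apply {N m : ℕ} {g : List (ℕ × ℕ) → Option Bool}
    {B : Fin 3 → ℕ → Finset (ℕ × ℕ)} (hB : ∀ a, ∀ i < m, ∀ p ∈ B a i, p.1 < N ∧ p.2 < N)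
    (hsum : ∀ a, (9 / 4 : ℝ) * (N : ℝ) ^ 2 ≤ (∑ i ∈ Finset.range m, (B a i).card : ℕ)) (hN : 0 < N)
    (h : ∀ L ∈ (drawList N m).support, (∀ a, L ∉ avoiding m (B a)) → g L = some false) :
    2 / 3 ≤ ((drawList N m).map g) (some false) := by
  have hev : ∀ a, (drawList N m).toOuterMeasure (avoiding m (B a)) ≤ ENNReal.ofReal (1 / 9) := by
    intro a
    refine (drawList_avoiding_le m (B a) (hB a)).trans (ENNReal.ofReal_le_ofReal ?_)
    refine le_trans (Real.exp_le_exp.2 (neg_le_neg ?_)) exp_neg_le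
    rw [le_div_iff₀ (by positivity)]
    exact hsum a
  rw [← PMF.toOuterMeasure_apply_singleton, PMF.toOuterMeasure_map_apply]
  set μ := (drawList N m).toOuterMeasure
  have h1 : (1 : ℝ≥0∞) ≤ μ (g ⁻¹' {some false}) + μ (⋃ a, avoiding m (B a)) := by
    refine le_trans ?_ (MeasureTheory.measure_union_le (μ := μ) _ _)
    refine ((PMF.toOuterMeasure_apply_eq_one_iff _ _).2 fun L hL => ?_).ge
    by_cases hc : ∃ a, L ∈ avoiding m (B a)
    · exact Or.inr (Set.mem_iUnion.2 hc)
    · exact Or.inl (h L hL (not_exists.1 hc))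
  have h2 : μ (⋃ a, avoiding m (B a)) ≤ ENNReal.ofReal (1 / 3) := by
    refine (MeasureTheory.measure_iUnion_le _).trans ?_
    rw [tsum_fintype]
    refine (Finset.sum_le_sum fun a _ => hev a).trans ?_
    rw [Finset.sum_const, Finset.card_univ, Fintype.card_fin, nsmul_eq_mul,
      ← ENNReal.ofReal_natCast, ← ENNReal.ofReal_mul (by norm_num)]
    norm_num
  have h3 : (2 / 3 : ℝ≥0∞) = ENNReal.ofReal (2 / 3) := by
    rw [ENNReal.ofReal_div_of_pos (by norm_num)]
    norm_num
  rw [h3]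
  refine ENNReal.le_of_add_le_add_right (a := ENNReal.ofReal (1 / 3)) (by simp) ?_
  rw [← ENNReal.ofReal_add (by norm_num) (by norm_num)]
  refine le_trans (le_of_eq ?_) (h1.trans (add_le_add_right h2 _))
  norm_num

end ImageTesting

namespace ImageTesting

/-! ### Connected sets of pixels -/

/-- The pixels of an `n × n` image. -/
def box (n : ℕ) : Finset (ℕ × ℕ) := Finset.range n ×ˢ Finset.range n

theorem mem_box {n : ℕ} {p : ℕ × ℕ} : p ∈ box n ↔ p.1 < n ∧ p.2 < n := by
  simp [box]

theorem card_box (n : ℕ) : (box n).card = n * n := by simp [box]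

/-- `p` and `q` are joined by a path of pixels in `S`. -/
def Joined (S : Set (ℕ × ℕ)) : ℕ × ℕ → ℕ × ℕ → Prop :=
  Relation.ReflTransGen fun p q => Adj p q ∧ p ∈ S ∧ q ∈ S

theorem Joined.symm {S : Set (ℕ × ℕ)} {p q : ℕ × ℕ} (h : Joined S p q) : Joined S q p := by
  induction h with
  | refl => exact .refl
  | tail _ h ih => exact .head ⟨h.1.symm, h.2.2, h.2.1⟩ ih

theorem Joined.mono {S S' : Set (ℕ × ℕ)} (hS : S ⊆ S') {p q : ℕ × ℕ} (h : Joined S p q) :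
    Joined S' p q :=
  Relation.ReflTransGen.mono (fun _ _ h => ⟨h.1, hS h.2.1, hS h.2.2⟩) _ _ h

theorem joined_snd {S : Set (ℕ × ℕ)} {x a b : ℕ} (hab : a ≤ b)
    (h : ∀ j, a ≤ j → j ≤ b → (x, j) ∈ S) : Joined S (x, b) (x, a) := by
  induction b, hab using Nat.le_induction with
  | base => exact .refl
  | succ b hab ih =>
    refine Relation.ReflTransGen.head (b := (x, b)) ⟨Or.inl ⟨rfl, Or.inr rfl⟩, h _ (by omega) le_rfl, h _ hab (by omega)⟩
      (ih fun j h1 h2 => h j h1 (by omega))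

theorem joined_fst {S : Set (ℕ × ℕ)} {y a b : ℕ} (hab : a ≤ b)
    (h : ∀ j, a ≤ j → j ≤ b → (j, y) ∈ S) : Joined S (b, y) (a, y) := by
  induction b, hab using Nat.le_induction with
  | base => exact .refl
  | succ b hab ih =>
    refine Relation.ReflTransGen.head (b := (b, y)) ⟨Or.inr ⟨rfl, Or.inr rfl⟩, h _ (by omega) le_rfl, h _ hab (by omega)⟩
      (ih fun j h1 h2 => h j h1 (by omega))

theorem joined_row (y a b : ℕ) {c d : ℕ} (hc : c ∈ Finset.Icc a b) (hd : d ∈ Finset.Icc a b) :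
    Joined (((Finset.Icc a b).image fun x => (x, y) : Finset (ℕ × ℕ)) : Set (ℕ × ℕ))
      (c, y) (d, y) := by
  have key : ∀ {c}, c ∈ Finset.Icc a b → Joined (((Finset.Icc a b).image fun x => (x, y) :
      Finset (ℕ × ℕ)) : Set (ℕ × ℕ)) (c, y) (a, y) := by
    intro c hc
    rw [Finset.mem_Icc] at hc
    refine joined_fst hc.1 fun j _ _ => ?_
    simp only [Finset.coe_image, Set.mem_image, Finset.mem_coe, Finset.mem_Icc]
    exact ⟨j, by omega, rfl⟩
  exact (key hc).trans (key hd).symm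

theorem joined_column (x a b : ℕ) {c d : ℕ} (hc : c ∈ Finset.Icc a b) (hd : d ∈ Finset.Icc a b) :
    Joined (((Finset.Icc a b).image fun y => (x, y) : Finset (ℕ × ℕ)) : Set (ℕ × ℕ))
      (x, c) (x, d) := by
  have key : ∀ {c}, c ∈ Finset.Icc a b → Joined (((Finset.Icc a b).image fun y => (x, y) :
      Finset (ℕ × ℕ)) : Set (ℕ × ℕ)) (x, c) (x, a) := by
    intro c hc
    rw [Finset.mem_Icc] at hc
    refine joined_snd hc.1 fun j _ _ => ?_
    simp only [Finset.coe_image, Set.mem_image, Finset.mem_coe, Finset.mem_Icc]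
    exact ⟨j, by omega, rfl⟩
  exact (key hc).trans (key hd).symm

/-- Two pixels at distance at most `l` in both coordinates are joined by a short path. -/
theorem exists_path {n l : ℕ} {p q : ℕ × ℕ} (hp : p ∈ box n) (hq : q ∈ box n)
    (h1 : p.1 ≤ q.1 + l ∧ q.1 ≤ p.1 + l) (h2 : p.2 ≤ q.2 + l ∧ q.2 ≤ p.2 + l) :
    ∃ P ⊆ box n, P.card ≤ 2 * l + 2 ∧ p ∈ P ∧ ∀ z ∈ P, Joined P z q := by
  classical
  obtain ⟨p1, p2⟩ := p
  obtain ⟨q1, q2⟩ := q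
  simp only [mem_box] at hp hq h1 h2
  -- An L-shaped path with its corner at `(q1, p2)`; each arm has at most `l + 1` pixels.
  refine ⟨(Finset.Icc (min p1 q1) (max p1 q1)).image (fun x => (x, p2)) ∪
    (Finset.Icc (min p2 q2) (max p2 q2)).image (fun y => (q1, y)), ?_, ?_, ?_, ?_⟩
  · intro z hz
    rcases Finset.mem_union.1 hz with hz | hz <;>
    · obtain ⟨j, hj, rfl⟩ := Finset.mem_image.1 hz
      rw [Finset.mem_Icc] at hj
      rw [mem_box]
      simp only
      omega
  · refine (Finset.card_union_le _ _).trans ?_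
    refine (Nat.add_le_add Finset.card_image_le Finset.card_image_le).trans ?_
    rw [Nat.card_Icc, Nat.card_Icc]
    omega
  · exact Finset.mem_union_left _ (Finset.mem_image.2 ⟨p1, by simp, rfl⟩)
  · rw [Finset.coe_union]
    intro z hz
    rcases Finset.mem_union.1 hz with hz | hz
    · obtain ⟨j, hj, rfl⟩ := Finset.mem_image.1 hz
      exact ((joined_row p2 _ _ hj (by simp : q1 ∈ _)).mono Set.subset_union_left).trans
        ((joined_column q1 _ _ (by simp : p2 ∈ _) (by simp : q2 ∈ _)).mono
          Set.subset_union_right)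
    · obtain ⟨j, hj, rfl⟩ := Finset.mem_image.1 hz
      exact (joined_column q1 _ _ hj (by simp : q2 ∈ _)).mono Set.subset_union_right

variable {n : ℕ} {M : Image n}

theorem Black.mem_box {p : ℕ × ℕ} (h : Black M p) : p ∈ box n := by
  rw [ImageTesting.mem_box]
  by_contra hc
  exact h (by unfold pixel; rw [dif_neg hc])

theorem black_iff {p : ℕ × ℕ} : Black M p ↔ ∃ (h1 : p.1 < n) (h2 : p.2 < n),
    M ⟨p.1, h1⟩ ⟨p.2, h2⟩ = true := by
  unfold Black pixel
  by_cases h : p.1 < n ∧ p.2 < n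
  · rw [dif_pos h]
    simp [h.1, h.2]
  · rw [dif_neg h]
    simp only [ne_eq, not_true_eq_false, false_iff]
    rintro ⟨h1, h2, -⟩
    exact h ⟨h1, h2⟩

theorem imageGraph_adj_iff {p q : {p : Fin n × Fin n // M p.1 p.2 = true}} :
    (imageGraph M).Adj p q ↔ Adj ((p.1.1 : ℕ), (p.1.2 : ℕ)) ((q.1.1 : ℕ), (q.1.2 : ℕ)) := by
  show |(p.1.1 : ℤ) - (q.1.1 : ℤ)| + |(p.1.2 : ℤ) - (q.1.2 : ℤ)| = 1 ↔ _
  unfold Adj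
  rcases abs_cases ((p.1.1 : ℤ) - (q.1.1 : ℤ)) with h1 | h1 <;>
  rcases abs_cases ((p.1.2 : ℤ) - (q.1.2 : ℤ)) with h2 | h2 <;>
  · rw [h1.1, h2.1]
    simp only
    omega

theorem mem_connectedImages_iff :
    M ∈ connectedImages n ↔ ∀ p q, Black M p → Black M q → Linked M Adj p q := by
  constructor
  · intro h p q hp hq
    obtain ⟨a1, a2, a3⟩ := black_iff.1 hp
    obtain ⟨b1, b2, b3⟩ := black_iff.1 hq
    have hr := h ⟨(⟨p.1, a1⟩, ⟨p.2, a2⟩), a3⟩ ⟨(⟨q.1, b1⟩, ⟨q.2, b2⟩), b3⟩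
    rw [SimpleGraph.reachable_iff_reflTransGen] at hr
    refine Relation.ReflTransGen.lift (fun z : {p : Fin n × Fin n // M p.1 p.2 = true} => ((z.1.1 : ℕ), (z.1.2 : ℕ))) (fun a b hab => ?_) _ _ hr
    exact ⟨imageGraph_adj_iff.1 hab, black_iff.2 ⟨a.1.1.2, a.1.2.2, a.2⟩,
      black_iff.2 ⟨b.1.1.2, b.1.2.2, b.2⟩⟩
  · intro h p q
    rw [SimpleGraph.reachable_iff_reflTransGen]
    have key : ∀ z, Linked M Adj ((p.1.1 : ℕ), (p.1.2 : ℕ)) z → ∀ q : {p : Fin n × Fin n //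
        M p.1 p.2 = true}, z = ((q.1.1 : ℕ), (q.1.2 : ℕ)) →
        Relation.ReflTransGen (imageGraph M).Adj p q := by
      intro z hz
      induction hz with
      | refl =>
        intro q hq
        have : p = q := by
          simp only [Prod.mk.injEq] at hq
          exact Subtype.ext (Prod.ext (Fin.ext hq.1) (Fin.ext hq.2))
        rw [this]
      | @tail y z _ hyz ih =>
        rintro q rfl
        obtain ⟨h1, h2, h3⟩ := black_iff.1 hyz.2.1
        exact (ih ⟨(⟨y.1, h1⟩, ⟨y.2, h2⟩), h3⟩ rfl).tail (imageGraph_adj_iff.2 hyz.1)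
    exact key _ (h _ _ (black_iff.2 ⟨p.1.1.2, p.1.2.2, p.2⟩)
      (black_iff.2 ⟨q.1.1.2, q.1.2.2, q.2⟩)) q rfl

/-- The distance to connectedness is at most the number of pixels that change if `S` becomes the set
of black pixels. -/
theorem absoluteDistance_le {S : Set (ℕ × ℕ)} (hbox : ∀ p ∈ S, p ∈ box n) (o : ℕ × ℕ)
    (hconn : ∀ p ∈ S, Joined S p o) (D : Finset (ℕ × ℕ))
    (hD : ∀ p ∈ box n, (Black M p ∧ p ∉ S) ∨ (p ∈ S ∧ ¬ Black M p) → p ∈ D) :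
    absoluteDistance M (connectedImages n) ≤ D.card := by
  classical
  set M' : Image n := fun i j => decide (((i : ℕ), (j : ℕ)) ∈ S) with hM'
  have hb : ∀ p, Black M' p ↔ p ∈ S := by
    intro p
    rw [black_iff]
    constructor
    · rintro ⟨h1, h2, h3⟩
      simpa [hM'] using h3
    · intro hp
      have := mem_box.1 (hbox p hp)
      exact ⟨this.1, this.2, by simpa [hM'] using hp⟩
  have hmem : M' ∈ connectedImages n := by
    rw [mem_connectedImages_iff]
    intro p q hp hq
    rw [hb] at hp hq
    have hj := (hconn p hp).trans (hconn q hq).symm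
    exact Relation.ReflTransGen.mono
      (fun a b h => ⟨h.1, (hb a).2 h.2.1, (hb b).2 h.2.2⟩) _ _ hj
  have hle : absoluteDistance M (connectedImages n) ≤ hammingDistance M M' :=
    Nat.sInf_le ⟨M', hmem, rfl⟩
  refine hle.trans ?_
  unfold hammingDistance
  rw [← Finset.card_image_of_injective (f := fun p : Fin n × Fin n => ((p.1 : ℕ), (p.2 : ℕ)))]
  · refine Finset.card_le_card fun z hz => ?_
    obtain ⟨p, hp, rfl⟩ := Finset.mem_image.1 hz
    rw [Finset.mem_filter] at hp
    refine hD _ (mem_box.2 ⟨p.1.2, p.2.2⟩) ?_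
    have hne := hp.2
    have e1 : Black M ((p.1 : ℕ), (p.2 : ℕ)) ↔ M p.1 p.2 = true := by
      rw [black_iff]
      simp
    rw [e1]
    by_cases hs : ((p.1 : ℕ), (p.2 : ℕ)) ∈ S
    · right
      refine ⟨hs, fun h => hne ?_⟩
      rw [h, hM']
      simp [hs]
    · left
      refine ⟨?_, hs⟩
      by_contra h
      apply hne
      rw [hM']
      simp only [hs, decide_false]
      simpa using h
  · intro a b hab
    simp only [Prod.mk.injEq] at hab
    exact Prod.ext (Fin.ext hab.1) (Fin.ext hab.2)

theorem Linked.black {rel : ℕ × ℕ → ℕ × ℕ → Prop} {p q : ℕ × ℕ} (h : Linked M rel p q)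
    (hp : Black M p) : Black M q := by
  cases h with
  | refl => exact hp
  | tail _ h => exact h.2.2

theorem Isolated.of_linked {rel : ℕ × ℕ → ℕ × ℕ → Prop} {r : ℕ} {p q : ℕ × ℕ}
    (h : Isolated M rel r p) (hpq : Linked M rel p q) : Isolated M rel r q :=
  ⟨hpq.black h.1, fun z hz => h.2 z (hpq.trans hz)⟩

/-- A component that avoids the grid stays in its square. -/
theorem Isolated.tile_eq {R : ℕ} {p q : ℕ × ℕ} (h : Isolated M Adj R p) (hpq : Linked M Adj p q) :
    tile R q = tile R p := by
  induction hpq with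
  | refl => rfl
  | @tail y z hy hyz ih =>
    rw [← ih]
    have h1 := h.2 y hy
    have h2 := h.2 z (hy.tail hyz)
    -- The quotient changes only on arrival at a multiple of `R`, which is a grid pixel.
    have key : ∀ a : ℕ, ¬ R ∣ a + 1 → (a + 1) / R = a / R := fun a ha => Nat.succ_div_of_not_dvd ha
    unfold OnGrid at h1 h2
    push Not at h1 h2
    obtain ⟨y1, y2⟩ := y
    obtain ⟨z1, z2⟩ := z
    have hadj := hyz.1
    simp only [Adj, tile] at *
    rcases hadj with ⟨rfl, rfl | rfl⟩ | ⟨rfl, rfl | rfl⟩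
    · rw [key _ h2.2]
    · rw [key _ h1.2]
    · rw [key _ h2.1]
    · rw [key _ h1.1]

/-- An isolated component and a black pixel outside of its square refute connectedness. -/
theorem not_mem_connectedImages {R : ℕ} {c q : ℕ × ℕ} (hc : IsoTile M R c) (hq : Black M q)
    (hne : tile R q ≠ c) : M ∉ connectedImages n := by
  obtain ⟨p, hp, rfl⟩ := hc
  rw [mem_connectedImages_iff]
  exact fun h => hne (hp.tile_eq (h p q hp.1 hq))

/-! ### The backbone -/

section backbone
variable {rel : ℕ × ℕ → ℕ × ℕ → Prop} {l J : ℕ}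

/-- The square `c` of side `l * 2 ^ e` contains an isolated pixel on the grid of side `l`. -/
def BadTile (M : Image n) (rel : ℕ × ℕ → ℕ × ℕ → Prop) (l e : ℕ) (c : ℕ × ℕ) : Prop :=
  ∃ q, Isolated M rel (l * 2 ^ e) q ∧ OnGrid l q ∧ tile (l * 2 ^ e) q = c

/-- The pixels that divide the bad squares of side `l * 2 ^ (e + 1)`. -/
def LevelPixel (M : Image n) (rel : ℕ × ℕ → ℕ × ℕ → Prop) (l e : ℕ) (p : ℕ × ℕ) : Prop :=
  OnGrid (l * 2 ^ e) p ∧ BadTile M rel l (e + 1) (tile (l * 2 ^ (e + 1)) p)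

/-- The coarsest grid and the dividing pixels of all levels. -/
def Backbone (M : Image n) (rel : ℕ × ℕ → ℕ × ℕ → Prop) (l J : ℕ) (p : ℕ × ℕ) : Prop :=
  OnGrid (l * 2 ^ J) p ∨ ∃ e < J, LevelPixel M rel l e p

theorem Backbone.onGrid {p : ℕ × ℕ} (h : Backbone M rel l J p) : OnGrid l p := by
  rcases h with h | ⟨e, -, h, -⟩
  · exact h.of_dvd (dvd_mul_right _ _)
  · exact h.of_dvd (dvd_mul_right _ _)

theorem tile_two_mul (r : ℕ) (p : ℕ × ℕ) :
    tile (r * 2) p = ((tile r p).1 / 2, (tile r p).2 / 2) := by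
  simp only [tile, Nat.div_div_eq_div_mul]

/-- The same pixel is a witness, because a coarser grid has fewer pixels to be linked to. So the bad
squares of all levels are nested, which lets the dividing lines hang on to each other. -/
theorem BadTile.succ {e : ℕ} {p : ℕ × ℕ} (h : BadTile M rel l e (tile (l * 2 ^ e) p)) :
    BadTile M rel l (e + 1) (tile (l * 2 ^ (e + 1)) p) := by
  obtain ⟨q, h1, h2, h3⟩ := h
  refine ⟨q, h1.of_dvd (Nat.mul_dvd_mul_left l (pow_dvd_pow 2 (by omega))), h2, ?_⟩
  rw [pow_succ, ← mul_assoc, tile_two_mul, tile_two_mul, h3]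

/-- Walk along the grid line to a coordinate axis and along the axis to the origin. The axes belong
to the grid, as every side divides `0`. -/
theorem joined_of_onGrid {S : Set (ℕ × ℕ)} {R : ℕ} (hS : ∀ p ∈ box n, OnGrid R p → p ∈ S)
    {p : ℕ × ℕ} (hp : p ∈ box n) (h : OnGrid R p) : Joined S p (0, 0) := by
  rw [mem_box] at hp
  rcases h with h | h
  · refine (joined_snd (x := p.1) (a := 0) (b := p.2) (by omega) fun j _ hj => ?_).trans
      (joined_fst (y := 0) (a := 0) (b := p.1) (by omega) fun j _ hj => ?_)
    · exact hS _ (mem_box.2 ⟨hp.1, by simp only; omega⟩) (Or.inl h)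
    · exact hS _ (mem_box.2 ⟨by simp only; omega, by simp only; omega⟩) (Or.inr (dvd_zero _))
  · refine (joined_fst (y := p.2) (a := 0) (b := p.1) (by omega) fun j _ hj => ?_).trans
      (joined_snd (x := 0) (a := 0) (b := p.2) (by omega) fun j _ hj => ?_)
    · exact hS _ (mem_box.2 ⟨by simp only; omega, hp.2⟩) (Or.inr h)
    · exact hS _ (mem_box.2 ⟨by simp only; omega, by simp only; omega⟩) (Or.inl (dvd_zero _))

theorem div_of_between {r a j : ℕ} (h1 : a / r * r ≤ j) (h2 : j ≤ a) : j / r = a / r := by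
  rcases Nat.eq_zero_or_pos r with rfl | hr
  · simp
  · exact le_antisymm (Nat.div_le_div_right h2) ((Nat.le_div_iff_mul_le hr).2 h1)

/-- Induction from coarse to fine levels. A dividing line is followed down to the lower boundary of
its bad square, which lies on the next coarser grid. The square around it on the next level is bad
as well, so the end point is again in the backbone; at the top level it is on the coarsest grid. -/
theorem joined_of_backbone {S : Set (ℕ × ℕ)} (hS : ∀ p ∈ box n, Backbone M rel l J p → p ∈ S)
    {p : ℕ × ℕ} (hp : p ∈ box n) (h : Backbone M rel l J p) : Joined S p (0, 0) := by
  have hgrid : ∀ {p}, p ∈ box n → OnGrid (l * 2 ^ J) p → Joined S p (0, 0) := fun {p} hp h =>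
    joined_of_onGrid (fun q hq hg => hS q hq (Or.inl hg)) hp h
  have key : ∀ d e, e + d + 1 = J → ∀ p ∈ box n, LevelPixel M rel l e p → Joined S p (0, 0) := by
    intro d
    induction d with
    | zero =>
      intro e he p hp hl
      obtain ⟨p1, p2⟩ := p
      have hb := mem_box.1 hp
      simp only at hb
      have hle1 := Nat.div_mul_le_self p1 (l * 2 ^ (e + 1))
      have hle2 := Nat.div_mul_le_self p2 (l * 2 ^ (e + 1))
      obtain ⟨hg | hg, hbad⟩ := hl
      · refine (joined_snd (x := p1) hle2 fun j h1 h2 => ?_).trans (hgrid ?_ (Or.inr ?_))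
        · have hj : tile (l * 2 ^ (e + 1)) (p1, j) = tile (l * 2 ^ (e + 1)) (p1, p2) := by
            simp only [tile, div_of_between h1 h2]
          exact hS _ (mem_box.2 ⟨hb.1, by simp only; omega⟩)
            (Or.inr ⟨e, by omega, Or.inl hg, by rw [hj]; exact hbad⟩)
        · exact mem_box.2 ⟨hb.1, by simp only; omega⟩
        · rw [← he]; exact dvd_mul_left _ _
      · refine (joined_fst (y := p2) hle1 fun j h1 h2 => ?_).trans (hgrid ?_ (Or.inl ?_))
        · have hj : tile (l * 2 ^ (e + 1)) (j, p2) = tile (l * 2 ^ (e + 1)) (p1, p2) := by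
            simp only [tile, div_of_between h1 h2]
          exact hS _ (mem_box.2 ⟨by simp only; omega, hb.2⟩)
            (Or.inr ⟨e, by omega, Or.inr hg, by rw [hj]; exact hbad⟩)
        · exact mem_box.2 ⟨by simp only; omega, hb.2⟩
        · rw [← he]; exact dvd_mul_left _ _
    | succ d ih =>
      intro e he p hp hl
      obtain ⟨p1, p2⟩ := p
      have hb := mem_box.1 hp
      simp only at hb
      have hle1 := Nat.div_mul_le_self p1 (l * 2 ^ (e + 1))
      have hle2 := Nat.div_mul_le_self p2 (l * 2 ^ (e + 1))
      obtain ⟨hg | hg, hbad⟩ := hl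
      · have hj : ∀ {j}, p2 / (l * 2 ^ (e + 1)) * (l * 2 ^ (e + 1)) ≤ j → j ≤ p2 →
            tile (l * 2 ^ (e + 1)) (p1, j) = tile (l * 2 ^ (e + 1)) (p1, p2) := fun h1 h2 => by
          simp only [tile, div_of_between h1 h2]
        refine (joined_snd (x := p1) hle2 fun j h1 h2 => ?_).trans
          (ih (e + 1) (by omega) _ (mem_box.2 ⟨hb.1, by simp only; omega⟩)
            ⟨Or.inr (dvd_mul_left _ _), BadTile.succ ?_⟩)
        · exact hS _ (mem_box.2 ⟨hb.1, by simp only; omega⟩)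
            (Or.inr ⟨e, by omega, Or.inl hg, by rw [hj h1 h2]; exact hbad⟩)
        · rw [hj le_rfl hle2]; exact hbad
      · have hj : ∀ {j}, p1 / (l * 2 ^ (e + 1)) * (l * 2 ^ (e + 1)) ≤ j → j ≤ p1 →
            tile (l * 2 ^ (e + 1)) (j, p2) = tile (l * 2 ^ (e + 1)) (p1, p2) := fun h1 h2 => by
          simp only [tile, div_of_between h1 h2]
        refine (joined_fst (y := p2) hle1 fun j h1 h2 => ?_).trans
          (ih (e + 1) (by omega) _ (mem_box.2 ⟨by simp only; omega, hb.2⟩)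
            ⟨Or.inl (dvd_mul_left _ _), BadTile.succ ?_⟩)
        · exact hS _ (mem_box.2 ⟨by simp only; omega, hb.2⟩)
            (Or.inr ⟨e, by omega, Or.inr hg, by rw [hj h1 h2]; exact hbad⟩)
        · rw [hj le_rfl hle1]; exact hbad
  rcases h with h | ⟨e, he, h⟩
  · exact hgrid hp h
  · exact key (J - e - 1) e (by omega) p hp h

/-- Black pixels that are not isolated are linked to the backbone. -/
theorem exists_backbone_linked {p : ℕ × ℕ} (hp : Black M p) (h : ¬ Isolated M rel l p) :
    ∃ g, Backbone M rel l J g ∧ Linked M rel p g := by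
  -- Climb from grid to grid. If the pixel `g` reached on level `e` is isolated on level `e + 1`,
  -- then `g` itself makes its square bad and is one of the pixels that divide it. Otherwise `g` is
  -- linked to the next grid.
  have key : ∀ e ≤ J, (∃ g, Backbone M rel l J g ∧ Linked M rel p g) ∨
      ∃ g, OnGrid (l * 2 ^ e) g ∧ Linked M rel p g := by
    intro e
    induction e with
    | zero =>
      intro _
      right
      unfold Isolated at h
      push Not at h
      obtain ⟨q, hq, hg⟩ := h hp
      exact ⟨q, by simpa using hg, hq⟩
    | succ e ih =>
      intro he
      rcases ih (by omega) with h | ⟨g, hg, hl⟩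
      · exact Or.inl h
      · by_cases hi : Isolated M rel (l * 2 ^ (e + 1)) g
        · exact Or.inl ⟨g, Or.inr ⟨e, by omega, hg, g, hi, hg.of_dvd (dvd_mul_right _ _), rfl⟩, hl⟩
        · unfold Isolated at hi
          push Not at hi
          obtain ⟨q, hq, hg'⟩ := hi (hl.black hp)
          exact Or.inr ⟨q, hg', hl.trans hq⟩
  rcases key J le_rfl with h | ⟨g, hg, hl⟩
  · exact h
  · exact ⟨g, Or.inl hg, hl⟩

end backbone
end ImageTesting

namespace ImageTesting

variable {n : ℕ} {M : Image n} {rel : ℕ × ℕ → ℕ × ℕ → Prop} {l J R : ℕ}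

/-! ### The distance to connectedness -/

open scoped Classical in
/-- The squares of side `l * 2 ^ e` with an isolated pixel on the grid of side `l`. -/
noncomputable def badTiles (M : Image n) (rel : ℕ × ℕ → ℕ × ℕ → Prop) (l e : ℕ) :
    Finset (ℕ × ℕ) :=
  ((box n).filter fun q => Isolated M rel (l * 2 ^ e) q ∧ OnGrid l q).image (tile (l * 2 ^ e))

theorem mem_badTiles {e : ℕ} {c : ℕ × ℕ} : c ∈ badTiles M rel l e ↔ BadTile M rel l e c := by
  classical
  unfold badTiles BadTile
  simp only [Finset.mem_image, Finset.mem_filter]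
  constructor
  · rintro ⟨q, ⟨-, h1, h2⟩, h3⟩
    exact ⟨q, h1, h2, h3⟩
  · rintro ⟨q, h1, h2, h3⟩
    exact ⟨q, ⟨h1.1.mem_box, h1, h2⟩, h3⟩

open scoped Classical in
theorem card_onGrid_le (n R : ℕ) (hR : 0 < R) :
    ((box n).filter (OnGrid R)).card ≤ 2 * ((n / R + 1) * n) := by
  have hsub : (box n).filter (OnGrid R) ⊆
      ((Finset.range (n / R + 1)).image (· * R)) ×ˢ Finset.range n ∪
      Finset.range n ×ˢ ((Finset.range (n / R + 1)).image (· * R)) := by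
    intro p hp
    rw [Finset.mem_filter, mem_box] at hp
    have key : ∀ a < n, R ∣ a → a ∈ (Finset.range (n / R + 1)).image (· * R) := by
      rintro a ha ⟨b, rfl⟩
      refine Finset.mem_image.2 ⟨b, ?_, mul_comm _ _⟩
      rw [Finset.mem_range, Nat.lt_succ_iff, Nat.le_div_iff_mul_le hR, mul_comm]
      exact ha.le
    rw [Finset.mem_union, Finset.mem_product, Finset.mem_product]
    rcases hp.2 with h | h
    · exact Or.inl ⟨key _ hp.1.1 h, Finset.mem_range.2 hp.1.2⟩
    · exact Or.inr ⟨Finset.mem_range.2 hp.1.1, key _ hp.1.2 h⟩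
  refine (Finset.card_le_card hsub).trans ((Finset.card_union_le _ _).trans ?_)
  rw [Finset.card_product, Finset.card_product, Finset.card_range]
  have : ((Finset.range (n / R + 1)).image (· * R)).card ≤ n / R + 1 :=
    Finset.card_image_le.trans (Finset.card_range _).le
  nlinarith

/-- The number of pixels that divide a square of side `2 * r` into four. -/
theorem card_dividing_le (r : ℕ) (hr : 0 < r) (c : ℕ × ℕ) (A : Finset (ℕ × ℕ))
    (hA : ∀ p ∈ A, OnGrid r p ∧ tile (r * 2) p = c) : A.card ≤ 4 * (r * 2) := by
  classical
  have hsub : A ⊆ ({c.1 * 2 * r, (c.1 * 2 + 1) * r} : Finset ℕ) ×ˢ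
        Finset.Ico (c.2 * (r * 2)) (c.2 * (r * 2) + r * 2) ∪
      Finset.Ico (c.1 * (r * 2)) (c.1 * (r * 2) + r * 2) ×ˢ
        ({c.2 * 2 * r, (c.2 * 2 + 1) * r} : Finset ℕ) := by
    intro p hp
    obtain ⟨hg, ht⟩ := hA p hp
    have key : ∀ a, r ∣ a → a ∈ ({a / (r * 2) * 2 * r, (a / (r * 2) * 2 + 1) * r} : Finset ℕ) := by
      rintro a ⟨b, rfl⟩
      rw [← Nat.div_div_eq_div_mul, Nat.mul_div_cancel_left b hr, Finset.mem_insert,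
        Finset.mem_singleton, mul_comm r b]
      rcases Nat.even_or_odd' b with ⟨d, rfl | rfl⟩
      · left; congr 1; omega
      · right; congr 1; omega
    have key' : ∀ a, a ∈ Finset.Ico (a / (r * 2) * (r * 2)) (a / (r * 2) * (r * 2) + r * 2) := by
      intro a
      rw [Finset.mem_Ico]
      exact ⟨Nat.div_mul_le_self _ _, Nat.lt_div_mul_add (by omega)⟩
    subst ht
    rw [Finset.mem_union, Finset.mem_product, Finset.mem_product]
    exact hg.imp (fun h => ⟨key _ h, key' _⟩) fun h => ⟨key' _, key _ h⟩
  refine (Finset.card_le_card hsub).trans ((Finset.card_union_le _ _).trans ?_)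
  rw [Finset.card_product, Finset.card_product, Nat.card_Ico, Nat.card_Ico]
  have h1 := Finset.card_le_two (a := c.1 * 2 * r) (b := (c.1 * 2 + 1) * r)
  have h2 := Finset.card_le_two (a := c.2 * 2 * r) (b := (c.2 * 2 + 1) * r)
  simp only [Nat.add_sub_cancel_left]
  nlinarith

open scoped Classical in
theorem card_levelPixel_le (hl : 0 < l) (e : ℕ) :
    ((box n).filter (LevelPixel M rel l e)).card ≤
      4 * (l * 2 ^ (e + 1)) * (badTiles M rel l (e + 1)).card := by
  refine Finset.card_le_mul_card_image_of_maps_to (f := tile (l * 2 ^ (e + 1)))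
    (fun p hp => ?_) _ fun c _ => ?_
  · exact mem_badTiles.2 (Finset.mem_filter.1 hp).2.2
  · rw [pow_succ, ← mul_assoc]
    refine card_dividing_le (l * 2 ^ e) (by positivity) c _ fun p hp => ?_
    rw [Finset.mem_filter, Finset.mem_filter] at hp
    exact ⟨hp.1.2.1, hp.2⟩

open scoped Classical in
theorem card_backbone_le (hl : 0 < l) :
    ((box n).filter (Backbone M rel l J)).card ≤ 2 * ((n / (l * 2 ^ J) + 1) * n) +
      4 * ∑ e ∈ Finset.range J, l * 2 ^ (e + 1) * (badTiles M rel l (e + 1)).card := by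
  have hsub : (box n).filter (Backbone M rel l J) ⊆ (box n).filter (OnGrid (l * 2 ^ J)) ∪
      (Finset.range J).biUnion fun e => (box n).filter (LevelPixel M rel l e) := by
    intro p hp
    rw [Finset.mem_filter] at hp
    rw [Finset.mem_union, Finset.mem_biUnion, Finset.mem_filter]
    rcases hp.2 with h | ⟨e, he, h⟩
    · exact Or.inl ⟨hp.1, h⟩
    · exact Or.inr ⟨e, Finset.mem_range.2 he, Finset.mem_filter.2 ⟨hp.1, h⟩⟩
  refine (Finset.card_le_card hsub).trans ((Finset.card_union_le _ _).trans ?_)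
  refine Nat.add_le_add (card_onGrid_le n _ (by positivity)) (Finset.card_biUnion_le.trans ?_)
  rw [Finset.mul_sum]
  refine Finset.sum_le_sum fun e _ => ?_
  rw [← mul_assoc]
  exact card_levelPixel_le hl e

theorem not_isolated_of_linked {p q : ℕ × ℕ} {r : ℕ} (hrel : ∀ p q, rel p q → rel q p)
    (h : Linked M rel p q) (hn : ¬ Isolated M rel r p) : ¬ Isolated M rel r q :=
  fun hq => hn (hq.of_linked (h.symm hrel))

open scoped Classical in
-- Paint the backbone and erase the isolated black pixels. Being isolated is constant along a chain
-- of linked pixels, so the chain from a remaining pixel to the backbone survives the erasure.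
theorem absoluteDistance_le_of_adj :
    absoluteDistance M (connectedImages n) ≤ ((box n).filter (Backbone M Adj l J)).card +
      ((box n).filter (Isolated M Adj l)).card := by
  set S : Set (ℕ × ℕ) := {p | p ∈ box n ∧ (Backbone M Adj l J p ∨ (Black M p ∧
    ¬ Isolated M Adj l p))} with hS
  refine (absoluteDistance_le (S := S) (fun p hp => hp.1) (0, 0) ?_
    ((box n).filter (Backbone M Adj l J) ∪ (box n).filter (Isolated M Adj l)) ?_).trans
    (Finset.card_union_le _ _)
  · have hback : ∀ p ∈ box n, Backbone M Adj l J p → Joined S p (0, 0) := fun p hp h =>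
      joined_of_backbone (S := S) (fun q hq hb => ⟨hq, Or.inl hb⟩) hp h
    rintro p ⟨hp, h | ⟨h1, h2⟩⟩
    · exact hback p hp h
    · obtain ⟨g, hg, hl⟩ := exists_backbone_linked (J := J) h1 h2
      have hgb := (hl.black h1).mem_box
      refine Relation.ReflTransGen.trans ?_ (hback g hgb hg)
      induction hl using Relation.ReflTransGen.head_induction_on with
      | refl => exact .refl
      | @head a b hab _ ih =>
        have hb : ¬ Isolated M Adj l b :=
          not_isolated_of_linked (fun _ _ => Adj.symm) (.single hab) h2
        exact .head ⟨hab.1, ⟨hp, Or.inr ⟨h1, h2⟩⟩, ⟨hab.2.2.mem_box, Or.inr ⟨hab.2.2, hb⟩⟩⟩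
          (ih hab.2.2.mem_box hab.2.2 hb)
  · rintro p hp (⟨h1, h2⟩ | ⟨⟨-, h1⟩, h2⟩)
    · refine Finset.mem_union_right _ (Finset.mem_filter.2 ⟨hp, ?_⟩)
      by_contra h
      exact h2 ⟨hp, Or.inr ⟨h1, h⟩⟩
    · exact Finset.mem_union_left _ (Finset.mem_filter.2 ⟨hp, h1.resolve_right fun h => h2 h.1⟩)

open scoped Classical in
/-- The component of `p`. -/
noncomputable def component (M : Image n) (p : ℕ × ℕ) : Finset (ℕ × ℕ) :=
  (box n).filter (Linked M Adj p)

theorem mem_component {p q : ℕ × ℕ} (hp : Black M p) : q ∈ component M p ↔ Linked M Adj p q := by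
  classical
  rw [component, Finset.mem_filter]
  exact ⟨fun h => h.2, fun h => ⟨(h.black hp).mem_box, h⟩⟩

theorem component_eq {p q : ℕ × ℕ} (h : Linked M Adj p q) : component M p = component M q := by
  classical
  unfold component
  refine Finset.filter_congr fun z _ => ?_
  exact ⟨fun hz => (h.symm fun _ _ => Adj.symm).trans hz, fun hz => h.trans hz⟩

open scoped Classical in
/-- The components that lie inside of the squares of side `R`. -/
noncomputable def components (M : Image n) (R : ℕ) : Finset (Finset (ℕ × ℕ)) :=
  ((box n).filter (Isolated M Adj R)).image (component M)

theorem component_mem_components {p : ℕ × ℕ} (h : Isolated M Adj R p) :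
    component M p ∈ components M R := by
  classical
  exact Finset.mem_image_of_mem _ (Finset.mem_filter.2 ⟨h.1.mem_box, h⟩)

/-- The backbone is reached from `p` by `m` steps. -/
def Steps (M : Image n) (rel : ℕ × ℕ → ℕ × ℕ → Prop) (F : ℕ × ℕ → Prop) : ℕ → ℕ × ℕ → Prop
  | 0, p => F p
  | m + 1, p => ∃ q, (rel p q ∧ Black M p ∧ Black M q) ∧ Steps M rel F m q

theorem exists_steps {F : ℕ × ℕ → Prop} {p g : ℕ × ℕ} (h : Linked M rel p g) (hg : F g) :
    ∃ m, Steps M rel F m p := by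
  induction h using Relation.ReflTransGen.head_induction_on with
  | refl => exact ⟨0, hg⟩
  | head h _ ih =>
    obtain ⟨m, hm⟩ := ih
    exact ⟨m + 1, _, h, hm⟩

theorem Steps.exists_linked {F : ℕ × ℕ → Prop} {m : ℕ} {p : ℕ × ℕ} (h : Steps M rel F m p) :
    ∃ g, F g ∧ Linked M rel p g := by
  induction m generalizing p with
  | zero => exact ⟨p, h, .refl⟩
  | succ m ih =>
    obtain ⟨q, hq, hs⟩ := h
    obtain ⟨g, hg, hl⟩ := ih hs
    exact ⟨g, hg, .head hq hl⟩

theorem CellRel.le {p q : ℕ × ℕ} (h : CellRel l p q) :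
    (p.1 ≤ q.1 + l ∧ q.1 ≤ p.1 + l) ∧ (p.2 ≤ q.2 + l ∧ q.2 ≤ p.2 + l) := by
  obtain ⟨c, ⟨⟨h1, h2⟩, h3, h4⟩, ⟨h5, h6⟩, h7, h8⟩ := h
  omega

/-- A short path from a component to a component that is closer to `F`. -/
theorem exists_link (l : ℕ) (F : ℕ × ℕ → Prop) (C : Finset (ℕ × ℕ)) :
    ∃ P ⊆ box n, P.card ≤ 2 * l + 2 ∧ (∀ m, (∃ p ∈ C, Steps M (CellRel l) F (m + 1) p) →
      (∀ p ∈ C, ∀ j ≤ m, ¬ Steps M (CellRel l) F j p) →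
      ∃ p ∈ C, ∃ q, CellRel l p q ∧ Black M p ∧ Black M q ∧ Steps M (CellRel l) F m q ∧
        Joined P p q) ∧ ∀ z ∈ P, ∃ q m, Black M q ∧ Steps M (CellRel l) F m q ∧ Joined P z q := by
  by_cases h : ∃ m, (∃ p ∈ C, Steps M (CellRel l) F (m + 1) p) ∧
      ∀ p ∈ C, ∀ j ≤ m, ¬ Steps M (CellRel l) F j p
  · obtain ⟨m, ⟨p, hp, q, ⟨hpq, h1, h2⟩, hq⟩, hmin⟩ := h
    obtain ⟨P, hP, hcard, hpP, hj⟩ := exists_path h1.mem_box h2.mem_box hpq.le.1 hpq.le.2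
    refine ⟨P, hP, hcard, ?_, fun z hz => ⟨q, m, h2, hq, hj z hz⟩⟩
    rintro m' ⟨p', hp', hs⟩ hmin'
    -- Both `m + 1` and `m' + 1` are the least number of steps from `C` to `F`. So one path per
    -- component serves every `m` in the conclusion.
    have hm : m' = m := by
      rcases lt_trichotomy m' m with hlt | rfl | hlt
      · exact absurd hs (hmin p' hp' _ hlt)
      · rfl
      · exact absurd ⟨q, ⟨hpq, h1, h2⟩, hq⟩ (hmin' p hp (m + 1) hlt)
    subst hm
    exact ⟨p, hp, q, hpq, h1, h2, hq, hj p hpP⟩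
  · exact ⟨∅, Finset.empty_subset _, by simp, fun m h1 h2 => absurd ⟨m, h1, h2⟩ h,
      by simp⟩

theorem Adj.cellRel (hl : 0 < l) {p q : ℕ × ℕ} (h : Adj p q) : CellRel l p q := by
  have key : ∀ a : ℕ, a / l * l ≤ a ∧ a < a / l * l + l := fun a =>
    ⟨Nat.div_mul_le_self _ _, Nat.lt_div_mul_add hl⟩
  have h1 := key (min p.1 q.1)
  have h2 := key (min p.2 q.2)
  refine ⟨(min p.1 q.1 / l, min p.2 q.2 / l), ?_⟩
  unfold InCell
  unfold Adj at h
  simp only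
  omega

open scoped Classical in
-- A `CellRel` step need not be a path of pixels, so besides the backbone one short link per
-- component is painted, from a pixel with the fewest steps to the backbone. Strong induction on the
-- number of steps then walks any remaining black pixel home: inside its component to the best
-- pixel, over the link to another component, and so on. The pixels of the links themselves are
-- joined to black pixels linked to the backbone.
theorem absoluteDistance_le_of_cellRel (hl : 0 < l) :
    absoluteDistance M (connectedImages n) ≤
      ((box n).filter (Backbone M (CellRel l) l J)).card +
      ((box n).filter (Isolated M (CellRel l) l)).card +
      (2 * l + 2) * (components M (l * 2 ^ J)).card := by
  choose P hPbox hPcard hP hPj using exists_link (M := M) l (Backbone M (CellRel l) l J)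
  set U : Finset (ℕ × ℕ) := (components M (l * 2 ^ J)).biUnion P with hU
  set S : Set (ℕ × ℕ) := {p | p ∈ box n ∧ (Backbone M (CellRel l) l J p ∨ (Black M p ∧
    ¬ Isolated M (CellRel l) l p) ∨ p ∈ U)} with hS
  have hUcard : U.card ≤ (2 * l + 2) * (components M (l * 2 ^ J)).card := by
    rw [mul_comm]
    exact Finset.card_biUnion_le_card_mul _ _ _ fun C _ => hPcard C
  have hni : ∀ {p q}, Linked M Adj p q → ¬ Isolated M (CellRel l) l p →
      ¬ Isolated M (CellRel l) l q := fun {p q} h hn =>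
    not_isolated_of_linked (fun _ _ => CellRel.symm)
      (Relation.ReflTransGen.mono (fun _ _ h => ⟨Adj.cellRel hl h.1, h.2⟩) _ _ h) hn
  have hback : ∀ p ∈ box n, Backbone M (CellRel l) l J p → Joined S p (0, 0) := fun p hp h =>
    joined_of_backbone (S := S) (fun q hq hb => ⟨hq, Or.inl hb⟩) hp h
  have hjoin : ∀ {p q}, Black M p → ¬ Isolated M (CellRel l) l p → Linked M Adj p q →
      Joined S p q := by
    intro p q hp hn h
    induction h with
    | refl => exact .refl
    | tail h h' ih =>
      exact ih.tail ⟨h'.1, ⟨h'.2.1.mem_box, Or.inr (Or.inl ⟨h'.2.1, hni h hn⟩)⟩,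
        h'.2.2.mem_box, Or.inr (Or.inl ⟨h'.2.2, hni (h.tail h') hn⟩)⟩
  have key : ∀ m p, Steps M (CellRel l) (Backbone M (CellRel l) l J) m p → Black M p →
      ¬ Isolated M (CellRel l) l p → Joined S p (0, 0) := by
    intro m
    induction m using Nat.strong_induction_on with
    | _ m ih =>
      intro p hm hp hn
      by_cases hsmall : ∃ q ∈ component M p, ∃ j < m,
          Steps M (CellRel l) (Backbone M (CellRel l) l J) j q
      · obtain ⟨q, hq, j, hj, hs⟩ := hsmall
        rw [mem_component hp] at hq
        exact (hjoin hp hn hq).trans (ih j hj q hs (hq.black hp) (hni hq hn))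
      · push Not at hsmall
        cases m with
        | zero => exact hback p hp.mem_box hm
        | succ m =>
          -- A component that touches the coarsest grid is attached to the backbone directly. Thus
          -- links are paid only for components that lie inside of a square of side `R`.
          by_cases hi : Isolated M Adj (l * 2 ^ J) p
          · obtain ⟨q, hq, q', h1, h2, h3, h4, h5⟩ := hP (component M p) m
              ⟨p, (mem_component hp).2 .refl, hm⟩
              fun z hz j hj => hsmall z hz j (by omega)
            rw [mem_component hp] at hq
            have hq' : ¬ Isolated M (CellRel l) l q' := not_isolated_of_linked
              (fun _ _ => CellRel.symm) (.single ⟨h1, h2, h3⟩) (hni hq hn)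
            refine ((hjoin hp hn hq).trans (h5.mono fun z hz => ?_)).trans
              (ih m (by omega) q' h4 h3 hq')
            exact ⟨hPbox _ hz, Or.inr (Or.inr (Finset.mem_biUnion.2
              ⟨_, component_mem_components hi, hz⟩))⟩
          · unfold Isolated at hi
            push Not at hi
            obtain ⟨q, hq, hg⟩ := hi hp
            exact (hjoin hp hn hq).trans (hback q (hq.black hp).mem_box (Or.inl hg))
  have hblack : ∀ p, Black M p → ¬ Isolated M (CellRel l) l p → Joined S p (0, 0) := by
    intro p hp hn
    obtain ⟨g, hg, hlk⟩ := exists_backbone_linked (J := J) hp hn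
    obtain ⟨m, hm⟩ := exists_steps hlk hg
    exact key m p hm hp hn
  refine (absoluteDistance_le (S := S) (fun p hp => hp.1) (0, 0) ?_
    ((box n).filter (Backbone M (CellRel l) l J) ∪ (box n).filter (Isolated M (CellRel l) l) ∪ U)
    ?_).trans ((Finset.card_union_le _ _).trans
      (Nat.add_le_add (Finset.card_union_le _ _) hUcard))
  · rintro p ⟨hp, h | h | h⟩
    · exact hback p hp h
    · exact hblack p h.1 h.2
    · obtain ⟨C, hC, hz⟩ := Finset.mem_biUnion.1 h
      obtain ⟨q, m, hq, hs, hj⟩ := hPj C p hz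
      obtain ⟨g, hg, hlk⟩ := hs.exists_linked
      refine (hj.mono fun z hz => ?_).trans (hblack q hq fun hi => hi.2 g hlk hg.onGrid)
      exact ⟨hPbox _ hz, Or.inr (Or.inr (Finset.mem_biUnion.2 ⟨C, hC, hz⟩))⟩
  · rintro p hp (⟨h1, h2⟩ | ⟨⟨-, h1⟩, h2⟩)
    · refine Finset.mem_union_left _ (Finset.mem_union_right _ (Finset.mem_filter.2 ⟨hp, ?_⟩))
      by_contra h
      exact h2 ⟨hp, Or.inr (Or.inl ⟨h1, h⟩)⟩
    · rcases h1 with h1 | h1 | h1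
      · exact Finset.mem_union_left _ (Finset.mem_union_left _ (Finset.mem_filter.2 ⟨hp, h1⟩))
      · exact absurd h1.1 h2
      · exact Finset.mem_union_right _ h1

end ImageTesting

namespace ImageTesting

variable {n : ℕ} {M : Image n} {rel : ℕ × ℕ → ℕ × ℕ → Prop} {l J R K N k : ℕ} {ε : ℝ}

/-! ### Samples that detect a component -/

open scoped Classical in
/-- The pixels whose square of the level of the sample `t` is detected. -/
noncomputable def levelSet (M : Image n) (rel : ℕ × ℕ → ℕ × ℕ → Prop) (l J N t : ℕ) :
    Finset (ℕ × ℕ) :=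
  (box N).filter fun q => (∃ p, Isolated M rel (side l J t) p ∧ OnGrid l p ∧
    tile (side l J t) p = tile (side l J t) q) ∨ Isolated M rel (side l J t) q

/-- As `r` divides `N`, no square is cut off by the boundary of the sampled region. This is the
reason for sampling from the padded side instead of from the image. -/
theorem card_tile_filter {r N : ℕ} {c p : ℕ × ℕ} (hr : 0 < r) (hN : r ∣ N) (hp : p ∈ box N)
    (hc : tile r p = c) : r * r ≤ ((box N).filter fun q => tile r q = c).card := by
  subst hc
  have hsub : Finset.Ico (p.1 / r * r) (p.1 / r * r + r) ×ˢ
      Finset.Ico (p.2 / r * r) (p.2 / r * r + r) ⊆ (box N).filter fun q => tile r q = tile r p := by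
    intro q hq
    simp only [Finset.mem_product, Finset.mem_Ico] at hq
    have key : ∀ a b, a < N → a / r * r ≤ b → b < a / r * r + r → b < N ∧ b / r = a / r := by
      intro a b ha h1 h2
      obtain ⟨d, rfl⟩ := hN
      have h3 : a / r < d := Nat.div_lt_of_lt_mul ha
      have h4 : a / r * r + r ≤ r * d := by nlinarith
      refine ⟨by omega, ?_⟩
      rw [Nat.div_eq_iff hr]
      omega
    rw [mem_box] at hp
    obtain ⟨h1, h2⟩ := key _ _ hp.1 hq.1.1 hq.1.2
    obtain ⟨h3, h4⟩ := key _ _ hp.2 hq.2.1 hq.2.2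
    rw [Finset.mem_filter, mem_box]
    exact ⟨⟨h1, h3⟩, by simp only [tile, h2, h4]⟩
  refine le_trans (le_of_eq ?_) (Finset.card_le_card hsub)
  rw [Finset.card_product, Nat.card_Ico, Nat.card_Ico, Nat.add_sub_cancel_left,
    Nat.add_sub_cancel_left]

/-- Every pixel of a bad square is a good sample at that level, black or white and inside of the
image or not. -/
theorem card_badTiles_le (hl : 0 < l) (hn : n ≤ N) {e t : ℕ} (ht : side l J t = l * 2 ^ e)
    (hN : l * 2 ^ e ∣ N) :
    (l * 2 ^ e) * (l * 2 ^ e) * (badTiles M rel l e).card ≤ (levelSet M rel l J N t).card := by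
  classical
  have hsub : (box N).filter (fun q => tile (l * 2 ^ e) q ∈ badTiles M rel l e) ⊆
      levelSet M rel l J N t := by
    intro q hq
    rw [Finset.mem_filter, mem_badTiles] at hq
    rw [levelSet, Finset.mem_filter, ht]
    exact ⟨hq.1, Or.inl hq.2⟩
  refine le_trans ?_ (Finset.card_le_card hsub)
  refine Finset.mul_card_image_le_card_of_maps_to (f := tile (l * 2 ^ e))
    (fun q hq => (Finset.mem_filter.1 hq).2) _ fun c hc => ?_
  obtain ⟨p, hp, hg, hpc⟩ := mem_badTiles.1 hc
  have hb := mem_box.1 hp.1.mem_box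
  refine (card_tile_filter (by positivity) hN (mem_box.2 ⟨by omega, by omega⟩) hpc).trans
    (Finset.card_le_card fun q hq => ?_)
  rw [Finset.mem_filter] at hq
  rw [Finset.mem_filter, Finset.mem_filter]
  exact ⟨⟨hq.1, hq.2 ▸ hc⟩, hq.2⟩

theorem sum_Ico_dyadic (f : ℕ → ℕ) (a m : ℕ) : ∑ t ∈ Finset.Ico a (a * 2 ^ m), f t =
    ∑ i ∈ Finset.range m, ∑ t ∈ Finset.Ico (a * 2 ^ i) (a * 2 ^ (i + 1)), f t := by
  induction m with
  | zero => simp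
  | succ m ih =>
    rw [Finset.sum_range_succ, ← ih, Finset.sum_Ico_consecutive]
    · exact Nat.le_mul_of_pos_right a (by positivity)
    · exact Nat.mul_le_mul_left a (Nat.pow_le_pow_right (by norm_num) (by omega))

theorem log_of_mem_Ico {i t : ℕ} (ht : t ∈ Finset.Ico (256 * 2 ^ i) (256 * 2 ^ (i + 1))) :
    Nat.log 2 t = 8 + i := by
  rw [Finset.mem_Ico, show 256 = 2 ^ 8 by norm_num, ← pow_add, ← pow_add] at ht
  exact Nat.log_eq_of_pow_le_of_lt_pow ht.1 ht.2

open scoped Classical in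
-- Level `i` has `256 * 2 ^ i` samples and squares of side `r = l * 2 ^ (J - i)`; since `2 ^ i * r =
-- R`, a bad square contributes `256 * 2 ^ i * r² = 256 * R * r`. From number `256 * 2 ^ J` on the
-- side is `l`; at least `256 * R` samples remain there, and each can hit an isolated pixel itself.
theorem sum_card_levelSet_ge (hl : 0 < l) (hR : R = l * 2 ^ J) (hn : n ≤ N) (hN : R ∣ N) :
    256 * R * (∑ e ∈ Finset.range J, l * 2 ^ (e + 1) * (badTiles M rel l (e + 1)).card +
      ((box n).filter (Isolated M rel l)).card) ≤
    ∑ t ∈ Finset.Ico 256 (512 * R), (levelSet M rel l J N t).card := by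
  have hpow : 2 ^ J ≤ R := by rw [hR]; exact Nat.le_mul_of_pos_left _ hl
  rw [← Finset.sum_Ico_consecutive _ (Nat.le_mul_of_pos_right 256 (by positivity : 0 < 2 ^ J))
    (by omega), sum_Ico_dyadic, mul_add, Finset.mul_sum,
    ← Finset.sum_range_reflect (fun e => 256 * R * (l * 2 ^ (e + 1) *
      (badTiles M rel l (e + 1)).card))]
  refine Nat.add_le_add (Finset.sum_le_sum fun i hi => ?_) ?_
  · rw [Finset.mem_range] at hi
    have hJ : J - 1 - i + 1 = J - i := by omega
    rw [hJ]
    refine le_trans ?_ (Finset.card_nsmul_le_sum _ _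
      ((l * 2 ^ (J - i)) * (l * 2 ^ (J - i)) * (badTiles M rel l (J - i)).card) fun t ht => ?_)
    · rw [Nat.card_Ico, smul_eq_mul, pow_succ]
      have e1 : 256 * (2 ^ i * 2) - 256 * 2 ^ i = 256 * 2 ^ i := by omega
      have e2 : R = 2 ^ i * (l * 2 ^ (J - i)) := by
        rw [hR, mul_left_comm, ← pow_add, Nat.add_sub_cancel' hi.le]
      rw [e1, e2]
      apply le_of_eq
      ring
    · refine card_badTiles_le hl hn ?_ (dvd_trans ?_ hN)
      · rw [side, log_of_mem_Ico ht]
        congr 2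
        omega
      · rw [hR]
        exact Nat.mul_dvd_mul_left l (pow_dvd_pow 2 (by omega))
  · refine le_trans ?_ (Finset.card_nsmul_le_sum _ _
      ((box n).filter (Isolated M rel l)).card fun t ht => ?_)
    · rw [Nat.card_Ico, smul_eq_mul]
      exact Nat.mul_le_mul_right _ (by omega)
    · rw [Finset.mem_Ico] at ht
      have hside : side l J t = l := by
        have : J + 8 ≤ Nat.log 2 t := by
          refine Nat.le_log_of_pow_le (by norm_num) (le_trans (le_of_eq ?_) ht.1)
          rw [pow_add]; norm_num [mul_comm]
        rw [side, Nat.sub_eq_zero_of_le this]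
        simp
      refine Finset.card_le_card fun q hq => ?_
      rw [Finset.mem_filter, mem_box] at hq
      rw [levelSet, Finset.mem_filter, hside, mem_box]
      exact ⟨⟨by omega, by omega⟩, Or.inr hq.2⟩

open scoped Classical in
theorem filter_component_eq {C : Finset (ℕ × ℕ)} (hC : C ∈ components M R) :
    ((box n).filter fun q => Isolated M Adj R q ∧ component M q = C) = C := by
  obtain ⟨p, hp, rfl⟩ := Finset.mem_image.1 hC
  rw [Finset.mem_filter] at hp
  ext q
  rw [Finset.mem_filter, mem_component hp.2.1]
  constructor
  · rintro ⟨-, h1, h2⟩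
    rw [← mem_component hp.2.1, ← h2, mem_component h1.1]
    exact .refl
  · intro h
    have hq := hp.2.of_linked h
    exact ⟨hq.1.mem_box, hq, (component_eq h).symm⟩

open scoped Classical in
theorem card_filter_component (φ : Finset (ℕ × ℕ) → Prop) [DecidablePred φ] :
    ((box n).filter fun q => Isolated M Adj R q ∧ φ (component M q)).card =
      ∑ C ∈ (components M R).filter φ, C.card := by
  rw [Finset.card_eq_sum_card_fiberwise (f := component M) (t := (components M R).filter φ)]
  · refine Finset.sum_congr rfl fun C hC => ?_
    rw [Finset.mem_filter] at hC
    conv_rhs => rw [← filter_component_eq hC.1]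
    congr 1
    ext q
    simp only [Finset.mem_filter]
    constructor
    · rintro ⟨⟨h1, h2, -⟩, h3⟩
      exact ⟨h1, h2, h3⟩
    · rintro ⟨h1, h2, h3⟩
      exact ⟨⟨h1, h2, h3 ▸ hC.2⟩, h3⟩
  · intro q hq
    rw [Finset.mem_coe, Finset.mem_filter] at hq
    exact Finset.mem_coe.2 (Finset.mem_filter.2 ⟨component_mem_components hq.2.1, hq.2.2⟩)

open scoped Classical in
/-- The pixels whose component is explored completely from the sample `t`. -/
noncomputable def componentSet (M : Image n) (R K t : ℕ) : Finset (ℕ × ℕ) :=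
  (box n).filter fun q => Isolated M Adj R q ∧ (component M q).card * t ≤ K

theorem componentDet_of_mem {L : List (ℕ × ℕ)} {t : ℕ} (ht : 0 < t)
    (h : L.getD t 0 ∈ componentSet M R K t) : ComponentDet M R K L t := by
  classical
  rw [componentSet, Finset.mem_filter] at h
  refine ⟨h.2.1, fun A hA => ?_⟩
  refine (Finset.card_le_card fun p hp => ?_).trans ((Nat.le_div_iff_mul_le ht).2 h.2.2)
  exact (mem_component h.2.1.1).2 (hA p hp)

open scoped Classical in
-- A component `C` is explored completely from a sample `t ≤ K / |C|`, so it contributes `|C| * ⌊K /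
-- |C|⌋`, which is at least `K / 2` when `|C| ≤ K`. The harmonic budget `K / t` thus treats all
-- sizes alike.
theorem card_smallComponents_le : K * ((components M R).filter fun C => C.card ≤ K).card ≤
    2 * ∑ t ∈ Finset.Ico 1 (K + 1), (componentSet M R K t).card := by
  have h1 : ∀ t, (componentSet M R K t).card =
      ∑ C ∈ components M R, if C.card * t ≤ K then C.card else 0 := by
    intro t
    rw [componentSet, card_filter_component fun C => C.card * t ≤ K, Finset.sum_filter]
  simp only [h1]
  rw [Finset.sum_comm, Finset.mul_sum, mul_comm, ← smul_eq_mul, ← Finset.sum_const,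
    Finset.sum_filter]
  refine Finset.sum_le_sum fun C hC => ?_
  split_ifs with hle
  · have hpos : 0 < C.card := by
      rw [Finset.card_pos, ← filter_component_eq hC]
      obtain ⟨p, hp, rfl⟩ := Finset.mem_image.1 hC
      rw [Finset.mem_filter] at hp
      exact ⟨p, Finset.mem_filter.2 ⟨hp.1, hp.2, rfl⟩⟩
    have h2 : K / C.card * C.card ≤
        ∑ t ∈ Finset.Ico 1 (K + 1), if C.card * t ≤ K then C.card else 0 := by
      rw [← Finset.sum_filter, Finset.sum_const, smul_eq_mul]
      refine Nat.mul_le_mul_right _ ?_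
      have h3 : Finset.Ico 1 (K / C.card + 1) ⊆
          (Finset.Ico 1 (K + 1)).filter fun t => C.card * t ≤ K := by
        intro t ht
        rw [Finset.mem_Ico, Nat.lt_succ_iff, Nat.le_div_iff_mul_le hpos] at ht
        rw [Finset.mem_filter, Finset.mem_Ico]
        have : t ≤ t * C.card := Nat.le_mul_of_pos_right _ hpos
        exact ⟨⟨ht.1, by omega⟩, by rw [mul_comm]; exact ht.2⟩
      refine le_trans (le_of_eq ?_) (Finset.card_le_card h3)
      simp
    have h4 := Nat.lt_div_mul_add (a := K) hpos
    have h5 : C.card ≤ K / C.card * C.card :=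
      Nat.le_mul_of_pos_left _ (Nat.div_pos hle hpos)
    omega
  · exact Nat.zero_le _

open scoped Classical in
-- Components are disjoint. With `K = 256 * l * R` there are too few large ones for their links to
-- matter.
theorem card_largeComponents_le :
    K * ((components M R).filter fun C => ¬ C.card ≤ K).card ≤ n * n := by
  rw [mul_comm, ← card_box, ← smul_eq_mul]
  refine (Finset.card_nsmul_le_sum _ (fun C => C.card) K fun C hC => ?_).trans ?_
  · have := (Finset.mem_filter.1 hC).2
    omega
  · rw [← card_filter_component fun C => ¬ C.card ≤ K]
    exact Finset.card_filter_le _ _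

/-- The sizes in the analysis of the testers. -/
structure Scale (n k R N : ℕ) (ε : ℝ) : Prop where
  pos : 0 < ε
  lt_one : ε < 1
  one_le : 1 ≤ k * ε
  le : k * ε ≤ 3 / 2
  large : 64 ≤ ε ^ 3 * (n : ℝ) ^ 2
  le_side : 4 * k ≤ R
  side_le : 2 * R ≤ 9 * k
  le_padded : n ≤ N
  padded_le : N ≤ 2 * n
  dvd : R ∣ N

theorem Scale.sq_le (h : Scale n k R N ε) : (9 / 4 : ℝ) * (N : ℝ) ^ 2 ≤ 9 * (n : ℝ) ^ 2 := by
  have h1 : (N : ℝ) ≤ 2 * n := by exact_mod_cast h.padded_le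
  have h2 : (N : ℝ) ^ 2 ≤ (2 * n) ^ 2 := by gcongr
  nlinarith

theorem Scale.four_le (h : Scale n k R N ε) : 4 ≤ R * ε := by
  have h1 : 4 * (k : ℝ) ≤ R := by exact_mod_cast h.le_side
  nlinarith [h.pos, h.one_le]

/-- From `R ε ≥ 4` comes `n / R ≤ ε n / 4`, and from `ε³ n² ≥ 64` comes `1 ≤ ε n / 8`; twice the sum
of the two is the factor `3/4`. A quarter of the distance is left for everything else. -/
theorem Scale.grid_le (h : Scale n k R N ε) :
    ((2 * ((n / R + 1) * n) : ℕ) : ℝ) ≤ 3 / 4 * (ε * (n : ℝ) ^ 2) := by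
  have hR := h.four_le
  have hε := h.pos
  have hRpos : (0 : ℝ) < R := by
    by_contra hc
    nlinarith
  have h1 : ((n / R : ℕ) : ℝ) ≤ n * ε / 4 := by
    refine (Nat.cast_div_le).trans ?_
    rw [div_le_iff₀ hRpos]
    have : (0 : ℝ) ≤ n := Nat.cast_nonneg n
    nlinarith
  have hn : (8 : ℝ) ≤ ε * n := by
    have h0 : 0 ≤ ε * n := by positivity
    have h2 : (64 : ℝ) ≤ (ε * n) ^ 2 := by
      refine h.large.trans ?_
      have : ε ^ 3 ≤ ε ^ 2 := pow_le_pow_of_le_one hε.le h.lt_one.le (by norm_num)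
      nlinarith [sq_nonneg (n : ℝ)]
    nlinarith
  have h0 : (0 : ℝ) ≤ n := Nat.cast_nonneg n
  push_cast
  nlinarith

/-- The remaining quarter gives `4 x + y ≥ ε n² / 4`, hence `x + y ≥ ε n² / 16`. With the factor
`256 R` and `R ε ≥ 4` this is at least `64 n²`, well above the required `9 n²`. -/
theorem nonadaptive_sum_ge (h : Scale n k R N ε) (hl : 0 < l) (hR : R = l * 2 ^ J)
    (hfar : ε * (n : ℝ) ^ 2 ≤ absoluteDistance M (connectedImages n)) :
    (9 / 4 : ℝ) * (N : ℝ) ^ 2 ≤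
      (∑ t ∈ Finset.Ico 256 (512 * R), (levelSet M Adj l J N t).card : ℕ) := by
  classical
  have h1 := (absoluteDistance_le_of_adj (M := M) (l := l) (J := J)).trans
    (Nat.add_le_add_right (card_backbone_le hl) _)
  have h2 := sum_card_levelSet_ge (M := M) (rel := Adj) hl hR h.le_padded h.dvd
  rw [← hR] at h1
  have h3 := h.grid_le
  have h4 := h.sq_le
  have h5 := h.four_le
  have h1' : (absoluteDistance M (connectedImages n) : ℝ) ≤ _ := Nat.cast_le.2 h1
  have h2' : _ ≤ ((∑ t ∈ Finset.Ico 256 (512 * R), (levelSet M Adj l J N t).card : ℕ) : ℝ) :=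
    Nat.cast_le.2 h2
  generalize (∑ t ∈ Finset.Ico 256 (512 * R), (levelSet M Adj l J N t).card) = u at *
  generalize (∑ e ∈ Finset.range J, l * 2 ^ (e + 1) * (badTiles M Adj l (e + 1)).card) = x at *
  generalize ((box n).filter (Isolated M Adj l)).card = y at *
  rw [Nat.cast_add, Nat.cast_add] at h1'
  push_cast at h1' h2' h3
  have hx : (0 : ℝ) ≤ x := Nat.cast_nonneg x
  have hxy : ε * (n : ℝ) ^ 2 / 16 ≤ x + y := by nlinarith [Nat.cast_nonneg (α := ℝ) y]
  have h6 : (R : ℝ) * (ε * (n : ℝ) ^ 2 / 16) ≤ R * (x + y) := by gcongr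
  have h7 : 4 * (n : ℝ) ^ 2 ≤ R * ε * (n : ℝ) ^ 2 := by gcongr
  nlinarith

/-- Bad squares with isolated pixels and links share the remaining quarter of the distance. If `4 x
+ y` is at least `ε n² / 9`, the samples of the squares suffice; otherwise the links are expensive,
so there are many small components. -/
theorem adaptive_sum_ge (h : Scale n k R N ε) (hl : 8 ≤ l) (hR : R = l * 2 ^ J)
    (hK : K = 256 * l * R)
    (hfar : ε * (n : ℝ) ^ 2 ≤ absoluteDistance M (connectedImages n)) :
    (9 / 4 : ℝ) * (N : ℝ) ^ 2 ≤
      (∑ t ∈ Finset.Ico 256 (512 * R), (levelSet M (CellRel l) l J N t).card : ℕ) ∨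
    (9 / 4 : ℝ) * (N : ℝ) ^ 2 ≤
      (∑ t ∈ Finset.Ico 1 (K + 1), (componentSet M R K t).card : ℕ) := by
  classical
  have h1 := (absoluteDistance_le_of_cellRel (M := M) (l := l) (J := J) (by omega)).trans
    (Nat.add_le_add_right (Nat.add_le_add_right (card_backbone_le (by omega)) _) _)
  have h2 := sum_card_levelSet_ge (M := M) (rel := CellRel l) (by omega) hR h.le_padded h.dvd
  rw [← hR, ← Finset.card_filter_add_card_filter_not (s := components M R)
    (fun C => C.card ≤ K)] at h1
  have hs := card_smallComponents_le (M := M) (R := R) (K := K)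
  have hb := card_largeComponents_le (M := M) (R := R) (K := K)
  have h3 := h.grid_le
  have h4 := h.sq_le
  have h5 := h.four_le
  have h1' : (absoluteDistance M (connectedImages n) : ℝ) ≤ _ := Nat.cast_le.2 h1
  have h2' : _ ≤ ((∑ t ∈ Finset.Ico 256 (512 * R), (levelSet M (CellRel l) l J N t).card : ℕ) :
    ℝ) := Nat.cast_le.2 h2
  generalize (∑ t ∈ Finset.Ico 256 (512 * R), (levelSet M (CellRel l) l J N t).card) = u at *
  generalize (∑ t ∈ Finset.Ico 1 (K + 1), (componentSet M R K t).card) = v at *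
  generalize (∑ e ∈ Finset.range J, l * 2 ^ (e + 1) * (badTiles M (CellRel l) l (e + 1)).card) = x
    at *
  generalize ((box n).filter (Isolated M (CellRel l) l)).card = y at *
  generalize ((components M R).filter fun C => C.card ≤ K).card = a at *
  generalize ((components M R).filter fun C => ¬ C.card ≤ K).card = b at *
  have hs' : (K : ℝ) * a ≤ 2 * v := by exact_mod_cast hs
  have hb' : (K : ℝ) * b ≤ n * n := by exact_mod_cast hb
  have hK' : (K : ℝ) = 256 * l * R := by exact_mod_cast hK
  have hl' : (8 : ℝ) ≤ l := by exact_mod_cast hl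
  rw [Nat.cast_add, Nat.cast_add, Nat.cast_add] at h1'
  push_cast at h1' h2' h3
  rw [hK'] at hs' hb'
  have hε := h.pos
  have hx : (0 : ℝ) ≤ x := Nat.cast_nonneg x
  have hy : (0 : ℝ) ≤ y := Nat.cast_nonneg y
  have ha : (0 : ℝ) ≤ a := Nat.cast_nonneg a
  have hb0 : (0 : ℝ) ≤ b := Nat.cast_nonneg b
  have hn0 : (0 : ℝ) ≤ (n : ℝ) ^ 2 := sq_nonneg _
  have h7 : 4 * (n : ℝ) ^ 2 ≤ R * ε * (n : ℝ) ^ 2 := by gcongr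
  -- The `b` large components have more than `K = 256 l R` pixels each; combined with `R ε ≥ 4`,
  -- their links cost a negligible part of `ε n²`.
  have hlb : (l : ℝ) * b * 1024 ≤ ε * (n : ℝ) ^ 2 := by
    have h8 : (256 * l * R * b) * ε ≤ (n : ℝ) ^ 2 * ε := by
      refine mul_le_mul_of_nonneg_right (hb'.trans (le_of_eq (by ring))) hε.le
    have h9 : 4 * (256 * l * b) ≤ (R * ε) * (256 * l * b) := by gcongr
    nlinarith
  by_cases hc : ε * (n : ℝ) ^ 2 / 9 ≤ 4 * x + y
  · left
    have h6 : (R : ℝ) * (ε * (n : ℝ) ^ 2 / 36) ≤ R * (x + y) := by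
      refine mul_le_mul_of_nonneg_left ?_ (Nat.cast_nonneg R)
      linarith
    nlinarith
  · right
    push Not at hc
    -- This is `2 l + 2 ≤ 9 l / 4`, where `l ≥ 8` is used.
    have h9 : (2 * l + 2 : ℝ) * (a + b) ≤ 9 / 4 * (l * a) + 9 / 4 * (l * b) := by nlinarith
    have h10 : ε * (n : ℝ) ^ 2 / 27 ≤ l * a := by linarith
    have h11 : (R : ℝ) * (ε * (n : ℝ) ^ 2 / 27) ≤ R * (l * a) :=
      mul_le_mul_of_nonneg_left h10 (Nat.cast_nonneg R)
    nlinarith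

end ImageTesting

namespace ImageTesting

variable {n : ℕ} {M : Image n} {l J R K N k m : ℕ} {ε : ℝ}

/-! ### Rejection of far images -/

/-- Add elements until the target is reached; the last one overshoots by at most `W`. -/
theorem exists_subset_sum {ι : Type*} [DecidableEq ι] (s : Finset ι) (w : ι → ℕ) (W x : ℕ)
    (hw : ∀ i ∈ s, w i ≤ W) (hx : x ≤ ∑ i ∈ s, w i) :
    ∃ A ⊆ s, x ≤ ∑ i ∈ A, w i ∧ ∑ i ∈ A, w i ≤ x + W := by
  induction s using Finset.induction_on with
  | empty => exact ⟨∅, le_rfl, hx, by simp⟩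
  | insert a s ha ih =>
    by_cases hs : x ≤ ∑ i ∈ s, w i
    · obtain ⟨A, h1, h2⟩ := ih (fun i hi => hw i (Finset.mem_insert_of_mem hi)) hs
      exact ⟨A, h1.trans (Finset.subset_insert _ _), h2⟩
    · refine ⟨_, le_rfl, hx, ?_⟩
      rw [Finset.sum_insert ha]
      have := hw a (Finset.mem_insert_self _ _)
      omega

open scoped Classical in
theorem absoluteDistance_le_card_black :
    absoluteDistance M (connectedImages n) ≤ ((box n).filter (Black M)).card := by
  refine absoluteDistance_le (S := ∅) (by simp) (0, 0) (by simp) _ ?_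
  rintro p hp (h | h)
  · exact Finset.mem_filter.2 ⟨hp, h.1⟩
  · exact absurd h.1 (by simp)

theorem card_tile_filter_le (hR : 0 < R) (c : ℕ × ℕ) (A : Finset (ℕ × ℕ))
    (hA : ∀ p ∈ A, tile R p = c) : A.card ≤ R * R := by
  have hsub : A ⊆ Finset.Ico (c.1 * R) (c.1 * R + R) ×ˢ Finset.Ico (c.2 * R) (c.2 * R + R) := by
    intro p hp
    obtain rfl := hA p hp
    simp only [Finset.mem_product, Finset.mem_Ico, tile]
    exact ⟨⟨Nat.div_mul_le_self _ _, Nat.lt_div_mul_add hR⟩, Nat.div_mul_le_self _ _,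
      Nat.lt_div_mul_add hR⟩
  refine (Finset.card_le_card hsub).trans (le_of_eq ?_)
  rw [Finset.card_product, Nat.card_Ico, Nat.card_Ico, Nat.add_sub_cancel_left,
    Nat.add_sub_cancel_left]

open scoped Classical in
/-- The squares can be divided into two groups with many black pixels each. -/
theorem exists_groups (h : Scale n k R N ε)
    (hfar : ε * (n : ℝ) ^ 2 ≤ absoluteDistance M (connectedImages n)) :
    ∃ A : Finset (ℕ × ℕ),
      ε * (n : ℝ) ^ 2 / 8 ≤ ((box n).filter fun p => Black M p ∧ tile R p ∈ A).card ∧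
      ε * (n : ℝ) ^ 2 / 8 ≤ ((box n).filter fun p => Black M p ∧ tile R p ∉ A).card := by
  have hR4 := h.four_le
  have hε := h.pos
  have hRpos : 0 < R := by
    rcases Nat.eq_zero_or_pos R with rfl | hR
    · norm_num at hR4
    · exact hR
  set b := (box n).filter (Black M) with hb
  have hblack : ε * (n : ℝ) ^ 2 ≤ b.card := hfar.trans (Nat.cast_le.2 absoluteDistance_le_card_black)
  set w : ℕ × ℕ → ℕ := fun c => (b.filter fun p => tile R p = c).card with hw
  have hsum : ∀ A : Finset (ℕ × ℕ), ∑ c ∈ A, w c =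
      ((box n).filter fun p => Black M p ∧ tile R p ∈ A).card := by
    intro A
    rw [Finset.card_eq_sum_card_fiberwise (f := tile R) (t := A)]
    · refine Finset.sum_congr rfl fun c hc => ?_
      rw [hw, hb]
      simp only
      congr 1
      ext p
      simp only [Finset.mem_filter]
      constructor
      · rintro ⟨⟨h1, h2⟩, rfl⟩
        exact ⟨⟨h1, h2, hc⟩, rfl⟩
      · rintro ⟨⟨h1, h2, -⟩, h4⟩
        exact ⟨⟨h1, h2⟩, h4⟩
    · intro p hp
      rw [Finset.mem_coe, Finset.mem_filter] at hp
      exact hp.2.2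
  have htotal : ∑ c ∈ b.image (tile R), w c = b.card :=
    (Finset.card_eq_sum_card_image (tile R) b).symm
  set x := ⌈ε * (n : ℝ) ^ 2 / 8⌉₊ with hx
  have hx0 : 0 ≤ ε * (n : ℝ) ^ 2 / 8 := by positivity
  have hx1 : ε * (n : ℝ) ^ 2 / 8 ≤ x := Nat.le_ceil _
  have hx2 : (x : ℝ) < ε * (n : ℝ) ^ 2 / 8 + 1 := Nat.ceil_lt_add_one hx0
  have hbig : 64 ≤ ε ^ 2 * (ε * (n : ℝ) ^ 2) := by
    have := h.large
    nlinarith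
  have hε2 : ε ^ 2 ≤ 1 := pow_le_one₀ hε.le h.lt_one.le
  have hn64 : 64 ≤ ε * (n : ℝ) ^ 2 := by
    have h0 : 0 ≤ ε * (n : ℝ) ^ 2 := by positivity
    nlinarith
  -- From `R ≤ 9k/2` and `k ε ≤ 3/2` comes `R ε ≤ 27/4`, and `ε³ n² ≥ 64`. The fraction rounds `729
  -- / 1024` up.
  have hRR : ((R * R : ℕ) : ℝ) ≤ 183 / 256 * (ε * (n : ℝ) ^ 2) := by
    have h1 : 2 * (R : ℝ) ≤ 9 * k := by exact_mod_cast h.side_le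
    have h2 : (R : ℝ) * ε ≤ 27 / 4 := by nlinarith [h.le]
    have h3 : ((R : ℝ) * ε) ^ 2 ≤ (27 / 4) ^ 2 := by
      have : (0 : ℝ) ≤ R * ε := by positivity
      gcongr
    have h4 : (R : ℝ) * R * ε ^ 2 ≤ 183 / 256 * (ε * (n : ℝ) ^ 2) * ε ^ 2 := by nlinarith
    push_cast
    exact le_of_mul_le_mul_right h4 (by positivity)
  obtain ⟨A, hA, h1, h2⟩ := exists_subset_sum (b.image (tile R)) w (R * R) x
    (fun c _ => card_tile_filter_le hRpos c _ fun p hp => (Finset.mem_filter.1 hp).2)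
    (by
      rw [htotal, hx]
      refine Nat.ceil_le.2 ?_
      linarith)
  rw [hsum] at h1 h2
  refine ⟨A, hx1.trans (Nat.cast_le.2 h1), ?_⟩
  have hsplit : ((box n).filter fun p => Black M p ∧ tile R p ∈ A).card +
      ((box n).filter fun p => Black M p ∧ tile R p ∉ A).card = b.card := by
    rw [← Finset.card_filter_add_card_filter_not (s := b) (fun p => tile R p ∈ A), hb,
      Finset.filter_filter, Finset.filter_filter]
  have hsplit' : (((box n).filter fun p => Black M p ∧ tile R p ∈ A).card : ℝ) +
      ((box n).filter fun p => Black M p ∧ tile R p ∉ A).card = b.card := by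
    exact_mod_cast hsplit
  have h2' : (((box n).filter fun p => Black M p ∧ tile R p ∈ A).card : ℝ) ≤ x + (R * R : ℕ) := by
    exact_mod_cast h2
  -- Group `A` takes at most `1/8` of `ε n²` for the target, `1/64` for rounding up and `183/256`
  -- for the overshoot, together `219/256`. This leaves `37/256 ≥ 1/8` for the other group.
  linarith

theorem sum_range_ite (f : ℕ → ℕ) (a b m : ℕ) (hb : b ≤ m) :
    ∑ t ∈ Finset.range m, (if a ≤ t ∧ t < b then f t else 0) = ∑ t ∈ Finset.Ico a b, f t := by
  rw [← Finset.sum_filter]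
  refine Finset.sum_congr ?_ fun _ _ => rfl
  ext t
  simp only [Finset.mem_filter, Finset.mem_range, Finset.mem_Ico]
  omega

/-- Three events suffice: a detection, and a black sample from each of the two groups among the
first `128 k`. For a group the total is `128 k * ε n² / 8 ≥ 16 n²`. The events need not be
independent, because a union bound is used. -/
theorem two_thirds_le_of_far (h : Scale n k R N ε)
    (hfar : ε * (n : ℝ) ^ 2 ≤ absoluteDistance M (connectedImages n)) (hm : 128 * k ≤ m)
    {B : ℕ → Finset (ℕ × ℕ)} {a b : ℕ} (hB : ∀ t, B t ⊆ box N) (hb : b ≤ m)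
    (hsum : (9 / 4 : ℝ) * (N : ℝ) ^ 2 ≤ (∑ t ∈ Finset.Ico a b, (B t).card : ℕ))
    {g : List (ℕ × ℕ) → Option Bool}
    (hg : ∀ L ∈ (drawList N m).support, (∃ t, a ≤ t ∧ t < b ∧ L.getD t 0 ∈ B t) →
      (∃ j < 128 * k, ∃ j' < 128 * k, Black M (L.getD j 0) ∧ Black M (L.getD j' 0) ∧
        tile R (L.getD j 0) ≠ tile R (L.getD j' 0)) → g L = some false) :
    2 / 3 ≤ ((drawList N m).map g) (some false) := by
  classical
  obtain ⟨A, hA, hA'⟩ := exists_groups h hfar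
  set D := (box n).filter fun p => Black M p ∧ tile R p ∈ A with hD
  set D' := (box n).filter fun p => Black M p ∧ tile R p ∉ A with hD'
  have hnpos : 0 < n := by
    rcases Nat.eq_zero_or_pos n with rfl | hn
    · have := h.large
      norm_num at this
    · exact hn
  have hbox : box n ⊆ box N := fun p hp => by
    have := h.le_padded
    rw [mem_box] at hp ⊢
    omega
  have hgroup : ∀ F : Finset (ℕ × ℕ), ε * (n : ℝ) ^ 2 / 8 ≤ F.card → (9 / 4 : ℝ) * (N : ℝ) ^ 2 ≤
      (∑ t ∈ Finset.range m, (if 0 ≤ t ∧ t < 128 * k then F else ∅).card : ℕ) := by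
    intro F hF
    have e : ∀ t, (if 0 ≤ t ∧ t < 128 * k then F else ∅).card =
        if 0 ≤ t ∧ t < 128 * k then F.card else 0 := by
      intro t
      split_ifs <;> simp
    simp only [e]
    rw [sum_range_ite (fun _ => F.card) 0 (128 * k) m hm]
    simp only [Finset.sum_const, Nat.card_Ico, smul_eq_mul, Nat.sub_zero]
    push_cast
    have h1 := h.sq_le
    have h2 : (n : ℝ) ^ 2 ≤ k * ε * (n : ℝ) ^ 2 :=
      le_mul_of_one_le_left (sq_nonneg _) h.one_le
    have h3 : (k : ℝ) * (ε * (n : ℝ) ^ 2 / 8) ≤ k * F.card := by gcongr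
    nlinarith
  refine two_thirds_le_map_apply (B := ![fun t => if a ≤ t ∧ t < b then B t else ∅,
    fun t => if 0 ≤ t ∧ t < 128 * k then D else ∅,
    fun t => if 0 ≤ t ∧ t < 128 * k then D' else ∅]) ?_ ?_ ?_ ?_
  · intro i t _ p hp
    have hp' : p ∈ box N := by
      fin_cases i
      · simp only [Fin.zero_eta, Matrix.cons_val_zero] at hp
        split_ifs at hp
        · exact hB t hp
        · simp at hp
      · simp only [Fin.mk_one, Matrix.cons_val_one, Matrix.cons_val_zero] at hp
        split_ifs at hp
        · exact hbox (Finset.mem_filter.1 hp).1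
        · simp at hp
      · simp only [Fin.reduceFinMk, Matrix.cons_val] at hp
        split_ifs at hp
        · exact hbox (Finset.mem_filter.1 hp).1
        · simp at hp
    exact mem_box.1 hp'
  · intro i
    fin_cases i
    · refine hsum.trans (Nat.cast_le.2 (le_of_eq ?_))
      rw [← sum_range_ite (fun t => (B t).card) a b m hb]
      refine Finset.sum_congr rfl fun t _ => ?_
      simp only [Fin.zero_eta, Matrix.cons_val_zero]
      split_ifs <;> simp
    · exact hgroup D hA
    · exact hgroup D' hA'
  · exact hnpos.trans_le h.le_padded
  · intro L hL hav
    have h0 := hav 0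
    have h1 := hav 1
    have h2 := hav 2
    simp only [avoiding, Set.mem_ofPred_eq, not_forall, not_not, Matrix.cons_val_zero] at h0
    simp only [avoiding, Set.mem_ofPred_eq, not_forall, not_not, Matrix.cons_val_one,
      Matrix.cons_val_zero] at h1
    simp only [avoiding, Set.mem_ofPred_eq, not_forall, not_not, Matrix.cons_val] at h2
    obtain ⟨t, -, ht⟩ := h0
    obtain ⟨j, -, hj⟩ := h1
    obtain ⟨j', -, hj'⟩ := h2
    split_ifs at ht with ht'
    · split_ifs at hj with hjk
      · split_ifs at hj' with hjk'
        · rw [hD, Finset.mem_filter] at hj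
          rw [hD', Finset.mem_filter] at hj'
          exact hg L hL ⟨t, ht'.1, ht'.2, ht⟩ ⟨j, hjk.2, j', hjk'.2, hj.2.1, hj'.2.1,
            fun he => hj'.2.2 (he ▸ hj.2.2)⟩
        · simp at hj'
      · simp at hj
    · simp at ht

/-- Far images are rejected if the detection of a component in a square leads to rejection. -/
theorem nonadaptive_rejects (h : Scale n k R N ε) (hl : 0 < l) (hR : R = l * 2 ^ J)
    (hfar : ε * (n : ℝ) ^ 2 ≤ absoluteDistance M (connectedImages n)) (hm : 512 * R ≤ m)
    {g : List (ℕ × ℕ) → Option Bool}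
    (hg : ∀ L ∈ (drawList N m).support, (∃ j < 512 * R - 256, PixelDet M l J L (256 + j)) →
      (∃ j < 128 * k, ∃ j' < 128 * k, Black M (L.getD j 0) ∧ Black M (L.getD j' 0) ∧
        tile R (L.getD j 0) ≠ tile R (L.getD j' 0)) → g L = some false) :
    2 / 3 ≤ ((drawList N m).map g) (some false) := by
  classical
  have hkR := h.le_side
  refine two_thirds_le_of_far (B := levelSet M Adj l J N) h hfar (by omega)
    (fun t => Finset.filter_subset _ _) hm
    (nonadaptive_sum_ge h hl hR hfar) ?_
  rintro L hL ⟨t, h1, h2, h3⟩ hj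
  refine hg L hL ⟨t - 256, by omega, ?_⟩ hj
  rw [Nat.add_sub_cancel' h1]
  rw [levelSet, Finset.mem_filter] at h3
  rcases h3.2 with ⟨p, hp, -, ht⟩ | hp
  · exact ⟨p, hp, ht⟩
  · exact ⟨_, hp, rfl⟩

/-- Far images are rejected if the detection of a component in a square, or of a small component,
leads to rejection. -/
theorem adaptive_rejects (h : Scale n k R N ε) (hl : 8 ≤ l) (hR : R = l * 2 ^ J)
    (hK : K = 256 * l * R)
    (hfar : ε * (n : ℝ) ^ 2 ≤ absoluteDistance M (connectedImages n)) (hm : K < m)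
    {g : List (ℕ × ℕ) → Option Bool}
    (hg : ∀ L ∈ (drawList N m).support, ((∃ j < 512 * R - 256, CellDet M l J L (256 + j)) ∨
        ∃ j < K, ComponentDet M R K L (1 + j)) →
      (∃ j < 128 * k, ∃ j' < 128 * k, Black M (L.getD j 0) ∧ Black M (L.getD j' 0) ∧
        tile R (L.getD j 0) ≠ tile R (L.getD j' 0)) → g L = some false) :
    2 / 3 ≤ ((drawList N m).map g) (some false) := by
  classical
  have hkR := h.le_side
  have hRK : 512 * R ≤ K := by rw [hK]; exact Nat.mul_le_mul_right _ (by omega)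
  rcases adaptive_sum_ge h hl hR hK hfar with hs | hs
  · refine two_thirds_le_of_far (B := levelSet M (CellRel l) l J N) h hfar (by omega)
      (fun t => Finset.filter_subset _ _) (by omega) hs ?_
    rintro L hL ⟨t, h1, h2, h3⟩ hj
    refine hg L hL (Or.inl ⟨t - 256, by omega, ?_⟩) hj
    rw [Nat.add_sub_cancel' h1]
    rw [levelSet, Finset.mem_filter] at h3
    exact h3.2
  · refine two_thirds_le_of_far (B := componentSet M R K) h hfar (by omega) (fun t p hp => ?_) (by omega) hs ?_
    · have := mem_box.1 (Finset.mem_filter.1 hp).1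
      have := h.le_padded
      rw [mem_box]
      omega
    rintro L hL ⟨t, h1, h2, h3⟩ hj
    refine hg L hL (Or.inr ⟨t - 1, by omega, ?_⟩) hj
    rw [Nat.add_sub_cancel' h1]
    exact componentDet_of_mem (by omega) h3

end ImageTesting

namespace ImageTesting

variable {l J R K k : ℕ}

/-! ### Running times -/

/-- Level `i` has `256 * 2 ^ i` samples of cost `4 ^ (J - i)`, that is `256 * 2 ^ J * 2 ^ (J - i)`,
a geometric series. Beyond the last level each sample costs `1`. -/
theorem sum_level_le (hR : 2 ^ J ≤ R) : ∑ i ∈ Finset.range (512 * R - 256),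
    2 ^ (J + 8 - Nat.log 2 (256 + i)) * 2 ^ (J + 8 - Nat.log 2 (256 + i)) ≤
      512 * (2 ^ J * 2 ^ J) + 512 * R := by
  have hpos : 0 < 2 ^ J := by positivity
  have h1 := Finset.sum_Ico_eq_sum_range
    (fun t => 2 ^ (J + 8 - Nat.log 2 t) * 2 ^ (J + 8 - Nat.log 2 t)) 256 (512 * R)
  rw [← h1, ← Finset.sum_Ico_consecutive _ (Nat.le_mul_of_pos_right 256 hpos)
    (by omega), sum_Ico_dyadic]
  refine Nat.add_le_add ?_ ?_
  · have h2 : ∀ i ∈ Finset.range J, ∑ t ∈ Finset.Ico (256 * 2 ^ i) (256 * 2 ^ (i + 1)),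
        2 ^ (J + 8 - Nat.log 2 t) * 2 ^ (J + 8 - Nat.log 2 t) =
        256 * 2 ^ J * (2 * 2 ^ (J - 1 - i)) := by
      intro i hi
      rw [Finset.mem_range] at hi
      have h3 : ∀ t ∈ Finset.Ico (256 * 2 ^ i) (256 * 2 ^ (i + 1)),
          2 ^ (J + 8 - Nat.log 2 t) * 2 ^ (J + 8 - Nat.log 2 t) = 2 ^ (J - i) * 2 ^ (J - i) := by
        intro t ht
        rw [log_of_mem_Ico ht, show J + 8 - (8 + i) = J - i by omega]
      rw [Finset.sum_congr rfl h3, Finset.sum_const, Nat.card_Ico, smul_eq_mul,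
        show 256 * 2 ^ (i + 1) - 256 * 2 ^ i = 256 * 2 ^ i by rw [pow_succ]; omega]
      have h4 : 2 ^ J = 2 ^ i * 2 ^ (J - i) := by rw [← pow_add, Nat.add_sub_cancel' hi.le]
      have h5 : 2 * 2 ^ (J - 1 - i) = 2 ^ (J - i) := by
        rw [← pow_succ', show J - 1 - i + 1 = J - i by omega]
      have h9 : 256 * 2 ^ i * (2 ^ (J - i) * 2 ^ (J - i)) =
          256 * (2 ^ i * 2 ^ (J - i)) * 2 ^ (J - i) := by
        simp only [mul_assoc]
      rw [h9, ← h4, h5]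
    rw [Finset.sum_congr rfl h2, ← Finset.mul_sum, ← Finset.mul_sum,
      Finset.sum_range_reflect (fun i => 2 ^ i) J, Nat.geomSum_eq le_rfl]
    have h6 : (2 ^ J - 1) / (2 - 1) ≤ 2 ^ J := by simp
    have h7 : 256 * 2 ^ J * (2 * ((2 ^ J - 1) / (2 - 1))) ≤ 256 * 2 ^ J * (2 * 2 ^ J) := by gcongr
    refine h7.trans (le_of_eq (by ring))
  · have h8 : ∀ t ∈ Finset.Ico (256 * 2 ^ J) (512 * R),
        2 ^ (J + 8 - Nat.log 2 t) * 2 ^ (J + 8 - Nat.log 2 t) ≤ 1 := by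
      intro t ht
      rw [Finset.mem_Ico] at ht
      have : J + 8 ≤ Nat.log 2 t := by
        refine Nat.le_log_of_pow_le (by norm_num) (le_trans (le_of_eq ?_) ht.1)
        rw [pow_add]; norm_num [mul_comm]
      rw [Nat.sub_eq_zero_of_le this]
      norm_num
    refine (Finset.sum_le_card_nsmul _ _ _ h8).trans ?_
    rw [Nat.card_Ico, smul_eq_mul]
    omega

/-- In a dyadic block the `2 ^ i` terms are at most `K / 2 ^ i` each, so every block contributes at
most `K`. -/
theorem sum_div_le (K : ℕ) :
    ∑ i ∈ Finset.range K, K / (1 + i) ≤ K * (Nat.log 2 K + 1) := by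
  have h1 := Finset.sum_Ico_eq_sum_range (fun t => K / t) 1 (K + 1)
  rw [Nat.add_sub_cancel] at h1
  rw [← h1]
  have hK : K + 1 ≤ 1 * 2 ^ (Nat.log 2 K + 1) := by
    rw [one_mul]
    exact Nat.lt_pow_succ_log_self (by norm_num) K
  refine (Finset.sum_le_sum_of_subset (Finset.Ico_subset_Ico_right hK)).trans ?_
  rw [sum_Ico_dyadic, mul_comm]
  refine (Finset.sum_le_card_nsmul _ _ K fun i _ => ?_).trans (by simp)
  refine (Finset.sum_le_card_nsmul _ _ (K / 2 ^ i) fun t ht => ?_).trans ?_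
  · rw [Finset.mem_Ico, one_mul] at ht
    exact Nat.div_le_div_left ht.1 (by positivity)
  · rw [Nat.card_Ico, smul_eq_mul, pow_succ, show 1 * (2 ^ i * 2) - 1 * 2 ^ i = 2 ^ i by omega]
    exact Nat.mul_div_le _ _

/-- The squares cost `l * 4 ^ J = R * 2 ^ J` and `l * R`, the components `K log K`, of order `l * R
* log k`. The choice of `J` gives `l * log k ≤ 72 * 2 ^ J`, which turns all of it into `O(k * 2 ^
J)`. -/
theorem adaptiveTime_le (hk : 3 ≤ k) (hl : 8 ≤ l) (hR : R = l * 2 ^ J) (hR2 : 2 * R ≤ 9 * k) (hK : K = 256 * l * R) (hlk : l ≤ 4 * k)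
    (hJ : k * Nat.log 2 k < 16 * (2 ^ J * 2 ^ J)) :
    6 * k + 21 + 10 * (K + 1) + adaptiveTime l J R K k + 10 ≤ 10 ^ 10 * (k * 2 ^ J) := by
  set p := 2 ^ J with hp
  have hppos : 0 < p := by positivity
  have hpR : p ≤ R := by rw [hR]; exact Nat.le_mul_of_pos_left _ (by omega)
  set lg := Nat.log 2 k with hlg
  have hlg1 : 1 ≤ lg := Nat.le_log_of_pow_le (by norm_num) (by omega)
  have hkp : k ≤ k * p := Nat.le_mul_of_pos_right _ hppos
  have hlp : l * lg ≤ 72 * p := by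
    have h1 : 2 * (l * p) * lg ≤ 9 * k * lg := Nat.mul_le_mul_right _ (hR ▸ hR2)
    have h2 : (l * lg) * (2 * p) ≤ (72 * p) * (2 * p) := by nlinarith
    exact Nat.le_of_mul_le_mul_right h2 (by omega)
  have hlR : l * R * lg ≤ 324 * (k * p) := by
    have h1 : l * lg * (2 * R) ≤ 72 * p * (9 * k) := Nat.mul_le_mul hlp hR2
    nlinarith
  have hlR1 : l * R ≤ 324 * (k * p) := le_trans (Nat.le_mul_of_pos_right _ (by omega)) hlR
  have hRp : 2 * (R * p) ≤ 9 * (k * p) := by nlinarith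
  -- `K` is at most `2 ^ 13 * k²`, and `13 + 2 * (lg + 1) ≤ 17 * lg` because `lg ≥ 1`.
  have hKlog : Nat.log 2 K + 1 ≤ 17 * lg := by
    have h1 : k < 2 ^ (lg + 1) := Nat.lt_pow_succ_log_self (by norm_num) k
    have h2 : K < 2 ^ (17 * lg) := by
      have h3 : K ≤ 2 ^ 13 * (k * k) := by
        rw [hK]
        nlinarith
      have h4 : k * k < 2 ^ (lg + 1) * 2 ^ (lg + 1) := Nat.mul_lt_mul_of_lt_of_lt h1 h1
      calc K < 2 ^ 13 * (2 ^ (lg + 1) * 2 ^ (lg + 1)) := by omega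
        _ = 2 ^ (13 + (lg + 1 + (lg + 1))) := by rw [← pow_add, ← pow_add]
        _ ≤ 2 ^ (17 * lg) := Nat.pow_le_pow_right (by norm_num) (by omega)
    exact Nat.log_lt_of_lt_pow (by rw [hK]; exact (Nat.mul_pos (by omega) (by omega)).ne') h2
  have hs2 : ∑ i ∈ Finset.range K, (72 * (K / (1 + i)) + 66) ≤ 72 * (K * (17 * lg)) + K * 66 := by
    rw [Finset.sum_add_distrib, ← Finset.mul_sum, Finset.sum_const, Finset.card_range, smul_eq_mul]
    have := (sum_div_le K).trans (Nat.mul_le_mul_left K hKlog)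
    omega
  have hs1 : ∑ i ∈ Finset.range (512 * R - 256),
      ((66 * l + 320) * ((2 ^ (J + 8 - Nat.log 2 (256 + i)) + 2) *
        (2 ^ (J + 8 - Nat.log 2 (256 + i)) + 2)) + 59) ≤
      954 * l * (512 * (p * p) + 512 * R) + 512 * R * 59 := by
    rw [Finset.sum_add_distrib, Finset.sum_const, Finset.card_range, smul_eq_mul]
    refine Nat.add_le_add ?_ (Nat.mul_le_mul_right _ (by omega))
    refine le_trans ?_ (Nat.mul_le_mul_left (954 * l) (sum_level_le hpR))
    rw [Finset.mul_sum]
    refine Finset.sum_le_sum fun i _ => ?_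
    have h1 : 1 ≤ 2 ^ (J + 8 - Nat.log 2 (256 + i)) := Nat.one_le_two_pow
    generalize 2 ^ (J + 8 - Nat.log 2 (256 + i)) = d at *
    have h2 : (d + 2) * (d + 2) ≤ 9 * (d * d) := by nlinarith
    calc (66 * l + 320) * ((d + 2) * (d + 2)) ≤ (106 * l) * (9 * (d * d)) :=
          Nat.mul_le_mul (by omega) h2
      _ = 954 * l * (d * d) := by ring
  have e1 : 954 * l * (512 * (p * p) + 512 * R) = 488448 * (R * p) + 488448 * (l * R) := by
    rw [hR]; ring
  have e2 : K * (17 * lg) = 4352 * (l * R * lg) := by rw [hK]; ring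
  have e3 : K = 256 * (l * R) := by rw [hK]; ring
  rw [e1] at hs1
  rw [e2] at hs2
  unfold adaptiveTime
  omega

/-- With `l ≤ 17` the smallest squares cost a constant, and the geometric series over the levels is
`O(R²) = O(k²)`. -/
theorem nonadaptiveTime_le (hk : 3 ≤ k) (hl : 8 ≤ l) (hR : R = l * 2 ^ J) (hR2 : 2 * R ≤ 9 * k)
    (hK : K = 256 * l * R) (hJ : k < 4 * 2 ^ J) :
    2 * k + 15 + 10 * (K + 1) + nonadaptiveTime l J R k + 10 ≤ 10 ^ 10 * (k * k) := by
  set p := 2 ^ J with hp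
  have hppos : 0 < p := by positivity
  have hpR : p ≤ R := by rw [hR]; exact Nat.le_mul_of_pos_left _ (by omega)
  -- `l * p = R ≤ 9k/2 < 18 p`.
  have hl17 : l ≤ 17 := by
    by_contra hc
    have : 18 * p ≤ l * p := Nat.mul_le_mul_right _ (by omega)
    omega
  have hkk : k ≤ k * k := Nat.le_mul_of_pos_right _ (by omega)
  have hRR : 4 * (R * R) ≤ 81 * (k * k) := by nlinarith
  have hsum : ∑ i ∈ Finset.range (512 * R - 256),
      (side l J (256 + i) + 1) * (side l J (256 + i) + 1) ≤
      2 * (l * l) * (512 * (p * p) + 512 * R) := by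
    refine le_trans ?_ (Nat.mul_le_mul_left (2 * (l * l)) (sum_level_le hpR))
    rw [Finset.mul_sum]
    refine Finset.sum_le_sum fun i _ => ?_
    unfold side
    have h1 : 1 ≤ 2 ^ (J + 8 - Nat.log 2 (256 + i)) := Nat.one_le_two_pow
    generalize 2 ^ (J + 8 - Nat.log 2 (256 + i)) = d at *
    have h2 : 8 ≤ l * d := le_trans hl (Nat.le_mul_of_pos_right _ h1)
    calc (l * d + 1) * (l * d + 1) ≤ 2 * ((l * d) * (l * d)) := by nlinarith
      _ = 2 * (l * l) * (d * d) := by ring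
  have e1 : 2 * (l * l) * (512 * (p * p) + 512 * R) = 1024 * (R * R) + 1024 * (l * (l * R)) := by
    rw [hR]; ring
  rw [e1] at hsum
  have hlR : l * R ≤ 17 * R := Nat.mul_le_mul_right _ hl17
  have hllR : l * (l * R) ≤ 17 * (17 * R) := Nat.mul_le_mul hl17 hlR
  have e3 : K = 256 * (l * R) := by rw [hK]; ring
  unfold nonadaptiveTime
  simp only [Finset.sum_add_distrib, ← Finset.mul_sum, Finset.sum_const, Finset.card_range,
    smul_eq_mul]
  generalize ∑ i ∈ Finset.range (512 * R - 256),
      (side l J (256 + i) + 1) * (side l J (256 + i) + 1) = u at *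
  omega

end ImageTesting

namespace ImageTesting

/-! ### The testers -/

/-- Execution is deterministic, so an existential in the postcondition can be chosen beforehand. It
is used to fix the exponent `J` computed by the program, on which the time bounds depend. -/
theorem Runs.exists_of {n : ℕ} {X : Ctx n} {s : St} {p : Program} {T : ℕ} {ι : Type*}
    {P : ι → Prop} {Q : ι → St → Prop} (h : Runs X s p T fun s' => ∃ i, P i ∧ Q i s')
    (hg : X.Good s) (hq : s.qs.length + T ≤ X.B) : ∃ i, P i ∧ Runs X s p T (Q i) := by
  obtain ⟨t, ht, s', h1, h2, h3, i, h4, h5⟩ := h hg hq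
  exact ⟨i, h4, fun _ _ => ⟨t, ht, s', h1, h2, h3, h5⟩⟩

/-- Memory and time are at most a large constant times `n ^ 4`; as `n ≥ 8`, the constant is absorbed
by `n ^ 16`. -/
theorem le_pow_twenty {n : ℕ} (hn : 8 ≤ n) : 10 ^ 12 * n ^ 4 ≤ n ^ 20 := by
  rw [show n ^ 20 = n ^ 16 * n ^ 4 by ring]
  exact Nat.mul_le_mul_right _ (le_trans (by norm_num) (Nat.pow_le_pow_left hn 16))

/-- The machine with words of `1200` times the length of `n`. -/
def machine {n : ℕ} (M : Image n) (hn : 8 ≤ n) : Ctx n where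
  M := M
  w := 1200 * Nat.size n
  B := n ^ 20
  hB := le_trans (by norm_num) (Nat.pow_le_pow_left hn 20)
  hw := by
    -- The word length is `20 * 60` times the length of `n`: the exponent `20` of the bound on words
    -- times the `60` leaves allowed in an expression.
    rw [show 1200 = 20 * 60 by norm_num, mul_comm, pow_mul, pow_mul]
    refine Nat.pow_lt_pow_left ?_ (by norm_num)
    exact Nat.pow_lt_pow_left (Nat.lt_size_self n) (by norm_num)

theorem good_start {n k : ℕ} (M : Image n) (hn : 8 ≤ n) (hk : k ≤ n) :
    (machine M hn).Good (St.start n k) := by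
  have h : n ≤ n ^ 20 := Nat.le_self_pow (by norm_num) n
  refine ⟨fun r => ?_, fun a => Nat.zero_le _⟩
  show (if r = 0 then n else if r = 1 then k else 0) ≤ n ^ 20
  split_ifs <;> omega

/-! ### Complete runs with the computed parameters. -/

section main
variable {n k J l R N K : ℕ}

/-- The relations between the parameters of a tester. -/
structure Params (n k J l R N K : ℕ) : Prop where
  hn : 8 ≤ n
  hk : 3 ≤ k
  hkn : k ≤ n
  le_l : 8 ≤ l
  l_le : l ≤ 4 * k
  hR : R = l * 2 ^ J
  le_R : 4 * k ≤ R
  R_le : 2 * R ≤ 9 * k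
  hN : N = padded n R
  hK : K = 256 * l * R

theorem params_cellSide (hn : 8 ≤ n) (hk : 3 ≤ k) (hkn : k ≤ n) (hJ : 2 * 2 ^ J ≤ k) :
    Params n k J (cellSide k J) (cellSide k J * 2 ^ J) (padded n (cellSide k J * 2 ^ J))
      (256 * cellSide k J * (cellSide k J * 2 ^ J)) := by
  obtain ⟨h1, h2, h3, h4⟩ := cellSide_bounds hk hJ
  exact ⟨hn, hk, hkn, h3, h4, rfl, h1, by omega, rfl, rfl⟩

theorem Params.lt_N (h : Params n k J l R N K) : n < N ∧ N ≤ n + R := by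
  rw [h.hN]
  have := h.le_R
  have := h.hk
  exact padded_bounds (by omega)

theorem Params.le_K (h : Params n k J l R N K) : 512 * R ≤ K := by
  rw [h.hK]
  exact Nat.mul_le_mul_right _ (by have := h.le_l; omega)

theorem Params.K_le (h : Params n k J l R N K) : K ≤ 5120 * n ^ 2 := by
  have h1 : l ≤ 4 * n := by have := h.l_le; have := h.hkn; omega
  have h2 : R ≤ 5 * n := by have := h.R_le; have := h.hkn; omega
  rw [h.hK]
  have := Nat.mul_le_mul h1 h2
  nlinarith

theorem Params.memory_le (h : Params n k J l R N K) :
    2 * (K + 1) + (512 * R - 256 + K) * (2 * ((R + 2) * (R + 2))) ≤ n ^ 20 := by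
  refine le_trans ?_ (le_pow_twenty h.hn)
  have hn := h.hn
  have hK := h.K_le
  have h2 : R ≤ 5 * n := by have := h.R_le; have := h.hkn; omega
  have h3 : n ≤ n ^ 2 := Nat.le_self_pow (by norm_num) n
  have h4 : (R + 2) * (R + 2) ≤ 36 * n ^ 2 := by
    have : R + 2 ≤ 6 * n := by omega
    exact (Nat.mul_le_mul this this).trans (le_of_eq (by ring))
  have h5 : 512 * R - 256 + K ≤ 7680 * n ^ 2 := by omega
  have h6 := Nat.mul_le_mul h5 (Nat.mul_le_mul_left 2 h4)
  have h7 : 7680 * n ^ 2 * (2 * (36 * n ^ 2)) = 552960 * n ^ 4 := by ring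
  have h8 : n ^ 2 ≤ n ^ 4 := Nat.pow_le_pow_right (by omega) (by norm_num)
  omega

theorem Params.sampled (h : Params n k J l R N K) {M : Image n} {s : St}
    (hg : (machine M h.hn).Good s) (hr : Ready n k J l s) (h6 : s.reg 6 = K)
    {L : List (ℕ × ℕ)} (hL : L.length = K + 1) (hlt : ∀ p ∈ L, p.1 < N ∧ p.2 < N) :
    Sampled M l R K ((R + 2) * (R + 2)) L 0 (L.foldl St.drawn (s.set 10 0)) ∧
      (L.foldl St.drawn (s.set 10 0)).reg 1 = k ∧
      (L.foldl St.drawn (s.set 10 0)).qs = s.qs ∧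
      (L.foldl St.drawn (s.set 10 0)).rcv = false ∧
      (L.foldl St.drawn (s.set 10 0)).itl = false := by
  have hB := h.memory_le
  have hNB : N ≤ n ^ 20 := by
    have h1 := h.lt_N
    have h2 : R ≤ 5 * n := by have := h.R_le; have := h.hkn; omega
    have h3 : n ≤ n ^ 4 := Nat.le_self_pow (by norm_num) n
    refine le_trans ?_ (le_pow_twenty h.hn)
    omega
  have hXB : (machine M h.hn).B = n ^ 20 := rfl
  obtain ⟨-, g2, g3, g4, g5, g6, g7⟩ := foldl_drawn (X := machine M h.hn) (s := s.set 10 0)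
    (hg.set (Nat.zero_le _)) L (fun p hp => by have := hlt p hp; omega)
    (by simp only [St.set_reg, if_true]; omega)
  have hreg : ∀ r, r ≠ 10 → r ≠ 20 → r ≠ 21 →
      (L.foldl St.drawn (s.set 10 0)).reg r = s.reg r := by
    intro r h1 h2 h3
    rw [g2 r (by assumption) (by assumption) (by assumption), St.set_reg, if_neg h1]
  have h10 : (s.set 10 0).reg 10 = 0 := by simp
  rw [h10] at g3 g4
  have h16 : (L.foldl St.drawn (s.set 10 0)).reg 16 = 2 * L.length := by
    rw [hreg 16 (by omega) (by omega) (by omega), hr.h16, hL, h.hK, h.hR]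
  refine ⟨⟨?_, ?_, ?_, ?_, ?_, ?_, ?_, ?_⟩, ?_, ?_, ?_, ?_⟩
  · rw [hreg 3 (by omega) (by omega) (by omega), hr.h3]
  · rw [hreg 4 (by omega) (by omega) (by omega), hr.h4, h.hR]
  · rw [hreg 6 (by omega) (by omega) (by omega), h6]
  · rw [hreg 7 (by omega) (by omega) (by omega), hr.h7, h.hR]
  · intro t ht
    have := g3 t ht
    simpa using this
  · rw [h16]; simp
  · intro a ha
    rw [h16] at ha
    rw [g4 a (by omega)]
    simp [hr.mem]
  · intro hc
    rw [hreg 41 (by omega) (by omega) (by omega), hr.h41] at hc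
    exact absurd rfl hc
  · rw [hreg 1 (by omega) (by omega) (by omega), hr.h1]
  · rw [g5]; rfl
  · rw [g6]; exact hr.rcv
  · rw [g7]; exact hr.itl

/-- `f` describes the final configurations of a tester that detects components if `Det`. -/
def Decides (M : Image n) (R k N m : ℕ) (Det : List (ℕ × ℕ) → Prop) (f : List (ℕ × ℕ) → Config) :
    Prop :=
  ∀ L ∈ (drawList N m).support, ∃ s : St, Outcome M R k L (Det L) s ∧
    (f L).verdict = some (decide (s.reg 41 * s.reg 44 = 0))

/-- The run of the adaptive tester, as a function of its samples. -/
theorem exists_run_adaptive (M : Image n) (hn : 8 ≤ n) (hk : 3 ≤ k) (hkn : k ≤ n) :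
    ∃ J l R N K, Params n k J l R N K ∧ (J ≠ 0 → 4 * (2 ^ J * 2 ^ J) ≤ k * Nat.log 2 k) ∧
      ∃ f, run M (1200 * Nat.size n) (10 ^ 10 * (k * 2 ^ J))
          ((St.start n k).cfg [tester adaptiveParams adaptiveMain]) =
          (drawList N (K + 1)).map f ∧
        Decides M R k N (K + 1) (fun L => (∃ j < 512 * R - 256, CellDet M l J L (256 + j)) ∨
          ∃ j < K, ComponentDet M R K L (1 + j)) f := by
  have hg := good_start (k := k) M hn hkn
  have hXB : (machine M hn).B = n ^ 20 := rfl
  have hB20 := le_pow_twenty hn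
  have hn4 : n ≤ n ^ 4 := Nat.le_self_pow (by norm_num) n
  have hn24 : n ^ 2 ≤ n ^ 4 := Nat.pow_le_pow_right (by omega) (by norm_num)
  obtain ⟨J, ⟨hJ1, hJ2, hJ3⟩, hparams⟩ := Runs.exists_of (runs_adaptiveParams (X := machine M hn)
    hk hkn (by omega)) hg (by rw [show (St.start n k).qs = [] from rfl, List.length_nil]; omega)
  have hp := params_cellSide hn hk hkn hJ1
  refine ⟨J, _, _, _, _, hp, hJ3, ?_⟩
  have htime := adaptiveTime_le hk hp.le_l hp.hR hp.R_le hp.hK hp.l_le hJ2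
  have hTB : 10 ^ 10 * (k * 2 ^ J) ≤ n ^ 20 := by
    have h1 : k * 2 ^ J ≤ n ^ 2 := by
      rw [sq]
      exact Nat.mul_le_mul hkn (by omega)
    omega
  generalize cellSide k J * 2 ^ J = R at *
  generalize cellSide k J = l at *
  have hmain : ∀ s, (machine M hn).Good s → Ready n k J l s → s.qs = [] → s.reg 5 = padded n R →
      s.reg 6 = 256 * l * R → ∀ L : List (ℕ × ℕ), L.length = 256 * l * R + 1 →
      (∀ p ∈ L, p.1 < padded n R ∧ p.2 < padded n R) →
      Runs (machine M hn) (L.foldl St.drawn (s.set 10 0)) adaptiveMain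
        (adaptiveTime l J R (256 * l * R) k)
        (Outcome M R k L ((∃ j < 512 * R - 256, CellDet M l J L (256 + j)) ∨
          ∃ j < 256 * l * R, ComponentDet M R (256 * l * R) L (1 + j))) := by
    intro s hs hr hq _ h6 L hL hlt
    obtain ⟨h1, h2, h3, h4, h5⟩ := hp.sampled hs hr h6 hL hlt
    have hK := hp.le_K
    have hk' := hp.le_R
    refine runs_adaptiveMain (X := machine M hn) h1 h2 (by have := hp.le_l; omega) hp.hR
      (h3.trans hq) h4 h5 (by omega) (by omega) (by omega) (fun p hpL => ?_) le_rfl ?_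
    · have := hlt p hpL
      have := hp.lt_N
      have := hp.R_le
      omega
    · rw [hL]
      exact hp.memory_le
  obtain ⟨f, hf, hf'⟩ := exists_run_tester (X := machine M hn) hg (main := adaptiveMain)
    (T₂ := adaptiveTime l J R (256 * l * R) k)
    (T := 10 ^ 10 * (k * 2 ^ J)) hk (by have := hp.lt_N; omega) rfl (by omega) hparams hmain htime
  refine ⟨f, hf, fun L hL => ?_⟩
  obtain ⟨s', h1, -, h3⟩ := hf' L hL
  exact ⟨s', h1, h3⟩

/-- The run of the nonadaptive tester, as a function of its samples. -/
theorem exists_run_nonadaptive (M : Image n) (hn : 8 ≤ n) (hk : 3 ≤ k) (hkn : k ≤ n) :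
    ∃ J l R N K, Params n k J l R N K ∧
      ∃ f, run M (1200 * Nat.size n) (10 ^ 10 * (k * k))
          ((St.start n k).cfg [tester nonadaptiveParams nonadaptiveMain]) =
          (drawList N (K + 1)).map f ∧
        Decides M R k N (K + 1) (fun L => ∃ j < 512 * R - 256, PixelDet M l J L (256 + j)) f ∧
        ∀ L ∈ (drawList N (K + 1)).support, (f L).interleaved = false := by
  have hg := good_start (k := k) M hn hkn
  have hXB : (machine M hn).B = n ^ 20 := rfl
  have hB20 := le_pow_twenty hn
  have hn4 : n ≤ n ^ 4 := Nat.le_self_pow (by norm_num) n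
  have hn24 : n ^ 2 ≤ n ^ 4 := Nat.pow_le_pow_right (by omega) (by norm_num)
  obtain ⟨J, ⟨hJ1, hJ2⟩, hparams⟩ := Runs.exists_of (runs_nonadaptiveParams (X := machine M hn)
    hk hkn (by omega)) hg (by rw [show (St.start n k).qs = [] from rfl, List.length_nil]; omega)
  have hp := params_cellSide hn hk hkn hJ1
  refine ⟨J, _, _, _, _, hp, ?_⟩
  have htime := nonadaptiveTime_le hk hp.le_l hp.hR hp.R_le hp.hK hJ2
  have hTB : 10 ^ 10 * (k * k) ≤ n ^ 20 := by
    have h1 : k * k ≤ n ^ 2 := by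
      rw [sq]
      exact Nat.mul_le_mul hkn hkn
    omega
  generalize cellSide k J * 2 ^ J = R at *
  generalize cellSide k J = l at *
  have hmain : ∀ s, (machine M hn).Good s → Ready n k J l s → s.qs = [] → s.reg 5 = padded n R →
      s.reg 6 = 256 * l * R → ∀ L : List (ℕ × ℕ), L.length = 256 * l * R + 1 →
      (∀ p ∈ L, p.1 < padded n R ∧ p.2 < padded n R) →
      Runs (machine M hn) (L.foldl St.drawn (s.set 10 0)) nonadaptiveMain (nonadaptiveTime l J R k)
        (fun s' => Outcome M R k L (∃ j < 512 * R - 256, PixelDet M l J L (256 + j)) s' ∧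
          s'.itl = false) := by
    intro s hs hr hq _ h6 L hL hlt
    obtain ⟨h1, h2, h3, h4, h5⟩ := hp.sampled hs hr h6 hL hlt
    have hK := hp.le_K
    have hk' := hp.le_R
    refine runs_nonadaptiveMain (X := machine M hn) h1 h2 (by have := hp.le_l; omega) hp.hR
      (h3.trans hq) h4 h5 (by omega) (by omega) le_rfl ?_
    rw [hL]
    refine le_trans ?_ hp.memory_le
    gcongr
    omega
  obtain ⟨f, hf, hf'⟩ := exists_run_tester (X := machine M hn) hg (main := nonadaptiveMain)
    (T₂ := nonadaptiveTime l J R k)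
    (T := 10 ^ 10 * (k * k)) hk (by have := hp.lt_N; omega) rfl (by omega) hparams hmain htime
  refine ⟨f, hf, fun L hL => ?_, fun L hL => ?_⟩
  · obtain ⟨s', h1, -, h3⟩ := hf' L hL
    exact ⟨s', h1.1, h3⟩
  · obtain ⟨s', h1, h2, -⟩ := hf' L hL
    rw [h2, h1.2]

end main
end ImageTesting

namespace ImageTesting

variable {n k : ℕ} {ε : ℝ}

/-! ### One-sided error testers -/

theorem run_eq_of_halted {M : Image n} {w T T' : ℕ} {z : Config}
    (h : ∀ y ∈ (run M w T z).support, y.verdict ≠ none) (hT : T ≤ T') :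
    run M w T' z = run M w T z := by
  obtain ⟨d, rfl⟩ := Nat.exists_eq_add_of_le hT
  rw [run_add]
  exact (bind_congr_support fun y hy => run_of_verdict (h y hy)).trans (PMF.bind_pure _)

/-- One time `T` at which the run has halted settles everything: a halted machine does not change,
and `T` steps make at most `T` queries. `T` may depend on the image. -/
theorem isTester_of_run {P : Program} {c : ℕ} {q t : ℝ}
    (h : ∀ M : Image n, ∃ T : ℕ, (T : ℝ) ≤ q ∧ (T : ℝ) ≤ t ∧
      (∀ z ∈ (outcome P c ε M T).support, z.verdict ≠ none) ∧
      (M ∈ connectedImages n → ∀ z ∈ (outcome P c ε M T).support, z.verdict = some true) ∧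
      (IsFar ε M (connectedImages n) →
        2 / 3 ≤ ((outcome P c ε M T).map Config.verdict) (some false))) :
    IsTester P c n ε q t := by
  have key : ∀ M : Image n, ∃ T : ℕ, (T : ℝ) ≤ q ∧ outcome P c ε M ⌊t⌋₊ = outcome P c ε M T ∧
      (∀ z ∈ (outcome P c ε M T).support, z.verdict ≠ none) ∧
      (M ∈ connectedImages n → ∀ z ∈ (outcome P c ε M T).support, z.verdict = some true) ∧
      (IsFar ε M (connectedImages n) →
        2 / 3 ≤ ((outcome P c ε M T).map Config.verdict) (some false)) := by
    intro M
    obtain ⟨T, h1, h2, h3, h4⟩ := h M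
    exact ⟨T, h1, run_eq_of_halted h3 (Nat.le_floor h2), h3, h4⟩
  refine ⟨fun M => ?_, fun M => ?_, fun M => ?_, fun M => ?_⟩
  all_goals
    obtain ⟨T, h1, h2, h3, h4, h5⟩ := key M
    rw [h2]
  · exact h3
  · intro z hz
    refine le_trans ?_ h1
    have := (extends_of_mem_support_run hz).length_le
    simp only [initial, List.length_nil, zero_add] at this
    exact_mod_cast this
  · exact h4
  · exact h5

theorem Decides.spec {M : Image n} {R N m : ℕ} {Det : List (ℕ × ℕ) → Prop}
    {f : List (ℕ × ℕ) → Config} (h : Decides M R k N m Det f) {μ : PMF Config}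
    (hμ : μ = (drawList N m).map f) :
    (∀ z ∈ μ.support, z.verdict ≠ none) ∧
    (M ∈ connectedImages n → ∀ z ∈ μ.support, z.verdict = some true) ∧
    ∀ L ∈ (drawList N m).support, Det L →
      (∃ j < 128 * k, ∃ j' < 128 * k, Black M (L.getD j 0) ∧ Black M (L.getD j' 0) ∧
        tile R (L.getD j 0) ≠ tile R (L.getD j' 0)) → (f L).verdict = some false := by
  subst hμ
  refine ⟨fun z hz => ?_, fun hM z hz => ?_, fun L hL hdet hj => ?_⟩
  · rw [PMF.support_map] at hz
    obtain ⟨L, hL, rfl⟩ := hz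
    obtain ⟨s, -, hv⟩ := h L hL
    rw [hv]
    simp
  · rw [PMF.support_map] at hz
    obtain ⟨L, hL, rfl⟩ := hz
    obtain ⟨s, ho, hv⟩ := h L hL
    rw [hv]
    by_cases h0 : s.reg 41 * s.reg 44 = 0
    · rw [decide_eq_true h0]
    · obtain ⟨c, hc, j, -, hb, hne⟩ := ho.sound h0
      exact absurd hM (not_mem_connectedImages hc hb hne)
  · obtain ⟨s, ho, hv⟩ := h L hL
    rw [hv, decide_eq_false (ho.complete hdet hj)]

theorem initial_eq (P : Program) (n : ℕ) (ε : ℝ) :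
    initial P n ε = (St.start n ⌈1 / ε⌉₊).cfg [P] := rfl

/-- Either paint all white pixels or erase all black pixels except one. The smaller cost is below
half of the pixels. -/
theorem two_mul_absoluteDistance_lt (M : Image n) (hn : 0 < n) :
    2 * absoluteDistance M (connectedImages n) < n * n := by
  classical
  have hnn : 0 < n * n := Nat.mul_pos hn hn
  have h1 : absoluteDistance M (connectedImages n) ≤ ((box n).filter fun p => ¬ Black M p).card := by
    refine absoluteDistance_le (S := {p | p ∈ box n}) (fun p hp => hp) (0, 0) (fun p hp => ?_) _ ?_
    · exact joined_of_onGrid (R := 1) (fun q hq _ => hq) hp (Or.inl (one_dvd _))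
    · rintro p hp (h | h)
      · exact absurd hp h.2
      · exact Finset.mem_filter.2 ⟨hp, h.2⟩
  have h2 := Finset.card_filter_add_card_filter_not (s := box n) (Black M)
  rw [card_box] at h2
  rcases Finset.eq_empty_or_nonempty ((box n).filter (Black M)) with he | ⟨p, hp⟩
  · have h3 := absoluteDistance_le_card_black (M := M)
    rw [he, Finset.card_empty] at h3
    omega
  · have h3 : absoluteDistance M (connectedImages n) ≤
        (((box n).filter (Black M)).erase p).card := by
      refine absoluteDistance_le (S := {p}) ?_ p ?_ _ ?_
      · rintro q rfl
        exact (Finset.mem_filter.1 hp).1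
      · rintro q rfl
        exact .refl
      · rintro q hq (h | h)
        · exact Finset.mem_erase.2 ⟨h.2, Finset.mem_filter.2 ⟨hq, h.1⟩⟩
        · have hqp : q = p := h.1
          exact absurd (hqp ▸ (Finset.mem_filter.1 hp).2) h.2
    rw [Finset.card_erase_of_mem hp] at h3
    have h4 : 0 < ((box n).filter (Black M)).card := Finset.card_pos.2 ⟨p, hp⟩
    omega

theorem IsFar.le_absoluteDistance {M : Image n} (hn : 0 < n) (h : IsFar ε M (connectedImages n)) :
    ε * (n : ℝ) ^ 2 ≤ absoluteDistance M (connectedImages n) := by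
  unfold IsFar relativeDistance at h
  rwa [le_div_iff₀ (by positivity)] at h

/-- For `ε ≥ 1/2` no image is far, so accepting without any query is correct. The query bound tends
to zero as `ε` tends to `1`, hence no query may be made here. -/
theorem isTester_of_le (hn : 8 ≤ n) (hε : 1 / 2 ≤ ε) (hk : ⌈1 / ε⌉₊ < 3) {params main : Program}
    {q t : ℝ} (hq : 0 ≤ q) (ht : 2 ≤ t) :
    IsTester (tester params main) 1200 n ε q t := by
  have hrun : ∀ M : Image n, outcome (tester params main) 1200 ε M ⌊t⌋₊ =
      PMF.pure { (St.start n ⌈1 / ε⌉₊).cfg [] with verdict := some true } := fun M =>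
    run_tester_of_lt (X := machine M hn) (good_start (k := ⌈1 / ε⌉₊) M hn (by omega)) hk
      (Nat.le_floor (by exact_mod_cast ht))
  refine ⟨fun M z hz => ?_, fun M z hz => ?_, fun M _ z hz => ?_, fun M hM => ?_⟩
  · rw [hrun, PMF.support_pure, Set.mem_singleton_iff] at hz
    simp [hz]
  · rw [hrun, PMF.support_pure, Set.mem_singleton_iff] at hz
    rw [hz]
    simpa [St.cfg, St.start] using hq
  · rw [hrun, PMF.support_pure, Set.mem_singleton_iff] at hz
    simp [hz]
  · exfalso
    have h1 := hM.le_absoluteDistance (by omega)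
    have h2 : (2 : ℝ) * absoluteDistance M (connectedImages n) < n * n := by
      exact_mod_cast two_mul_absoluteDistance_lt M (by omega)
    nlinarith [sq_nonneg (n : ℝ)]

/-- What the hypotheses of the theorem say about `k = ⌈1 / ε⌉`. -/
theorem input_bounds (hε : 0 < ε) (hε1 : ε < 1) (hn : 8 * ε ^ (-(3 / 2) : ℝ) ≤ (n : ℝ)) :
    8 ≤ n ∧ ⌈1 / ε⌉₊ ≤ n ∧ 1 ≤ ⌈1 / ε⌉₊ * ε ∧ 64 ≤ ε ^ 3 * (n : ℝ) ^ 2 ∧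
    ((⌈1 / ε⌉₊ < 3 ∧ 1 / 2 ≤ ε) ∨ (3 ≤ ⌈1 / ε⌉₊ ∧ ε < 1 / 2 ∧ ⌈1 / ε⌉₊ * ε ≤ 3 / 2)) := by
  have hx : ε ^ 3 * (ε ^ (-(3 / 2) : ℝ)) ^ 2 = 1 := by
    rw [← Real.rpow_natCast, ← Real.rpow_natCast, ← Real.rpow_mul hε.le, ← Real.rpow_add hε]
    norm_num
  have hxpos : 0 < ε ^ (-(3 / 2) : ℝ) := Real.rpow_pos_of_pos hε _
  have hinv : 1 / ε ≤ ε ^ (-(3 / 2) : ℝ) := by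
    rw [one_div, ← Real.rpow_neg_one]
    exact Real.rpow_le_rpow_of_exponent_ge hε hε1.le (by norm_num)
  have h1 : 1 ≤ 1 / ε := by
    rw [le_div_iff₀ hε]
    linarith
  have hk1 : 1 / ε ≤ ⌈1 / ε⌉₊ := Nat.le_ceil _
  have hk2 : (⌈1 / ε⌉₊ : ℝ) < 1 / ε + 1 := Nat.ceil_lt_add_one (by positivity)
  have hmul : 1 / ε * ε = 1 := by field_simp
  refine ⟨?_, ?_, ?_, ?_, ?_⟩
  · have : (8 : ℝ) ≤ n := by linarith
    exact_mod_cast this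
  · have : (⌈1 / ε⌉₊ : ℝ) ≤ n := by linarith
    exact_mod_cast this
  · nlinarith
  · have h2 : (8 * ε ^ (-(3 / 2) : ℝ)) ^ 2 ≤ (n : ℝ) ^ 2 := by gcongr
    have h3 : ε ^ 3 * (8 * ε ^ (-(3 / 2) : ℝ)) ^ 2 ≤ ε ^ 3 * (n : ℝ) ^ 2 := by gcongr
    nlinarith
  · by_cases h : 1 / 2 ≤ ε
    · left
      refine ⟨?_, h⟩
      have : ⌈1 / ε⌉₊ ≤ 2 := by
        refine Nat.ceil_le.2 ?_
        rw [div_le_iff₀ hε]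
        push_cast
        linarith
      omega
    · right
      push Not at h
      refine ⟨?_, h, by nlinarith⟩
      refine Nat.succ_le_of_lt (Nat.lt_ceil.2 ?_)
      rw [lt_div_iff₀ hε]
      push_cast
      linarith

theorem Params.scale {J l R N K : ℕ} (h : Params n k J l R N K) (hε : 0 < ε) (hε1 : ε < 1 / 2)
    (h1 : 1 ≤ k * ε) (h2 : k * ε ≤ 3 / 2) (h3 : 64 ≤ ε ^ 3 * (n : ℝ) ^ 2)
    (h4 : 8 * (1 / ε) ≤ n) : Scale n k R N ε where
  pos := hε
  lt_one := by linarith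
  one_le := h1
  le := h2
  large := h3
  le_side := h.le_R
  side_le := h.R_le
  le_padded := h.lt_N.1.le
  padded_le := by
    -- `R ≤ 9k/2 ≤ 27/(4 ε) ≤ 8/ε ≤ n`, so padding at most doubles the side.
    have h5 : R ≤ n := by
      have h6 : 2 * (R : ℝ) ≤ 9 * k := by exact_mod_cast h.R_le
      have h7 : (k : ℝ) ≤ 3 / 2 * (1 / ε) := by
        rw [mul_one_div, le_div_iff₀ hε]
        exact h2
      have h8 : (R : ℝ) ≤ n := by linarith
      exact_mod_cast h8
    have := h.lt_N.2
    omega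
  dvd := by
    rw [h.hN]
    exact dvd_mul_right _ _

/-- Compare squares: `(k * 2 ^ J)² ≤ k³ log k`. Here `k³ ≤ 27/8 ε⁻³`, and `log k` is at most `1 +
log (1/ε) ≤ 2 log (1/ε)` because `ε < 1/2`. The constant `27/4` is below `3²`. -/
theorem mul_pow_le (hε : 0 < ε) (hε1 : ε < 1 / 2) (hk : 3 ≤ k) (hkε : k * ε ≤ 3 / 2) {J : ℕ}
    (hJ : J ≠ 0 → 4 * (2 ^ J * 2 ^ J) ≤ k * Nat.log 2 k) :
    (k : ℝ) * 2 ^ J ≤ 3 * (ε ^ (-(3 / 2) : ℝ) * Real.sqrt (Real.logb 2 (1 / ε))) := by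
  have hlog : 1 ≤ Nat.log 2 k := Nat.le_log_of_pow_le (by norm_num) (by omega)
  have hJ' : 2 ^ J * 2 ^ J ≤ k * Nat.log 2 k := by
    by_cases h0 : J = 0
    · subst h0
      have := Nat.mul_le_mul hk hlog
      simp only [pow_zero]
      omega
    · have := hJ h0
      omega
  have hx : ε ^ 3 * (ε ^ (-(3 / 2) : ℝ)) ^ 2 = 1 := by
    rw [← Real.rpow_natCast, ← Real.rpow_natCast, ← Real.rpow_mul hε.le, ← Real.rpow_add hε]
    norm_num
  have hxpos : 0 < ε ^ (-(3 / 2) : ℝ) := Real.rpow_pos_of_pos hε _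
  have hL1 : 1 ≤ Real.logb 2 (1 / ε) := by
    rw [Real.le_logb_iff_rpow_le (by norm_num) (by positivity), Real.rpow_one, le_div_iff₀ hε]
    linarith
  have hL2 : (Nat.log 2 k : ℝ) ≤ 2 * Real.logb 2 (1 / ε) := by
    have h1 : (Nat.log 2 k : ℝ) ≤ Real.logb 2 k := Real.natLog_le_logb k 2
    have h2 : Real.logb 2 k ≤ Real.logb 2 (2 * (1 / ε)) := by
      refine Real.logb_le_logb_of_le (by norm_num) (by positivity) ?_
      rw [mul_one_div, le_div_iff₀ hε]
      linarith
    rw [Real.logb_mul (by norm_num) (by positivity), Real.logb_self_eq_one (by norm_num)] at h2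
    linarith
  have hsq : Real.sqrt (Real.logb 2 (1 / ε)) ^ 2 = Real.logb 2 (1 / ε) :=
    Real.sq_sqrt (by linarith)
  have hJr : (2 : ℝ) ^ J * 2 ^ J ≤ k * Nat.log 2 k := by exact_mod_cast hJ'
  set x := ε ^ (-(3 / 2) : ℝ)
  set L := Real.logb 2 (1 / ε)
  refine le_of_sq_le_sq ?_ (by positivity)
  have h1 : ((k : ℝ) * 2 ^ J) ^ 2 ≤ (k : ℝ) ^ 3 * (2 * L) := by
    calc ((k : ℝ) * 2 ^ J) ^ 2 = (k : ℝ) ^ 2 * (2 ^ J * 2 ^ J) := by ring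
      _ ≤ (k : ℝ) ^ 2 * (k * (2 * L)) := 
        mul_le_mul_of_nonneg_left (hJr.trans (mul_le_mul_of_nonneg_left hL2 (Nat.cast_nonneg k)))
          (sq_nonneg _)
      _ = (k : ℝ) ^ 3 * (2 * L) := by ring
  have h2 : (k : ℝ) ^ 3 ≤ 27 / 8 * x ^ 2 := by
    have h3 : (k * ε) ^ 3 ≤ (3 / 2 : ℝ) ^ 3 := by gcongr
    have h4 : (k : ℝ) ^ 3 * ε ^ 3 ≤ 27 / 8 * x ^ 2 * ε ^ 3 := by nlinarith
    exact le_of_mul_le_mul_right h4 (by positivity)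
  calc ((k : ℝ) * 2 ^ J) ^ 2 ≤ (k : ℝ) ^ 3 * (2 * L) := h1
    _ ≤ 27 / 8 * x ^ 2 * (2 * L) := by gcongr
    _ ≤ 9 * x ^ 2 * L := by nlinarith [mul_nonneg (sq_nonneg x) (by linarith : 0 ≤ L)]
    _ = (3 * (x * Real.sqrt L)) ^ 2 := by rw [mul_pow, mul_pow, hsq]; ring

theorem isTester_adaptive (hε : 0 < ε) (hε1 : ε < 1) (hn : 8 * ε ^ (-(3 / 2) : ℝ) ≤ (n : ℝ)) :
    IsTester (tester adaptiveParams adaptiveMain) 1200 n ε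
      (10 ^ 11 * (ε ^ (-(3 / 2) : ℝ) * Real.sqrt (Real.logb 2 (1 / ε))))
      (10 ^ 11 * (1 + ε ^ (-(3 / 2) : ℝ) * Real.sqrt (Real.logb 2 (1 / ε)))) := by
  obtain ⟨h8, hkn, hk1, h64, ⟨hk, hhalf⟩ | ⟨hk, hhalf, hk2⟩⟩ := input_bounds hε hε1 hn
  · have : 0 ≤ ε ^ (-(3 / 2) : ℝ) * Real.sqrt (Real.logb 2 (1 / ε)) := by positivity
    exact isTester_of_le h8 hhalf hk (by positivity) (by linarith)
  · refine isTester_of_run fun M => ?_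
    obtain ⟨J, l, R, N, K, hp, hJ, f, hf, hdec⟩ := exists_run_adaptive M h8 hk hkn
    have htime := mul_pow_le hε hhalf hk hk2 hJ
    have hinv : 8 * (1 / ε) ≤ (n : ℝ) := by
      refine le_trans ?_ hn
      gcongr
      rw [one_div, ← Real.rpow_neg_one]
      exact Real.rpow_le_rpow_of_exponent_ge hε hε1.le (by norm_num)
    have hpos : 0 ≤ ε ^ (-(3 / 2) : ℝ) * Real.sqrt (Real.logb 2 (1 / ε)) := by positivity
    obtain ⟨d1, d2, d3⟩ := hdec.spec hf
    refine ⟨10 ^ 10 * (⌈1 / ε⌉₊ * 2 ^ J), ?_, ?_, d1, d2, fun hfar => ?_⟩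
    · push_cast
      linarith
    · push_cast
      linarith
    · unfold outcome
      rw [initial_eq, hf, PMF.map_comp]
      exact adaptive_rejects (hp.scale hε hhalf hk1 hk2 h64 hinv) hp.le_l hp.hR hp.hK
        (hfar.le_absoluteDistance (by omega)) (Nat.lt_succ_self _) d3

theorem isTester_nonadaptive (hε : 0 < ε) (hε1 : ε < 1)
    (hn : 8 * ε ^ (-(3 / 2) : ℝ) ≤ (n : ℝ)) :
    IsNonadaptive (tester nonadaptiveParams nonadaptiveMain) 1200 n ε ∧
    IsTester (tester nonadaptiveParams nonadaptiveMain) 1200 n ε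
      (10 ^ 11 * (1 / ε ^ 2)) (10 ^ 11 * (1 / ε ^ 2)) := by
  -- The flag `interleaved` is never reset, so it is enough to inspect late times: a violation at
  -- time `t` would still be visible at time `t + T`.
  have hnon : ∀ (T : ℕ), (∀ M : Image n, ∀ T' ≥ T, ∀ z ∈ (outcome
      (tester nonadaptiveParams nonadaptiveMain) 1200 ε M T').support, z.interleaved = false) →
      IsNonadaptive (tester nonadaptiveParams nonadaptiveMain) 1200 n ε := by
    intro T h M t z hz
    obtain ⟨y, hy⟩ := (run M (1200 * Nat.size n) T z).support_nonempty
    have hy' : y ∈ (outcome (tester nonadaptiveParams nonadaptiveMain) 1200 ε M (t + T)).support := by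
      unfold outcome
      rw [run_add, PMF.mem_support_bind_iff]
      exact ⟨z, hz, hy⟩
    have h1 := h M (t + T) (by omega) y hy'
    have h2 := (extends_of_mem_support_run hy).interleaved
    by_contra hc
    rw [h2 (by simpa using hc)] at h1
    exact absurd h1 (by simp)
  have hinv1 : 1 ≤ 1 / ε ^ 2 := by
    rw [le_div_iff₀ (by positivity), one_mul]
    exact pow_le_one₀ hε.le hε1.le
  obtain ⟨h8, hkn, hk1, h64, ⟨hk, hhalf⟩ | ⟨hk, hhalf, hk2⟩⟩ := input_bounds hε hε1 hn
  · refine ⟨hnon 2 fun M T hT z hz => ?_,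
      isTester_of_le h8 hhalf hk (by positivity) (by linarith)⟩
    have hrun : outcome (tester nonadaptiveParams nonadaptiveMain) 1200 ε M T =
        PMF.pure { (St.start n ⌈1 / ε⌉₊).cfg [] with verdict := some true } :=
      run_tester_of_lt (X := machine M h8) (good_start (k := ⌈1 / ε⌉₊) M h8 (by omega)) hk hT
    rw [hrun, PMF.support_pure, Set.mem_singleton_iff] at hz
    rw [hz]
    rfl
  · have hinv : 8 * (1 / ε) ≤ (n : ℝ) := by
      refine le_trans ?_ hn
      gcongr
      rw [one_div, ← Real.rpow_neg_one]
      exact Real.rpow_le_rpow_of_exponent_ge hε hε1.le (by norm_num)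
    have htime : ((10 ^ 10 * (⌈1 / ε⌉₊ * ⌈1 / ε⌉₊) : ℕ) : ℝ) ≤ 10 ^ 11 * (1 / ε ^ 2) := by
      push_cast
      rw [mul_one_div, le_div_iff₀ (by positivity)]
      have h1 : (⌈1 / ε⌉₊ * ε) * (⌈1 / ε⌉₊ * ε) ≤ (3 / 2 : ℝ) * (3 / 2) := by gcongr
      nlinarith
    refine ⟨hnon (10 ^ 10 * (⌈1 / ε⌉₊ * ⌈1 / ε⌉₊)) fun M T hT z hz => ?_,
      isTester_of_run fun M => ?_⟩
    · obtain ⟨J, l, R, N, K, hp, f, hf, hdec, hitl⟩ := exists_run_nonadaptive M h8 hk hkn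
      obtain ⟨d1, -, -⟩ := hdec.spec hf
      unfold outcome at hz
      rw [initial_eq, run_eq_of_halted d1 hT, hf, PMF.support_map] at hz
      obtain ⟨L, hL, rfl⟩ := hz
      exact hitl L hL
    · obtain ⟨J, l, R, N, K, hp, f, hf, hdec, hitl⟩ := exists_run_nonadaptive M h8 hk hkn
      obtain ⟨d1, d2, d3⟩ := hdec.spec hf
      refine ⟨10 ^ 10 * (⌈1 / ε⌉₊ * ⌈1 / ε⌉₊), htime, htime, d1, d2, fun hfar => ?_⟩
      unfold outcome
      rw [initial_eq, hf, PMF.map_comp]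
      have hK := hp.le_K
      exact nonadaptive_rejects (hp.scale hε hhalf hk1 hk2 h64 hinv)
        (by have := hp.le_l; omega) hp.hR (hfar.le_absoluteDistance (by omega)) (by omega) d3

end ImageTesting

theorem theorem1 :
    (∃ (P : Program) (c : ℕ) (C : ℝ), ∀ (n : ℕ) (ε : ℝ), 0 < ε → ε < 1 →
      8 * ε ^ (-(3 / 2) : ℝ) ≤ (n : ℝ) →
        IsTester P c n ε
          (C * (ε ^ (-(3 / 2) : ℝ) * Real.sqrt (Real.logb 2 (1 / ε))))
          (C * (1 + ε ^ (-(3 / 2) : ℝ) * Real.sqrt (Real.logb 2 (1 / ε))))) ∧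
    (∃ (P : Program) (c : ℕ) (C : ℝ), ∀ (n : ℕ) (ε : ℝ), 0 < ε → ε < 1 →
      8 * ε ^ (-(3 / 2) : ℝ) ≤ (n : ℝ) →
        IsNonadaptive P c n ε ∧ IsTester P c n ε (C * (1 / ε ^ 2)) (C * (1 / ε ^ 2))) := by
  exact ⟨⟨tester adaptiveParams adaptiveMain, 1200, 10 ^ 11, fun _ _ h1 h2 h3 =>
      isTester_adaptive h1 h2 h3⟩,
    ⟨tester nonadaptiveParams nonadaptiveMain, 1200, 10 ^ 11, fun _ _ h1 h2 h3 =>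
      isTester_nonadaptive h1 h2 h3⟩⟩
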